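/- **Setting.** Let $R\in\mathbb Z_{\ge1}$, let $\sigma$ be a permutation of $\{1,\dots,R\}$ of order $T$, and let $\omega\in\mathbb C^\times$ be a primitive $T$-th root of unity. Let $\mathfrak n$ be the free complex Lie algebra on $F_1,\dots,F_R$; $\sigma$ acts on it by $\sigma(F_a)=F_{\sigma(a)}$, and $\mathfrak n^\sigma$ is the subalgebra of fixed elements. Let $\iota(1),\dots,\iota(r)$ be representatives of the cycles of $\sigma$ (fixed points included), $T_i$ the length of the cycle of $\iota(i)$, and grade $\mathfrak n$ by $\mathbb Z_{\ge0}^r$, where $\sigma^kF_{\iota(i)}$ has degree ("weight") the $i$-th unit vector. Let $N\ge0$ and let $z_1,\dots,z_N$ be non-zero complex numbers with pairwise disjoint orbits under multiplication by powers of $\omega$. For a Lie algebra $L$ and an $L$-module $M$, the chain complex $C_k(L,M)=\bigwedge^kL\otimes M$ has the differential $d:C_k\to C_{k-1}$, $$d(g_k\wedge\dots\wedge g_1\otimes x)=\sum_{i}(-1)^{i-1}g_k\wedge\dots\hat g_i\dots\wedge g_1\otimes g_ix+\sum_{i<j}(-1)^{i+j}g_k\wedge\dots\hat g_j\dots\hat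 g_i\dots\wedge g_1\wedge[g_j,g_i]\otimes x .$$ Put $\mathsf M_{0,N}=U(\mathfrak n^\sigma)\otimes U(\mathfrak n)^{\otimes N}$, on which $\mathfrak n^\sigma$ acts by left multiplication on each factor, extended as a derivation. Weights are extended additively to envelopes, exterior powers and tensor products. Fix a weight $\lambda\in\mathbb Z_{\ge0}^r$ and put $m=|\lambda|=\lambda_1+\dots+\lambda_r$. For $1\le i\le r$, $1\le n\le\lambda_i$ write $(i,n)$ for the number $\lambda_1+\dots+\lambda_{i-1}+n\in\{1,\dots,m\}$. **The arrangement.** $\mathcal C_{0,N;m}$ is the arrangement in $\mathbb C^m$ of the hyperplanes $t_i=\omega^kt_j$ ($i<j$), $t_i=\omega^kz_j$, and $t_i=0$ ($k\in\mathbb Z/T$). An edge is a non-empty intersection of hyperplanes of the arrangement (including $\mathbb C^m$). The flag space $\mathcal F^q(\mathcal C_{0,N;m})$ is the complex vector space generated by the flags $L^0\supset\dots\supset L^q$ of edges with $\operatorname{codim}L^i=i$, modulo the relations, for $0<i<q$ and each partial flag with the $i$-th edge missing, that the sum of all flags completing it is zero. The differential $d:\mathcal F^q\to\mathcal F^{q+1}$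 sends a flag $L^0\supset\dots\supset L^q$ to the sum of all flags $L^0\supset\dots\supset L^q\supset L^{q+1}$. **The maps $\psi_k$.** Let $\mathfrak a$ be the free complex Lie algebra on generators ${}^kf_i$, $k\in\mathbb Z/T$, $1\le i\le m$, graded by $\mathbb Z_{\ge0}^m$, where ${}^kf_i$ has weight the $i$-th unit vector. Let $\tau$ be the automorphism ${}^kf_i\mapsto{}^{k+1}f_i$, $\bar{\mathfrak a}$ the subalgebra of $\tau$-invariants, $\overline g=\sum_{j\in\mathbb Z/T}\tau^jg$, $f_i={}^0f_i$, and $\mathcal M_{0,N}=U(\bar{\mathfrak a})\otimes U(\mathfrak a)^{\otimes N}$. A commutator is an iterated bracket of generators ${}^kf_i$; if the generators occurring in a commutator $g$ are ${}^{k_1}f_{i_1},\dots,{}^{k_l}f_{i_l}$, let $$L_g:\ \omega^{k_1}t_{i_1}=\dots=\omega^{k_l}t_{i_l},\qquad L_g^j:\ \omega^{k_1}t_{i_1}=\dots=\omega^{k_l}t_{i_l}=z_j\quad(1\le j\le N),\qquad L_g^0:\ t_{i_1}=\dots=t_{i_l}=0 .$$ The linear maps $\psi_p:C_p(\bar{\mathfrak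 a},\mathcal M_{0,N})_{[1^m]}\to\mathcal F^{m-p}(\mathcal C_{0,N;m})$ ($0\le p\le m$, $[1^m]$ the weight $(1,\dots,1)$) are determined by the following rules. First, $\psi_m(\overline f_1\wedge\dots\wedge\overline f_m\otimes1\otimes\dots\otimes1)$ is the flag $\mathbb C^m$. Next, let $g_1,\dots,g_{p+1}$ be commutators, $x_0$ a product of elements $\overline g$ and $x_1,\dots,x_N$ products of elements $g$, with $g$ commutators, and suppose that $\psi_{p+1}(\overline g_{p+1}\wedge\dots\wedge\overline g_1\otimes x_0\otimes\dots\otimes x_N)=\pm(L^0\supset\dots\supset L^q)$, $q=m-p-1$. Then, with the same sign, $\psi_p(x')=\pm(L^0\supset\dots\supset L^q\supset L^q\cap L')$ for * $x'=\overline g_{p+1}\wedge\dots\wedge\overline g_2\otimes x_0\otimes\dots\otimes g_1x_j\otimes\dots\otimes x_N$ and $L'=L_{g_1}^j$; * $x'=\overline g_{p+1}\wedge\dots\wedge\overline g_2\otimes\overline g_1x_0\otimes x_1\otimes\dots\otimes x_N$ and $L'=L_{g_1}^0$; * $x'=\overline g_{p+1}\wedge\dots\wedge\overline g_3\wedge\overline{[g_1,g_2]}\otimes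 x_0\otimes\dots\otimes x_N$ and $L'=L_{[g_1,g_2]}$. **Cyclotomic symmetrization.** Let $\jmath:\mathfrak n\to\mathfrak a$ be the Lie algebra homomorphism with $$\jmath(\sigma^kF_{\iota(i)})=\sum_{l=0}^{T/T_i-1}\sum_{n=1}^{\lambda_i}{}^{k+T_il}f_{(i,n)} .$$ It satisfies $\jmath\circ\sigma=\tau\circ\jmath$, so it induces maps $C_k(\mathfrak n^\sigma,\mathsf M_{0,N})\to C_k(\bar{\mathfrak a},\mathcal M_{0,N})$. Let $\mathsf s:C_k(\mathfrak n^\sigma,\mathsf M_{0,N})_\lambda\to C_k(\bar{\mathfrak a},\mathcal M_{0,N})_{[1^m]}$ be this map, restricted to the weight $\lambda$ subspace and followed by the projection to the weight $[1^m]$ subspace. **The symmetry group.** Let $\Sigma\mathbb Z_\lambda=\prod_{i=1}^r\Sigma_{\lambda_i}\ltimes(\mathbb Z/(T/T_i))^{\lambda_i}$, with the product $(s',k')(s,k)=(s's,(k_n+k'_{s(n)})_n)$ in each factor. An element $g=(s_i,(k_{i,n})_n)_i$ transforms the coordinate functions by $g\cdot t_{(i,n)}=\omega^{T_ik_{i,n}}t_{(i,s_i(n))}$;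 this gives an action on the hyperplanes of $\mathcal C_{0,N;m}$, on its flags, and on the spaces $\mathcal F^q(\mathcal C_{0,N;m})$. Put $(-1)^{|g|}=\prod_i\operatorname{sgn}(s_i)$ and $$\mathcal F^q(\mathcal C_{0,N;m})^{\Sigma\mathbb Z_\lambda}=\{F\in\mathcal F^q(\mathcal C_{0,N;m}):(-1)^{|g|}\,g\cdot F=F\ \text{for all }g\in\Sigma\mathbb Z_\lambda\}.$$ **Theorem.** The rules above define a unique family of linear maps $\psi_0,\dots,\psi_m$. The subspaces $C_\bullet(\mathfrak n^\sigma,\mathsf M_{0,N})_\lambda$ and $\mathcal F^\bullet(\mathcal C_{0,N;m})^{\Sigma\mathbb Z_\lambda}$ are complexes, and for $k=0,1,\dots,m$ the map $$\psi_k\circ\mathsf s:\ C_k(\mathfrak n^\sigma,\mathsf M_{0,N})_\lambda\longrightarrow\mathcal F^{m-k}(\mathcal C_{0,N;m})^{\Sigma\mathbb Z_\lambda}$$ is a linear isomorphism onto. These maps form an isomorphism of complexes: $d\circ\psi_{k+1}\circ\mathsf s=\psi_k\circ\mathsf s\circ d$ for $0\le k<m$. -/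

import Mathlib

open scoped TensorProduct

namespace Cyclotomic

noncomputable section

/-! ### Hyperplane arrangements and their flag complexes -/

section Arrangement

variable {m : ℕ}

/-- An edge of a collection of hyperplanes in `ℂ^m`: a non-empty intersection of some of its members
(the empty intersection is `ℂ^m`). -/
def IsEdge (𝒞 : Set (AffineSubspace ℂ (Fin m → ℂ))) (L : AffineSubspace ℂ (Fin m → ℂ)) : Prop :=
  L ≠ ⊥ ∧ ∃ S ⊆ 𝒞, L = sInf S

/-- Flags `ℂ^m = L⁰ ⊃ L¹ ⊃ ⋯ ⊃ Lᵏ` in which `Lʲ` is an edge of codimension `j`. -/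
@[ext]
structure Flag (𝒞 : Set (AffineSubspace ℂ (Fin m → ℂ))) (k : ℕ) where
  /-- the edges `L⁰, …, Lᵏ` -/
  edge : Fin (k + 1) → AffineSubspace ℂ (Fin m → ℂ)
  isEdge : ∀ j, IsEdge 𝒞 (edge j)
  codim : ∀ j : Fin (k + 1), Module.finrank ℂ (edge j).direction + (j : ℕ) = m
  anti : Antitone edge

/-- The last edge of a flag. -/
def Flag.last {𝒞 : Set (AffineSubspace ℂ (Fin m → ℂ))} {k : ℕ} (F : Flag 𝒞 k) :
    AffineSubspace ℂ (Fin m → ℂ) :=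
  F.edge (Fin.last k)

/-- Forget the last edge of a flag. -/
def Flag.init {𝒞 : Set (AffineSubspace ℂ (Fin m → ℂ))} {k : ℕ} (F : Flag 𝒞 (k + 1)) :
    Flag 𝒞 k where
  edge j := F.edge j.castSucc
  isEdge _ := F.isEdge _
  codim j := F.codim j.castSucc
  anti _ _ h := F.anti (Fin.castSucc_le_castSucc_iff.2 h)

instance Flag.instFinite (𝒞 : Set (AffineSubspace ℂ (Fin m → ℂ))) [Finite 𝒞] (k : ℕ) :
    Finite (Flag 𝒞 k) := by
  have h1 : {L | IsEdge 𝒞 L}.Finite := by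
    refine ((Set.toFinite 𝒞).finite_subsets.image sInf).subset ?_
    rintro L ⟨-, S, hS, rfl⟩
    exact ⟨S, hS, rfl⟩
  have : Finite {L | IsEdge 𝒞 L} := h1
  refine Finite.of_injective
    (fun F : Flag 𝒞 k => fun j : Fin (k + 1) => (⟨F.edge j, F.isEdge j⟩ : {L | IsEdge 𝒞 L})) ?_
  intro F G h
  ext1
  funext j
  exact congrArg Subtype.val (congrFun h j)

instance Flag.instFintype (𝒞 : Set (AffineSubspace ℂ (Fin m → ℂ))) [Finite 𝒞] (k : ℕ) :
    Fintype (Flag 𝒞 k) := Fintype.ofFinite _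

/-- The image `{x | e x ∈ L}` of an edge under the action of the coordinate change `e`
(acting on an equation `ℓ = 0` by `ℓ ↦ ℓ ∘ e`). -/
def pullback (e : (Fin m → ℂ) ≃ₗ[ℂ] (Fin m → ℂ)) (L : AffineSubspace ℂ (Fin m → ℂ)) :
    AffineSubspace ℂ (Fin m → ℂ) :=
  L.comap e.toLinearMap.toAffineMap

variable {𝒞 : Set (AffineSubspace ℂ (Fin m → ℂ))} {k : ℕ}

lemma pullback_symm_pullback (e : (Fin m → ℂ) ≃ₗ[ℂ] (Fin m → ℂ))
    (L : AffineSubspace ℂ (Fin m → ℂ)) : pullback e.symm (pullback e L) = L := by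
  ext x; simp [pullback]

lemma pullback_pullback_symm (e : (Fin m → ℂ) ≃ₗ[ℂ] (Fin m → ℂ))
    (L : AffineSubspace ℂ (Fin m → ℂ)) : pullback e (pullback e.symm L) = L := by
  ext x; simp [pullback]

lemma finrank_pullback (e : (Fin m → ℂ) ≃ₗ[ℂ] (Fin m → ℂ)) (L : AffineSubspace ℂ (Fin m → ℂ)) :
    Module.finrank ℂ (pullback e L).direction = Module.finrank ℂ L.direction := by
  have h : pullback e L = L.map e.symm.toLinearMap.toAffineMap := by
    ext x
    simp only [pullback, AffineSubspace.mem_comap, AffineSubspace.mem_map]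
    constructor
    · intro hx
      exact ⟨e x, hx, by simp⟩
    · rintro ⟨y, hy, rfl⟩
      simpa using hy
  rw [h, AffineSubspace.map_direction]
  exact LinearEquiv.finrank_map_eq e.symm _

lemma IsEdge.pullback {e : (Fin m → ℂ) ≃ₗ[ℂ] (Fin m → ℂ)} (he : ∀ H ∈ 𝒞, pullback e H ∈ 𝒞)
    {L : AffineSubspace ℂ (Fin m → ℂ)} (hL : IsEdge 𝒞 L) : IsEdge 𝒞 (pullback e L) := by
  obtain ⟨h0, S, hS, rfl⟩ := hL
  constructor
  · intro h
    apply h0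
    rw [← pullback_symm_pullback e (sInf S), h]
    rfl
  · refine ⟨Cyclotomic.pullback e '' S, ?_, ?_⟩
    · rintro _ ⟨H, hH, rfl⟩
      exact he H (hS hH)
    · ext x
      simp [Cyclotomic.pullback, AffineSubspace.mem_sInf_iff]

/-- The action of a coordinate change preserving the collection of hyperplanes on its flags. -/
def Flag.pullback (e : (Fin m → ℂ) ≃ₗ[ℂ] (Fin m → ℂ)) (he : ∀ H ∈ 𝒞, pullback e H ∈ 𝒞)
    (F : Flag 𝒞 k) : Flag 𝒞 k where
  edge j := Cyclotomic.pullback e (F.edge j)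
  isEdge j := (F.isEdge j).pullback he
  codim j := by rw [finrank_pullback]; exact F.codim j
  anti _ _ h := AffineSubspace.comap_mono (F.anti h)

section

variable (𝒞 : Set (AffineSubspace ℂ (Fin m → ℂ))) [Finite 𝒞] (k : ℕ)

open Classical in
/-- The sum of all flags that agree with `F` except possibly at the `i`-th edge, i.e. of all flags
that fill the gap left by removing the `i`-th edge of `F`. -/
def flagRelation (F : Flag 𝒞 k) (i : Fin (k + 1)) : Flag 𝒞 k →₀ ℂ :=
  ∑ G : Flag 𝒞 k with (∀ j, j ≠ i → G.edge j = F.edge j), Finsupp.single G 1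

/-- The subspace spanned by the flag relations; the gap is at a place `0 < i < k`. -/
def flagRelations : Submodule ℂ (Flag 𝒞 k →₀ ℂ) :=
  Submodule.span ℂ {x | ∃ (F : Flag 𝒞 k) (i : Fin (k + 1)), 0 < (i : ℕ) ∧ (i : ℕ) < k ∧
    x = flagRelation 𝒞 k F i}

/-- The flag space `ℱᵏ(𝒞)` over `ℂ`. -/
abbrev FlagSpace : Type := (Flag 𝒞 k →₀ ℂ) ⧸ flagRelations 𝒞 k

variable {𝒞 k}

/-- The class of a flag in the flag space. -/
def FlagSpace.mk (F : Flag 𝒞 k) : FlagSpace 𝒞 k :=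
  (flagRelations 𝒞 k).mkQ (Finsupp.single F 1)

lemma FlagSpace.sum_mk_eq_zero (F : Flag 𝒞 k) (i : Fin (k + 1)) (h0 : 0 < (i : ℕ))
    (hk : (i : ℕ) < k) {s : Finset (Flag 𝒞 k)}
    (hs : ∀ G, G ∈ s ↔ ∀ j, j ≠ i → G.edge j = F.edge j) :
    ∑ G ∈ s, FlagSpace.mk G = 0 := by
  classical
  have h : flagRelation 𝒞 k F i ∈ flagRelations 𝒞 k :=
    Submodule.subset_span ⟨F, i, h0, hk, rfl⟩
  rw [← Submodule.Quotient.mk_eq_zero] at h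
  rw [← h, flagRelation, ← Submodule.mkQ_apply, map_sum]
  refine Finset.sum_congr ?_ fun _ _ => rfl
  ext G
  simp [hs]

/-- A linear map out of the flag space from values on flags that satisfy the flag relations. -/
def FlagSpace.lift {E : Type*} [AddCommGroup E] [Module ℂ E] (f : Flag 𝒞 k → E)
    (hf : ∀ (F : Flag 𝒞 k) (i : Fin (k + 1)), 0 < (i : ℕ) → (i : ℕ) < k →
      ∀ s : Finset (Flag 𝒞 k), (∀ G, G ∈ s ↔ ∀ j, j ≠ i → G.edge j = F.edge j) →
        ∑ G ∈ s, f G = 0) :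
    FlagSpace 𝒞 k →ₗ[ℂ] E :=
  (flagRelations 𝒞 k).liftQ (Finsupp.linearCombination ℂ f) <| by
    classical
    refine Submodule.span_le.2 ?_
    rintro _ ⟨F, i, h0, hk, rfl⟩
    have := hf F i h0 hk {G | ∀ j, j ≠ i → G.edge j = F.edge j} (by simp)
    simp only [SetLike.mem_coe, LinearMap.mem_ker, flagRelation, map_sum,
      Finsupp.linearCombination_single, one_smul]
    exact this

@[simp]
lemma FlagSpace.lift_mk {E : Type*} [AddCommGroup E] [Module ℂ E] (f : Flag 𝒞 k → E)
    (hf : ∀ (F : Flag 𝒞 k) (i : Fin (k + 1)), 0 < (i : ℕ) → (i : ℕ) < k →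
      ∀ s : Finset (Flag 𝒞 k), (∀ G, G ∈ s ↔ ∀ j, j ≠ i → G.edge j = F.edge j) →
        ∑ G ∈ s, f G = 0) (F : Flag 𝒞 k) :
    FlagSpace.lift f hf (FlagSpace.mk F) = f F := by
  refine (Submodule.liftQ_apply _ _ _).trans ?_
  simp

variable (𝒞 k)

open Classical in
/-- The differential of the flag complex: a flag of length `k` is sent to the sum of all flags of
length `k + 1` that extend it by one more edge. -/
def flagDiff : FlagSpace 𝒞 k →ₗ[ℂ] FlagSpace 𝒞 (k + 1) :=
  FlagSpace.lift (fun F => ∑ G : Flag 𝒞 (k + 1) with G.init = F, FlagSpace.mk G) <| by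
    intro F i h0 hk s hs
    rw [← Finset.sum_biUnion (by
      intro a _ b _ hab
      simp only [Function.onFun, Finset.disjoint_left, Finset.mem_filter, Finset.mem_univ, true_and]
      rintro G rfl h
      exact hab h)]
    rw [← Finset.sum_fiberwise_of_maps_to
      (t := Finset.image Flag.last (Finset.univ : Finset (Flag 𝒞 (k + 1))))
      (g := Flag.last) (by intro G _; simp)]
    refine Finset.sum_eq_zero fun E _ => ?_
    by_cases hne : ∃ G₀ : Flag 𝒞 (k + 1), G₀.init ∈ s ∧ G₀.last = E
    · obtain ⟨G₀, hG₀, rfl⟩ := hne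
      refine FlagSpace.sum_mk_eq_zero G₀ i.castSucc (by simpa using h0)
        (by simpa using hk.trans (Nat.lt_succ_self k)) ?_
      intro G
      simp only [Finset.mem_filter, Finset.mem_biUnion, Finset.mem_univ, true_and,
        exists_eq_right']
      rw [hs] at hG₀ ⊢
      constructor
      · rintro ⟨h1, h2⟩ j hj
        induction j using Fin.lastCases with
        | last => exact h2
        | cast j =>
          have hj' : j ≠ i := fun h => hj (by rw [h])
          exact (h1 j hj').trans (hG₀ j hj').symm
      · intro h
        refine ⟨fun j hj => ?_, h (Fin.last _) ?_⟩
        · exact (h j.castSucc (fun e => hj (Fin.castSucc_injective _ e))).trans (hG₀ j hj)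
        · intro e
          have := congrArg Fin.val e
          simp at this
          omega
    · refine Finset.sum_eq_zero fun G hG => (hne ⟨G, ?_, ?_⟩).elim
      · simp only [Finset.mem_filter, Finset.mem_biUnion, Finset.mem_univ, true_and,
          exists_eq_right'] at hG
        exact hG.1
      · exact (Finset.mem_filter.1 hG).2

/-- A coordinate change preserving a finite collection of hyperplanes acts on the flag space. -/
def flagAction (e : (Fin m → ℂ) ≃ₗ[ℂ] (Fin m → ℂ))
    (he : ∀ H ∈ 𝒞, pullback e H ∈ 𝒞) : FlagSpace 𝒞 k →ₗ[ℂ] FlagSpace 𝒞 k :=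
  FlagSpace.lift (fun F => FlagSpace.mk (F.pullback e he)) <| by
    classical
    intro F i h0 hk s hs
    have hinj : Function.Injective (Cyclotomic.pullback e) :=
      Function.LeftInverse.injective (pullback_symm_pullback e)
    have he' : ∀ H ∈ 𝒞, Cyclotomic.pullback e.symm H ∈ 𝒞 := by
      intro H hH
      obtain ⟨K, hK⟩ := Finite.surjective_of_injective
        (f := fun H : 𝒞 => (⟨Cyclotomic.pullback e H, he H H.2⟩ : 𝒞))
        (fun a b h => Subtype.ext (hinj (congrArg Subtype.val h))) ⟨H, hH⟩
      have hK' : Cyclotomic.pullback e K.1 = H := congrArg Subtype.val hK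
      rw [← hK', pullback_symm_pullback]
      exact K.2
    have hFinj : Function.Injective (Flag.pullback (𝒞 := 𝒞) (k := k) e he) := by
      intro F G h
      ext1
      funext j
      exact hinj (congrFun (congrArg Flag.edge h) j)
    rw [← Finset.sum_image (f := FlagSpace.mk) (fun a _ b _ h => hFinj h)]
    refine FlagSpace.sum_mk_eq_zero (F.pullback e he) i h0 hk fun G => ?_
    simp only [Finset.mem_image]
    constructor
    · rintro ⟨G, hG, rfl⟩ j hj
      exact congrArg (Cyclotomic.pullback e) ((hs G).1 hG j hj)
    · intro hG
      refine ⟨G.pullback e.symm he', (hs _).2 fun j hj => ?_, ?_⟩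
      · change Cyclotomic.pullback e.symm (G.edge j) = _
        rw [hG j hj]
        exact pullback_symm_pullback e _
      · ext1
        funext j
        exact pullback_pullback_symm e _

end

end Arrangement

/-! ### The cyclotomic discriminantal arrangement -/

section CyclotomicArrangement

variable {T m N : ℕ}

/-- The affine hyperplane `ℓ = c`. -/
def hyperplane (ℓ : (Fin m → ℂ) →ₗ[ℂ] ℂ) (c : ℂ) : AffineSubspace ℂ (Fin m → ℂ) :=
  (AffineSubspace.mk' c ⊥).comap ℓ.toAffineMap

@[simp]
lemma mem_hyperplane (ℓ : (Fin m → ℂ) →ₗ[ℂ] ℂ) (c : ℂ) (t : Fin m → ℂ) :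
    t ∈ hyperplane ℓ c ↔ ℓ t = c := by
  simp [hyperplane, AffineSubspace.mem_mk', sub_eq_zero]

/-- The power `ω^k` for `k ∈ ℤ/T` (where `ω^T = 1`). -/
def cycPow (ω : ℂˣ) (k : ZMod T) : ℂˣ := ω ^ k.val

lemma pow_mod_of_isPrimitiveRoot {ω : ℂˣ} (hω : IsPrimitiveRoot ω T) (n : ℕ) :
    ω ^ (n % T) = ω ^ n :=
  (pow_eq_pow_mod n hω.pow_eq_one).symm

lemma cycPow_add [NeZero T] {ω : ℂˣ} (hω : IsPrimitiveRoot ω T) (a b : ZMod T) :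
    cycPow ω (a + b) = cycPow ω a * cycPow ω b := by
  rw [cycPow, cycPow, cycPow, ← pow_add, ZMod.val_add, pow_mod_of_isPrimitiveRoot hω]

lemma cycPow_sub [NeZero T] {ω : ℂˣ} (hω : IsPrimitiveRoot ω T) (a b : ZMod T) :
    cycPow ω (a - b) = cycPow ω a * (cycPow ω b)⁻¹ := by
  rw [eq_mul_inv_iff_mul_eq, ← cycPow_add hω, sub_add_cancel]

/-- The hyperplane `t_i - ω^k t_j = 0`. -/
def hyperplaneTT (ω : ℂˣ) (i j : Fin m) (k : ZMod T) : AffineSubspace ℂ (Fin m → ℂ) :=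
  hyperplane (LinearMap.proj i - (cycPow ω k : ℂ) • LinearMap.proj j) 0

/-- The hyperplane `t_i - ω^k z_j = 0`. -/
def hyperplaneTZ (ω : ℂˣ) (z : Fin N → ℂ) (i : Fin m) (j : Fin N) (k : ZMod T) :
    AffineSubspace ℂ (Fin m → ℂ) :=
  hyperplane (LinearMap.proj i) ((cycPow ω k : ℂ) * z j)

/-- The hyperplane `t_i = 0`. -/
def hyperplaneT0 (i : Fin m) : AffineSubspace ℂ (Fin m → ℂ) :=
  hyperplane (LinearMap.proj i) 0

/-- The cyclotomic discriminantal arrangement `𝒞_{0,N;m}` in `ℂ^m`. (The hyperplane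
`t_i = ω^k t_j` is the hyperplane `t_j = ω^{-k} t_i`, so `i ≠ j` gives the same collection as
`i < j`.) -/
def cycArrangement (T m : ℕ) {N : ℕ} (ω : ℂˣ) (z : Fin N → ℂ) :
    Set (AffineSubspace ℂ (Fin m → ℂ)) :=
  {H | (∃ (i j : Fin m) (k : ZMod T), i ≠ j ∧ H = hyperplaneTT ω i j k) ∨
    (∃ (i : Fin m) (j : Fin N) (k : ZMod T), H = hyperplaneTZ ω z i j k) ∨
    ∃ i : Fin m, H = hyperplaneT0 i}

instance cycArrangement_finite [NeZero T] (ω : ℂˣ) (z : Fin N → ℂ) :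
    Finite (cycArrangement T m ω z) := by
  have h : (Set.range (fun p : Fin m × Fin m × ZMod T => hyperplaneTT ω p.1 p.2.1 p.2.2) ∪
      (Set.range (fun p : Fin m × Fin N × ZMod T => hyperplaneTZ ω z p.1 p.2.1 p.2.2) ∪
        Set.range (hyperplaneT0 (m := m)))).Finite :=
    (Set.finite_range _).union ((Set.finite_range _).union (Set.finite_range _))
  refine h.subset ?_
  rintro H (⟨i, j, k, -, rfl⟩ | ⟨i, j, k, rfl⟩ | ⟨i, rfl⟩)
  · exact Or.inl ⟨(i, j, k), rfl⟩
  · exact Or.inr (Or.inl ⟨(i, j, k), rfl⟩)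
  · exact Or.inr (Or.inr ⟨i, rfl⟩)

end CyclotomicArrangement

/-! ### The symmetry group -/

section Symmetry

/-- The wreath product `Σ_n ≀ ℤ/d`: pairs `(s, k)` of a permutation of `n` letters and a tuple of
elements of `ℤ/d`. -/
@[ext]
structure Wreath (n d : ℕ) where
  /-- the permutation `s` -/
  perm : Equiv.Perm (Fin n)
  /-- the tuple `(k_1, …, k_n)` -/
  shift : Fin n → ZMod d

instance Wreath.instGroup (n d : ℕ) : Group (Wreath n d) where
  mul g' g := ⟨g'.perm * g.perm, fun p => g.shift p + g'.shift (g.perm p)⟩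
  one := ⟨1, 0⟩
  inv g := ⟨g.perm⁻¹, fun p => -g.shift (g.perm⁻¹ p)⟩
  mul_assoc a b c := by
    refine Wreath.ext rfl (funext fun p => ?_)
    exact (add_assoc _ _ _).symm
  one_mul a := by
    refine Wreath.ext rfl (funext fun p => ?_)
    exact add_zero _
  mul_one a := by
    refine Wreath.ext rfl (funext fun p => ?_)
    exact zero_add _
  inv_mul_cancel a := by
    refine Wreath.ext (inv_mul_cancel a.perm) (funext fun p => ?_)
    change a.shift p + -a.shift (a.perm⁻¹ (a.perm p)) = 0
    simp

variable {R r : ℕ}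

/-- The length `T_i` of the cycle of `σ` through the `i`-th representative. -/
def cycleLength (σ : Equiv.Perm (Fin R)) (rep : Fin r → Fin R) (i : Fin r) : ℕ :=
  Function.minimalPeriod σ (rep i)

/-- The group `ΣZ_λ = ∏_i (Σ_{λ_i} ≀ ℤ/(T/T_i))`. -/
abbrev SigmaZ (T : ℕ) (σ : Equiv.Perm (Fin R)) (rep : Fin r → Fin R) (lam : Fin r → ℕ) : Type :=
  ∀ i, Wreath (lam i) (T / cycleLength σ rep i)

variable {T : ℕ} {σ : Equiv.Perm (Fin R)} {rep : Fin r → Fin R} {lam : Fin r → ℕ}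

/-- The sign `(-1)^{|g|} = ∏_i (-1)^{|s_i|}`. -/
def SigmaZ.sign (g : SigmaZ T σ rep lam) : ℤ := ∏ i, (Equiv.Perm.sign (g i).perm : ℤ)

/-- The permutation of `{1, …, m}`, `m = λ_1 + ⋯ + λ_r`, effected by `g`: it permutes the `i`-th
block of `λ_i` consecutive numbers by `s_i`. -/
def SigmaZ.perm (g : SigmaZ T σ rep lam) : Equiv.Perm (Fin (∑ i, lam i)) :=
  (finSigmaFinEquiv.symm.trans (Equiv.sigmaCongrRight fun i => (g i).perm)).trans finSigmaFinEquiv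

/-- The scalar `ω^{T_i k_n}` attached by `g` to the `n`-th element of the `i`-th block. -/
def SigmaZ.scalar (ω : ℂˣ) (g : SigmaZ T σ rep lam) (p : Fin (∑ i, lam i)) : ℂˣ :=
  ω ^ (cycleLength σ rep (finSigmaFinEquiv.symm p).1 *
    ((g (finSigmaFinEquiv.symm p).1).shift (finSigmaFinEquiv.symm p).2).val)

/-- The coordinate change defined by `g`: precomposition with it sends the coordinate function
`t_{(i,n)}` to `ω^{T_i k_n} t_{(i,s(n))}`. -/
def SigmaZ.coordChange (ω : ℂˣ) (g : SigmaZ T σ rep lam) :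
    (Fin (∑ i, lam i) → ℂ) ≃ₗ[ℂ] (Fin (∑ i, lam i) → ℂ) :=
  (LinearEquiv.funCongrLeft ℂ ℂ g.perm).trans
    (LinearEquiv.piCongrRight fun p => LinearEquiv.smulOfUnit (g.scalar ω p))

lemma SigmaZ.coordChange_apply (ω : ℂˣ) (g : SigmaZ T σ rep lam) (t : Fin (∑ i, lam i) → ℂ)
    (p : Fin (∑ i, lam i)) :
    g.coordChange ω t p = (g.scalar ω p : ℂ) * t (g.perm p) := rfl

lemma SigmaZ.scalar_eq_cycPow [NeZero T] {ω : ℂˣ} (hω : IsPrimitiveRoot ω T)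
    (g : SigmaZ T σ rep lam) (p : Fin (∑ i, lam i)) :
    ∃ a : ZMod T, g.scalar ω p = cycPow ω a := by
  refine ⟨((cycleLength σ rep (finSigmaFinEquiv.symm p).1 *
    ((g (finSigmaFinEquiv.symm p).1).shift (finSigmaFinEquiv.symm p).2).val : ℕ) : ZMod T), ?_⟩
  rw [SigmaZ.scalar, cycPow, ZMod.val_natCast, pow_mod_of_isPrimitiveRoot hω]

lemma SigmaZ.pullback_mem [NeZero T] {N : ℕ} {ω : ℂˣ} (hω : IsPrimitiveRoot ω T) (z : Fin N → ℂ)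
    (g : SigmaZ T σ rep lam) (H : AffineSubspace ℂ (Fin (∑ i, lam i) → ℂ))
    (hH : H ∈ cycArrangement T (∑ i, lam i) ω z) :
    pullback (g.coordChange ω) H ∈ cycArrangement T (∑ i, lam i) ω z := by
  rcases hH with ⟨i, j, k, hij, rfl⟩ | ⟨i, j, k, rfl⟩ | ⟨i, rfl⟩
  · obtain ⟨a, ha⟩ := g.scalar_eq_cycPow hω i
    obtain ⟨b, hb⟩ := g.scalar_eq_cycPow hω j
    refine Or.inl ⟨g.perm i, g.perm j, k + b - a, fun h => hij (g.perm.injective h), ?_⟩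
    ext t
    simp only [pullback, hyperplaneTT, AffineSubspace.mem_comap, mem_hyperplane,
      LinearMap.coe_toAffineMap, LinearEquiv.coe_coe, LinearMap.sub_apply, LinearMap.smul_apply,
      LinearMap.proj_apply, SigmaZ.coordChange_apply, smul_eq_mul, ha, hb, cycPow_sub hω,
      cycPow_add hω, Units.val_mul, Units.val_inv_eq_inv_val, sub_eq_zero]
    have := (cycPow ω a).ne_zero
    field_simp
  · obtain ⟨a, ha⟩ := g.scalar_eq_cycPow hω i
    refine Or.inr (Or.inl ⟨g.perm i, j, k - a, ?_⟩)
    ext t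
    simp only [pullback, hyperplaneTZ, AffineSubspace.mem_comap, mem_hyperplane,
      LinearMap.coe_toAffineMap, LinearEquiv.coe_coe,
      LinearMap.proj_apply, SigmaZ.coordChange_apply, ha, cycPow_sub hω,
      Units.val_mul, Units.val_inv_eq_inv_val]
    have := (cycPow ω a).ne_zero
    field_simp
  · refine Or.inr (Or.inr ⟨g.perm i, ?_⟩)
    ext t
    simp [pullback, hyperplaneT0, SigmaZ.coordChange_apply]

/-- The action of `g` on the flag space of the cyclotomic discriminantal arrangement. -/
def SigmaZ.act [NeZero T] {N : ℕ} {ω : ℂˣ} (hω : IsPrimitiveRoot ω T) (z : Fin N → ℂ) (q : ℕ)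
    (g : SigmaZ T σ rep lam) :
    FlagSpace (cycArrangement T (∑ i, lam i) ω z) q →ₗ[ℂ]
      FlagSpace (cycArrangement T (∑ i, lam i) ω z) q :=
  flagAction _ _ (g.coordChange ω) (g.pullback_mem hω z)

variable (σ rep lam) in
/-- The isotypic subspace `{v | (-1)^{|g|} g·v = v for all g ∈ ΣZ_λ}` of the flag space. -/
def isotypicFlags [NeZero T] {N : ℕ} {ω : ℂˣ} (hω : IsPrimitiveRoot ω T) (z : Fin N → ℂ) (q : ℕ) :
    Submodule ℂ (FlagSpace (cycArrangement T (∑ i, lam i) ω z) q) :=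
  ⨅ g : SigmaZ T σ rep lam,
    LinearMap.eqLocus ((SigmaZ.sign g : ℂ) • SigmaZ.act hω z q g) LinearMap.id

end Symmetry

/-! ### The chain complex of a Lie algebra -/

section Chain

variable {L M E : Type*} [LieRing L] [LieAlgebra ℂ L] [AddCommGroup M] [Module ℂ M]
  [AddCommGroup E] [Module ℂ E] {k : ℕ}

/-- The wedge product `g_k ∧ ⋯ ∧ g_1` (in decreasing order) as an alternating map of
`(g_1, …, g_k)`. -/
def wedgeRev (L : Type*) [LieRing L] [LieAlgebra ℂ L] (k : ℕ) : L [⋀^Fin k]→ₗ[ℂ] ⋀[ℂ]^k L :=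
  (exteriorPower.ιMulti ℂ k).domDomCongr Fin.revPerm

/-- A linear map out of `⋀^k L ⊗ M` from its values on `(g_k ∧ ⋯ ∧ g_1) ⊗ x`. -/
def chainLift (f : L [⋀^Fin k]→ₗ[ℂ] (M →ₗ[ℂ] E)) : ⋀[ℂ]^k L ⊗[ℂ] M →ₗ[ℂ] E :=
  TensorProduct.lift (exteriorPower.alternatingMapLinearEquiv (f.domDomCongr Fin.revPerm))

@[simp]
lemma chainLift_apply (f : L [⋀^Fin k]→ₗ[ℂ] (M →ₗ[ℂ] E)) (g : Fin k → L) (x : M) :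
    chainLift f (wedgeRev L k g ⊗ₜ x) = f g x := by
  simp only [chainLift, wedgeRev, AlternatingMap.domDomCongr_apply, TensorProduct.lift.tmul,
    exteriorPower.alternatingMapLinearEquiv_apply_ιMulti]
  congr 2
  funext i
  simp

/-- The sum `∑_i (-1)^{i-1} f(g_k ∧ ⋯ ĝ_i ⋯ ∧ g_1, g_i · x)`. -/
def actSum (ρ : L →ₗ[ℂ] Module.End ℂ M) (f : ⋀[ℂ]^k L →ₗ[ℂ] M →ₗ[ℂ] E) :
    L [⋀^Fin (k + 1)]→ₗ[ℂ] (M →ₗ[ℂ] E) :=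
  AlternatingMap.alternatizeUncurryFin
    { toFun := fun a => ((LinearMap.lcomp ℂ E (ρ a)).comp f).compAlternatingMap (wedgeRev L k)
      map_add' := fun a b => by ext; simp
      map_smul' := fun c a => by ext; simp }

/-- The sum `∑_{i<j} (-1)^{i+j} f(g_k ∧ ⋯ ĝ_j ⋯ ĝ_i ⋯ ∧ g_1 ∧ [g_j, g_i], x)`, written as half of the
sum over all pairs `i ≠ j`. -/
def bracketSum (f : ⋀[ℂ]^(k + 1) L →ₗ[ℂ] M →ₗ[ℂ] E) : L [⋀^Fin (k + 1 + 1)]→ₗ[ℂ] (M →ₗ[ℂ] E) :=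
  (1 / 2 : ℂ) • AlternatingMap.alternatizeUncurryFin
    (AlternatingMap.alternatizeUncurryFinLM ∘ₗ
      LinearMap.mk₂ ℂ (fun a b => f.compAlternatingMap ((wedgeRev L (k + 1)).curryLeft ⁅a, b⁆))
        (by intros; ext; simp) (by intros; ext; simp) (by intros; ext; simp)
        (by intros; ext; simp))

/-- The sum `actSum`, as a linear map. -/
def chainDiffAuxZero (ρ : L →ₗ[ℂ] Module.End ℂ M) (f : ⋀[ℂ]^k L →ₗ[ℂ] M →ₗ[ℂ] E) :
    ⋀[ℂ]^(k + 1) L ⊗[ℂ] M →ₗ[ℂ] E :=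
  chainLift (actSum ρ f)

/-- The sum of `actSum` and `bracketSum`, as a linear map. -/
def chainDiffAux (ρ : L →ₗ[ℂ] Module.End ℂ M) (f : ⋀[ℂ]^(k + 1) L →ₗ[ℂ] M →ₗ[ℂ] E) :
    ⋀[ℂ]^(k + 1 + 1) L ⊗[ℂ] M →ₗ[ℂ] E :=
  chainLift (actSum ρ f + bracketSum f)

/-- The differential `⋀^{k+1} L ⊗ M → ⋀^k L ⊗ M` of the standard chain complex of a Lie algebra `L`
with coefficients in `M`, where `ρ` is the action of `L` on `M`. Explicit formulas are
`chainDiff_zero_apply` and `chainDiff_succ_apply`. -/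
def chainDiff (ρ : L →ₗ[ℂ] Module.End ℂ M) :
    (k : ℕ) → (⋀[ℂ]^(k + 1) L ⊗[ℂ] M →ₗ[ℂ] ⋀[ℂ]^k L ⊗[ℂ] M)
  | 0 => chainDiffAuxZero (E := ⋀[ℂ]^0 L ⊗[ℂ] M) ρ (TensorProduct.mk ℂ (⋀[ℂ]^0 L) M)
  | k + 1 => chainDiffAux (E := ⋀[ℂ]^(k + 1) L ⊗[ℂ] M) ρ (TensorProduct.mk ℂ (⋀[ℂ]^(k + 1) L) M)

lemma actSum_apply (ρ : L →ₗ[ℂ] Module.End ℂ M) (f : ⋀[ℂ]^k L →ₗ[ℂ] M →ₗ[ℂ] E)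
    (g : Fin (k + 1) → L) (x : M) :
    actSum ρ f g x = ∑ i : Fin (k + 1),
      (-1 : ℂ) ^ (i : ℕ) • f (wedgeRev L k (i.removeNth g)) (ρ (g i) x) := by
  rw [actSum, AlternatingMap.alternatizeUncurryFin_apply, LinearMap.sum_apply]
  refine Finset.sum_congr rfl fun i _ => ?_
  rcases Nat.even_or_odd (i : ℕ) with h | h <;> simp [h.neg_one_pow]

lemma bracketSum_apply (f : ⋀[ℂ]^(k + 1) L →ₗ[ℂ] M →ₗ[ℂ] E) (g : Fin (k + 1 + 1) → L) (x : M) :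
    bracketSum f g x = ∑ i : Fin (k + 1), ∑ j ≥ i, (-1 : ℂ) ^ ((i : ℕ) + (j + 1)) •
      f (wedgeRev L (k + 1) (Fin.cons ⁅g j.succ, g i.castSucc⁆
        (j.removeNth (i.castSucc.removeNth g)))) x := by
  rw [bracketSum, AlternatingMap.smul_apply,
    AlternatingMap.alternatizeUncurryFin_alternatizeUncurryFinLM_comp_apply, LinearMap.smul_apply,
    LinearMap.sum_apply, Finset.smul_sum]
  refine Finset.sum_congr rfl fun i _ => ?_
  rw [LinearMap.sum_apply, Finset.smul_sum]
  refine Finset.sum_congr rfl fun j _ => ?_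
  have h : ∀ a b : L, ∀ v, ((wedgeRev L (k + 1)).curryLeft ⁅a, b⁆) v =
      -((wedgeRev L (k + 1)).curryLeft ⁅b, a⁆) v := by
    intro a b v
    rw [← lie_skew, map_neg, AlternatingMap.neg_apply]
  have h' : ∀ a v, ((wedgeRev L (k + 1)).curryLeft a) v = wedgeRev L (k + 1) (Fin.cons a v) :=
    fun a v => rfl
  rw [← h']
  simp only [LinearMap.mk₂_apply, LinearMap.compAlternatingMap_apply,
    h (g i.castSucc) (g j.succ), map_neg]
  rw [← add_assoc, pow_succ]
  rcases Nat.even_or_odd ((i : ℕ) + j) with hij | hij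
  · simp only [hij.neg_one_pow, one_smul, LinearMap.sub_apply, LinearMap.neg_apply, one_mul,
      neg_smul]
    module
  · simp only [hij.neg_one_pow, one_smul, LinearMap.sub_apply, LinearMap.neg_apply, neg_mul, one_mul,
      neg_smul, neg_neg]
    module

lemma chainDiffAuxZero_apply (ρ : L →ₗ[ℂ] Module.End ℂ M) (f : ⋀[ℂ]^k L →ₗ[ℂ] M →ₗ[ℂ] E)
    (g : Fin (k + 1) → L) (x : M) :
    chainDiffAuxZero ρ f (wedgeRev L (k + 1) g ⊗ₜ x) = actSum ρ f g x :=
  chainLift_apply _ _ _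

lemma chainDiffAux_apply (ρ : L →ₗ[ℂ] Module.End ℂ M) (f : ⋀[ℂ]^(k + 1) L →ₗ[ℂ] M →ₗ[ℂ] E)
    (g : Fin (k + 1 + 1) → L) (x : M) :
    chainDiffAux ρ f (wedgeRev L (k + 1 + 1) g ⊗ₜ x) = actSum ρ f g x + bracketSum f g x :=
  chainLift_apply _ _ _

/-- `d(g_1 ⊗ x) = g_1·x`. -/
lemma chainDiff_zero_apply (ρ : L →ₗ[ℂ] Module.End ℂ M) (g : Fin 1 → L) (x : M) :
    chainDiff ρ 0 (wedgeRev L 1 g ⊗ₜ x) = wedgeRev L 0 Fin.elim0 ⊗ₜ ρ (g 0) x := by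
  rw [chainDiff, chainDiffAuxZero_apply, actSum_apply]
  simp [Subsingleton.elim (Fin.removeNth 0 g) Fin.elim0]

/-- `d(g_k ∧ ⋯ ∧ g_1 ⊗ x) = ∑_i (-1)^{i-1} g_k ∧ ⋯ ĝ_i ⋯ ∧ g_1 ⊗ g_i·x
  + ∑_{i<j} (-1)^{i+j} g_k ∧ ⋯ ĝ_j ⋯ ĝ_i ⋯ ∧ g_1 ∧ [g_j, g_i] ⊗ x`. In the second sum, the pairs
`i ≤ j` in `Fin (k + 1)` encode the pairs `i < j + 1` of places. -/
lemma chainDiff_succ_apply (ρ : L →ₗ[ℂ] Module.End ℂ M) (k : ℕ) (g : Fin (k + 1 + 1) → L) (x : M) :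
    chainDiff ρ (k + 1) (wedgeRev L (k + 1 + 1) g ⊗ₜ x) =
      ∑ i : Fin (k + 1 + 1), (-1 : ℂ) ^ (i : ℕ) • (wedgeRev L (k + 1) (i.removeNth g) ⊗ₜ ρ (g i) x) +
      ∑ i : Fin (k + 1), ∑ j ≥ i, (-1 : ℂ) ^ ((i : ℕ) + (j + 1)) •
        (wedgeRev L (k + 1) (Fin.cons ⁅g j.succ, g i.castSucc⁆
          (j.removeNth (i.castSucc.removeNth g))) ⊗ₜ x) := by
  rw [chainDiff, chainDiffAux_apply, actSum_apply, bracketSum_apply]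
  rfl

end Chain

/-! ### Free Lie algebras with a permutation automorphism -/

section FreeLie

variable {X Y J : Type}

attribute [local instance] LieRing.ofAssociativeRing

/-- The automorphism of the free Lie algebra that permutes the generators by `e`. -/
def permHom (e : Equiv.Perm X) : FreeLieAlgebra ℂ X →ₗ⁅ℂ⁆ FreeLieAlgebra ℂ X :=
  FreeLieAlgebra.lift ℂ fun x => FreeLieAlgebra.of ℂ (e x)

@[simp]
lemma permHom_of (e : Equiv.Perm X) (x : X) :
    permHom e (FreeLieAlgebra.of ℂ x) = FreeLieAlgebra.of ℂ (e x) := by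
  simp [permHom]

/-- The subalgebra of elements fixed by the automorphism `permHom e`. -/
def fixedSubalgebra (e : Equiv.Perm X) : LieSubalgebra ℂ (FreeLieAlgebra ℂ X) where
  carrier := {x | permHom e x = x}
  add_mem' {a b} ha hb := by
    simp only [Set.mem_ofPred_eq] at ha hb ⊢
    rw [map_add, ha, hb]
  zero_mem' := map_zero _
  smul_mem' c a ha := by
    simp only [Set.mem_ofPred_eq] at ha ⊢
    rw [map_smul, ha]
  lie_mem' {a b} ha hb := by
    change permHom e ⁅a, b⁆ = ⁅a, b⁆
    rw [LieHom.map_lie, show permHom e a = a from ha, show permHom e b = b from hb]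

/-- `U(L^e) ⊗ U(L)^{⊗ N}` for the free Lie algebra `L` on `X`. -/
abbrev CoeffModule (e : Equiv.Perm X) (N : ℕ) : Type :=
  UniversalEnvelopingAlgebra ℂ (fixedSubalgebra e) ⊗[ℂ]
    (⨂[ℂ] _ : Fin N, UniversalEnvelopingAlgebra ℂ (FreeLieAlgebra ℂ X))

/-- The element `x ⊗ 1 ⊗ ⋯ ⊗ 1 + 1 ⊗ x ⊗ 1 ⊗ ⋯ ⊗ 1 + ⋯ + 1 ⊗ ⋯ ⊗ 1 ⊗ x` of the algebra
`U(L^e) ⊗ U(L)^{⊗ N}`, for `x ∈ L^e`. -/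
def coeffDiag (e : Equiv.Perm X) (N : ℕ) : fixedSubalgebra e →ₗ[ℂ] CoeffModule e N :=
  Algebra.TensorProduct.includeLeft.toLinearMap ∘ₗ
      (UniversalEnvelopingAlgebra.ι ℂ : fixedSubalgebra e →ₗ⁅ℂ⁆ _).toLinearMap +
    ∑ i : Fin N, Algebra.TensorProduct.includeRight.toLinearMap ∘ₗ
      (PiTensorProduct.singleAlgHom (R := ℂ)
        (A := fun _ : Fin N => UniversalEnvelopingAlgebra ℂ (FreeLieAlgebra ℂ X)) i).toLinearMap ∘ₗ
      (UniversalEnvelopingAlgebra.ι ℂ : FreeLieAlgebra ℂ X →ₗ⁅ℂ⁆ _).toLinearMap ∘ₗ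
      (fixedSubalgebra e).toSubmodule.subtype

/-- The action of `L^e` on `U(L^e) ⊗ U(L)^{⊗ N}`: left multiplication on each factor, extended to
the tensor product as a derivation. See `coeffAct_tprod`. -/
def coeffAct (e : Equiv.Perm X) (N : ℕ) :
    fixedSubalgebra e →ₗ[ℂ] Module.End ℂ (CoeffModule e N) :=
  (LinearMap.mul ℂ (CoeffModule e N)) ∘ₗ coeffDiag e N

lemma coeffAct_tprod (e : Equiv.Perm X) (N : ℕ) (x : fixedSubalgebra e)
    (u : UniversalEnvelopingAlgebra ℂ (fixedSubalgebra e))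
    (v : Fin N → UniversalEnvelopingAlgebra ℂ (FreeLieAlgebra ℂ X)) :
    coeffAct e N x (u ⊗ₜ PiTensorProduct.tprod ℂ v) =
      (UniversalEnvelopingAlgebra.ι ℂ x * u) ⊗ₜ PiTensorProduct.tprod ℂ v +
      ∑ i, u ⊗ₜ PiTensorProduct.tprod ℂ
        (Function.update v i (UniversalEnvelopingAlgebra.ι ℂ (x : FreeLieAlgebra ℂ X) * v i)) := by
  have h : ∀ (i : Fin N) (y : UniversalEnvelopingAlgebra ℂ (FreeLieAlgebra ℂ X)),
      (Pi.mulSingle i y : Fin N → UniversalEnvelopingAlgebra ℂ (FreeLieAlgebra ℂ X)) * v =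
        Function.update v i (y * v i) := by
    intro i y
    funext j
    rcases eq_or_ne j i with rfl | hj
    · simp
    · simp [hj]
  simp [coeffAct, coeffDiag, PiTensorProduct.singleAlgHom, h, -UniversalEnvelopingAlgebra.ι_apply]
  rfl

/-- The space `⋀^k L^e ⊗ (U(L^e) ⊗ U(L)^{⊗ N})` of `k`-chains. -/
abbrev ChainSpace (e : Equiv.Perm X) (N k : ℕ) : Type :=
  ⋀[ℂ]^k (fixedSubalgebra e) ⊗[ℂ] CoeffModule e N

/-- The differential of the standard chain complex of `L^e` with coefficients in
`U(L^e) ⊗ U(L)^{⊗ N}`. -/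
def chainD (e : Equiv.Perm X) (N k : ℕ) : ChainSpace e N (k + 1) →ₗ[ℂ] ChainSpace e N k :=
  chainDiff (coeffAct e N) k

/-- The map of fixed-point subalgebras induced by a homomorphism of free Lie algebras that
intertwines the two automorphisms. -/
def fixedMap {e : Equiv.Perm X} {e' : Equiv.Perm Y}
    (φ : FreeLieAlgebra ℂ X →ₗ⁅ℂ⁆ FreeLieAlgebra ℂ Y)
    (hφ : ∀ x, φ (permHom e x) = permHom e' (φ x)) :
    fixedSubalgebra e →ₗ⁅ℂ⁆ fixedSubalgebra e' where
  toFun x := ⟨φ x, by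
    change permHom e' (φ x) = φ x
    rw [← hφ, show permHom e (x : FreeLieAlgebra ℂ X) = x from x.2]⟩
  map_add' x y := Subtype.ext (by simp)
  map_smul' c x := Subtype.ext (by simp)
  map_lie' {x y} := Subtype.ext (by simp)

/-- The map of universal envelopes induced by a homomorphism of Lie algebras. -/
def envMap {L L' : Type} [LieRing L] [LieAlgebra ℂ L] [LieRing L'] [LieAlgebra ℂ L']
    (φ : L →ₗ⁅ℂ⁆ L') : UniversalEnvelopingAlgebra ℂ L →ₐ[ℂ] UniversalEnvelopingAlgebra ℂ L' :=
  UniversalEnvelopingAlgebra.lift ℂ ((UniversalEnvelopingAlgebra.ι ℂ).comp φ)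

/-- The map of chain spaces induced by a homomorphism of free Lie algebras that intertwines the two
automorphisms. -/
def chainMap {e : Equiv.Perm X} {e' : Equiv.Perm Y}
    (φ : FreeLieAlgebra ℂ X →ₗ⁅ℂ⁆ FreeLieAlgebra ℂ Y)
    (hφ : ∀ x, φ (permHom e x) = permHom e' (φ x)) (N k : ℕ) :
    ChainSpace e N k →ₗ[ℂ] ChainSpace e' N k :=
  TensorProduct.map (exteriorPower.map k (fixedMap φ hφ).toLinearMap)
    (TensorProduct.map (envMap (fixedMap φ hφ)).toLinearMap
      (PiTensorProduct.map fun _ => (envMap φ).toLinearMap))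

/-! ### Commutators and weights -/

/-- `IsCommutator A g`: the element `g` is an iterated bracket of generators, in which the generators
listed (with multiplicity) in `A` occur. -/
inductive IsCommutator : Multiset X → FreeLieAlgebra ℂ X → Prop
  | of (x : X) : IsCommutator {x} (FreeLieAlgebra.of ℂ x)
  | lie {A B : Multiset X} {g h : FreeLieAlgebra ℂ X} :
      IsCommutator A g → IsCommutator B h → IsCommutator (A + B) ⁅g, h⁆

/-- The subspace of weight `μ` of the free Lie algebra, where the generator `x` has weight
`deg x`. -/
def weightLie (deg : X → J → ℕ) (μ : J → ℕ) : Submodule ℂ (FreeLieAlgebra ℂ X) :=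
  Submodule.span ℂ {g | ∃ A, IsCommutator A g ∧ (A.map deg).sum = μ}

/-- The subspace of weight `μ` of the fixed-point subalgebra. -/
def weightFixed (e : Equiv.Perm X) (deg : X → J → ℕ) (μ : J → ℕ) :
    Submodule ℂ (fixedSubalgebra e) :=
  (weightLie deg μ).comap (fixedSubalgebra e).toSubmodule.subtype

/-- The subspace of weight `μ` of the universal envelope of a Lie algebra with weight subspaces `W`:
it is spanned by products of weight vectors with total weight `μ`. -/
def weightEnv {L : Type} [LieRing L] [LieAlgebra ℂ L] (W : (J → ℕ) → Submodule ℂ L) (μ : J → ℕ) :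
    Submodule ℂ (UniversalEnvelopingAlgebra ℂ L) :=
  Submodule.span ℂ {u | ∃ l : List ((J → ℕ) × L), (∀ p ∈ l, p.2 ∈ W p.1) ∧
    (l.map Prod.fst).sum = μ ∧ u = (l.map fun p => UniversalEnvelopingAlgebra.ι ℂ p.2).prod}

/-- The subspace of weight `μ` of the chain space: it is spanned by tensor products of weight vectors
with total weight `μ`. -/
def weightChain (e : Equiv.Perm X) (deg : X → J → ℕ) (N k : ℕ) (μ : J → ℕ) :
    Submodule ℂ (ChainSpace e N k) :=
  Submodule.span ℂ {x | ∃ (a : Fin k → J → ℕ) (b : J → ℕ) (c : Fin N → J → ℕ)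
    (g : Fin k → fixedSubalgebra e) (u : UniversalEnvelopingAlgebra ℂ (fixedSubalgebra e))
    (v : Fin N → UniversalEnvelopingAlgebra ℂ (FreeLieAlgebra ℂ X)),
    (∀ i, g i ∈ weightFixed e deg (a i)) ∧ u ∈ weightEnv (weightFixed e deg) b ∧
    (∀ j, v j ∈ weightEnv (weightLie deg) (c j)) ∧ ∑ i, a i + b + ∑ j, c j = μ ∧
    x = exteriorPower.ιMulti ℂ k g ⊗ₜ (u ⊗ₜ PiTensorProduct.tprod ℂ v)}

open Classical in
/-- The projection onto `p` along `q`, for complementary subspaces `p` and `q`. -/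
def projAlong {E : Type} [AddCommGroup E] [Module ℂ E] (p q : Submodule ℂ E) : E →ₗ[ℂ] p :=
  if h : IsCompl p q then Submodule.projectionOnto p q h else 0

/-- The projection of the chain space to its subspace of weight `μ`, along the sum of the other
weight subspaces. (The chain space is the direct sum of its weight subspaces.) -/
def weightProj (e : Equiv.Perm X) (deg : X → J → ℕ) (N k : ℕ) (μ : J → ℕ) :
    ChainSpace e N k →ₗ[ℂ] weightChain e deg N k μ :=
  projAlong (E := ChainSpace e N k) (weightChain e deg N k μ)
    (⨆ (ν : J → ℕ) (_ : ν ≠ μ), weightChain e deg N k ν)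

end FreeLie

/-! ### Cyclotomic symmetrization -/

section Symmetrization

/-- The weight of the generator `F_a` of the free Lie algebra `𝔫`: the `i`-th unit vector if `a` lies in
the `i`-th cycle of `σ`. -/
def degCycle {R r : ℕ} (σ : Equiv.Perm (Fin R)) (rep : Fin r → Fin R) (a : Fin R) : Fin r → ℕ :=
  fun i => if σ.SameCycle (rep i) a then 1 else 0

/-- The weight of the generator `ᵏf_i` of the free Lie algebra `𝔞`: the `i`-th unit vector. -/
def degIndex (T m : ℕ) (x : ZMod T × Fin m) : Fin m → ℕ := Pi.single x.2 1

/-- The permutation `ᵏf_i ↦ ᵏ⁺¹f_i` of the generators of `𝔞`, which defines the automorphism `τ`. -/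
def cycShift (T m : ℕ) : Equiv.Perm (ZMod T × Fin m) :=
  Equiv.prodCongr (Equiv.addRight 1) (Equiv.refl _)

variable {R r : ℕ} (T : ℕ) [NeZero T] (σ : Equiv.Perm (Fin R)) (rep : Fin r → Fin R)
  (lam : Fin r → ℕ)

/-- The homomorphism `𝔫 → 𝔞` that sends `F_a` to the sum of all `ᵏf_{(i,n)}`, `1 ≤ n ≤ λ_i`, such that
`σ^k F_{rep i} = F_a`. (If `T_i` is the length of the cycle of `rep i` and `F_a = σ^k F_{rep i}`, these
are the generators `ᵏ⁺ˡf_{(i,n)}` where `l` is a multiple of `T_i` and `1 ≤ n ≤ λ_i`.) -/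
def jHom : FreeLieAlgebra ℂ (Fin R) →ₗ⁅ℂ⁆ FreeLieAlgebra ℂ (ZMod T × Fin (∑ i, lam i)) :=
  FreeLieAlgebra.lift ℂ fun a =>
    ∑ x : ZMod T × Fin (∑ i, lam i) with (σ ^ x.1.val) (rep (finSigmaFinEquiv.symm x.2).1) = a,
      FreeLieAlgebra.of ℂ x

variable {T σ}

lemma jHom_permHom (hT : orderOf σ = T) (x : FreeLieAlgebra ℂ (Fin R)) :
    jHom T σ rep lam (permHom σ x) =
      permHom (cycShift T (∑ i, lam i)) (jHom T σ rep lam x) := by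
  have hpow : ∀ (k : ZMod T), σ ^ (k + 1).val = σ * σ ^ k.val := by
    intro k
    have h1 : σ ^ ((k.val + (1 : ZMod T).val) % T) = σ ^ (k.val + (1 : ZMod T).val) :=
      (pow_eq_pow_mod _ (hT ▸ pow_orderOf_eq_one σ)).symm
    have h2 : σ ^ (1 : ZMod T).val = σ := by
      have : σ ^ (1 % T) = σ ^ 1 := (pow_eq_pow_mod _ (hT ▸ pow_orderOf_eq_one σ)).symm
      rw [← Nat.cast_one, ZMod.val_natCast, this, pow_one]
    rw [ZMod.val_add, h1, pow_add, h2, ← pow_succ, pow_succ']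
  suffices h : (jHom T σ rep lam).comp (permHom σ) =
      (permHom (cycShift T (∑ i, lam i))).comp (jHom T σ rep lam) from LieHom.congr_fun h x
  refine FreeLieAlgebra.hom_ext fun a => ?_
  simp only [LieHom.comp_apply, permHom_of, jHom, FreeLieAlgebra.lift_of_apply, map_sum]
  symm
  refine Finset.sum_equiv (cycShift T (∑ i, lam i)) (fun y => ?_) (fun y _ => rfl)
  simp only [Finset.mem_filter, Finset.mem_univ, true_and]
  change _ ↔ (σ ^ (y.1 + 1).val) (rep (finSigmaFinEquiv.symm y.2).1) = σ a
  rw [hpow, Equiv.Perm.mul_apply, σ.injective.eq_iff]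

variable (σ)

/-- The cyclotomic symmetrization map: the map of chain spaces induced by `jHom`, restricted to the
subspace of weight `λ` and composed with the projection to the subspace of weight `(1, …, 1)`. -/
def symmetrize (hT : orderOf σ = T) (N k : ℕ) :
    weightChain σ (degCycle σ rep) N k lam →ₗ[ℂ]
      weightChain (cycShift T (∑ i, lam i)) (degIndex T (∑ i, lam i)) N k 1 :=
  weightProj (cycShift T (∑ i, lam i)) (degIndex T (∑ i, lam i)) N k 1 ∘ₗ
    chainMap (jHom T σ rep lam) (jHom_permHom rep lam hT) N k ∘ₗ
    (weightChain σ (degCycle σ rep) N k lam).subtype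

end Symmetrization

/-! ### The maps from chains to flags -/

section Psi

variable {T m N : ℕ} [NeZero T]

/-- The element `∑_{j ∈ ℤ/T} τ^j g` of the `τ`-invariant subalgebra of `𝔞`. -/
def orbitSum (g : FreeLieAlgebra ℂ (ZMod T × Fin m)) : fixedSubalgebra (cycShift T m) :=
  ⟨∑ j : ZMod T, permHom (Equiv.prodCongr (Equiv.addRight j) (Equiv.refl _)) g, by
    have h : ∀ j : ZMod T, (permHom (cycShift T m)).comp
        (permHom (Equiv.prodCongr (Equiv.addRight j) (Equiv.refl (Fin m)))) =
          permHom (Equiv.prodCongr (Equiv.addRight (j + 1)) (Equiv.refl (Fin m))) := by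
      intro j
      refine FreeLieAlgebra.hom_ext fun x => ?_
      rcases x with ⟨a, b⟩
      simp [cycShift, add_assoc]
    change permHom (cycShift T m) _ = _
    rw [map_sum]
    refine Fintype.sum_equiv (Equiv.addRight 1) _ _ fun j => ?_
    exact LieHom.congr_fun (h j) g⟩

/-- The generator `f_i = ⁰f_i`. -/
def gen (T : ℕ) (i : Fin m) : FreeLieAlgebra ℂ (ZMod T × Fin m) := FreeLieAlgebra.of ℂ (0, i)

/-- For a commutator with content `A`: the edge `ω^{k_1} t_{i_1} = ⋯ = ω^{k_l} t_{i_l}`, where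
`(k_1, i_1), …, (k_l, i_l)` are the elements of `A`. -/
def swimming (ω : ℂˣ) (A : Multiset (ZMod T × Fin m)) : Set (Fin m → ℂ) :=
  {t | ∀ x ∈ A, ∀ y ∈ A, (cycPow ω x.1 : ℂ) * t x.2 = (cycPow ω y.1 : ℂ) * t y.2}

/-- The edge `ω^{k_1} t_{i_1} = ⋯ = ω^{k_l} t_{i_l} = c`. -/
def anchored (ω : ℂˣ) (c : ℂ) (A : Multiset (ZMod T × Fin m)) : Set (Fin m → ℂ) :=
  {t | ∀ x ∈ A, (cycPow ω x.1 : ℂ) * t x.2 = c}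

/-- A monomial of `U(𝔞)`: a product of commutators. -/
def IsMonomial (u : UniversalEnvelopingAlgebra ℂ (FreeLieAlgebra ℂ (ZMod T × Fin m))) : Prop :=
  ∃ l : List (FreeLieAlgebra ℂ (ZMod T × Fin m)), (∀ g ∈ l, ∃ A, IsCommutator A g) ∧
    u = (l.map fun g => UniversalEnvelopingAlgebra.ι ℂ g).prod

/-- A monomial of the universal envelope of the invariant subalgebra: a product of projected
commutators. -/
def IsProjMonomial (u : UniversalEnvelopingAlgebra ℂ (fixedSubalgebra (cycShift T m))) : Prop :=
  ∃ l : List (FreeLieAlgebra ℂ (ZMod T × Fin m)), (∀ g ∈ l, ∃ A, IsCommutator A g) ∧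
    u = (l.map fun g => UniversalEnvelopingAlgebra.ι ℂ (orbitSum g)).prod

/-- The chain `ḡ_k ∧ ⋯ ∧ ḡ_1 ⊗ x_0 ⊗ x_1 ⊗ ⋯ ⊗ x_N`. -/
def monomial {k : ℕ} (g : Fin k → FreeLieAlgebra ℂ (ZMod T × Fin m))
    (u : UniversalEnvelopingAlgebra ℂ (fixedSubalgebra (cycShift T m)))
    (v : Fin N → UniversalEnvelopingAlgebra ℂ (FreeLieAlgebra ℂ (ZMod T × Fin m))) :
    ChainSpace (cycShift T m) N k :=
  wedgeRev _ k (fun i => orbitSum (g i)) ⊗ₜ (u ⊗ₜ PiTensorProduct.tprod ℂ v)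

/-- The chains of weight `(1, …, 1)`. -/
abbrev MultilinearChains (T m N p : ℕ) : Type :=
  weightChain (cycShift T m) (degIndex T m) N p 1

variable (ω : ℂˣ) (z : Fin N → ℂ)

/-- The recursive rules for the linear maps `ψ_p` from the `p`-chains of weight `(1, …, 1)` to the flag
space `ℱ^{m-p}`; the indices are `p` and `q = m - p`. -/
structure IsPsi (ψ : ∀ p q : ℕ, p + q = m →
    (MultilinearChains T m N p →ₗ[ℂ] FlagSpace (cycArrangement T m ω z) q)) : Prop where
  /-- `ψ_m (f̄_1 ∧ ⋯ ∧ f̄_m ⊗ 1 ⊗ ⋯ ⊗ 1)` is the trivial flag `ℂ^m`. -/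
  base (h : m + 0 = m) (x : MultilinearChains T m N m) (F : Flag (cycArrangement T m ω z) 0)
    (hx : (x : ChainSpace (cycShift T m) N m) =
      exteriorPower.ιMulti ℂ m (fun i => orbitSum (gen T i)) ⊗ₜ
        (1 ⊗ₜ PiTensorProduct.tprod ℂ fun _ => 1)) :
    ψ m 0 h x = FlagSpace.mk F
  /-- If `ψ_{p+1} (ḡ_{p+1} ∧ ⋯ ∧ ḡ_1 ⊗ x_0 ⊗ ⋯ ⊗ x_N) = ± (L⁰ ⊃ ⋯ ⊃ L^q)`, then
  `ψ_p (ḡ_{p+1} ∧ ⋯ ∧ ḡ_2 ⊗ x_0 ⊗ ⋯ ⊗ g_1 x_j ⊗ ⋯ ⊗ x_N) = ± (L⁰ ⊃ ⋯ ⊃ L^q ⊃ L^q ∩ L_{g_1}^j)`, with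
  the same sign. -/
  anchor {p q : ℕ} (h : p + 1 + q = m) (h' : p + (q + 1) = m)
    (g : Fin p → FreeLieAlgebra ℂ (ZMod T × Fin m)) (g₁ : FreeLieAlgebra ℂ (ZMod T × Fin m))
    (A : Multiset (ZMod T × Fin m))
    (u : UniversalEnvelopingAlgebra ℂ (fixedSubalgebra (cycShift T m)))
    (v : Fin N → UniversalEnvelopingAlgebra ℂ (FreeLieAlgebra ℂ (ZMod T × Fin m))) (j : Fin N)
    (x : MultilinearChains T m N (p + 1)) (x' : MultilinearChains T m N p)
    (s : ℤˣ) (F : Flag (cycArrangement T m ω z) q) (F' : Flag (cycArrangement T m ω z) (q + 1))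
    (hg : ∀ i, ∃ B, IsCommutator B (g i)) (hg₁ : IsCommutator A g₁) (hu : IsProjMonomial u)
    (hv : ∀ i, IsMonomial (v i))
    (hx : (x : ChainSpace (cycShift T m) N (p + 1)) = monomial (Fin.cons g₁ g) u v)
    (hx' : (x' : ChainSpace (cycShift T m) N p) =
      monomial g u (Function.update v j (UniversalEnvelopingAlgebra.ι ℂ g₁ * v j)))
    (hF : F'.init = F)
    (hlast : (F'.last : Set (Fin m → ℂ)) = (F.last : Set (Fin m → ℂ)) ∩ anchored ω (z j) A)
    (hψ : ψ (p + 1) q h x = (s : ℤ) • FlagSpace.mk F) :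
    ψ p (q + 1) h' x' = (s : ℤ) • FlagSpace.mk F'
  /-- If `ψ_{p+1} (ḡ_{p+1} ∧ ⋯ ∧ ḡ_1 ⊗ x_0 ⊗ ⋯ ⊗ x_N) = ± (L⁰ ⊃ ⋯ ⊃ L^q)`, then
  `ψ_p (ḡ_{p+1} ∧ ⋯ ∧ ḡ_2 ⊗ ḡ_1 x_0 ⊗ x_1 ⊗ ⋯ ⊗ x_N) = ± (L⁰ ⊃ ⋯ ⊃ L^q ⊃ L^q ∩ L_{g_1}^0)`, with the
  same sign. -/
  origin {p q : ℕ} (h : p + 1 + q = m) (h' : p + (q + 1) = m)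
    (g : Fin p → FreeLieAlgebra ℂ (ZMod T × Fin m)) (g₁ : FreeLieAlgebra ℂ (ZMod T × Fin m))
    (A : Multiset (ZMod T × Fin m))
    (u : UniversalEnvelopingAlgebra ℂ (fixedSubalgebra (cycShift T m)))
    (v : Fin N → UniversalEnvelopingAlgebra ℂ (FreeLieAlgebra ℂ (ZMod T × Fin m)))
    (x : MultilinearChains T m N (p + 1)) (x' : MultilinearChains T m N p)
    (s : ℤˣ) (F : Flag (cycArrangement T m ω z) q) (F' : Flag (cycArrangement T m ω z) (q + 1))
    (hg : ∀ i, ∃ B, IsCommutator B (g i)) (hg₁ : IsCommutator A g₁) (hu : IsProjMonomial u)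
    (hv : ∀ i, IsMonomial (v i))
    (hx : (x : ChainSpace (cycShift T m) N (p + 1)) = monomial (Fin.cons g₁ g) u v)
    (hx' : (x' : ChainSpace (cycShift T m) N p) =
      monomial g (UniversalEnvelopingAlgebra.ι ℂ (orbitSum g₁) * u) v)
    (hF : F'.init = F)
    (hlast : (F'.last : Set (Fin m → ℂ)) = (F.last : Set (Fin m → ℂ)) ∩ anchored ω 0 A)
    (hψ : ψ (p + 1) q h x = (s : ℤ) • FlagSpace.mk F) :
    ψ p (q + 1) h' x' = (s : ℤ) • FlagSpace.mk F'
  /-- If `ψ_{p+2} (ḡ_{p+2} ∧ ⋯ ∧ ḡ_1 ⊗ x_0 ⊗ ⋯ ⊗ x_N) = ± (L⁰ ⊃ ⋯ ⊃ L^q)`, and `c` is the orbit sum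
  of `[g_1, g_2]`, then `ψ_{p+1} (ḡ_{p+2} ∧ ⋯ ∧ ḡ_3 ∧ c ⊗ x_0 ⊗ ⋯ ⊗ x_N) =
  ± (L⁰ ⊃ ⋯ ⊃ L^q ⊃ L^q ∩ L_{[g_1, g_2]})`, with the same sign. -/
  join {p q : ℕ} (h : p + 1 + 1 + q = m) (h' : p + 1 + (q + 1) = m)
    (g : Fin p → FreeLieAlgebra ℂ (ZMod T × Fin m)) (g₁ g₂ : FreeLieAlgebra ℂ (ZMod T × Fin m))
    (A₁ A₂ : Multiset (ZMod T × Fin m))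
    (u : UniversalEnvelopingAlgebra ℂ (fixedSubalgebra (cycShift T m)))
    (v : Fin N → UniversalEnvelopingAlgebra ℂ (FreeLieAlgebra ℂ (ZMod T × Fin m)))
    (x : MultilinearChains T m N (p + 1 + 1)) (x' : MultilinearChains T m N (p + 1))
    (s : ℤˣ) (F : Flag (cycArrangement T m ω z) q) (F' : Flag (cycArrangement T m ω z) (q + 1))
    (hg : ∀ i, ∃ B, IsCommutator B (g i)) (hg₁ : IsCommutator A₁ g₁) (hg₂ : IsCommutator A₂ g₂)
    (hu : IsProjMonomial u) (hv : ∀ i, IsMonomial (v i))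
    (hx : (x : ChainSpace (cycShift T m) N (p + 1 + 1)) =
      monomial (Fin.cons g₁ (Fin.cons g₂ g : Fin (p + 1) → _)) u v)
    (hx' : (x' : ChainSpace (cycShift T m) N (p + 1)) = monomial (Fin.cons ⁅g₁, g₂⁆ g) u v)
    (hF : F'.init = F)
    (hlast : (F'.last : Set (Fin m → ℂ)) = (F.last : Set (Fin m → ℂ)) ∩ swimming ω (A₁ + A₂))
    (hψ : ψ (p + 1 + 1) q h x = (s : ℤ) • FlagSpace.mk F) :
    ψ (p + 1) (q + 1) h' x' = (s : ℤ) • FlagSpace.mk F'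

end Psi

end

end Cyclotomic

open Cyclotomic

namespace Cyclotomic
noncomputable section

/-! ### Linear algebra -/

section Spectral

variable {E : Type*} [AddCommGroup E] [Module ℂ E]

lemma exists_spectralMap (f : Module.End ℂ E) (hf : ⨆ μ, f.eigenspace μ = ⊤) (F : ℂ → ℂ) :
    ∃ g : Module.End ℂ E, ∀ μ x, x ∈ f.eigenspace μ → g x = F μ • x := by
  classical
  have hint : DirectSum.IsInternal f.eigenspace :=
    DirectSum.isInternal_submodule_of_iSupIndep_of_iSup_eq_top
      f.eigenspaces_iSupIndep hf
  let e := LinearEquiv.ofBijective (DirectSum.coeLinearMap f.eigenspace) hint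
  refine ⟨(DirectSum.toModule ℂ ℂ E fun μ => F μ • (f.eigenspace μ).subtype) ∘ₗ
    e.symm.toLinearMap, fun μ x hx => ?_⟩
  have h : e.symm x = DirectSum.lof ℂ ℂ (fun μ => f.eigenspace μ) μ ⟨x, hx⟩ := by
    rw [LinearEquiv.symm_apply_eq]
    exact (DirectSum.coeLinearMap_lof f.eigenspace μ ⟨x, hx⟩).symm
  simp only [LinearMap.comp_apply, LinearEquiv.coe_coe, h, DirectSum.toModule_lof]
  rfl

open Classical in
/-- The operator that acts on the `μ`-eigenspace of `f` as the scalar `F μ`, provided that `f` is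
diagonalizable. -/
def spectralMap (f : Module.End ℂ E) (F : ℂ → ℂ) : Module.End ℂ E :=
  if hf : ⨆ μ, f.eigenspace μ = ⊤ then (exists_spectralMap f hf F).choose else 0

lemma spectralMap_apply {f : Module.End ℂ E} (hf : ⨆ μ, f.eigenspace μ = ⊤) (F : ℂ → ℂ) {μ : ℂ}
    {x : E} (hx : f x = μ • x) : spectralMap f F x = F μ • x := by
  rw [spectralMap, dif_pos hf]
  exact (exists_spectralMap f hf F).choose_spec μ x (Module.End.mem_eigenspace_iff.2 hx)

lemma iSup_eigenspace_eq_top {ι : Type*} {f : Module.End ℂ E} {W : ι → Submodule ℂ E} {χ : ι → ℂ}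
    (hW : ⨆ i, W i = ⊤) (hf : ∀ i, ∀ x ∈ W i, f x = χ i • x) : ⨆ μ, f.eigenspace μ = ⊤ := by
  rw [eq_top_iff, ← hW]
  exact iSup_le fun i => le_trans
    (fun x hx => Module.End.mem_eigenspace_iff.2 (hf i x hx)) (le_iSup _ (χ i))

lemma mem_iSup_of_eigenvector {ι : Type*} {f : Module.End ℂ E} {W : ι → Submodule ℂ E} {χ : ι → ℂ}
    (hW : ⨆ i, W i = ⊤) (hf : ∀ i, ∀ x ∈ W i, f x = χ i • x) {μ : ℂ} {x : E} (hx : f x = μ • x) :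
    x ∈ ⨆ (i) (_ : χ i = μ), W i := by
  classical
  have htop := iSup_eigenspace_eq_top hW hf
  let g := spectralMap f fun ν => if ν = μ then 1 else 0
  have hg : ∀ y, g y ∈ ⨆ (i) (_ : χ i = μ), W i := by
    intro y
    have hy : y ∈ ⨆ i, W i := hW ▸ Submodule.mem_top
    induction hy using Submodule.iSup_induction' with
    | mem i y hy =>
      rw [spectralMap_apply htop _ (hf i y hy)]
      split_ifs with h
      · rw [one_smul]
        exact Submodule.mem_iSup_of_mem i (Submodule.mem_iSup_of_mem h hy)
      · rw [zero_smul]; exact Submodule.zero_mem _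
    | zero => rw [map_zero]; exact Submodule.zero_mem _
    | add y z _ _ hy hz => rw [map_add]; exact Submodule.add_mem _ hy hz
  have := hg x
  rwa [spectralMap_apply htop _ hx, if_pos rfl, one_smul] at this

lemma isCompl_of_eigenvalues {ι : Type*} {f : Module.End ℂ E} {W : ι → Submodule ℂ E} {χ : ι → ℂ}
    (hχ : Function.Injective χ) (hW : ⨆ i, W i = ⊤) (hf : ∀ i, ∀ x ∈ W i, f x = χ i • x) (i : ι) :
    IsCompl (W i) (⨆ (j) (_ : j ≠ i), W j) := by
  constructor
  · have h := (f.eigenspaces_iSupIndep.comp hχ).mono (t := W)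
      fun i x hx => Module.End.mem_eigenspace_iff.2 (hf i x hx)
    exact h i
  · rw [codisjoint_iff, eq_top_iff, ← hW]
    refine iSup_le fun j => ?_
    by_cases h : j = i
    · subst h; exact le_sup_left
    · exact le_trans (le_iSup₂_of_le j h le_rfl) le_sup_right

lemma projAlong_apply_self {E : Type} [AddCommGroup E] [Module ℂ E] {p q : Submodule ℂ E}
    (h : IsCompl p q) {x : E} (hx : x ∈ p) : (projAlong p q x : E) = x := by
  rw [projAlong, dif_pos h]
  exact congrArg Subtype.val (Submodule.projectionOnto_apply_left h ⟨x, hx⟩)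

lemma projAlong_apply_zero {E : Type} [AddCommGroup E] [Module ℂ E] {p q : Submodule ℂ E}
    (h : IsCompl p q) {x : E} (hx : x ∈ q) : projAlong p q x = 0 := by
  rw [projAlong, dif_pos h]
  exact (Submodule.projectionOnto_apply_eq_zero_iff h).2 hx

end Spectral

section MultilinearSpan

lemma map_mem_span_of_mem_span {ι : Type*} [Finite ι] {M : ι → Type*}
    [∀ i, AddCommGroup (M i)] [∀ i, Module ℂ (M i)] {E : Type*} [AddCommGroup E] [Module ℂ E]
    (f : MultilinearMap ℂ M E) (S : ∀ i, Set (M i)) (x : ∀ i, M i)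
    (hx : ∀ i, x i ∈ Submodule.span ℂ (S i)) :
    f x ∈ Submodule.span ℂ {y | ∃ s : ∀ i, M i, (∀ i, s i ∈ S i) ∧ y = f s} := by
  classical
  have := Fintype.ofFinite ι
  suffices h : ∀ (t : Finset ι) (x : ∀ i, M i), (∀ i ∈ t, x i ∈ Submodule.span ℂ (S i)) →
      (∀ i ∉ t, x i ∈ S i) → f x ∈ Submodule.span ℂ {y | ∃ s : ∀ i, M i, (∀ i, s i ∈ S i) ∧ y = f s}
    from h Finset.univ x (fun i _ => hx i) (by simp)
  intro t
  induction t using Finset.induction_on with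
  | empty => exact fun x _ h => Submodule.subset_span ⟨x, fun i => h i (by simp), rfl⟩
  | insert a t ha ih =>
    intro x h1 h2
    have key : ∀ y ∈ Submodule.span ℂ (S a), f (Function.update x a y) ∈
        Submodule.span ℂ {y | ∃ s : ∀ i, M i, (∀ i, s i ∈ S i) ∧ y = f s} := by
      intro y hy
      induction hy using Submodule.span_induction with
      | mem y hy =>
        refine ih _ (fun i hi => ?_) (fun i hi => ?_)
        · rw [Function.update_of_ne (by rintro rfl; exact ha hi)]
          exact h1 i (Finset.mem_insert_of_mem hi)
        · by_cases hia : i = a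
          · subst hia; simpa using hy
          · rw [Function.update_of_ne hia]
            exact h2 i (by simp [hia, hi])
      | zero => rw [f.map_update_zero]; exact Submodule.zero_mem _
      | add y z _ _ hy hz => rw [f.map_update_add]; exact Submodule.add_mem _ hy hz
      | smul c y _ hy => rw [f.map_update_smul]; exact Submodule.smul_mem _ _ hy
    simpa using key (x a) (h1 a (Finset.mem_insert_self a t))

end MultilinearSpan

section PrimeCode

/-- An injective assignment of prime numbers. -/
def primeCode {D : Type*} [Countable D] (d : D) : ℕ :=
  Nat.nth Nat.Prime ((Countable.exists_injective_nat D).choose d)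

lemma primeCode_prime {D : Type*} [Countable D] (d : D) : (primeCode d).Prime :=
  Nat.prime_nth_prime _

lemma primeCode_injective {D : Type*} [Countable D] :
    Function.Injective (primeCode : D → ℕ) :=
  (Nat.nth_injective Nat.infinite_setOfPred_prime).comp
    (Countable.exists_injective_nat D).choose_spec

/-- The product of the primes assigned to the elements of a multiset. -/
def primeProd {D : Type*} [Countable D] (s : Multiset D) : ℂ :=
  (s.map fun d => (primeCode d : ℂ)).prod

lemma primeProd_add {D : Type*} [Countable D] (s t : Multiset D) :
    primeProd (s + t) = primeProd s * primeProd t := by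
  simp [primeProd]

@[simp]
lemma primeProd_zero {D : Type*} [Countable D] : primeProd (0 : Multiset D) = 1 := by
  simp [primeProd]

lemma primeProd_sum {D ι : Type*} [Countable D] (t : Finset ι) (s : ι → Multiset D) :
    primeProd (∑ i ∈ t, s i) = ∏ i ∈ t, primeProd (s i) := by
  classical
  induction t using Finset.induction_on with
  | empty => simp
  | insert a t ha ih => rw [Finset.sum_insert ha, Finset.prod_insert ha, primeProd_add, ih]

lemma primeProd_injective {D : Type*} [Countable D] :
    Function.Injective (primeProd : Multiset D → ℂ) := by
  intro s t h
  have key : ∀ s : Multiset D, UniqueFactorizationMonoid.normalizedFactors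
      (s.map (primeCode (D := D))).prod = s.map primeCode := fun s =>
    UniqueFactorizationMonoid.normalizedFactors_prod_of_prime fun p hp => by
      obtain ⟨d, -, rfl⟩ := Multiset.mem_map.1 hp
      exact (primeCode_prime d).prime
  have cast : ∀ s : Multiset D, primeProd s = (((s.map (primeCode (D := D))).prod : ℕ) : ℂ) := by
    intro s
    rw [primeProd, Nat.cast_multiset_prod, Multiset.map_map]
    rfl
  rw [cast, cast, Nat.cast_inj] at h
  have := congrArg UniqueFactorizationMonoid.normalizedFactors h
  rw [key, key] at this
  exact Multiset.map_injective primeCode_injective this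

/-- The product `∏ p_j^{μ_j}` for distinct primes `p_j`. -/
def primePow {J : Type*} [Fintype J] (μ : J → ℕ) : ℂ := ∏ j, (primeCode j : ℂ) ^ μ j

lemma primePow_injective {J : Type*} [Fintype J] :
    Function.Injective (primePow : (J → ℕ) → ℂ) := by
  classical
  intro μ ν h
  have key : ∀ μ : J → ℕ, primePow μ = primeProd (∑ j, Multiset.replicate (μ j) j) := by
    intro μ
    rw [primeProd_sum]
    simp [primePow, primeProd]
  rw [key, key] at h
  funext j
  have := congrArg (Multiset.count j) (primeProd_injective h)
  simpa [Multiset.count_sum', Multiset.count_replicate] using this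

end PrimeCode

end

end Cyclotomic

namespace Cyclotomic
noncomputable section

/-! ### Weights -/

section Weights

variable {X Y J : Type}

attribute [local instance] LieRing.ofAssociativeRing

lemma span_isCommutator :
    Submodule.span ℂ {g : FreeLieAlgebra ℂ X | ∃ A, IsCommutator A g} = ⊤ := by
  let S : Submodule ℂ (FreeLieAlgebra ℂ X) := Submodule.span ℂ {g | ∃ A, IsCommutator A g}
  let K : LieSubalgebra ℂ (FreeLieAlgebra ℂ X) :=
    { S with
      lie_mem' := by
        intro x y hx hy
        change x ∈ S at hx
        change y ∈ S at hy
        change ⁅x, y⁆ ∈ S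
        induction hx using Submodule.span_induction with
        | mem x hx =>
          induction hy using Submodule.span_induction with
          | mem y hy =>
            obtain ⟨A, hA⟩ := hx
            obtain ⟨B, hB⟩ := hy
            exact Submodule.subset_span ⟨A + B, hA.lie hB⟩
          | zero => rw [lie_zero]; exact S.zero_mem
          | add y z _ _ hy hz => rw [lie_add]; exact S.add_mem hy hz
          | smul c y _ hy => rw [lie_smul]; exact S.smul_mem c hy
        | zero => rw [zero_lie]; exact S.zero_mem
        | add y z _ _ hy hz => rw [add_lie]; exact S.add_mem hy hz
        | smul c y _ hy => rw [smul_lie]; exact S.smul_mem c hy }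
  let f : FreeLieAlgebra ℂ X →ₗ⁅ℂ⁆ K := FreeLieAlgebra.lift ℂ fun x =>
    ⟨FreeLieAlgebra.of ℂ x, Submodule.subset_span ⟨{x}, IsCommutator.of x⟩⟩
  have hf : K.incl.comp f = LieHom.id := by
    refine FreeLieAlgebra.hom_ext fun x => ?_
    simp [f]
  rw [eq_top_iff]
  intro x _
  have : ((f x : K) : FreeLieAlgebra ℂ X) = x := LieHom.congr_fun hf x
  rw [← this]
  exact (f x).2

/-- The endomorphism of the free Lie algebra that multiplies the generator `x` by `c x`. -/
def scaleHom (c : X → ℂ) : FreeLieAlgebra ℂ X →ₗ⁅ℂ⁆ FreeLieAlgebra ℂ X :=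
  FreeLieAlgebra.lift ℂ fun x => c x • FreeLieAlgebra.of ℂ x

@[simp]
lemma scaleHom_of (c : X → ℂ) (x : X) :
    scaleHom c (FreeLieAlgebra.of ℂ x) = c x • FreeLieAlgebra.of ℂ x := by
  simp [scaleHom]

lemma IsCommutator.scaleHom_apply (c : X → ℂ) {A : Multiset X} {g : FreeLieAlgebra ℂ X}
    (h : IsCommutator A g) : scaleHom c g = (A.map c).prod • g := by
  induction h with
  | of x => simp
  | lie hA hB ihA ihB =>
    rw [LieHom.map_lie, ihA, ihB, Multiset.map_add, Multiset.prod_add, smul_lie, lie_smul,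
      smul_smul]

lemma scaleHom_permHom {e : Equiv.Perm X} {c : X → ℂ} (hc : ∀ x, c (e x) = c x)
    (x : FreeLieAlgebra ℂ X) : scaleHom c (permHom e x) = permHom e (scaleHom c x) := by
  suffices h : (scaleHom c).comp (permHom e) = (permHom e).comp (scaleHom c) from
    LieHom.congr_fun h x
  refine FreeLieAlgebra.hom_ext fun x => ?_
  simp [hc]

lemma IsCommutator.permHom (e : Equiv.Perm X) {A : Multiset X} {g : FreeLieAlgebra ℂ X}
    (h : IsCommutator A g) : IsCommutator (A.map e) (permHom e g) := by
  induction h with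
  | of x => simpa using IsCommutator.of (e x)
  | lie hA hB ihA ihB =>
    rw [LieHom.map_lie, Multiset.map_add]
    exact ihA.lie ihB

lemma IsCommutator.ne_zero {A : Multiset X} {g : FreeLieAlgebra ℂ X}
    (h : IsCommutator A g) : A ≠ 0 := by
  induction h with
  | of x => simp
  | lie hA hB ihA ihB => simp [ihA]

lemma permHom_pow_comm {e : Equiv.Perm X} {e' : Equiv.Perm Y}
    {φ : FreeLieAlgebra ℂ X →ₗ⁅ℂ⁆ FreeLieAlgebra ℂ Y}
    (hφ : ∀ x, φ (permHom e x) = permHom e' (φ x)) (n : ℕ) (x : FreeLieAlgebra ℂ X) :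
    φ (permHom (e ^ n) x) = permHom (e' ^ n) (φ x) := by
  have key : ∀ {Z : Type} (e : Equiv.Perm Z) (n : ℕ) (x : FreeLieAlgebra ℂ Z),
      permHom (e ^ (n + 1)) x = permHom e (permHom (e ^ n) x) := by
    intro Z e n x
    suffices h : permHom (e ^ (n + 1)) = (permHom e).comp (permHom (e ^ n)) from
      LieHom.congr_fun h x
    refine FreeLieAlgebra.hom_ext fun x => ?_
    simp [pow_succ']
  have one : ∀ {Z : Type} (x : FreeLieAlgebra ℂ Z), permHom 1 x = x := by
    intro Z x
    suffices h : permHom (1 : Equiv.Perm Z) = LieHom.id from LieHom.congr_fun h x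
    refine FreeLieAlgebra.hom_ext fun x => ?_
    simp
  induction n with
  | zero => rw [pow_zero, pow_zero, one, one]
  | succ n ih => rw [key, key, hφ, ih]

lemma permHom_permHom (e f : Equiv.Perm X) (x : FreeLieAlgebra ℂ X) :
    permHom e (permHom f x) = permHom (e * f) x := by
  suffices h : (permHom e).comp (permHom f) = permHom (e * f) from LieHom.congr_fun h x
  refine FreeLieAlgebra.hom_ext fun x => ?_
  simp

lemma permHom_one (x : FreeLieAlgebra ℂ X) : permHom 1 x = x := by
  suffices h : permHom (1 : Equiv.Perm X) = LieHom.id from LieHom.congr_fun h x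
  refine FreeLieAlgebra.hom_ext fun x => ?_
  simp

/-- The sum `∑_{j<n} e^j g`, as an element of the fixed-point subalgebra, where `e^n = 1`. -/
def cycSum {e : Equiv.Perm X} {n : ℕ} (hn : e ^ n = 1) :
    FreeLieAlgebra ℂ X →ₗ[ℂ] fixedSubalgebra e :=
  LinearMap.codRestrict (fixedSubalgebra e).toSubmodule
    (∑ j ∈ Finset.range n, (permHom (e ^ j)).toLinearMap) (by
      intro g
      change permHom e _ = _
      simp only [LinearMap.sum_apply, map_sum, LieHom.coe_toLinearMap, permHom_permHom, ← pow_succ']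
      have h := Finset.sum_range_succ' (fun k => permHom (e ^ k) g) n
      rw [Finset.sum_range_succ, hn, pow_zero] at h
      exact (add_right_cancel h).symm)

lemma coe_cycSum {e : Equiv.Perm X} {n : ℕ} (hn : e ^ n = 1) (g : FreeLieAlgebra ℂ X) :
    (cycSum hn g : FreeLieAlgebra ℂ X) = ∑ j ∈ Finset.range n, permHom (e ^ j) g := by
  change (∑ j ∈ Finset.range n, (permHom (e ^ j)).toLinearMap) g = _
  rw [LinearMap.sum_apply]
  rfl

lemma cycSum_coe {e : Equiv.Perm X} {n : ℕ} (hn : e ^ n = 1) (x : fixedSubalgebra e) :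
    cycSum hn (x : FreeLieAlgebra ℂ X) = (n : ℂ) • x := by
  refine Subtype.ext ?_
  have h : ∀ j, permHom (e ^ j) (x : FreeLieAlgebra ℂ X) = x := by
    intro j
    induction j with
    | zero => rw [pow_zero, permHom_one]
    | succ j ih => rw [pow_succ', ← permHom_permHom, ih]; exact x.2
  rw [coe_cycSum]
  simp [h, Nat.cast_smul_eq_nsmul]

lemma fixedMap_cycSum {e : Equiv.Perm X} {e' : Equiv.Perm Y} {n : ℕ} (hn : e ^ n = 1)
    (hn' : e' ^ n = 1) (φ : FreeLieAlgebra ℂ X →ₗ⁅ℂ⁆ FreeLieAlgebra ℂ Y)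
    (hφ : ∀ x, φ (permHom e x) = permHom e' (φ x)) (g : FreeLieAlgebra ℂ X) :
    fixedMap φ hφ (cycSum hn g) = cycSum hn' (φ g) := by
  refine Subtype.ext ?_
  change φ (cycSum hn g) = _
  rw [coe_cycSum, coe_cycSum, map_sum]
  exact Finset.sum_congr rfl fun j _ => permHom_pow_comm hφ j g

/-- The element `y` of the fixed-point subalgebra is the sum of the images of a commutator with
content `A` under the powers of `e`. -/
def IsCycCommutator {e : Equiv.Perm X} {n : ℕ} (hn : e ^ n = 1) (A : Multiset X)
    (y : fixedSubalgebra e) : Prop :=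
  ∃ g, IsCommutator A g ∧ y = cycSum hn g

lemma span_isCycCommutator {e : Equiv.Perm X} {n : ℕ} (hn : e ^ n = 1) (h0 : n ≠ 0) :
    Submodule.span ℂ {y : fixedSubalgebra e | ∃ A, IsCycCommutator hn A y} = ⊤ := by
  rw [eq_top_iff]
  intro x _
  have hx : x = (n : ℂ)⁻¹ • cycSum hn (x : FreeLieAlgebra ℂ X) := by
    rw [cycSum_coe, smul_smul, inv_mul_cancel₀ (Nat.cast_ne_zero.2 h0), one_smul]
  rw [hx]
  refine Submodule.smul_mem _ _ ?_
  have h : (x : FreeLieAlgebra ℂ X) ∈ Submodule.span ℂ {g | ∃ A, IsCommutator A g} :=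
    span_isCommutator ▸ Submodule.mem_top
  refine Submodule.span_le.2 ?_ (Submodule.apply_mem_span_image_of_mem_span (cycSum hn) h)
  rintro _ ⟨g, ⟨A, hA⟩, rfl⟩
  exact Submodule.subset_span ⟨A, g, hA, rfl⟩

lemma weightFixed_le {e : Equiv.Perm X} {n : ℕ} (hn : e ^ n = 1) (h0 : n ≠ 0) (deg : X → J → ℕ)
    (μ : J → ℕ) : weightFixed e deg μ ≤
      Submodule.span ℂ {y | ∃ A, IsCycCommutator hn A y ∧ (A.map deg).sum = μ} := by
  intro x hx
  have hx' : x = (n : ℂ)⁻¹ • cycSum hn (x : FreeLieAlgebra ℂ X) := by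
    rw [cycSum_coe, smul_smul, inv_mul_cancel₀ (Nat.cast_ne_zero.2 h0), one_smul]
  rw [hx']
  refine Submodule.smul_mem _ _ ?_
  have h : (x : FreeLieAlgebra ℂ X) ∈ weightLie deg μ := hx
  refine Submodule.span_le.2 ?_ (Submodule.apply_mem_span_image_of_mem_span (cycSum hn) h)
  rintro _ ⟨g, ⟨A, hA, hd⟩, rfl⟩
  exact Submodule.subset_span ⟨A, ⟨g, hA, rfl⟩, hd⟩

lemma sum_map_deg_map {e : Equiv.Perm X} {deg : X → J → ℕ} (hdeg : ∀ x, deg (e x) = deg x)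
    (j : ℕ) (A : Multiset X) : ((A.map (e ^ j : Equiv.Perm X)).map deg).sum = (A.map deg).sum := by
  have h : ∀ x, deg ((e ^ j : Equiv.Perm X) x) = deg x := by
    intro x
    induction j with
    | zero => simp
    | succ j ih => rw [pow_succ', Equiv.Perm.mul_apply, hdeg, ih]
  rw [Multiset.map_map]
  simp only [Function.comp_def, h]

lemma IsCycCommutator.mem_weightFixed {e : Equiv.Perm X} {n : ℕ} {hn : e ^ n = 1}
    {deg : X → J → ℕ} (hdeg : ∀ x, deg (e x) = deg x) {A : Multiset X} {y : fixedSubalgebra e}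
    (h : IsCycCommutator hn A y) : y ∈ weightFixed e deg (A.map deg).sum := by
  obtain ⟨g, hg, rfl⟩ := h
  change (cycSum hn g : FreeLieAlgebra ℂ X) ∈ weightLie deg _
  rw [coe_cycSum]
  refine Submodule.sum_mem _ fun j _ => Submodule.subset_span ⟨_, hg.permHom _, ?_⟩
  exact sum_map_deg_map hdeg j A

/-- Monomials of the universal envelope in elements `g` with content `a`, where `S a g`; the content
of a monomial is the sum of the contents of its factors. -/
inductive EnvMonomial {L M : Type} [LieRing L] [LieAlgebra ℂ L] [AddCommMonoid M]
    (S : M → L → Prop) : M → UniversalEnvelopingAlgebra ℂ L → Prop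
  | one : EnvMonomial S 0 1
  | mul {a b : M} {g : L} {u : UniversalEnvelopingAlgebra ℂ L} : S a g → EnvMonomial S b u →
      EnvMonomial S (a + b) (UniversalEnvelopingAlgebra.ι ℂ g * u)

section Env

variable {L M : Type} [LieRing L] [LieAlgebra ℂ L] [AddCommMonoid M] {S : M → L → Prop}

lemma EnvMonomial.exists_list {a : M} {u : UniversalEnvelopingAlgebra ℂ L}
    (h : EnvMonomial S a u) : ∃ l : List (M × L), (∀ p ∈ l, S p.1 p.2) ∧
      (l.map Prod.fst).sum = a ∧ u = (l.map fun p => UniversalEnvelopingAlgebra.ι ℂ p.2).prod := by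
  induction h with
  | one => exact ⟨[], by simp, rfl, rfl⟩
  | @mul a b g u hg _ ih =>
    obtain ⟨l, h1, h2, h3⟩ := ih
    refine ⟨(a, g) :: l, ?_, by simp [h2], by simp [h3]⟩
    simpa [hg] using h1

lemma adjoin_range_ι :
    Algebra.adjoin ℂ (Set.range (UniversalEnvelopingAlgebra.ι ℂ (L := L))) = ⊤ := by
  let K := Algebra.adjoin ℂ (Set.range (UniversalEnvelopingAlgebra.ι ℂ (L := L)))
  let f : L →ₗ⁅ℂ⁆ K :=
    { LinearMap.codRestrict (Subalgebra.toSubmodule K)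
        (UniversalEnvelopingAlgebra.ι ℂ (L := L)).toLinearMap
        (fun x => Algebra.subset_adjoin ⟨x, rfl⟩) with
      map_lie' := by
        intro x y
        refine Subtype.ext ?_
        exact LieHom.map_lie _ x y }
  have hf : K.val.comp (UniversalEnvelopingAlgebra.lift ℂ f) =
      AlgHom.id ℂ (UniversalEnvelopingAlgebra ℂ L) := by
    refine UniversalEnvelopingAlgebra.hom_ext (R := ℂ) ?_
    ext x
    have := UniversalEnvelopingAlgebra.lift_ι_apply ℂ f x
    simp only [LieHom.comp_apply, AlgHom.coe_toLieHom, AlgHom.comp_apply, this]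
    rfl
  rw [eq_top_iff]
  intro u _
  have : ((UniversalEnvelopingAlgebra.lift ℂ f u : K) : UniversalEnvelopingAlgebra ℂ L) = u :=
    AlgHom.congr_fun hf u
  rw [← this]
  exact (UniversalEnvelopingAlgebra.lift ℂ f u).2

lemma span_envMonomial (hS : Submodule.span ℂ {g : L | ∃ a, S a g} = ⊤) :
    Submodule.span ℂ {u | ∃ a, EnvMonomial S a u} = ⊤ := by
  set W : Submodule ℂ (UniversalEnvelopingAlgebra ℂ L) :=
    Submodule.span ℂ {u | ∃ a, EnvMonomial S a u} with hW
  have h1 : ∀ x : L, ∀ w ∈ W, UniversalEnvelopingAlgebra.ι ℂ x * w ∈ W := by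
    intro x w hw
    have hx : x ∈ Submodule.span ℂ {g : L | ∃ a, S a g} := hS ▸ Submodule.mem_top
    induction hx using Submodule.span_induction with
    | mem x hx =>
      obtain ⟨a, ha⟩ := hx
      induction hw using Submodule.span_induction with
      | mem w hw =>
        obtain ⟨b, hb⟩ := hw
        exact Submodule.subset_span ⟨a + b, EnvMonomial.mul ha hb⟩
      | zero => rw [mul_zero]; exact W.zero_mem
      | add y z _ _ hy hz => rw [mul_add]; exact W.add_mem hy hz
      | smul c y _ hy => rw [mul_smul_comm]; exact W.smul_mem c hy
    | zero => rw [map_zero, zero_mul]; exact W.zero_mem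
    | add y z _ _ hy hz => rw [map_add, add_mul]; exact W.add_mem hy hz
    | smul c y _ hy => rw [map_smul, smul_mul_assoc]; exact W.smul_mem c hy
  have h2 : ∀ u : UniversalEnvelopingAlgebra ℂ L, ∀ w ∈ W, u * w ∈ W := by
    intro u
    have hu : u ∈ Algebra.adjoin ℂ (Set.range (UniversalEnvelopingAlgebra.ι ℂ (L := L))) :=
      adjoin_range_ι (L := L) ▸ Algebra.mem_top
    induction hu using Algebra.adjoin_induction with
    | mem u hu => obtain ⟨x, rfl⟩ := hu; exact h1 x
    | algebraMap r => intro w hw; rw [← Algebra.smul_def]; exact W.smul_mem r hw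
    | add u v _ _ hu hv => intro w hw; rw [add_mul]; exact W.add_mem (hu w hw) (hv w hw)
    | mul u v _ _ hu hv => intro w hw; rw [mul_assoc]; exact hu _ (hv w hw)
  rw [eq_top_iff]
  intro u _
  rw [← mul_one u]
  exact h2 u 1 (Submodule.subset_span ⟨0, EnvMonomial.one⟩)

lemma weightEnv_le {W : (J → ℕ) → Submodule ℂ L} (d : M →+ (J → ℕ))
    (hW : ∀ μ, W μ ≤ Submodule.span ℂ {y | ∃ a, S a y ∧ d a = μ}) (μ : J → ℕ) :
    weightEnv W μ ≤ Submodule.span ℂ {u | ∃ a, EnvMonomial S a u ∧ d a = μ} := by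
  refine Submodule.span_le.2 ?_
  rintro _ ⟨l, hl, rfl, rfl⟩
  induction l with
  | nil => exact Submodule.subset_span ⟨0, EnvMonomial.one, by simp⟩
  | cons p l ih =>
    have h1 := Submodule.apply_mem_span_image_of_mem_span
      (UniversalEnvelopingAlgebra.ι ℂ (L := L)).toLinearMap (hW p.1 (hl p (by simp)))
    have h2 := ih fun q hq => hl q (by simp [hq])
    have h3 := Submodule.mul_mem_mul h1 h2
    rw [Submodule.span_mul_span] at h3
    rw [List.map_cons, List.map_cons, List.sum_cons, List.prod_cons]
    refine Submodule.span_mono ?_ h3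
    rintro _ ⟨_, ⟨y, ⟨a, ha, hda⟩, rfl⟩, _, ⟨b, hb, hdb⟩, rfl⟩
    exact ⟨a + b, EnvMonomial.mul ha hb, by rw [map_add, hda, hdb]⟩

lemma EnvMonomial.mem_weightEnv {W : (J → ℕ) → Submodule ℂ L} (d : M →+ (J → ℕ))
    (hW : ∀ a y, S a y → y ∈ W (d a)) {a : M} {u : UniversalEnvelopingAlgebra ℂ L}
    (h : EnvMonomial S a u) : u ∈ weightEnv W (d a) := by
  obtain ⟨l, h1, rfl, rfl⟩ := h.exists_list
  refine Submodule.subset_span ⟨l.map fun p => (d p.1, p.2), ?_, ?_, ?_⟩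
  · intro p hp
    obtain ⟨q, hq, rfl⟩ := List.mem_map.1 hp
    exact hW _ _ (h1 q hq)
  · rw [map_list_sum, List.map_map, List.map_map]
    rfl
  · rw [List.map_map]
    rfl

lemma EnvMonomial.envMap {L' M' : Type} [LieRing L'] [LieAlgebra ℂ L'] [AddCommMonoid M']
    {S' : M' → L' → Prop} (φ : L →ₗ⁅ℂ⁆ L') (d : M →+ M') (h : ∀ a y, S a y → S' (d a) (φ y))
    {a : M} {u : UniversalEnvelopingAlgebra ℂ L} (hu : EnvMonomial S a u) :
    EnvMonomial S' (d a) (envMap φ u) := by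
  induction hu with
  | one => rw [map_zero, map_one]; exact EnvMonomial.one
  | @mul a b g u hg _ ih =>
    have hι : Cyclotomic.envMap φ (UniversalEnvelopingAlgebra.ι ℂ g) =
        UniversalEnvelopingAlgebra.ι ℂ (φ g) :=
      UniversalEnvelopingAlgebra.lift_ι_apply ℂ _ g
    rw [map_add, map_mul, hι]
    exact EnvMonomial.mul (h _ _ hg) ih

lemma envMap_ι {L' : Type} [LieRing L'] [LieAlgebra ℂ L'] (φ : L →ₗ⁅ℂ⁆ L') (x : L) :
    envMap φ (UniversalEnvelopingAlgebra.ι ℂ x) = UniversalEnvelopingAlgebra.ι ℂ (φ x) :=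
  UniversalEnvelopingAlgebra.lift_ι_apply ℂ _ x

lemma EnvMonomial.envMap_eq_smul (φ : L →ₗ⁅ℂ⁆ L) {c : M → ℂ} (h0 : c 0 = 1)
    (hadd : ∀ a b, c (a + b) = c a * c b) (h : ∀ a y, S a y → φ y = c a • y)
    {a : M} {u : UniversalEnvelopingAlgebra ℂ L} (hu : EnvMonomial S a u) :
    Cyclotomic.envMap φ u = c a • u := by
  induction hu with
  | one => rw [map_one, h0, one_smul]
  | @mul a b g u hg _ ih =>
    rw [map_mul, envMap_ι, ih, h _ _ hg, hadd, map_smul, smul_mul_assoc, mul_smul_comm, smul_smul]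

end Env

end Weights

/-! ### Monomials of the chain space -/

section MonomialChains

variable {X Y J : Type}

attribute [local instance] LieRing.ofAssociativeRing

lemma map_wedgeRev {L L' : Type} [LieRing L] [LieAlgebra ℂ L] [LieRing L'] [LieAlgebra ℂ L']
    (f : L →ₗ[ℂ] L') {k : ℕ} (g : Fin k → L) :
    exteriorPower.map k f (wedgeRev L k g) = wedgeRev L' k fun i => f (g i) := by
  simp only [wedgeRev, AlternatingMap.domDomCongr_apply, exteriorPower.map_apply_ιMulti]
  rfl

lemma chainMap_tmul {e : Equiv.Perm X} {e' : Equiv.Perm Y}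
    (φ : FreeLieAlgebra ℂ X →ₗ⁅ℂ⁆ FreeLieAlgebra ℂ Y)
    (hφ : ∀ x, φ (permHom e x) = permHom e' (φ x)) {N k : ℕ} (g : Fin k → fixedSubalgebra e)
    (u : UniversalEnvelopingAlgebra ℂ (fixedSubalgebra e))
    (v : Fin N → UniversalEnvelopingAlgebra ℂ (FreeLieAlgebra ℂ X)) :
    chainMap φ hφ N k (wedgeRev _ k g ⊗ₜ (u ⊗ₜ PiTensorProduct.tprod ℂ v)) =
      wedgeRev _ k (fun i => fixedMap φ hφ (g i)) ⊗ₜ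
        (envMap (fixedMap φ hφ) u ⊗ₜ PiTensorProduct.tprod ℂ fun j => envMap φ (v j)) := by
  rw [chainMap, TensorProduct.map_tmul, TensorProduct.map_tmul, map_wedgeRev,
    PiTensorProduct.map_tprod]
  rfl

/-- The chain `x` is a product of (cyclic sums of) commutators, with contents `A i` for the exterior
factors, `A₀` for the first and `A' j` for the other factors of the coefficients. -/
def IsMonomialChain {e : Equiv.Perm X} {n : ℕ} (hn : e ^ n = 1) {N k : ℕ}
    (A : Fin k → Multiset X) (A₀ : Multiset X) (A' : Fin N → Multiset X) (x : ChainSpace e N k) :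
    Prop :=
  ∃ (g : Fin k → fixedSubalgebra e) (u : UniversalEnvelopingAlgebra ℂ (fixedSubalgebra e))
    (v : Fin N → UniversalEnvelopingAlgebra ℂ (FreeLieAlgebra ℂ X)),
    (∀ i, IsCycCommutator hn (A i) (g i)) ∧ EnvMonomial (IsCycCommutator hn) A₀ u ∧
    (∀ j, EnvMonomial IsCommutator (A' j) (v j)) ∧
    x = wedgeRev _ k g ⊗ₜ (u ⊗ₜ PiTensorProduct.tprod ℂ v)

/-- The total content of a monomial chain. -/
def totalContent {N k : ℕ} (A : Fin k → Multiset X) (A₀ : Multiset X) (A' : Fin N → Multiset X) :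
    Multiset X :=
  ∑ i, A i + A₀ + ∑ j, A' j

lemma tmul_mem_span_image2 {E F : Type*} [AddCommGroup E] [Module ℂ E] [AddCommGroup F]
    [Module ℂ F] {S : Set E} {S' : Set F} {x : E} {y : F} (hx : x ∈ Submodule.span ℂ S)
    (hy : y ∈ Submodule.span ℂ S') :
    x ⊗ₜ[ℂ] y ∈ Submodule.span ℂ (Set.image2 (fun a b => a ⊗ₜ[ℂ] b) S S') := by
  have h := Submodule.apply_mem_map₂ (TensorProduct.mk ℂ E F) hx hy
  rw [Submodule.map₂_span_span] at h
  exact h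

lemma chain_mem_span {e : Equiv.Perm X} {n : ℕ} (hn : e ^ n = 1) {N k : ℕ} {M : Type}
    [AddCommMonoid M] (d : Multiset X →+ M) {a : Fin k → M} {b : M} {c : Fin N → M}
    {g : Fin k → fixedSubalgebra e}
    {u : UniversalEnvelopingAlgebra ℂ (fixedSubalgebra e)}
    {v : Fin N → UniversalEnvelopingAlgebra ℂ (FreeLieAlgebra ℂ X)}
    (hg : ∀ i, g i ∈ Submodule.span ℂ {y | ∃ A, IsCycCommutator hn A y ∧ d A = a i})
    (hu : u ∈ Submodule.span ℂ {y | ∃ A, EnvMonomial (IsCycCommutator hn) A y ∧ d A = b})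
    (hv : ∀ j, v j ∈ Submodule.span ℂ {y | ∃ A, EnvMonomial IsCommutator A y ∧ d A = c j}) :
    (wedgeRev _ k g ⊗ₜ (u ⊗ₜ PiTensorProduct.tprod ℂ v) : ChainSpace e N k) ∈
      Submodule.span ℂ {x | ∃ A A₀ A', IsMonomialChain hn A A₀ A' x ∧
        d (totalContent A A₀ A') = ∑ i, a i + b + ∑ j, c j} := by
  have h1 := map_mem_span_of_mem_span (wedgeRev (fixedSubalgebra e) k).toMultilinearMap _ g hg
  have h2 := map_mem_span_of_mem_span (PiTensorProduct.tprod ℂ (s := fun _ : Fin N =>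
    UniversalEnvelopingAlgebra ℂ (FreeLieAlgebra ℂ X))) _ v hv
  have h3 := tmul_mem_span_image2 h1 (tmul_mem_span_image2 hu h2)
  refine Submodule.span_mono ?_ h3
  rintro _ ⟨_, ⟨g, hg, rfl⟩, _, ⟨u, hu, _, ⟨v, hv, rfl⟩, rfl⟩, rfl⟩
  choose A hA hA2 using hg
  obtain ⟨A₀, hA₀, hA₀2⟩ := hu
  choose A' hA' hA'2 using hv
  refine ⟨A, A₀, A', ⟨g, u, v, hA, hA₀, hA', rfl⟩, ?_⟩
  simp [totalContent, hA2, hA₀2, hA'2]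

lemma span_isMonomialChain {e : Equiv.Perm X} {n : ℕ} (hn : e ^ n = 1) (h0 : n ≠ 0) (N k : ℕ) :
    Submodule.span ℂ {x : ChainSpace e N k | ∃ A A₀ A', IsMonomialChain hn A A₀ A' x} = ⊤ := by
  have key : ∀ (g : Fin k → fixedSubalgebra e) u v,
      (wedgeRev _ k g ⊗ₜ (u ⊗ₜ PiTensorProduct.tprod ℂ v) : ChainSpace e N k) ∈
      Submodule.span ℂ {x | ∃ A A₀ A', IsMonomialChain hn A A₀ A' x} := by
    intro g u v
    have h := chain_mem_span hn (N := N) (k := k) (0 : Multiset X →+ ℕ) (a := fun _ => 0) (b := 0)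
      (c := fun _ => 0) (g := g) (u := u) (v := v)
      (fun i => by simpa using span_isCycCommutator hn h0 ▸ Submodule.mem_top)
      (by simpa using span_envMonomial (span_isCycCommutator hn h0) ▸ Submodule.mem_top)
      (fun j => by simpa using span_envMonomial span_isCommutator ▸ Submodule.mem_top)
    simpa using h
  have hw : Submodule.span ℂ (Set.range (wedgeRev (fixedSubalgebra e) k)) = ⊤ := by
    rw [← exteriorPower.ιMulti_span]
    congr 1
    ext y
    constructor
    · rintro ⟨g, rfl⟩; exact ⟨_, rfl⟩
    · rintro ⟨g, rfl⟩
      exact ⟨fun i => g i.rev, by simp [wedgeRev, Function.comp_def]⟩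
  have ht := PiTensorProduct.span_tprod_eq_top (R := ℂ) (s := fun _ : Fin N =>
    UniversalEnvelopingAlgebra ℂ (FreeLieAlgebra ℂ X))
  rw [eq_top_iff]
  intro x _
  induction x using TensorProduct.induction_on with
  | zero => exact Submodule.zero_mem _
  | add x y hx hy => exact Submodule.add_mem _ (hx Submodule.mem_top) (hy Submodule.mem_top)
  | tmul w y =>
    induction y using TensorProduct.induction_on with
    | zero => rw [TensorProduct.tmul_zero]; exact Submodule.zero_mem _
    | add x y hx hy =>
      rw [TensorProduct.tmul_add]
      exact Submodule.add_mem _ (hx Submodule.mem_top) (hy Submodule.mem_top)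
    | tmul u y =>
      have h1 : w ∈ Submodule.span ℂ (Set.range (wedgeRev (fixedSubalgebra e) k)) :=
        hw ▸ Submodule.mem_top
      have h2 : y ∈ Submodule.span ℂ (Set.range (PiTensorProduct.tprod ℂ (s := fun _ : Fin N =>
          UniversalEnvelopingAlgebra ℂ (FreeLieAlgebra ℂ X)))) := ht ▸ Submodule.mem_top
      have h3 := tmul_mem_span_image2 h1 (tmul_mem_span_image2
        (Submodule.mem_span_singleton_self u) h2)
      refine Submodule.span_le.2 ?_ h3
      rintro _ ⟨_, ⟨g, rfl⟩, _, ⟨_, rfl, _, ⟨v, rfl⟩, rfl⟩, rfl⟩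
      exact key g _ v

/-- The weight of a multiset of generators. -/
def degSum (deg : X → J → ℕ) : Multiset X →+ (J → ℕ) where
  toFun A := (A.map deg).sum
  map_zero' := by simp
  map_add' := by simp

lemma degSum_apply (deg : X → J → ℕ) (A : Multiset X) : degSum deg A = (A.map deg).sum := rfl

lemma degSum_singleton (deg : X → J → ℕ) (x : X) : degSum deg {x} = deg x := by
  simp [degSum_apply]

lemma weightChain_le {e : Equiv.Perm X} {n : ℕ} (hn : e ^ n = 1) (h0 : n ≠ 0) (deg : X → J → ℕ)
    (N k : ℕ) (μ : J → ℕ) : weightChain e deg N k μ ≤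
      Submodule.span ℂ {x | ∃ A A₀ A', IsMonomialChain hn A A₀ A' x ∧
        degSum deg (totalContent A A₀ A') = μ} := by
  refine Submodule.span_le.2 ?_
  rintro _ ⟨a, b, c, g, u, v, hg, hu, hv, rfl, rfl⟩
  have hw : exteriorPower.ιMulti ℂ k g = wedgeRev _ k fun i => g (Fin.revPerm i) := by
    simp [wedgeRev, Function.comp_def]
  have hsum : ∑ i, a i = ∑ i, a (Fin.revPerm i) := (Equiv.sum_comp Fin.revPerm a).symm
  rw [hw, hsum]
  refine chain_mem_span hn (degSum deg) (fun i => weightFixed_le hn h0 deg _ (hg _)) ?_ ?_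
  · exact weightEnv_le (degSum deg) (weightFixed_le hn h0 deg) _ hu
  · exact fun j => weightEnv_le (S := IsCommutator) (degSum deg) (fun μ => le_rfl) _ (hv j)

lemma IsMonomialChain.mem_weightChain {e : Equiv.Perm X} {n : ℕ} {hn : e ^ n = 1}
    {deg : X → J → ℕ} (hdeg : ∀ x, deg (e x) = deg x) {N k : ℕ} {A : Fin k → Multiset X}
    {A₀ : Multiset X} {A' : Fin N → Multiset X} {x : ChainSpace e N k}
    (h : IsMonomialChain hn A A₀ A' x) :
    x ∈ weightChain e deg N k (degSum deg (totalContent A A₀ A')) := by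
  obtain ⟨g, u, v, hg, hu, hv, rfl⟩ := h
  unfold weightChain
  refine Submodule.subset_span ?_
  refine ⟨fun i => degSum deg (A i.rev), degSum deg A₀,
    fun j => degSum deg (A' j), fun i => g i.rev, u, v, fun i => ?_, ?_, fun j => ?_, ?_, ?_⟩
  · exact (hg _).mem_weightFixed hdeg
  · exact hu.mem_weightEnv (degSum deg) fun A y hy => hy.mem_weightFixed hdeg
  · exact (hv j).mem_weightEnv (W := weightLie deg) (degSum deg) fun A y hy => Submodule.subset_span ⟨A, hy, rfl⟩
  · rw [totalContent, map_add, map_add, map_sum, map_sum]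
    congr 2
    exact Equiv.sum_comp Fin.revPerm fun i => degSum deg (A i)
  · rfl

lemma iSup_weightChain {e : Equiv.Perm X} {n : ℕ} (hn : e ^ n = 1) (h0 : n ≠ 0)
    {deg : X → J → ℕ} (hdeg : ∀ x, deg (e x) = deg x) (N k : ℕ) :
    ⨆ μ, weightChain e deg N k μ = ⊤ := by
  rw [eq_top_iff, ← span_isMonomialChain hn h0 N k]
  refine Submodule.span_le.2 ?_
  rintro x ⟨A, A₀, A', hx⟩
  exact Submodule.mem_iSup_of_mem _ (hx.mem_weightChain hdeg)

lemma prod_map_sum {ι M : Type*} [CommMonoid M] (c : X → M) (t : Finset ι) (A : ι → Multiset X) :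
    ((∑ i ∈ t, A i).map c).prod = ∏ i ∈ t, ((A i).map c).prod := by
  classical
  induction t using Finset.induction_on with
  | empty => simp
  | insert a t ha ih => rw [Finset.sum_insert ha, Finset.prod_insert ha, Multiset.map_add,
      Multiset.prod_add, ih]

lemma IsMonomialChain.map_scaleHom {e : Equiv.Perm X} {n : ℕ} {hn : e ^ n = 1} {c : X → ℂ}
    (hc : ∀ x, c (e x) = c x) {N k : ℕ} {A : Fin k → Multiset X}
    {A₀ : Multiset X} {A' : Fin N → Multiset X} {x : ChainSpace e N k}
    (h : IsMonomialChain hn A A₀ A' x) :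
    chainMap (scaleHom c) (scaleHom_permHom hc) N k x =
      ((totalContent A A₀ A').map c).prod • x := by
  obtain ⟨g, u, v, hg, hu, hv, rfl⟩ := h
  let χ : Multiset X → ℂ := fun A => (A.map c).prod
  have hχ0 : χ 0 = 1 := by simp [χ]
  have hχ : ∀ A B, χ (A + B) = χ A * χ B := by simp [χ]
  have h1 : ∀ A y, IsCycCommutator hn A y →
      fixedMap (scaleHom c) (scaleHom_permHom hc) y = χ A • y := by
    rintro A _ ⟨g, hg, rfl⟩
    rw [fixedMap_cycSum hn hn, hg.scaleHom_apply, map_smul]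
  have h2 : ∀ A (y : FreeLieAlgebra ℂ X), IsCommutator A y →
      scaleHom c y = χ A • y := fun A y hy => hy.scaleHom_apply c
  rw [chainMap_tmul, hu.envMap_eq_smul _ hχ0 hχ h1]
  have e1 : (fun i => fixedMap (scaleHom c) (scaleHom_permHom hc) (g i)) =
      fun i => χ (A i) • g i := funext fun i => h1 _ _ (hg i)
  have e2 : (fun j => envMap (scaleHom c) (v j)) =
      fun j => χ (A' j) • v j :=
    funext fun j => (hv j).envMap_eq_smul _ hχ0 hχ h2
  rw [e1, e2, AlternatingMap.map_smul_univ, MultilinearMap.map_smul_univ]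
  have e3 : ((totalContent A A₀ A').map c).prod =
      (∏ i, χ (A i)) * χ A₀ *
        ∏ j, χ (A' j) := by
    rw [← prod_map_sum, ← prod_map_sum, ← hχ, ← hχ, totalContent]
  rw [e3]
  simp only [TensorProduct.tmul_smul, ← TensorProduct.smul_tmul', smul_smul]
  congr 1
  ring

lemma chainMap_scaleHom_apply {e : Equiv.Perm X} {n : ℕ} (hn : e ^ n = 1) (h0 : n ≠ 0)
    {c : X → ℂ} (hc : ∀ x, c (e x) = c x) (deg : X → J → ℕ) (χ : (J → ℕ) → ℂ)
    (hχ : ∀ A : Multiset X, (A.map c).prod = χ (degSum deg A)) {N k : ℕ} {μ : J → ℕ}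
    {x : ChainSpace e N k} (hx : x ∈ weightChain e deg N k μ) :
    chainMap (scaleHom c) (scaleHom_permHom hc) N k x = χ μ • x := by
  replace hx := weightChain_le hn h0 deg N k μ hx
  induction hx using Submodule.span_induction with
  | mem x h =>
    obtain ⟨A, A₀, A', h, rfl⟩ := h
    rw [h.map_scaleHom hc, hχ]
  | zero => simp
  | add y z _ _ hy hz => rw [map_add, hy, hz, smul_add]
  | smul c y _ hy => rw [map_smul, hy, smul_comm]

lemma prod_map_primePow [Fintype J] (deg : X → J → ℕ) (A : Multiset X) :
    (A.map fun x => primePow (deg x)).prod = primePow (degSum deg A) := by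
  induction A using Multiset.induction_on with
  | empty => simp [primePow]
  | cons a A ih =>
    rw [Multiset.map_cons, Multiset.prod_cons, ih, ← Multiset.singleton_add, map_add,
      degSum_singleton, primePow, primePow, primePow, ← Finset.prod_mul_distrib]
    exact Finset.prod_congr rfl fun j _ => (pow_add _ _ _).symm

lemma isCompl_weightChain [Fintype J] {e : Equiv.Perm X} {n : ℕ} (hn : e ^ n = 1) (h0 : n ≠ 0)
    {deg : X → J → ℕ} (hdeg : ∀ x, deg (e x) = deg x) (N k : ℕ) (μ : J → ℕ) :
    IsCompl (weightChain e deg N k μ) (⨆ (ν : J → ℕ) (_ : ν ≠ μ), weightChain e deg N k ν) := by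
  have h : ∀ ν, ∀ x ∈ weightChain e deg N k ν, chainMap (scaleHom fun x => primePow (deg x))
      (scaleHom_permHom fun x => congrArg primePow (hdeg x)) N k x = primePow ν • x :=
    fun ν x hx => chainMap_scaleHom_apply hn h0 (fun x => congrArg primePow (hdeg x)) deg primePow (prod_map_primePow deg) hx
  exact isCompl_of_eigenvalues (E := ChainSpace e N k) (W := weightChain e deg N k)
    (f := chainMap (scaleHom fun x => primePow (deg x))
      (scaleHom_permHom fun x => congrArg primePow (hdeg x)) N k)
    primePow_injective (iSup_weightChain hn h0 hdeg N k) h μ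

lemma weightProj_apply_self [Fintype J] {e : Equiv.Perm X} {n : ℕ} (hn : e ^ n = 1) (h0 : n ≠ 0)
    {deg : X → J → ℕ} (hdeg : ∀ x, deg (e x) = deg x) {N k : ℕ} {μ : J → ℕ}
    {x : ChainSpace e N k} (hx : x ∈ weightChain e deg N k μ) :
    (weightProj e deg N k μ x : ChainSpace e N k) = x :=
  projAlong_apply_self (isCompl_weightChain hn h0 hdeg N k μ) hx

lemma weightProj_apply_of_ne [Fintype J] {e : Equiv.Perm X} {n : ℕ} (hn : e ^ n = 1) (h0 : n ≠ 0)
    {deg : X → J → ℕ} (hdeg : ∀ x, deg (e x) = deg x) {N k : ℕ} {μ ν : J → ℕ} (hne : ν ≠ μ)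
    {x : ChainSpace e N k} (hx : x ∈ weightChain e deg N k ν) :
    weightProj e deg N k μ x = 0 :=
  projAlong_apply_zero (isCompl_weightChain hn h0 hdeg N k μ)
    (Submodule.mem_iSup_of_mem ν (Submodule.mem_iSup_of_mem hne hx))

lemma weightChain_disjoint [Fintype J] {e : Equiv.Perm X} {n : ℕ} (hn : e ^ n = 1) (h0 : n ≠ 0)
    {deg : X → J → ℕ} (hdeg : ∀ x, deg (e x) = deg x) {N k : ℕ} {μ ν : J → ℕ}
    {x : ChainSpace e N k} (hx : x ∈ weightChain e deg N k μ) (hx' : x ∈ weightChain e deg N k ν)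
    (h : x ≠ 0) : μ = ν := by
  by_contra hne
  apply h
  rw [← weightProj_apply_self hn h0 hdeg hx, weightProj_apply_of_ne hn h0 hdeg (Ne.symm hne) hx']
  rfl

end MonomialChains

/-! ### The differential of the chain complex -/

section Cartan

variable {L M E : Type*} [LieRing L] [LieAlgebra ℂ L] [AddCommGroup M] [Module ℂ M]
  [AddCommGroup E] [Module ℂ E] {k : ℕ}

/-- A linear map out of `⋀^k L` from its values on `g_k ∧ ⋯ ∧ g_1`. -/
def wedgeLift : (L [⋀^Fin k]→ₗ[ℂ] E) →ₗ[ℂ] (⋀[ℂ]^k L →ₗ[ℂ] E) :=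
  (exteriorPower.alternatingMapLinearEquiv (R := ℂ) (n := k) (M := L) (N := E)).toLinearMap ∘ₗ
    { toFun := fun f => f.domDomCongr Fin.revPerm
      map_add' := fun _ _ => rfl
      map_smul' := fun _ _ => rfl }

@[simp]
lemma wedgeLift_apply (f : L [⋀^Fin k]→ₗ[ℂ] E) (g : Fin k → L) :
    wedgeLift f (wedgeRev L k g) = f g := by
  change exteriorPower.alternatingMapLinearEquiv (f.domDomCongr Fin.revPerm)
    (exteriorPower.ιMulti ℂ k (g ∘ Fin.revPerm)) = f g
  rw [exteriorPower.alternatingMapLinearEquiv_apply_ιMulti, AlternatingMap.domDomCongr_apply]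
  congr 1
  funext i
  simp

lemma span_wedgeRev : Submodule.span ℂ (Set.range (wedgeRev L k)) = ⊤ := by
  rw [← exteriorPower.ιMulti_span]
  congr 1
  ext y
  constructor
  · rintro ⟨g, rfl⟩; exact ⟨_, rfl⟩
  · rintro ⟨g, rfl⟩
    exact ⟨fun i => g i.rev, by simp [wedgeRev, Function.comp_def]⟩

lemma wedge_hom_ext {E : Type*} [AddCommMonoid E] [Module ℂ E] {f f' : ⋀[ℂ]^k L →ₗ[ℂ] E}
    (h : ∀ g, f (wedgeRev L k g) = f' (wedgeRev L k g)) : f = f' := by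
  refine LinearMap.ext_on span_wedgeRev ?_
  rintro _ ⟨g, rfl⟩
  exact h g

lemma chain_hom_ext {E : Type*} [AddCommMonoid E] [Module ℂ E] {f f' : ⋀[ℂ]^k L ⊗[ℂ] M →ₗ[ℂ] E}
    (h : ∀ g m, f (wedgeRev L k g ⊗ₜ m) = f' (wedgeRev L k g ⊗ₜ m)) : f = f' := by
  refine TensorProduct.ext (wedge_hom_ext fun g => LinearMap.ext fun m => ?_)
  exact h g m

/-- The operator `ω ↦ ω ∧ x`. -/
def wedgeCons (L : Type*) [LieRing L] [LieAlgebra ℂ L] (k : ℕ) :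
    L →ₗ[ℂ] (⋀[ℂ]^k L →ₗ[ℂ] ⋀[ℂ]^(k + 1) L) :=
  wedgeLift ∘ₗ AlternatingMap.curryLeft (wedgeRev L (k + 1))

@[simp]
lemma wedgeCons_apply (x : L) (g : Fin k → L) :
    wedgeCons L k x (wedgeRev L k g) = wedgeRev L (k + 1) (Fin.cons x g) := by
  rw [wedgeCons, LinearMap.comp_apply, wedgeLift_apply]
  rfl

lemma wedgeRev_eq_wedgeCons (g : Fin (k + 1) → L) :
    wedgeRev L (k + 1) g = wedgeCons L k (g 0) (wedgeRev L k (Fin.tail g)) := by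
  rw [wedgeCons_apply, Fin.cons_self_tail]

lemma wedgeRev_cons_cons_swap (x y : L) (g : Fin k → L) :
    wedgeRev L (k + 2) (Fin.cons x (Fin.cons y g : Fin (k + 1) → L)) =
      -wedgeRev L (k + 2) (Fin.cons y (Fin.cons x g : Fin (k + 1) → L)) := by
  rw [← AlternatingMap.map_swap _ _ (show (0 : Fin (k + 2)) ≠ 1 by simp)]
  congr 1
  funext i
  refine Fin.cases ?_ (fun i => ?_) i
  · simp
  · refine Fin.cases ?_ (fun i => ?_) i
    · simp
    · have h1 : i.succ.succ ≠ (0 : Fin (k + 2)) := Fin.succ_ne_zero _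
      have h2 : i.succ.succ ≠ (1 : Fin (k + 2)) := by
        rw [← Fin.succ_zero_eq_one]
        exact fun h => Fin.succ_ne_zero _ (Fin.succ_injective _ h)
      simp [Equiv.swap_apply_of_ne_of_ne h1 h2]

lemma wedgeRev_cons_removeNth (g : Fin (k + 1) → L) (i : Fin (k + 1)) :
    wedgeRev L (k + 1) (Fin.cons (g i) (i.removeNth g)) =
      (-1 : ℂ) ^ (i : ℕ) • wedgeRev L (k + 1) g := by
  have h := (wedgeRev L (k + 1)).neg_one_pow_smul_map_insertNth i (g i) (i.removeNth g)
  rw [Fin.insertNth_self_removeNth] at h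
  refine h.symm.trans ?_
  rcases Nat.even_or_odd (i : ℕ) with hi | hi
  · rw [hi.neg_one_pow, hi.neg_one_pow, one_smul, one_smul]
  · rw [hi.neg_one_pow, hi.neg_one_pow]
    exact Subtype.ext (by simp)

/-- The Lie derivative on `⋀^k L`. -/
def wedgeLie (x : L) : (k : ℕ) → (⋀[ℂ]^k L →ₗ[ℂ] ⋀[ℂ]^k L)
  | 0 => 0
  | k + 1 => wedgeLift (AlternatingMap.alternatizeUncurryFin
      (AlternatingMap.curryLeft (wedgeRev L (k + 1)) ∘ₗ (LieModule.toEnd ℂ L L x)))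

lemma wedgeLie_succ_apply (x : L) (g : Fin (k + 1) → L) :
    wedgeLie x (k + 1) (wedgeRev L (k + 1) g) =
      ∑ i : Fin (k + 1),
        (-1 : ℂ) ^ (i : ℕ) • wedgeRev L (k + 1) (Fin.cons ⁅x, g i⁆ (i.removeNth g)) := by
  rw [wedgeLie, wedgeLift_apply, AlternatingMap.alternatizeUncurryFin_apply]
  refine Finset.sum_congr rfl fun i _ => ?_
  rcases Nat.even_or_odd (i : ℕ) with hi | hi <;> simp [hi.neg_one_pow] <;> rfl

lemma cons_removeNth_succ {α : Type*} (x : α) (g : Fin (k + 1) → α) (i : Fin (k + 1)) :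
    (Fin.removeNth i.succ (Fin.cons x g : Fin (k + 2) → α)) =
      (Fin.cons x (i.removeNth g) : Fin (k + 1) → α) := by
  funext j
  refine Fin.cases ?_ (fun j => ?_) j
  · simp [Fin.removeNth]
  · simp [Fin.removeNth]

lemma cons_removeNth_zero {α : Type*} (x : α) (g : Fin k → α) :
    Fin.removeNth 0 (Fin.cons x g : Fin (k + 1) → α) = g := by
  funext j
  simp [Fin.removeNth]

lemma wedgeLie_wedgeCons (x y : L) (ω : ⋀[ℂ]^k L) :
    wedgeLie x (k + 1) (wedgeCons L k y ω) =
      wedgeCons L k y (wedgeLie x k ω) + wedgeCons L k ⁅x, y⁆ ω := by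
  suffices h : wedgeLie x (k + 1) ∘ₗ wedgeCons L k y =
      wedgeCons L k y ∘ₗ wedgeLie x k + wedgeCons L k ⁅x, y⁆ from LinearMap.congr_fun h ω
  refine wedge_hom_ext fun g => ?_
  simp only [LinearMap.comp_apply, LinearMap.add_apply, wedgeCons_apply]
  rw [wedgeLie_succ_apply, Fin.sum_univ_succ]
  refine (add_comm _ _).trans (congrArg₂ (· + ·) ?_ ?_)
  · cases k with
    | zero => simp [wedgeLie]
    | succ k =>
      rw [wedgeLie_succ_apply, map_sum]
      refine Finset.sum_congr rfl fun i _ => ?_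
      rw [map_smul, wedgeCons_apply, cons_removeNth_succ, Fin.cons_succ, wedgeRev_cons_cons_swap,
        Fin.val_succ, pow_succ]
      simp
  · simp

lemma wedgeLie_lie (x y : L) : ∀ (k : ℕ) (ω : ⋀[ℂ]^k L),
    wedgeLie ⁅x, y⁆ k ω = wedgeLie x k (wedgeLie y k ω) - wedgeLie y k (wedgeLie x k ω)
  | 0, ω => by simp [wedgeLie]
  | k + 1, ω => by
    suffices h : wedgeLie ⁅x, y⁆ (k + 1) =
        wedgeLie x (k + 1) ∘ₗ wedgeLie y (k + 1) - wedgeLie y (k + 1) ∘ₗ wedgeLie x (k + 1) from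
      LinearMap.congr_fun h ω
    refine wedge_hom_ext fun g => ?_
    simp only [LinearMap.comp_apply, LinearMap.sub_apply]
    rw [wedgeRev_eq_wedgeCons]
    simp only [wedgeLie_wedgeCons, map_add, wedgeLie_lie x y k, map_sub, LinearMap.add_apply,
      leibniz_lie x y (g 0)]
    have e1 : wedgeCons L k ⁅x, ⁅y, g 0⁆⁆ (wedgeRev L k (Fin.tail g)) =
        wedgeCons L k ⁅⁅x, y⁆, g 0⁆ (wedgeRev L k (Fin.tail g)) +
          wedgeCons L k ⁅y, ⁅x, g 0⁆⁆ (wedgeRev L k (Fin.tail g)) := by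
      rw [← LinearMap.add_apply, ← map_add, ← leibniz_lie]
    abel_nf

variable (ρ : L →ₗ[ℂ] Module.End ℂ M)

/-- The operator `ω ⊗ m ↦ (ω ∧ x) ⊗ m`. -/
def chainCons (M : Type*) [AddCommGroup M] [Module ℂ M] (k : ℕ) (x : L) :
    ⋀[ℂ]^k L ⊗[ℂ] M →ₗ[ℂ] ⋀[ℂ]^(k + 1) L ⊗[ℂ] M :=
  (wedgeCons L k x).rTensor M

/-- The Lie derivative on chains. -/
def chainLie (k : ℕ) (x : L) : ⋀[ℂ]^k L ⊗[ℂ] M →ₗ[ℂ] ⋀[ℂ]^k L ⊗[ℂ] M :=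
  (wedgeLie x k).rTensor M + (ρ x).lTensor (⋀[ℂ]^k L)

lemma chainCons_tmul (x : L) (g : Fin k → L) (m : M) :
    chainCons M k x (wedgeRev L k g ⊗ₜ m) = wedgeRev L (k + 1) (Fin.cons x g) ⊗ₜ m := by
  simp [chainCons]

lemma chainLie_tmul (x : L) (ω : ⋀[ℂ]^k L) (m : M) :
    chainLie ρ k x (ω ⊗ₜ m) = wedgeLie x k ω ⊗ₜ m + ω ⊗ₜ ρ x m := by
  simp [chainLie]

lemma chain_succ_hom_ext {E : Type*} [AddCommMonoid E] [Module ℂ E]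
    {f f' : ⋀[ℂ]^(k + 1) L ⊗[ℂ] M →ₗ[ℂ] E}
    (h : ∀ x w, f (chainCons M k x w) = f' (chainCons M k x w)) : f = f' := by
  refine chain_hom_ext fun g m => ?_
  have := h (g 0) (wedgeRev L k (Fin.tail g) ⊗ₜ m)
  rwa [chainCons_tmul, Fin.cons_self_tail] at this

lemma chainLie_chainCons (x y : L) (w : ⋀[ℂ]^k L ⊗[ℂ] M) :
    chainLie ρ (k + 1) x (chainCons M k y w) =
      chainCons M k y (chainLie ρ k x w) + chainCons M k ⁅x, y⁆ w := by
  suffices h : chainLie ρ (k + 1) x ∘ₗ chainCons M k y =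
      chainCons M k y ∘ₗ chainLie ρ k x + chainCons M k ⁅x, y⁆ from LinearMap.congr_fun h w
  refine TensorProduct.ext' fun ω m => ?_
  simp only [LinearMap.comp_apply, LinearMap.add_apply, chainCons, LinearMap.rTensor_tmul,
    chainLie_tmul, wedgeLie_wedgeCons, TensorProduct.add_tmul, map_add]
  abel

lemma chainLie_lie (hρ : ∀ x y m, ρ ⁅x, y⁆ m = ρ x (ρ y m) - ρ y (ρ x m)) (x y : L)
    (w : ⋀[ℂ]^k L ⊗[ℂ] M) :
    chainLie ρ k ⁅x, y⁆ w + chainLie ρ k y (chainLie ρ k x w) =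
      chainLie ρ k x (chainLie ρ k y w) := by
  suffices h : chainLie ρ k ⁅x, y⁆ + chainLie ρ k y ∘ₗ chainLie ρ k x =
      chainLie ρ k x ∘ₗ chainLie ρ k y from
    LinearMap.congr_fun h w
  refine TensorProduct.ext' fun ω m => ?_
  simp only [LinearMap.comp_apply, LinearMap.add_apply, chainLie_tmul, wedgeLie_lie, hρ, map_add,
    TensorProduct.sub_tmul, TensorProduct.tmul_sub]
  abel

lemma chainDiff_zero_chainCons (x : L) (w : ⋀[ℂ]^0 L ⊗[ℂ] M) :
    chainDiff ρ 0 (chainCons M 0 x w) = chainLie ρ 0 x w := by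
  suffices h : chainDiff ρ 0 ∘ₗ chainCons M 0 x = chainLie ρ 0 x from LinearMap.congr_fun h w
  refine chain_hom_ext (L := L) (M := M) fun g m => ?_
  rw [LinearMap.comp_apply, chainCons_tmul, chainDiff_zero_apply, chainLie_tmul]
  simp [wedgeLie, Subsingleton.elim g Fin.elim0]

lemma removeNth_removeNth_cons {α : Type*} (x : α) (g : Fin (k + 2) → α) (i j : Fin (k + 1)) :
    (j.succ.removeNth (i.succ.castSucc.removeNth (Fin.cons x g : Fin (k + 3) → α))) =
      (Fin.cons x (j.removeNth (i.castSucc.removeNth g)) : Fin (k + 1) → α) := by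
  rw [← Fin.succ_castSucc, cons_removeNth_succ, cons_removeNth_succ]

lemma sum_sum_ge_succ {E : Type*} [AddCommMonoid E] (F : Fin (k + 1) → Fin (k + 1) → E) :
    ∑ i, ∑ j ≥ i, F i j = ∑ j, F 0 j + ∑ i : Fin k, ∑ j ≥ i, F i.succ j.succ := by
  have h : ∀ (n : ℕ) (i : Fin n) (G : Fin n → E),
      ∑ j ≥ i, G j = ∑ j, if i ≤ j then G j else 0 := by
    intro n i G
    rw [← Finset.sum_filter]
    exact Finset.sum_congr (by ext; simp) fun _ _ => rfl
  simp only [h]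
  refine (Fin.sum_univ_succ _).trans (congrArg₂ (· + ·) ?_ ?_)
  · exact Finset.sum_congr rfl fun j _ => if_pos (Fin.zero_le j)
  · refine Finset.sum_congr rfl fun i _ => ?_
    refine (Fin.sum_univ_succ _).trans ?_
    rw [if_neg (by simp [Fin.succ_ne_zero]), zero_add]
    simp only [Fin.succ_le_succ_iff]

lemma add_right_cancel_of_module {E : Type*} [AddCommMonoid E] [Module ℂ E] {a b c : E}
    (h : a + c = b + c) : a = b := by
  have h0 : c + (-1 : ℂ) • c = 0 := by
    have := add_smul (1 : ℂ) (-1) c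
    rw [one_smul, add_neg_cancel, zero_smul] at this
    exact this.symm
  rw [← add_zero a, ← add_zero b, ← h0, ← add_assoc, ← add_assoc, h]

lemma add_neg_one_smul_cancel {E : Type*} [AddCommMonoid E] [Module ℂ E] (p q l s : E) :
    p + (-1 : ℂ) • q + (l + (-1 : ℂ) • s) + (q + s) = l + p := by
  have h : ∀ a : E, a + (-1 : ℂ) • a = 0 := fun a => by
    have := add_smul (1 : ℂ) (-1) a
    rw [one_smul, add_neg_cancel, zero_smul] at this
    exact this.symm
  calc _ = (l + p) + ((q + (-1 : ℂ) • q) + (s + (-1 : ℂ) • s)) := by abel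
    _ = _ := by rw [h, h, add_zero, add_zero]

lemma neg_one_smul_pow_smul {E : Type*} [AddCommMonoid E] [Module ℂ E] (n : ℕ) (a : E) :
    (-1 : ℂ) ^ (n + 1) • a = (-1 : ℂ) • ((-1 : ℂ) ^ n • a) := by
  rw [smul_smul, pow_succ']

lemma neg_one_smul_neg_one_smul {E : Type*} [AddCommMonoid E] [Module ℂ E] (a : E) :
    (-1 : ℂ) • ((-1 : ℂ) • a) = a := by
  rw [smul_smul]; norm_num

lemma wedgeRev_cons_lie_swap (x y : L) (g : Fin k → L) :
    wedgeRev L (k + 1) (Fin.cons ⁅x, y⁆ g) = (-1 : ℂ) • wedgeRev L (k + 1) (Fin.cons ⁅y, x⁆ g) := by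
  rw [← lie_skew, ← wedgeCons_apply, ← neg_one_smul ℂ, map_smul, LinearMap.smul_apply,
    wedgeCons_apply]

lemma wedgeRev_cons_cons_swap' (x y : L) (g : Fin k → L) :
    wedgeRev L (k + 2) (Fin.cons x (Fin.cons y g : Fin (k + 1) → L)) =
      (-1 : ℂ) • wedgeRev L (k + 2) (Fin.cons y (Fin.cons x g : Fin (k + 1) → L)) := by
  rw [wedgeRev_cons_cons_swap]
  exact Subtype.ext (by simp)

lemma actSum_cons (x : L) (g : Fin (k + 1) → L) (m : M) :
    ∑ i : Fin (k + 2), (-1 : ℂ) ^ (i : ℕ) •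
      (wedgeRev L (k + 1) (i.removeNth (Fin.cons x g : Fin (k + 2) → L)) ⊗ₜ[ℂ]
        ρ ((Fin.cons x g : Fin (k + 2) → L) i) m) =
      wedgeRev L (k + 1) g ⊗ₜ ρ x m + (-1 : ℂ) • ∑ i : Fin (k + 1),
        (-1 : ℂ) ^ (i : ℕ) • chainCons M k x (wedgeRev L k (i.removeNth g) ⊗ₜ[ℂ] ρ (g i) m) := by
  rw [Fin.sum_univ_succ, Finset.smul_sum]
  congr 1
  · rw [Fin.val_zero, pow_zero, one_smul, cons_removeNth_zero, Fin.cons_zero]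
  · refine Finset.sum_congr rfl fun i _ => ?_
    rw [Fin.val_succ, neg_one_smul_pow_smul, chainCons_tmul, cons_removeNth_succ, Fin.cons_succ]

lemma bracketSum_cons_zero (x : L) (g : Fin (k + 1) → L) (m : M) :
    ∑ j : Fin (k + 1), (-1 : ℂ) ^ (((0 : Fin (k + 1)) : ℕ) + ((j : ℕ) + 1)) •
      ((wedgeRev L (k + 1)) (Fin.cons
        ⁅(Fin.cons x g : Fin (k + 2) → L) j.succ,
          (Fin.cons x g : Fin (k + 2) → L) (0 : Fin (k + 1)).castSucc⁆
        (j.removeNth ((0 : Fin (k + 1)).castSucc.removeNth (Fin.cons x g : Fin (k + 2) → L)))) ⊗ₜ[ℂ]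
          m) =
      wedgeLie x (k + 1) (wedgeRev L (k + 1) g) ⊗ₜ[ℂ] m := by
  rw [wedgeLie_succ_apply, TensorProduct.sum_tmul]
  refine Finset.sum_congr rfl fun j _ => ?_
  rw [Fin.castSucc_zero, cons_removeNth_zero, Fin.cons_zero, Fin.cons_succ, Fin.val_zero, zero_add,
    wedgeRev_cons_lie_swap, TensorProduct.smul_tmul', neg_one_smul_pow_smul,
    ← TensorProduct.smul_tmul', smul_comm ((-1 : ℂ) ^ (j : ℕ)),
    ← TensorProduct.smul_tmul', neg_one_smul_neg_one_smul]

lemma chainDiff_succ_chainCons (x : L) : ∀ (k : ℕ) (w : ⋀[ℂ]^(k + 1) L ⊗[ℂ] M),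
    chainDiff ρ (k + 1) (chainCons M (k + 1) x w) + chainCons M k x (chainDiff ρ k w) =
      chainLie ρ (k + 1) x w
  | 0, w => by
    suffices h : chainDiff ρ 1 ∘ₗ chainCons M 1 x + chainCons M 0 x ∘ₗ chainDiff ρ 0 =
        chainLie ρ 1 x from LinearMap.congr_fun h w
    refine chain_hom_ext fun g m => ?_
    simp only [LinearMap.comp_apply, LinearMap.add_apply]
    rw [chainCons_tmul, chainDiff_succ_apply, chainLie_tmul, actSum_cons, sum_sum_ge_succ,
      bracketSum_cons_zero, chainDiff_zero_apply, Fin.sum_univ_zero, Fin.sum_univ_one]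
    have := add_neg_one_smul_cancel (wedgeRev L 1 g ⊗ₜ[ℂ] ρ x m)
      (chainCons M 0 x (wedgeRev L 0 Fin.elim0 ⊗ₜ[ℂ] ρ (g 0) m))
      (wedgeLie x 1 (wedgeRev L 1 g) ⊗ₜ[ℂ] m) 0
    rw [smul_zero, add_zero] at this
    rw [Fin.val_zero, pow_zero, one_smul, Subsingleton.elim (Fin.removeNth 0 g) Fin.elim0, ← this]
    simp only [add_zero]
  | k + 1, w => by
    suffices h : chainDiff ρ (k + 2) ∘ₗ chainCons M (k + 2) x + chainCons M (k + 1) x ∘ₗ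
        chainDiff ρ (k + 1) = chainLie ρ (k + 2) x from LinearMap.congr_fun h w
    refine chain_hom_ext fun g m => ?_
    simp only [LinearMap.comp_apply, LinearMap.add_apply]
    rw [chainCons_tmul, chainDiff_succ_apply, chainLie_tmul, actSum_cons, sum_sum_ge_succ,
      bracketSum_cons_zero, chainDiff_succ_apply, map_add]
    simp only [map_sum, map_smul]
    refine Eq.trans ?_ (add_neg_one_smul_cancel _ (∑ i : Fin (k + 2), (-1 : ℂ) ^ (i : ℕ) •
      chainCons M (k + 1) x (wedgeRev L (k + 1) (i.removeNth g) ⊗ₜ[ℂ] ρ (g i) m)) _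
      (∑ i : Fin (k + 1), ∑ j ≥ i, (-1 : ℂ) ^ ((i : ℕ) + (j + 1)) • chainCons M (k + 1) x
        (wedgeRev L (k + 1) (Fin.cons ⁅g j.succ, g i.castSucc⁆
          (j.removeNth (i.castSucc.removeNth g))) ⊗ₜ[ℂ] m)))
    congr 3
    rw [Finset.smul_sum]
    refine Finset.sum_congr rfl fun i _ => ?_
    rw [Finset.smul_sum]
    refine Finset.sum_congr rfl fun j _ => ?_
    rw [removeNth_removeNth_cons, wedgeRev_cons_cons_swap', chainCons_tmul, ← Fin.succ_castSucc,
      Fin.cons_succ, Fin.cons_succ, Fin.val_succ, Fin.val_succ, ← TensorProduct.smul_tmul',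
      smul_smul, smul_smul]
    congr 1
    ring

lemma chainLie_chainDiff (hρ : ∀ x y m, ρ ⁅x, y⁆ m = ρ x (ρ y m) - ρ y (ρ x m)) (x : L) :
    ∀ (k : ℕ) (w : ⋀[ℂ]^(k + 1) L ⊗[ℂ] M),
      chainLie ρ k x (chainDiff ρ k w) = chainDiff ρ k (chainLie ρ (k + 1) x w)
  | 0, w => by
    suffices h : chainLie ρ 0 x ∘ₗ chainDiff ρ 0 = chainDiff ρ 0 ∘ₗ chainLie ρ 1 x from
      LinearMap.congr_fun h w
    refine chain_succ_hom_ext fun y w => ?_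
    simp only [LinearMap.comp_apply, chainDiff_zero_chainCons, chainLie_chainCons, map_add]
    rw [← chainLie_lie ρ hρ, add_comm]
  | k + 1, w => by
    suffices h : chainLie ρ (k + 1) x ∘ₗ chainDiff ρ (k + 1) =
        chainDiff ρ (k + 1) ∘ₗ chainLie ρ (k + 2) x from LinearMap.congr_fun h w
    refine chain_succ_hom_ext fun y w => ?_
    simp only [LinearMap.comp_apply, chainLie_chainCons, map_add]
    have h1 := congrArg (chainLie ρ (k + 1) x) (chainDiff_succ_chainCons ρ y k w)
    have h2 := chainDiff_succ_chainCons ρ y k (chainLie ρ (k + 1) x w)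
    have h3 := chainDiff_succ_chainCons ρ ⁅x, y⁆ k w
    have h4 := chainLie_lie (k := k + 1) ρ hρ x y w
    rw [map_add, chainLie_chainCons, chainLie_chainDiff hρ x k w] at h1
    refine add_right_cancel_of_module (c := chainCons M k y (chainDiff ρ k (chainLie ρ (k + 1) x w)) +
      chainCons M k ⁅x, y⁆ (chainDiff ρ k w)) ?_
    rw [h1, add_add_add_comm, h2, h3, ← h4]
    exact add_comm _ _

lemma chainDiff_chainDiff (hρ : ∀ x y m, ρ ⁅x, y⁆ m = ρ x (ρ y m) - ρ y (ρ x m)) :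
    ∀ (k : ℕ) (w : ⋀[ℂ]^(k + 2) L ⊗[ℂ] M), chainDiff ρ k (chainDiff ρ (k + 1) w) = 0
  | 0, w => by
    suffices h : chainDiff ρ 0 ∘ₗ chainDiff ρ 1 = 0 from LinearMap.congr_fun h w
    refine chain_succ_hom_ext fun y w => ?_
    simp only [LinearMap.comp_apply, LinearMap.zero_apply]
    have h1 := congrArg (chainDiff ρ 0) (chainDiff_succ_chainCons ρ y 0 w)
    rw [map_add, chainDiff_zero_chainCons, ← chainLie_chainDiff ρ hρ] at h1
    refine add_right_cancel_of_module (h1.trans (zero_add _).symm)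
  | k + 1, w => by
    suffices h : chainDiff ρ (k + 1) ∘ₗ chainDiff ρ (k + 2) = 0 from LinearMap.congr_fun h w
    refine chain_succ_hom_ext fun y w => ?_
    simp only [LinearMap.comp_apply, LinearMap.zero_apply]
    have h1 := congrArg (chainDiff ρ (k + 1)) (chainDiff_succ_chainCons ρ y (k + 1) w)
    have h2 := chainDiff_succ_chainCons ρ y k (chainDiff ρ (k + 1) w)
    rw [chainDiff_chainDiff hρ k w, map_zero, add_zero] at h2
    rw [map_add, h2, ← chainLie_chainDiff ρ hρ] at h1
    refine add_right_cancel_of_module (h1.trans (zero_add _).symm)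

end Cartan

section Naturality

variable {L M L' M' : Type*} [LieRing L] [LieAlgebra ℂ L] [AddCommGroup M] [Module ℂ M]
  [LieRing L'] [LieAlgebra ℂ L'] [AddCommGroup M'] [Module ℂ M']

lemma exteriorPower_map_wedgeRev (f : L →ₗ[ℂ] L') (k : ℕ) (g : Fin k → L) :
    exteriorPower.map k f (wedgeRev L k g) = wedgeRev L' k (fun i => f (g i)) := by
  simp only [wedgeRev, AlternatingMap.domDomCongr_apply, exteriorPower.map_apply_ιMulti]
  rfl

lemma chainDiff_map (ρ : L →ₗ[ℂ] Module.End ℂ M) (ρ' : L' →ₗ[ℂ] Module.End ℂ M')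
    (f : L →ₗ⁅ℂ⁆ L') (F : M →ₗ[ℂ] M') (h : ∀ x m, F (ρ x m) = ρ' (f x) (F m)) (k : ℕ)
    (w : ⋀[ℂ]^(k + 1) L ⊗[ℂ] M) :
    chainDiff ρ' k (TensorProduct.map (exteriorPower.map (k + 1) f.toLinearMap) F w) =
      TensorProduct.map (exteriorPower.map k f.toLinearMap) F (chainDiff ρ k w) := by
  suffices H : chainDiff ρ' k ∘ₗ TensorProduct.map (exteriorPower.map (k + 1) f.toLinearMap) F =
      TensorProduct.map (exteriorPower.map k f.toLinearMap) F ∘ₗ chainDiff ρ k from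
    LinearMap.congr_fun H w
  refine chain_hom_ext fun g m => ?_
  simp only [LinearMap.comp_apply, TensorProduct.map_tmul, exteriorPower_map_wedgeRev]
  cases k with
  | zero =>
    rw [chainDiff_zero_apply, chainDiff_zero_apply, TensorProduct.map_tmul,
      exteriorPower_map_wedgeRev, h]
    congr 2
    exact Subsingleton.elim _ _
  | succ k =>
    rw [chainDiff_succ_apply, chainDiff_succ_apply, map_add, map_sum, map_sum]
    congr 1
    · refine Finset.sum_congr rfl fun i _ => ?_
      rw [map_smul, TensorProduct.map_tmul, exteriorPower_map_wedgeRev, h]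
      rfl
    · refine Finset.sum_congr rfl fun i _ => ?_
      rw [map_sum]
      refine Finset.sum_congr rfl fun j _ => ?_
      rw [map_smul, TensorProduct.map_tmul, exteriorPower_map_wedgeRev]
      congr 4
      funext l
      refine Fin.cases ?_ (fun l => ?_) l
      · simp
      · rfl

end Naturality

section ChainComplex

variable {X Y J : Type}

attribute [local instance] LieRing.ofAssociativeRing

lemma sum_commutator {ι A : Type*} [Fintype ι] [Ring A] (a b c : ι → A)
    (h : ∀ i, a i * b i - b i * a i = c i) (hc : ∀ i j, i ≠ j → a i * b j = b j * a i) :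
    (∑ i, a i) * (∑ i, b i) - (∑ i, b i) * (∑ i, a i) = ∑ i, c i := by
  classical
  rw [Finset.sum_mul_sum, Finset.sum_mul_sum, Finset.sum_comm (γ := ι), ← Finset.sum_sub_distrib]
  refine Finset.sum_congr rfl fun i _ => ?_
  rw [← Finset.sum_sub_distrib, Finset.sum_eq_single i, h]
  · intro j _ hj
    rw [hc j i hj, sub_self]
  · simp

lemma coeffDiag_lie (e : Equiv.Perm X) (N : ℕ) (x y : fixedSubalgebra e) :
    coeffDiag e N ⁅x, y⁆ = coeffDiag e N x * coeffDiag e N y - coeffDiag e N y * coeffDiag e N x := by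
  let a : fixedSubalgebra e → Option (Fin N) → CoeffModule e N := fun x o =>
    o.elim ((Algebra.TensorProduct.includeLeft : _ →ₐ[ℂ] CoeffModule e N) (UniversalEnvelopingAlgebra.ι ℂ x))
      fun i => (Algebra.TensorProduct.includeRight : _ →ₐ[ℂ] CoeffModule e N)
        (PiTensorProduct.singleAlgHom (R := ℂ)
          (A := fun _ : Fin N => UniversalEnvelopingAlgebra ℂ (FreeLieAlgebra ℂ X)) i
          (UniversalEnvelopingAlgebra.ι ℂ (x : FreeLieAlgebra ℂ X)))
  have ha : ∀ x, coeffDiag e N x = ∑ o, a x o := by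
    intro x
    rw [Fintype.sum_option]
    simp [coeffDiag, a]
    rfl
  rw [ha, ha, ha, sum_commutator (a x) (a y) (a ⁅x, y⁆)]
  · intro o
    cases o with
    | none =>
      simp only [a, Option.elim, ← map_mul, ← map_sub]
      rw [LieHom.map_lie]
      rfl
    | some i =>
      simp only [a, Option.elim, ← map_mul, ← map_sub]
      rw [LieSubalgebra.coe_bracket, LieHom.map_lie]
      rfl
  · intro o o' hoo
    cases o with
    | none =>
      cases o' with
      | none => exact (hoo rfl).elim
      | some j => simp [a, -UniversalEnvelopingAlgebra.ι_apply]
    | some i =>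
      cases o' with
      | none => simp [a, -UniversalEnvelopingAlgebra.ι_apply]
      | some j =>
        have hij : i ≠ j := fun h => hoo (by rw [h])
        simp only [a, Option.elim, ← map_mul]
        congr 1
        change PiTensorProduct.tprod ℂ (Pi.mulSingle i _) * PiTensorProduct.tprod ℂ (Pi.mulSingle j _) =
          PiTensorProduct.tprod ℂ (Pi.mulSingle j _) * PiTensorProduct.tprod ℂ (Pi.mulSingle i _)
        rw [PiTensorProduct.tprod_mul_tprod, PiTensorProduct.tprod_mul_tprod]
        congr 1
        exact (Pi.mulSingle_commute
          (f := fun _ : Fin N => UniversalEnvelopingAlgebra ℂ (FreeLieAlgebra ℂ X)) hij _ _).eq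

lemma coeffAct_lie (e : Equiv.Perm X) (N : ℕ) (x y : fixedSubalgebra e) (m : CoeffModule e N) :
    coeffAct e N ⁅x, y⁆ m = coeffAct e N x (coeffAct e N y m) - coeffAct e N y (coeffAct e N x m) := by
  change coeffDiag e N ⁅x, y⁆ * m = coeffDiag e N x * (coeffDiag e N y * m) -
    coeffDiag e N y * (coeffDiag e N x * m)
  rw [coeffDiag_lie, sub_mul, mul_assoc, mul_assoc]

lemma chainD_chainD (e : Equiv.Perm X) (N k : ℕ) (w : ChainSpace e N (k + 2)) :
    chainD e N k (chainD e N (k + 1) w) = 0 :=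
  chainDiff_chainDiff (coeffAct e N) (coeffAct_lie e N) k w

variable {e : Equiv.Perm X} {e' : Equiv.Perm Y}

lemma coeff_hom_ext {N : ℕ} {E : Type*} [AddCommMonoid E] [Module ℂ E]
    {f f' : CoeffModule e N →ₗ[ℂ] E}
    (h : ∀ u v, f (u ⊗ₜ PiTensorProduct.tprod ℂ v) = f' (u ⊗ₜ PiTensorProduct.tprod ℂ v)) :
    f = f' := by
  refine TensorProduct.ext (LinearMap.ext fun u => PiTensorProduct.ext ?_)
  ext v
  exact h u v

lemma chainD_chainMap (φ : FreeLieAlgebra ℂ X →ₗ⁅ℂ⁆ FreeLieAlgebra ℂ Y)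
    (hφ : ∀ x, φ (permHom e x) = permHom e' (φ x)) (N k : ℕ) (w : ChainSpace e N (k + 1)) :
    chainD e' N k (chainMap φ hφ N (k + 1) w) = chainMap φ hφ N k (chainD e N k w) := by
  refine chainDiff_map (coeffAct e N) (coeffAct e' N) (fixedMap φ hφ) _ (fun x m => ?_) k w
  set F : CoeffModule e N →ₗ[ℂ] CoeffModule e' N :=
    TensorProduct.map (envMap (fixedMap φ hφ)).toLinearMap
      (PiTensorProduct.map fun _ => (envMap φ).toLinearMap) with hF
  suffices H : F ∘ₗ coeffAct e N x = coeffAct e' N (fixedMap φ hφ x) ∘ₗ F from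
    LinearMap.congr_fun H m
  refine coeff_hom_ext fun u v => ?_
  rw [LinearMap.comp_apply, LinearMap.comp_apply, coeffAct_tprod, map_add, map_sum, hF]
  simp only [TensorProduct.map_tmul, PiTensorProduct.map_tprod, AlgHom.toLinearMap_apply]
  rw [coeffAct_tprod, map_mul, envMap_ι]
  congr 1
  refine Finset.sum_congr rfl fun i _ => ?_
  congr 2
  funext j
  rcases eq_or_ne j i with rfl | hj
  · rw [Function.update_self, Function.update_self, map_mul, envMap_ι]
    rfl
  · rw [Function.update_of_ne hj, Function.update_of_ne hj]

lemma mem_weightChain_iff [Fintype J] {n : ℕ} (hn : e ^ n = 1) (h0 : n ≠ 0)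
    {deg : X → J → ℕ} (hdeg : ∀ x, deg (e x) = deg x) {N k : ℕ} {μ : J → ℕ}
    {x : ChainSpace e N k} :
    x ∈ weightChain e deg N k μ ↔ chainMap (scaleHom fun x => primePow (deg x))
      (scaleHom_permHom fun x => congrArg primePow (hdeg x)) N k x = primePow μ • x := by
  have h : ∀ ν, ∀ x ∈ weightChain e deg N k ν, chainMap (scaleHom fun x => primePow (deg x))
      (scaleHom_permHom fun x => congrArg primePow (hdeg x)) N k x = primePow ν • x :=
    fun ν x hx => chainMap_scaleHom_apply hn h0 (fun x => congrArg primePow (hdeg x)) deg primePow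
      (prod_map_primePow deg) hx
  refine ⟨h μ x, fun hx => ?_⟩
  have := mem_iSup_of_eigenvector (E := ChainSpace e N k) (W := weightChain e deg N k)
    (χ := primePow) (iSup_weightChain hn h0 hdeg N k) h hx
  refine (iSup₂_le fun ν hν => ?_ : _ ≤ weightChain e deg N k μ) this
  rw [primePow_injective hν]

lemma chainD_mem_weightChain [Fintype J] {n : ℕ} (hn : e ^ n = 1) (h0 : n ≠ 0)
    {deg : X → J → ℕ} (hdeg : ∀ x, deg (e x) = deg x) {N k : ℕ} {μ : J → ℕ}
    {x : ChainSpace e N (k + 1)} (hx : x ∈ weightChain e deg N (k + 1) μ) :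
    chainD e N k x ∈ weightChain e deg N k μ := by
  rw [mem_weightChain_iff hn h0 hdeg] at hx ⊢
  rw [← chainD_chainMap, hx, map_smul]

lemma coe_weightProj_comm [Fintype J] {n : ℕ} (hn : e ^ n = 1) (h0 : n ≠ 0)
    {deg : X → J → ℕ} (hdeg : ∀ x, deg (e x) = deg x) {N N' k k' : ℕ} {μ : J → ℕ}
    {n' : ℕ} (hn' : e' ^ n' = 1) (h0' : n' ≠ 0)
    {deg' : Y → J → ℕ} (hdeg' : ∀ x, deg' (e' x) = deg' x)
    (f : ChainSpace e N k →ₗ[ℂ] ChainSpace e' N' k')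
    (hf : ∀ ν, ∀ x ∈ weightChain e deg N k ν, f x ∈ weightChain e' deg' N' k' ν)
    (x : ChainSpace e N k) :
    f (weightProj e deg N k μ x) = weightProj e' deg' N' k' μ (f x) := by
  have hx : x ∈ ⨆ ν, weightChain e deg N k ν := by
    rw [iSup_weightChain hn h0 hdeg]; trivial
  induction hx using Submodule.iSup_induction' with
  | mem ν x hx =>
    rcases eq_or_ne ν μ with rfl | hν
    · rw [weightProj_apply_self hn h0 hdeg hx, weightProj_apply_self hn' h0' hdeg' (hf _ _ hx)]
    · rw [weightProj_apply_of_ne hn h0 hdeg hν hx,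
        weightProj_apply_of_ne hn' h0' hdeg' hν (hf _ _ hx)]
      exact map_zero f
  | zero => simp
  | add y z _ _ hy hz => simp only [map_add, Submodule.coe_add, hy, hz]

end ChainComplex

/-! ### Operators that multiply monomials by functions of their contents -/

section ContentMap

variable {X : Type} [Countable X]

open Classical in
/-- The linear operator of the free Lie algebra that multiplies a commutator of content `A` by
`F A`. -/
def contentMap (F : Multiset X → ℂ) : FreeLieAlgebra ℂ X →ₗ[ℂ] FreeLieAlgebra ℂ X :=
  spectralMap (scaleHom fun x : X => (primeCode x : ℂ)).toLinearMap
    fun ν => if h : ∃ A : Multiset X, primeProd A = ν then F h.choose else 0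

lemma IsCommutator.contentMap_apply (F : Multiset X → ℂ) {A : Multiset X}
    {g : FreeLieAlgebra ℂ X} (hg : IsCommutator A g) : contentMap F g = F A • g := by
  have hW : ⨆ A : Multiset X, Submodule.span ℂ {g : FreeLieAlgebra ℂ X | IsCommutator A g} = ⊤ := by
    rw [eq_top_iff, ← span_isCommutator]
    refine Submodule.span_le.2 ?_
    rintro g ⟨A, hg⟩
    exact Submodule.mem_iSup_of_mem A (Submodule.subset_span hg)
  have hf : ∀ A : Multiset X, ∀ x ∈ Submodule.span ℂ {g : FreeLieAlgebra ℂ X | IsCommutator A g},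
      (scaleHom fun x : X => (primeCode x : ℂ)).toLinearMap x = primeProd A • x := by
    intro A x hx
    induction hx using Submodule.span_induction with
    | mem g hg => exact IsCommutator.scaleHom_apply _ hg
    | zero => simp
    | add y z _ _ hy hz => rw [map_add, hy, hz, smul_add]
    | smul c y _ hy => rw [map_smul, hy, smul_comm]
  rw [contentMap, spectralMap_apply (iSup_eigenspace_eq_top hW hf) _
    (hf A g (Submodule.subset_span hg))]
  have h : ∃ B : Multiset X, primeProd B = primeProd A := ⟨A, rfl⟩
  rw [dif_pos h, primeProd_injective h.choose_spec]

lemma freeLie_hom_ext {X : Type} {E : Type*} [AddCommMonoid E] [Module ℂ E]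
    {f f' : FreeLieAlgebra ℂ X →ₗ[ℂ] E}
    (h : ∀ A g, IsCommutator A g → f g = f' g) : f = f' := by
  refine LinearMap.ext_on span_isCommutator ?_
  rintro g ⟨A, hg⟩
  exact h A g hg

lemma contentMap_permHom {e : Equiv.Perm X} {F : Multiset X → ℂ}
    (hF : ∀ A : Multiset X, F (A.map e) = F A) (x : FreeLieAlgebra ℂ X) :
    contentMap F (permHom e x) = permHom e (contentMap F x) := by
  suffices h : contentMap F ∘ₗ (permHom e).toLinearMap = (permHom e).toLinearMap ∘ₗ contentMap F from
    LinearMap.congr_fun h x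
  refine freeLie_hom_ext fun A g hg => ?_
  simp only [LinearMap.comp_apply, LieHom.coe_toLinearMap]
  rw [(hg.permHom e).contentMap_apply, hg.contentMap_apply, hF, map_smul]

/-- The operator `contentMap` on the fixed-point subalgebra. -/
def fixedContentMap (e : Equiv.Perm X) (F : Multiset X → ℂ)
    (hF : ∀ A : Multiset X, F (A.map e) = F A) : fixedSubalgebra e →ₗ[ℂ] fixedSubalgebra e :=
  LinearMap.codRestrict (fixedSubalgebra e).toSubmodule
    (contentMap F ∘ₗ (fixedSubalgebra e).toSubmodule.subtype) fun x => by
      change permHom e (contentMap F x) = contentMap F x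
      rw [← contentMap_permHom hF, show permHom e (x : FreeLieAlgebra ℂ X) = x from x.2]

lemma coe_fixedContentMap {e : Equiv.Perm X} {F : Multiset X → ℂ}
    (hF : ∀ A : Multiset X, F (A.map e) = F A) (x : fixedSubalgebra e) :
    (fixedContentMap e F hF x : FreeLieAlgebra ℂ X) = contentMap F x := rfl

lemma fixedContentMap_cycSum {e : Equiv.Perm X} {n : ℕ} (hn : e ^ n = 1) {F : Multiset X → ℂ}
    (hF : ∀ A : Multiset X, F (A.map e) = F A) (g : FreeLieAlgebra ℂ X) :
    fixedContentMap e F hF (cycSum hn g) = cycSum hn (contentMap F g) := by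
  refine Subtype.ext ?_
  rw [coe_fixedContentMap, coe_cycSum, coe_cycSum, map_sum]
  have h : ∀ j, contentMap F (permHom (e ^ j) g) = permHom (e ^ j) (contentMap F g) := by
    intro j
    induction j with
    | zero => simp [permHom_one]
    | succ j ih => rw [pow_succ', ← permHom_permHom, contentMap_permHom hF, ih, permHom_permHom]
  exact Finset.sum_congr rfl fun j _ => h j

lemma IsCycCommutator.fixedContentMap_apply {e : Equiv.Perm X} {n : ℕ} {hn : e ^ n = 1}
    {F : Multiset X → ℂ} (hF : ∀ A : Multiset X, F (A.map e) = F A) {A : Multiset X}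
    {y : fixedSubalgebra e} (h : IsCycCommutator hn A y) : fixedContentMap e F hF y = F A • y := by
  obtain ⟨g, hg, rfl⟩ := h
  rw [fixedContentMap_cycSum, hg.contentMap_apply, map_smul]

end ContentMap

/-! ### The edge of a monomial chain -/

section Edge

variable {T m N : ℕ}

lemma cycShift_pow (j : ℕ) : cycShift T m ^ j =
    Equiv.prodCongr (Equiv.addRight (j : ZMod T)) (Equiv.refl _) := by
  induction j with
  | zero => ext x <;> simp
  | succ j ih =>
    rw [pow_succ', ih]
    ext x <;> simp [cycShift, add_assoc]

lemma cycShift_pow_self : cycShift T m ^ T = 1 := by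
  rw [cycShift_pow]
  ext x <;> simp

/-- The equations that describe the edge of a monomial: `t_i = 0`, or `ω^k t_i = z_j`, or
`ω^k t_i = t_{i'}`. -/
abbrev Equation (T m N : ℕ) : Type :=
  Fin m ⊕ (Fin N × (ZMod T × Fin m)) ⊕ (Fin m × Fin m × ZMod T)

/-- The equations for the edge of a commutator. -/
def blockEqs (N : ℕ) (A : Multiset (ZMod T × Fin m)) : Multiset (Equation T m N) :=
  A.bind fun x => A.map fun y => Sum.inr (Sum.inr (x.2, y.2, x.1 - y.1))

/-- The equations for the edge of a factor at the origin. -/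
def originEqs (N : ℕ) (A : Multiset (ZMod T × Fin m)) : Multiset (Equation T m N) :=
  A.map fun x => Sum.inl x.2

/-- The equations for the edge of a factor at `z_j`. -/
def siteEqs (j : Fin N) (A : Multiset (ZMod T × Fin m)) : Multiset (Equation T m N) :=
  A.map fun x => Sum.inr (Sum.inl (j, x))

/-- The equations for the edge of a monomial chain. -/
def chainEqs {k : ℕ} (A : Fin k → Multiset (ZMod T × Fin m)) (A₀ : Multiset (ZMod T × Fin m))
    (A' : Fin N → Multiset (ZMod T × Fin m)) : Multiset (Equation T m N) :=
  ∑ b, blockEqs N (A b) + originEqs N A₀ + ∑ j, siteEqs j (A' j)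

/-- The solutions of an equation. -/
def Equation.locus (ω : ℂˣ) (z : Fin N → ℂ) : Equation T m N → AffineSubspace ℂ (Fin m → ℂ)
  | Sum.inl i => hyperplaneT0 i
  | Sum.inr (Sum.inl (j, x)) => hyperplane ((cycPow ω x.1 : ℂ) • LinearMap.proj x.2) (z j)
  | Sum.inr (Sum.inr (i, i', k)) =>
    hyperplane ((cycPow ω k : ℂ) • LinearMap.proj i - LinearMap.proj i') 0

/-- The edge of a monomial chain. -/
def chainEdge (ω : ℂˣ) (z : Fin N → ℂ) {k : ℕ} (A : Fin k → Multiset (ZMod T × Fin m))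
    (A₀ : Multiset (ZMod T × Fin m)) (A' : Fin N → Multiset (ZMod T × Fin m)) :
    AffineSubspace ℂ (Fin m → ℂ) :=
  sInf {H | ∃ q ∈ chainEqs A A₀ A', H = q.locus ω z}

lemma mem_sum_multiset {ι α : Type*} [Fintype ι] {f : ι → Multiset α} {a : α} :
    a ∈ ∑ i, f i ↔ ∃ i, a ∈ f i := by
  simp [Multiset.mem_sum]

lemma mem_chainEdge [NeZero T] {ω : ℂˣ} (hω : IsPrimitiveRoot ω T) {z : Fin N → ℂ} {k : ℕ}
    {A : Fin k → Multiset (ZMod T × Fin m)} {A₀ : Multiset (ZMod T × Fin m)}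
    {A' : Fin N → Multiset (ZMod T × Fin m)} {t : Fin m → ℂ} :
    t ∈ chainEdge ω z A A₀ A' ↔ (∀ b, t ∈ swimming ω (A b)) ∧ t ∈ anchored ω 0 A₀ ∧
      ∀ j, t ∈ anchored ω (z j) (A' j) := by
  have hne : ∀ k : ZMod T, (cycPow ω k : ℂ) ≠ 0 := fun k => (cycPow ω k).ne_zero
  rw [chainEdge, AffineSubspace.mem_sInf_iff]
  constructor
  · intro h
    replace h : ∀ q ∈ chainEqs A A₀ A', t ∈ q.locus ω z := fun q hq => h _ ⟨q, hq, rfl⟩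
    refine ⟨fun b x hx y hy => ?_, fun x hx => ?_, fun j x hx => ?_⟩
    · have := h (Sum.inr (Sum.inr (x.2, y.2, x.1 - y.1))) (by
        simp only [chainEqs, Multiset.mem_add, mem_sum_multiset]
        exact Or.inl (Or.inl ⟨b, Multiset.mem_bind.2 ⟨x, hx, Multiset.mem_map.2 ⟨y, hy, rfl⟩⟩⟩))
      simp only [Equation.locus, mem_hyperplane, LinearMap.sub_apply, LinearMap.smul_apply,
        LinearMap.proj_apply, smul_eq_mul, cycPow_sub hω, sub_eq_zero, Units.val_mul,
        Units.val_inv_eq_inv_val] at this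
      rw [← this]
      have := hne y.1
      field_simp
    · have := h (Sum.inl x.2) (by
        simp only [chainEqs, Multiset.mem_add, mem_sum_multiset]
        exact Or.inl (Or.inr (Multiset.mem_map.2 ⟨x, hx, rfl⟩)))
      simp only [Equation.locus, hyperplaneT0, mem_hyperplane, LinearMap.proj_apply] at this
      rw [this, mul_zero]
    · have := h (Sum.inr (Sum.inl (j, x))) (by
        simp only [chainEqs, Multiset.mem_add, mem_sum_multiset]
        exact Or.inr ⟨j, Multiset.mem_map.2 ⟨x, hx, rfl⟩⟩)
      simpa [Equation.locus] using this
  · rintro ⟨h1, h2, h3⟩ _ ⟨q, hq, rfl⟩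
    simp only [chainEqs, Multiset.mem_add, mem_sum_multiset] at hq
    rcases hq with (⟨b, hq⟩ | hq) | ⟨j, hq⟩
    · obtain ⟨x, hx, hq⟩ := Multiset.mem_bind.1 hq
      obtain ⟨y, hy, rfl⟩ := Multiset.mem_map.1 hq
      have := h1 b x hx y hy
      simp only [Equation.locus, mem_hyperplane, LinearMap.sub_apply, LinearMap.smul_apply,
        LinearMap.proj_apply, smul_eq_mul, cycPow_sub hω, sub_eq_zero, Units.val_mul,
        Units.val_inv_eq_inv_val]
      have hy := hne y.1
      field_simp
      rw [this]
    · obtain ⟨x, hx, rfl⟩ := Multiset.mem_map.1 hq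
      have := h2 x hx
      simpa [Equation.locus, hyperplaneT0, hne] using this
    · obtain ⟨x, hx, rfl⟩ := Multiset.mem_map.1 hq
      have := h3 j x hx
      simpa [Equation.locus] using this

end Edge

/-! ### The projections to the monomials with a given edge -/

section EdgeProj

variable {T m N : ℕ} [NeZero T]

attribute [local instance] LieRing.ofAssociativeRing

omit [NeZero T] in
lemma blockEqs_map_cycShift (A : Multiset (ZMod T × Fin m)) :
    blockEqs N (A.map (cycShift T m)) = blockEqs N A := by
  rw [blockEqs, blockEqs, Multiset.bind_map]
  refine Multiset.bind_congr fun x _ => ?_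
  rw [Multiset.map_map]
  refine Multiset.map_congr rfl fun y _ => ?_
  simp [cycShift]

lemma primeCode_inl_cycShift (x : ZMod T × Fin m) :
    (primeCode (Sum.inl (cycShift T m x).2 : Equation T m N) : ℂ) =
      primeCode (Sum.inl x.2 : Equation T m N) := by
  simp [cycShift]

/-- The operator that multiplies a monomial chain by a number which determines its equations. -/
def eqsMap (T m N k : ℕ) [NeZero T] : Module.End ℂ (ChainSpace (cycShift T m) N k) :=
  TensorProduct.map
    (exteriorPower.map k (fixedContentMap (cycShift T m) (fun A => primeProd (blockEqs N A))
      fun A => congrArg primeProd (blockEqs_map_cycShift A)))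
    (TensorProduct.map
      (envMap (fixedMap (scaleHom fun x : ZMod T × Fin m =>
        (primeCode (Sum.inl x.2 : Equation T m N) : ℂ)) (scaleHom_permHom primeCode_inl_cycShift))).toLinearMap
      (PiTensorProduct.map fun j => (envMap (scaleHom fun x : ZMod T × Fin m =>
        (primeCode (Sum.inr (Sum.inl (j, x)) : Equation T m N) : ℂ))).toLinearMap))

lemma primeProd_map {D X : Type*} [Countable D] (A : Multiset X) (f : X → D) :
    primeProd (A.map f) = (A.map fun x => (primeCode (f x) : ℂ)).prod := by
  rw [primeProd, Multiset.map_map]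
  rfl

lemma IsMonomialChain.eqsMap_apply {k : ℕ} {A : Fin k → Multiset (ZMod T × Fin m)}
    {A₀ : Multiset (ZMod T × Fin m)} {A' : Fin N → Multiset (ZMod T × Fin m)}
    {x : ChainSpace (cycShift T m) N k} (h : IsMonomialChain cycShift_pow_self A A₀ A' x) :
    eqsMap T m N k x = primeProd (chainEqs A A₀ A') • x := by
  obtain ⟨g, u, v, hg, hu, hv, rfl⟩ := h
  rw [eqsMap, TensorProduct.map_tmul, TensorProduct.map_tmul, map_wedgeRev,
    PiTensorProduct.map_tprod]
  have e0 := hu.envMap_eq_smul (fixedMap (scaleHom fun x : ZMod T × Fin m =>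
        (primeCode (Sum.inl x.2 : Equation T m N) : ℂ)) (scaleHom_permHom primeCode_inl_cycShift))
    (c := fun A => primeProd (originEqs N A)) (by simp [originEqs])
    (fun A B => by simp only [originEqs, Multiset.map_add, primeProd_add]) (by
      rintro A _ ⟨g, hg, rfl⟩
      rw [fixedMap_cycSum cycShift_pow_self cycShift_pow_self, hg.scaleHom_apply, map_smul,
        originEqs, primeProd_map])
  have e1 : (fun i => fixedContentMap (cycShift T m) (fun A => primeProd (blockEqs N A))
      (fun A => congrArg primeProd (blockEqs_map_cycShift A)) (g i)) =
      fun i => primeProd (blockEqs N (A i)) • g i :=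
    funext fun i => (hg i).fixedContentMap_apply _
  have e2 : (fun j => (envMap (scaleHom fun x : ZMod T × Fin m =>
        (primeCode (Sum.inr (Sum.inl (j, x)) : Equation T m N) : ℂ))).toLinearMap (v j)) =
      fun j => primeProd (siteEqs j (A' j)) • v j :=
    funext fun j => (hv j).envMap_eq_smul _ (c := fun A => primeProd (siteEqs j A))
      (by simp [siteEqs]) (fun A B => by simp only [siteEqs, Multiset.map_add, primeProd_add])
      (fun A y hy => by rw [hy.scaleHom_apply, siteEqs, primeProd_map])
  rw [e1, e2, AlgHom.toLinearMap_apply, e0, AlternatingMap.map_smul_univ,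
    MultilinearMap.map_smul_univ, chainEqs, primeProd_add, primeProd_add, primeProd_sum,
    primeProd_sum]
  simp only [TensorProduct.tmul_smul, ← TensorProduct.smul_tmul', smul_smul]
  congr 1
  ring

open Classical in
/-- The projection to the span of the monomials with edge `L`. -/
def edgeProj (ω : ℂˣ) (z : Fin N → ℂ) (k : ℕ) (L : AffineSubspace ℂ (Fin m → ℂ)) :
    Module.End ℂ (ChainSpace (cycShift T m) N k) :=
  spectralMap (E := ChainSpace (cycShift T m) N k) (eqsMap T m N k) fun ν =>
    if ∃ (A : Fin k → Multiset (ZMod T × Fin m)) (A₀ : Multiset (ZMod T × Fin m))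
      (A' : Fin N → Multiset (ZMod T × Fin m)), chainEdge ω z A A₀ A' = L ∧
        primeProd (chainEqs A A₀ A') = ν then 1 else 0

open Classical in
lemma IsMonomialChain.edgeProj_apply (ω : ℂˣ) (z : Fin N → ℂ) (L : AffineSubspace ℂ (Fin m → ℂ))
    {k : ℕ} {A : Fin k → Multiset (ZMod T × Fin m)}
    {A₀ : Multiset (ZMod T × Fin m)} {A' : Fin N → Multiset (ZMod T × Fin m)}
    {x : ChainSpace (cycShift T m) N k} (h : IsMonomialChain cycShift_pow_self A A₀ A' x) :
    edgeProj ω z k L x = if chainEdge ω z A A₀ A' = L then x else 0 := by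
  have hW : ⨆ c : (Fin k → Multiset (ZMod T × Fin m)) × Multiset (ZMod T × Fin m) ×
      (Fin N → Multiset (ZMod T × Fin m)), Submodule.span ℂ
        {x : ChainSpace (cycShift T m) N k |
          IsMonomialChain cycShift_pow_self c.1 c.2.1 c.2.2 x} = ⊤ := by
    rw [eq_top_iff, ← span_isMonomialChain cycShift_pow_self (NeZero.ne T)]
    refine Submodule.span_le.2 ?_
    rintro x ⟨A, A₀, A', hx⟩
    exact Submodule.mem_iSup_of_mem (A, A₀, A') (Submodule.subset_span hx)
  have htop := iSup_eigenspace_eq_top (E := ChainSpace (cycShift T m) N k) (f := eqsMap T m N k)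
    (χ := fun c => primeProd (chainEqs c.1 c.2.1 c.2.2)) hW (by
      intro c x hx
      induction hx using Submodule.span_induction with
      | mem g hg => exact hg.eqsMap_apply
      | zero => simp
      | add y z _ _ hy hz => rw [map_add, hy, hz, smul_add]
      | smul c y _ hy => rw [map_smul, hy, smul_comm])
  rw [edgeProj, spectralMap_apply (E := ChainSpace (cycShift T m) N k) htop _ h.eqsMap_apply]
  by_cases hL : chainEdge ω z A A₀ A' = L
  · rw [if_pos hL, if_pos ⟨A, A₀, A', hL, rfl⟩, one_smul]
  · rw [if_neg hL, if_neg, zero_smul]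
    rintro ⟨B, B₀, B', h1, h2⟩
    refine hL (h1 ▸ ?_)
    rw [chainEdge, chainEdge, primeProd_injective h2]

end EdgeProj

/-! ### Placements of the indices of a multilinear monomial -/

section Placement

variable {T m N k : ℕ}

/-- The contents of the factors of a monomial chain as one family. -/
def contents {X : Type} (A : Fin k → Multiset X) (A₀ : Multiset X) (A' : Fin N → Multiset X) :
    Fin k ⊕ Option (Fin N) → Multiset X :=
  Sum.elim A fun o => o.elim A₀ A'

lemma sum_contents {X : Type} (A : Fin k → Multiset X) (A₀ : Multiset X)
    (A' : Fin N → Multiset X) : ∑ o, contents A A₀ A' o = totalContent A A₀ A' := by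
  simp [contents, totalContent, add_assoc]

/-- Each index occurs exactly once in the total content. -/
def IsMultilinear (A : Fin k → Multiset (ZMod T × Fin m)) (A₀ : Multiset (ZMod T × Fin m))
    (A' : Fin N → Multiset (ZMod T × Fin m)) : Prop :=
  (totalContent A A₀ A').map Prod.snd = Finset.univ.val

/-- The index `i` occurs at the factor `place i`, with the twist `tw i`, and nowhere else. -/
def IsPlacement (A : Fin k → Multiset (ZMod T × Fin m)) (A₀ : Multiset (ZMod T × Fin m))
    (A' : Fin N → Multiset (ZMod T × Fin m)) (place : Fin m → Fin k ⊕ Option (Fin N))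
    (tw : Fin m → ZMod T) : Prop :=
  ∀ o x, x ∈ contents A A₀ A' o ↔ place x.2 = o ∧ tw x.2 = x.1

lemma map_sum_multiset {ι α β : Type*} [Fintype ι] (f : α → β) (s : ι → Multiset α) :
    (∑ i, s i).map f = ∑ i, (s i).map f :=
  map_sum (Multiset.mapAddMonoidHom f) s Finset.univ

lemma IsMultilinear.exists_placement {A : Fin k → Multiset (ZMod T × Fin m)}
    {A₀ : Multiset (ZMod T × Fin m)} {A' : Fin N → Multiset (ZMod T × Fin m)}
    (h : IsMultilinear A A₀ A') : ∃ place tw, IsPlacement A A₀ A' place tw := by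
  classical
  rw [IsMultilinear, ← sum_contents, map_sum_multiset] at h
  have hex : ∀ i : Fin m, ∃ o, ∃ x ∈ contents A A₀ A' o, x.2 = i := by
    intro i
    have : i ∈ ∑ o, (contents A A₀ A' o).map Prod.snd := by rw [h]; exact Finset.mem_univ i
    obtain ⟨o, ho⟩ := mem_sum_multiset.1 this
    obtain ⟨x, hx, rfl⟩ := Multiset.mem_map.1 ho
    exact ⟨o, x, hx, rfl⟩
  have huniq : ∀ o o' x y, x ∈ contents A A₀ A' o → y ∈ contents A A₀ A' o' → x.2 = y.2 →
      o = o' ∧ x = y := by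
    intro o o' x y hx hy hxy
    have hoo : o = o' := by
      by_contra hne
      have hcount : (∑ o, (contents A A₀ A' o).map Prod.snd).count x.2 = 1 := by
        rw [h]
        exact Multiset.count_eq_one_of_mem Finset.univ.nodup (Finset.mem_univ_val _)
      rw [Multiset.count_sum'] at hcount
      have h1 : 1 ≤ ((contents A A₀ A' o).map Prod.snd).count x.2 :=
        Multiset.one_le_count_iff_mem.2 (Multiset.mem_map_of_mem _ hx)
      have h2 : 1 ≤ ((contents A A₀ A' o').map Prod.snd).count x.2 :=
        Multiset.one_le_count_iff_mem.2 (hxy ▸ Multiset.mem_map_of_mem _ hy)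
      have h3 := Finset.add_le_sum (s := Finset.univ)
        (f := fun o => ((contents A A₀ A' o).map Prod.snd).count x.2) (fun _ _ => Nat.zero_le _)
        (Finset.mem_univ o) (Finset.mem_univ o') hne
      omega
    subst hoo
    refine ⟨rfl, Multiset.inj_on_of_nodup_map ?_ x hx y hy hxy⟩
    refine Multiset.nodup_of_le ?_ (Finset.univ : Finset (Fin m)).nodup
    rw [← h]
    exact Finset.single_le_sum (f := fun o => (contents A A₀ A' o).map Prod.snd)
      (fun _ _ => bot_le) (Finset.mem_univ o)
  choose place x hx hxi using hex
  refine ⟨place, fun i => (x i).1, fun o y => ⟨fun hy => ?_, ?_⟩⟩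
  · obtain ⟨h1, h2⟩ := huniq _ _ _ _ (hx y.2) hy (hxi y.2)
    exact ⟨h1, congrArg Prod.fst h2⟩
  · rintro ⟨rfl, h2⟩
    have : y = x y.2 := Prod.ext h2.symm (hxi y.2).symm
    rw [this]
    have h3 := hx y.2
    rwa [hxi]

/-- The value common to the (twisted) coordinates whose indices have the given place. -/
def placeVal (z : Fin N → ℂ) (s : Fin k → ℂ) : Fin k ⊕ Option (Fin N) → ℂ :=
  Sum.elim s fun o => o.elim 0 z

/-- The points of the edge of a monomial with the given placement of the indices. -/
def placePoint (ω : ℂˣ) (z : Fin N → ℂ) (place : Fin m → Fin k ⊕ Option (Fin N))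
    (tw : Fin m → ZMod T) (s : Fin k → ℂ) (i : Fin m) : ℂ :=
  (cycPow ω (tw i) : ℂ)⁻¹ * placeVal z s (place i)

/-- The affine map whose image is the edge of a monomial. -/
def placeMap (ω : ℂˣ) (z : Fin N → ℂ) (place : Fin m → Fin k ⊕ Option (Fin N))
    (tw : Fin m → ZMod T) : (Fin k → ℂ) →ᵃ[ℂ] (Fin m → ℂ) where
  toFun := placePoint ω z place tw
  linear :=
    { toFun := placePoint ω 0 place tw
      map_add' := fun s s' => by
        funext i
        simp only [placePoint, Pi.add_apply]
        rcases place i with b | _ | j <;> simp [placeVal, mul_add]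
      map_smul' := fun c s => by
        funext i
        simp only [placePoint, Pi.smul_apply, RingHom.id_apply, smul_eq_mul]
        rcases place i with b | _ | j <;> simp [placeVal]
        ring }
  map_vadd' s v := by
    funext i
    simp only [vadd_eq_add, LinearMap.coe_mk, AddHom.coe_mk, Pi.add_apply, placePoint]
    rcases place i with b | _ | j <;> simp [placeVal, mul_add]

variable {A : Fin k → Multiset (ZMod T × Fin m)} {A₀ : Multiset (ZMod T × Fin m)}
  {A' : Fin N → Multiset (ZMod T × Fin m)} {place : Fin m → Fin k ⊕ Option (Fin N)}
  {tw : Fin m → ZMod T} {ω : ℂˣ} {z : Fin N → ℂ}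

lemma cycPow_mul_placePoint (s : Fin k → ℂ) (i : Fin m) :
    (cycPow ω (tw i) : ℂ) * placePoint ω z place tw s i = placeVal z s (place i) := by
  rw [placePoint, mul_inv_cancel_left₀ (cycPow ω (tw i)).ne_zero]

lemma IsPlacement.cycPow_mul (hp : IsPlacement A A₀ A' place tw) (s : Fin k → ℂ)
    {o : Fin k ⊕ Option (Fin N)} {x : ZMod T × Fin m} (hx : x ∈ contents A A₀ A' o) :
    (cycPow ω x.1 : ℂ) * placePoint ω z place tw s x.2 = placeVal z s o := by
  obtain ⟨h1, h2⟩ := (hp o x).1 hx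
  rw [← h1, ← h2, cycPow_mul_placePoint]

lemma IsPlacement.mem (hp : IsPlacement A A₀ A' place tw) (i : Fin m) :
    (tw i, i) ∈ contents A A₀ A' (place i) :=
  (hp _ _).2 ⟨rfl, rfl⟩

lemma IsPlacement.exists_mem (hp : IsPlacement A A₀ A' place tw) {b : Fin k} (hA : A b ≠ 0) :
    ∃ i, place i = Sum.inl b := by
  obtain ⟨x, hx⟩ := Multiset.exists_mem_of_ne_zero hA
  exact ⟨x.2, ((hp (Sum.inl b) x).1 hx).1⟩

variable [NeZero T]

lemma IsPlacement.placePoint_mem (hω : IsPrimitiveRoot ω T) (hp : IsPlacement A A₀ A' place tw)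
    (s : Fin k → ℂ) : placePoint ω z place tw s ∈ chainEdge ω z A A₀ A' := by
  rw [mem_chainEdge hω]
  refine ⟨fun b x hx y hy => ?_, fun x hx => ?_, fun j x hx => ?_⟩
  · rw [hp.cycPow_mul s (o := Sum.inl b) hx, hp.cycPow_mul s (o := Sum.inl b) hy]
  · exact hp.cycPow_mul s (o := Sum.inr none) hx
  · exact hp.cycPow_mul s (o := Sum.inr (some j)) hx

lemma IsPlacement.eq_placePoint (hω : IsPrimitiveRoot ω T) (hp : IsPlacement A A₀ A' place tw)
    (hA : ∀ b, A b ≠ 0) {t : Fin m → ℂ} (ht : t ∈ chainEdge ω z A A₀ A') :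
    ∃ s, t = placePoint ω z place tw s := by
  choose r hr using fun b => Multiset.exists_mem_of_ne_zero (hA b)
  rw [mem_chainEdge hω] at ht
  obtain ⟨h1, h2, h3⟩ := ht
  refine ⟨fun b => (cycPow ω (r b).1 : ℂ) * t (r b).2, funext fun i => ?_⟩
  have hne : (cycPow ω (tw i) : ℂ) ≠ 0 := (cycPow ω (tw i)).ne_zero
  rw [placePoint, eq_inv_mul_iff_mul_eq₀ hne]
  have hmem := hp.mem i
  rcases hpi : place i with b | _ | j <;> rw [hpi] at hmem
  · exact h1 b _ hmem _ (hr b)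
  · exact h2 _ hmem
  · exact h3 j _ hmem

lemma IsPlacement.chainEdge_eq (hω : IsPrimitiveRoot ω T) (hp : IsPlacement A A₀ A' place tw)
    (hA : ∀ b, A b ≠ 0) : chainEdge ω z A A₀ A' = (⊤ : AffineSubspace ℂ _).map
      (placeMap ω z place tw) := by
  ext t
  rw [AffineSubspace.mem_map]
  constructor
  · intro ht
    obtain ⟨s, rfl⟩ := hp.eq_placePoint hω hA ht
    exact ⟨s, trivial, rfl⟩
  · rintro ⟨s, -, rfl⟩
    exact hp.placePoint_mem hω s

omit [NeZero T] in
lemma IsPlacement.placePoint_injective (hp : IsPlacement A A₀ A' place tw)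
    (hA : ∀ b, A b ≠ 0) : Function.Injective (placePoint ω z place tw) := by
  intro s s' h
  funext b
  obtain ⟨i, hi⟩ := hp.exists_mem (hA b)
  have h1 := cycPow_mul_placePoint (ω := ω) (z := z) (place := place) (tw := tw) s i
  rw [h, cycPow_mul_placePoint, hi] at h1
  exact h1.symm

lemma IsPlacement.finrank_direction (hω : IsPrimitiveRoot ω T)
    (hp : IsPlacement A A₀ A' place tw) (hA : ∀ b, A b ≠ 0) :
    Module.finrank ℂ (chainEdge ω z A A₀ A').direction = k := by
  rw [hp.chainEdge_eq hω hA, AffineSubspace.map_direction, AffineSubspace.direction_top,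
    Submodule.map_top, LinearMap.finrank_range_of_inj (hp.placePoint_injective (z := 0) hA)]
  simp

omit [NeZero T] in
lemma mem_hyperplaneTT {i j : Fin m} {c : ZMod T} {t : Fin m → ℂ} :
    t ∈ hyperplaneTT ω i j c ↔ t i = (cycPow ω c : ℂ) * t j := by
  simp [hyperplaneTT, sub_eq_zero]

omit [NeZero T] in
lemma mem_hyperplaneTZ {i : Fin m} {j : Fin N} {c : ZMod T} {t : Fin m → ℂ} :
    t ∈ hyperplaneTZ ω z i j c ↔ t i = (cycPow ω c : ℂ) * z j := by
  simp [hyperplaneTZ]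

lemma mem_hyperplaneT0 {i : Fin m} {t : Fin m → ℂ} : t ∈ hyperplaneT0 i ↔ t i = 0 := by
  simp [hyperplaneT0]

lemma cycPow_neg (hω : IsPrimitiveRoot ω T) (a : ZMod T) :
    (cycPow ω (-a) : ℂ) = (cycPow ω a : ℂ)⁻¹ := by
  rw [← zero_sub, cycPow_sub hω]
  simp [cycPow]

lemma IsPlacement.isEdge (hω : IsPrimitiveRoot ω T) (hp : IsPlacement A A₀ A' place tw)
    (hA : ∀ b, A b ≠ 0) : IsEdge (cycArrangement T m ω z) (chainEdge ω z A A₀ A') := by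
  refine ⟨fun h => ?_, {H ∈ cycArrangement T m ω z | chainEdge ω z A A₀ A' ≤ H},
    fun H hH => hH.1, le_antisymm (le_sInf fun H hH => hH.2) ?_⟩
  · have := hp.placePoint_mem (z := z) hω 0
    rw [h] at this
    exact this
  intro t ht
  rw [AffineSubspace.mem_sInf_iff] at ht
  choose r hr using fun b => hp.exists_mem (hA b)
  have hs : t = placePoint ω z place tw fun b => (cycPow ω (tw (r b)) : ℂ) * t (r b) := by
    funext i
    have hne : (cycPow ω (tw i) : ℂ) ≠ 0 := (cycPow ω (tw i)).ne_zero
    rw [placePoint]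
    rcases hpi : place i with b | _ | j
    · rcases eq_or_ne i (r b) with rfl | hir
      · exact (inv_mul_cancel_left₀ hne _).symm
      · have := ht (hyperplaneTT ω i (r b) (tw (r b) - tw i)) ⟨Or.inl ⟨_, _, _, hir, rfl⟩, ?_⟩
        · rw [mem_hyperplaneTT, cycPow_sub hω] at this
          rw [this]
          simp [placeVal]
          ring
        · intro p hp'
          obtain ⟨s, rfl⟩ := hp.eq_placePoint hω hA hp'
          rw [mem_hyperplaneTT, cycPow_sub hω, placePoint, placePoint, hpi, hr]
          have := (cycPow ω (tw (r b))).ne_zero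
          simp only [Units.val_mul, Units.val_inv_eq_inv_val]
          field_simp
    · have := ht (hyperplaneT0 i) ⟨Or.inr (Or.inr ⟨_, rfl⟩), ?_⟩
      · rw [mem_hyperplaneT0] at this
        simp [placeVal, this]
      · intro p hp'
        obtain ⟨s, rfl⟩ := hp.eq_placePoint hω hA hp'
        rw [mem_hyperplaneT0, placePoint, hpi]
        simp [placeVal]
    · have := ht (hyperplaneTZ ω z i j (-tw i)) ⟨Or.inr (Or.inl ⟨_, _, _, rfl⟩), ?_⟩
      · rw [mem_hyperplaneTZ, cycPow_neg hω] at this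
        simp [placeVal, this]
      · intro p hp'
        obtain ⟨s, rfl⟩ := hp.eq_placePoint hω hA hp'
        rw [mem_hyperplaneTZ, cycPow_neg hω, placePoint, hpi]
        simp [placeVal]
  rw [hs]
  exact hp.placePoint_mem hω _

end Placement

/-! ### The terms of the differential of a monomial chain -/

section Terms

variable {T m N : ℕ}

attribute [local instance] LieRing.ofAssociativeRing

/-- The automorphism `τ^c` of `𝔞`. -/
def shiftHom (c : ZMod T) :
    FreeLieAlgebra ℂ (ZMod T × Fin m) →ₗ⁅ℂ⁆ FreeLieAlgebra ℂ (ZMod T × Fin m) :=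
  permHom (Equiv.prodCongr (Equiv.addRight c) (Equiv.refl _))

/-- The content of `τ^c g` in terms of the content of `g`. -/
def shiftContent (c : ZMod T) (A : Multiset (ZMod T × Fin m)) : Multiset (ZMod T × Fin m) :=
  A.map (Equiv.prodCongr (Equiv.addRight c) (Equiv.refl (Fin m)))

lemma mem_shiftContent {c : ZMod T} {A : Multiset (ZMod T × Fin m)} {x : ZMod T × Fin m} :
    x ∈ shiftContent c A ↔ (x.1 - c, x.2) ∈ A := by
  rw [shiftContent, Multiset.mem_map]
  constructor
  · rintro ⟨y, hy, rfl⟩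
    simpa using hy
  · intro h
    exact ⟨_, h, by ext <;> simp⟩

lemma shiftContent_map_snd (c : ZMod T) (A : Multiset (ZMod T × Fin m)) :
    (shiftContent c A).map Prod.snd = A.map Prod.snd := by
  rw [shiftContent, Multiset.map_map]
  rfl

lemma IsCommutator.shiftHom {A : Multiset (ZMod T × Fin m)}
    {g : FreeLieAlgebra ℂ (ZMod T × Fin m)} (h : IsCommutator A g) (c : ZMod T) :
    IsCommutator (shiftContent c A) (shiftHom c g) :=
  h.permHom _

lemma orbitSum_eq_cycSum [NeZero T] (g : FreeLieAlgebra ℂ (ZMod T × Fin m)) :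
    orbitSum g = cycSum cycShift_pow_self g := by
  refine Subtype.ext ?_
  rw [coe_cycSum]
  change ∑ j : ZMod T, permHom (Equiv.prodCongr (Equiv.addRight j) (Equiv.refl _)) g = _
  rw [Finset.sum_range]
  simp only [cycShift_pow]
  obtain ⟨n, rfl⟩ := Nat.exists_eq_succ_of_ne_zero (NeZero.ne T)
  exact Finset.sum_congr rfl fun j _ => congrArg
    (fun c : ZMod (n + 1) => permHom (Equiv.prodCongr (Equiv.addRight c) (Equiv.refl _)) g)
    (ZMod.natCast_zmod_val (n := n + 1) j).symm

/-- The map `g ↦ ∑_j τ^j g` as a linear map. -/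
def orbitMap (T m : ℕ) [NeZero T] :
    FreeLieAlgebra ℂ (ZMod T × Fin m) →ₗ[ℂ] fixedSubalgebra (cycShift T m) :=
  cycSum cycShift_pow_self

lemma orbitMap_apply [NeZero T] (g : FreeLieAlgebra ℂ (ZMod T × Fin m)) :
    orbitMap T m g = orbitSum g :=
  (orbitSum_eq_cycSum g).symm

lemma IsCommutator.orbitSum [NeZero T] {A : Multiset (ZMod T × Fin m)}
    {g : FreeLieAlgebra ℂ (ZMod T × Fin m)} (h : IsCommutator A g) :
    IsCycCommutator cycShift_pow_self A (orbitSum g) :=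
  ⟨g, h, orbitSum_eq_cycSum g⟩

lemma coe_orbitSum [NeZero T] (g : FreeLieAlgebra ℂ (ZMod T × Fin m)) :
    (orbitSum g : FreeLieAlgebra ℂ (ZMod T × Fin m)) = ∑ c : ZMod T, shiftHom c g := rfl

lemma shiftHom_shiftHom (c d : ZMod T) (g : FreeLieAlgebra ℂ (ZMod T × Fin m)) :
    shiftHom c (shiftHom d g) = shiftHom (c + d) g := by
  rw [shiftHom, shiftHom, permHom_permHom, shiftHom]
  congr 2
  ext x <;> simp [add_comm c, add_assoc]

lemma orbitSum_shiftHom [NeZero T] (c : ZMod T) (g : FreeLieAlgebra ℂ (ZMod T × Fin m)) :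
    orbitSum (shiftHom c g) = orbitSum g := by
  refine Subtype.ext ?_
  rw [coe_orbitSum, coe_orbitSum]
  simp only [shiftHom_shiftHom]
  exact Fintype.sum_equiv (Equiv.addRight c) _ _ fun _ => rfl

lemma orbitSum_lie [NeZero T] (g h : FreeLieAlgebra ℂ (ZMod T × Fin m)) :
    ⁅orbitSum g, orbitSum h⁆ = ∑ c : ZMod T, orbitSum ⁅shiftHom c g, h⁆ := by
  refine Subtype.ext ?_
  rw [LieSubalgebra.coe_bracket, coe_orbitSum, coe_orbitSum, AddSubmonoidClass.coe_finsetSum]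
  simp only [coe_orbitSum, LieHom.map_lie, shiftHom_shiftHom]
  rw [Finset.sum_comm, lie_sum]
  refine Finset.sum_congr rfl fun d _ => ?_
  rw [sum_lie]
  exact (Fintype.sum_equiv (Equiv.addLeft d) _ _ fun _ => rfl).symm

/-- Replace the blocks `i` and `j + 1` of a family by one new block (put first), for `i ≤ j`. -/
def joinBlocks {α : Type*} (f : α → α → α) : {k : ℕ} → (Fin (k + 1) → α) → Fin k → Fin k → Fin k → α
  | 0, _, i, _ => i.elim0
  | _ + 1, g, i, j => Fin.cons (f (g j.succ) (g i.castSucc)) (j.removeNth (i.castSucc.removeNth g))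

/-- The terms of the differential of a monomial chain with `k + 1` exterior factors: the factor `b`
goes to the origin, or the factor `b` goes to the site `j` after the twist `c`, or the factor
`j + 1`, twisted by `c`, is joined with the factor `i`. -/
abbrev ChainTerm (T N k : ℕ) : Type :=
  Fin (k + 1) ⊕ (Fin (k + 1) × Fin N × ZMod T) ⊕ ({p : Fin k × Fin k // p.1 ≤ p.2} × ZMod T)

namespace ChainTerm

variable {k : ℕ}

/-- The exponent of the sign of a term. -/
def parity : ChainTerm T N k → ℕ
  | Sum.inl b => b
  | Sum.inr (Sum.inl p) => p.1
  | Sum.inr (Sum.inr p) => p.1.1.1 + (p.1.1.2 + 1)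

/-- The exterior factors of a term. -/
def blocks (g : Fin (k + 1) → FreeLieAlgebra ℂ (ZMod T × Fin m)) :
    ChainTerm T N k → Fin k → FreeLieAlgebra ℂ (ZMod T × Fin m)
  | Sum.inl b => b.removeNth g
  | Sum.inr (Sum.inl p) => p.1.removeNth g
  | Sum.inr (Sum.inr p) => joinBlocks (fun h h' => ⁅shiftHom p.2 h, h'⁆) g p.1.1.1 p.1.1.2

/-- The factor of a term at the origin. -/
def originPart [NeZero T] (g : Fin (k + 1) → FreeLieAlgebra ℂ (ZMod T × Fin m))
    (u : UniversalEnvelopingAlgebra ℂ (fixedSubalgebra (cycShift T m))) :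
    ChainTerm T N k → UniversalEnvelopingAlgebra ℂ (fixedSubalgebra (cycShift T m))
  | Sum.inl b => UniversalEnvelopingAlgebra.ι ℂ (orbitSum (g b)) * u
  | _ => u

/-- The factors of a term at the sites. -/
def sitePart (g : Fin (k + 1) → FreeLieAlgebra ℂ (ZMod T × Fin m))
    (v : Fin N → UniversalEnvelopingAlgebra ℂ (FreeLieAlgebra ℂ (ZMod T × Fin m))) :
    ChainTerm T N k → Fin N → UniversalEnvelopingAlgebra ℂ (FreeLieAlgebra ℂ (ZMod T × Fin m))
  | Sum.inr (Sum.inl p) => Function.update v p.2.1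
      (UniversalEnvelopingAlgebra.ι ℂ (shiftHom p.2.2 (g p.1)) * v p.2.1)
  | _ => v

/-- A term of the differential of a monomial chain. -/
def chain [NeZero T] (g : Fin (k + 1) → FreeLieAlgebra ℂ (ZMod T × Fin m))
    (u : UniversalEnvelopingAlgebra ℂ (fixedSubalgebra (cycShift T m)))
    (v : Fin N → UniversalEnvelopingAlgebra ℂ (FreeLieAlgebra ℂ (ZMod T × Fin m)))
    (t : ChainTerm T N k) : ChainSpace (cycShift T m) N k :=
  monomial (t.blocks g) (t.originPart g u) (t.sitePart g v)

end ChainTerm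

variable [NeZero T] {k : ℕ}

lemma coeffAct_orbitSum (g : FreeLieAlgebra ℂ (ZMod T × Fin m))
    (u : UniversalEnvelopingAlgebra ℂ (fixedSubalgebra (cycShift T m)))
    (v : Fin N → UniversalEnvelopingAlgebra ℂ (FreeLieAlgebra ℂ (ZMod T × Fin m))) :
    coeffAct (cycShift T m) N (orbitSum g) (u ⊗ₜ PiTensorProduct.tprod ℂ v) =
      (UniversalEnvelopingAlgebra.ι ℂ (orbitSum g) * u) ⊗ₜ PiTensorProduct.tprod ℂ v +
      ∑ j : Fin N, ∑ c : ZMod T, u ⊗ₜ PiTensorProduct.tprod ℂ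
        (Function.update v j (UniversalEnvelopingAlgebra.ι ℂ (shiftHom c g) * v j)) := by
  rw [coeffAct_tprod]
  congr 1
  refine Finset.sum_congr rfl fun j _ => ?_
  rw [coe_orbitSum, map_sum, Finset.sum_mul, MultilinearMap.map_update_sum,
    TensorProduct.tmul_sum]

omit [NeZero T] in
lemma sum_sum_ge_eq_sum_subtype {E : Type*} [AddCommMonoid E] (F : Fin k → Fin k → E) :
    ∑ i, ∑ j ≥ i, F i j = ∑ p : {p : Fin k × Fin k // p.1 ≤ p.2}, F p.1.1 p.1.2 := by
  rw [← Finset.sum_subtype (p := fun p : Fin k × Fin k => p.1 ≤ p.2)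
    (Finset.univ.filter fun p : Fin k × Fin k => p.1 ≤ p.2) (by simp) fun p => F p.1 p.2,
    Finset.sum_filter, Fintype.sum_prod_type]
  refine Finset.sum_congr rfl fun i _ => ?_
  rw [← Finset.sum_filter]
  exact Finset.sum_congr (by ext; simp) fun _ _ => rfl

lemma sum_act_monomial (g : Fin (k + 1) → FreeLieAlgebra ℂ (ZMod T × Fin m))
    (u : UniversalEnvelopingAlgebra ℂ (fixedSubalgebra (cycShift T m)))
    (v : Fin N → UniversalEnvelopingAlgebra ℂ (FreeLieAlgebra ℂ (ZMod T × Fin m))) :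
    ∑ i : Fin (k + 1), (-1 : ℂ) ^ (i : ℕ) •
      (wedgeRev _ k (i.removeNth fun b => orbitSum (g b)) ⊗ₜ[ℂ]
        coeffAct (cycShift T m) N (orbitSum (g i)) (u ⊗ₜ PiTensorProduct.tprod ℂ v)) =
      ∑ b : Fin (k + 1), (-1 : ℂ) ^ (b : ℕ) • ChainTerm.chain (k := k) g u v (Sum.inl b) +
        ∑ p : Fin (k + 1) × Fin N × ZMod T,
          (-1 : ℂ) ^ (p.1 : ℕ) • ChainTerm.chain (k := k) g u v (Sum.inr (Sum.inl p)) := by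
  rw [Fintype.sum_prod_type, ← Finset.sum_add_distrib]
  refine Finset.sum_congr rfl fun i _ => ?_
  rw [coeffAct_orbitSum, TensorProduct.tmul_add, smul_add, TensorProduct.tmul_sum,
    Finset.smul_sum, Fintype.sum_prod_type]
  refine congrArg₂ (· + ·) rfl (Finset.sum_congr rfl fun j _ => ?_)
  rw [TensorProduct.tmul_sum, Finset.smul_sum]
  rfl

lemma chainD_monomial : ∀ {k : ℕ} (g : Fin (k + 1) → FreeLieAlgebra ℂ (ZMod T × Fin m))
    (u : UniversalEnvelopingAlgebra ℂ (fixedSubalgebra (cycShift T m)))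
    (v : Fin N → UniversalEnvelopingAlgebra ℂ (FreeLieAlgebra ℂ (ZMod T × Fin m))),
    chainD (cycShift T m) N k (monomial g u v) =
      ∑ t : ChainTerm T N k, (-1 : ℂ) ^ t.parity • t.chain g u v
  | 0, g, u, v => by
    have h1 : chainD (cycShift T m) N 0 (monomial g u v) = ∑ i : Fin 1, (-1 : ℂ) ^ (i : ℕ) •
      (wedgeRev _ 0 (i.removeNth fun b => orbitSum (g b)) ⊗ₜ[ℂ]
        coeffAct (cycShift T m) N (orbitSum (g i)) (u ⊗ₜ PiTensorProduct.tprod ℂ v)) := by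
      rw [monomial, chainD, chainDiff_zero_apply, Fin.sum_univ_one, Fin.val_zero, pow_zero, one_smul]
      congr 2
      exact Subsingleton.elim _ _
    rw [h1, sum_act_monomial, Fintype.sum_sum_type, Fintype.sum_sum_type]
    refine congrArg₂ (· + ·) rfl ?_
    refine (add_zero _).symm.trans (congrArg₂ (· + ·) rfl ?_)
    refine (Finset.sum_eq_zero fun p _ => ?_).symm
    exact p.1.1.1.elim0
  | k + 1, g, u, v => by
    rw [monomial, chainD, chainDiff_succ_apply]
    refine (congrArg₂ (· + ·) (sum_act_monomial g u v) (sum_sum_ge_eq_sum_subtype _)).trans ?_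
    rw [Fintype.sum_sum_type, Fintype.sum_sum_type, add_assoc]
    refine congrArg₂ (· + ·) rfl (congrArg₂ (· + ·) rfl ?_)
    rw [Fintype.sum_prod_type]
    refine Finset.sum_congr rfl fun p _ => ?_
    have h : wedgeRev (fixedSubalgebra (cycShift T m)) (k + 1)
        (Fin.cons ⁅orbitSum (g p.1.2.succ), orbitSum (g p.1.1.castSucc)⁆
          (p.1.2.removeNth (p.1.1.castSucc.removeNth fun b => orbitSum (g b)))) =
        ∑ c : ZMod T, wedgeRev (fixedSubalgebra (cycShift T m)) (k + 1)
          (fun b => orbitSum (joinBlocks (fun h h' => ⁅shiftHom c h, h'⁆) g p.1.1 p.1.2 b)) := by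
      rw [orbitSum_lie, ← wedgeCons_apply, map_sum, LinearMap.sum_apply]
      refine Finset.sum_congr rfl fun c _ => ?_
      rw [wedgeCons_apply]
      congr 1
      funext b
      refine Fin.cases rfl (fun b => rfl) b
    rw [h, TensorProduct.sum_tmul, Finset.smul_sum]
    rfl

end Terms

/-! ### The edges of the terms of the differential -/

section TermEdges

variable {T m N k : ℕ} [NeZero T]

attribute [local instance] LieRing.ofAssociativeRing

/-- The factors of the chain `monomial g u v` are monomials with the given contents. -/
structure HasContent (A : Fin k → Multiset (ZMod T × Fin m)) (A₀ : Multiset (ZMod T × Fin m))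
    (A' : Fin N → Multiset (ZMod T × Fin m)) (g : Fin k → FreeLieAlgebra ℂ (ZMod T × Fin m))
    (u : UniversalEnvelopingAlgebra ℂ (fixedSubalgebra (cycShift T m)))
    (v : Fin N → UniversalEnvelopingAlgebra ℂ (FreeLieAlgebra ℂ (ZMod T × Fin m))) : Prop where
  blocks : ∀ b, IsCommutator (A b) (g b)
  origin : EnvMonomial (IsCycCommutator cycShift_pow_self) A₀ u
  sites : ∀ j, EnvMonomial IsCommutator (A' j) (v j)

/-- The chain `monomial g u v` is a multilinear monomial with the given contents. -/
structure IsConfig (A : Fin k → Multiset (ZMod T × Fin m)) (A₀ : Multiset (ZMod T × Fin m))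
    (A' : Fin N → Multiset (ZMod T × Fin m)) (g : Fin k → FreeLieAlgebra ℂ (ZMod T × Fin m))
    (u : UniversalEnvelopingAlgebra ℂ (fixedSubalgebra (cycShift T m)))
    (v : Fin N → UniversalEnvelopingAlgebra ℂ (FreeLieAlgebra ℂ (ZMod T × Fin m))) : Prop
    extends HasContent A A₀ A' g u v where
  multilinear : IsMultilinear A A₀ A'

variable {A₀ : Multiset (ZMod T × Fin m)} {A' : Fin N → Multiset (ZMod T × Fin m)}
  {u : UniversalEnvelopingAlgebra ℂ (fixedSubalgebra (cycShift T m))}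
  {v : Fin N → UniversalEnvelopingAlgebra ℂ (FreeLieAlgebra ℂ (ZMod T × Fin m))}

lemma HasContent.isMonomialChain {A : Fin k → Multiset (ZMod T × Fin m)}
    {g : Fin k → FreeLieAlgebra ℂ (ZMod T × Fin m)} (h : HasContent A A₀ A' g u v) :
    IsMonomialChain cycShift_pow_self A A₀ A' (monomial g u v) :=
  ⟨fun b => orbitSum (g b), u, v, fun b => (h.blocks b).orbitSum, h.origin, h.sites, rfl⟩

omit [NeZero T] in
lemma IsConfig.ne_zero {A : Fin k → Multiset (ZMod T × Fin m)}
    {g : Fin k → FreeLieAlgebra ℂ (ZMod T × Fin m)} (h : IsConfig A A₀ A' g u v) (b : Fin k) :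
    A b ≠ 0 :=
  (h.blocks b).ne_zero

namespace ChainTerm

/-- The contents of the exterior factors of a term. -/
def blockContent (A : Fin (k + 1) → Multiset (ZMod T × Fin m)) :
    ChainTerm T N k → Fin k → Multiset (ZMod T × Fin m)
  | Sum.inl b => b.removeNth A
  | Sum.inr (Sum.inl p) => p.1.removeNth A
  | Sum.inr (Sum.inr p) => joinBlocks (fun B B' => shiftContent p.2 B + B') A p.1.1.1 p.1.1.2

/-- The content of the factor of a term at the origin. -/
def originContent (A : Fin (k + 1) → Multiset (ZMod T × Fin m)) (A₀ : Multiset (ZMod T × Fin m)) :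
    ChainTerm T N k → Multiset (ZMod T × Fin m)
  | Sum.inl b => A b + A₀
  | _ => A₀

/-- The contents of the factors of a term at the sites. -/
def siteContent (A : Fin (k + 1) → Multiset (ZMod T × Fin m))
    (A' : Fin N → Multiset (ZMod T × Fin m)) :
    ChainTerm T N k → Fin N → Multiset (ZMod T × Fin m)
  | Sum.inr (Sum.inl p) => Function.update A' p.2.1 (shiftContent p.2.2 (A p.1) + A' p.2.1)
  | _ => A'

/-- The condition, on the values of the blocks, that describes the edge of a term. -/
def locus (ω : ℂˣ) (z : Fin N → ℂ) : ChainTerm T N k → Set (Fin (k + 1) → ℂ)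
  | Sum.inl b => {s | s b = 0}
  | Sum.inr (Sum.inl p) => {s | (cycPow ω p.2.2 : ℂ) * s p.1 = z p.2.1}
  | Sum.inr (Sum.inr p) => {s | (cycPow ω p.2 : ℂ) * s p.1.1.2.succ = s p.1.1.1.castSucc}

end ChainTerm

omit [NeZero T] in
lemma succAbove_castSucc_of_le {i j : Fin k} (h : i ≤ j) : i.castSucc.succAbove j = j.succ :=
  Fin.succAbove_of_le_castSucc _ _ (Fin.castSucc_le_castSucc_iff.2 h)

omit [NeZero T] in
lemma forall_joinBlocks {α : Type*} (f : α → α → α) (g : Fin (k + 1) → α) {i j : Fin k}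
    (h : i ≤ j) (P : α → Prop) : (∀ b, P (joinBlocks f g i j b)) ↔
      P (f (g j.succ) (g i.castSucc)) ∧ ∀ b, b ≠ i.castSucc → b ≠ j.succ → P (g b) := by
  cases k with
  | zero => exact i.elim0
  | succ k =>
    rw [Fin.forall_fin_succ]
    refine and_congr Iff.rfl ⟨fun H b h1 h2 => ?_, fun H b => ?_⟩
    · obtain ⟨c, rfl⟩ := Fin.exists_succAbove_eq h1
      have hc : c ≠ j := fun hc => h2 (by rw [hc, succAbove_castSucc_of_le h])
      obtain ⟨d, rfl⟩ := Fin.exists_succAbove_eq hc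
      exact H d
    · refine H _ (Fin.succAbove_ne _ _) ?_
      rw [← succAbove_castSucc_of_le h]
      exact fun hc => Fin.succAbove_ne _ _ (Fin.succAbove_right_injective hc)

omit [NeZero T] in
lemma sum_joinBlocks {α : Type*} [AddCommMonoid α] (f : α → α → α) (g : Fin (k + 1) → α)
    {i j : Fin k} (h : i ≤ j) : ∑ b, joinBlocks f g i j b + (g j.succ + g i.castSucc) =
      f (g j.succ) (g i.castSucc) + ∑ b, g b := by
  cases k with
  | zero => exact i.elim0
  | succ k =>
    rw [Fin.sum_univ_succ, Fin.sum_univ_succAbove g i.castSucc,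
      Fin.sum_univ_succAbove (fun b => g (i.castSucc.succAbove b)) j, succAbove_castSucc_of_le h]
    simp only [joinBlocks, Fin.cons_zero, Fin.cons_succ, Fin.removeNth]
    abel

omit [NeZero T] in
lemma ChainTerm.map_snd_totalContent (A : Fin (k + 1) → Multiset (ZMod T × Fin m))
    (A₀ : Multiset (ZMod T × Fin m)) (A' : Fin N → Multiset (ZMod T × Fin m))
    (t : ChainTerm T N k) :
    (totalContent (t.blockContent A) (t.originContent A A₀) (t.siteContent A A')).map Prod.snd =
      (totalContent A A₀ A').map Prod.snd := by
  simp only [totalContent, Multiset.map_add, map_sum_multiset]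
  rcases t with b | ⟨b, j, c⟩ | ⟨⟨⟨i, j⟩, hij⟩, c⟩
  · rw [Fin.sum_univ_succAbove _ b]
    simp only [ChainTerm.blockContent, ChainTerm.originContent, ChainTerm.siteContent,
      Multiset.map_add, Fin.removeNth]
    abel
  · rw [Fin.sum_univ_succAbove _ b]
    simp only [ChainTerm.blockContent, ChainTerm.originContent, ChainTerm.siteContent,
      Fin.removeNth]
    have e1 : ∑ j', ((Function.update A' j (shiftContent c (A b) + A' j)) j').map Prod.snd =
        (A b).map Prod.snd + ∑ j', (A' j').map Prod.snd := by
      rw [← Finset.add_sum_erase _ _ (Finset.mem_univ j),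
        ← Finset.add_sum_erase _ (fun j' => (A' j').map Prod.snd) (Finset.mem_univ j),
        Function.update_self, Multiset.map_add, shiftContent_map_snd, add_assoc]
      congr 2
      refine Finset.sum_congr rfl fun j' hj' => ?_
      rw [Function.update_of_ne (Finset.ne_of_mem_erase hj')]
    rw [e1]
    abel
  · simp only [ChainTerm.blockContent, ChainTerm.originContent, ChainTerm.siteContent]
    congr 2
    have e := congrArg (Multiset.map Prod.snd)
      (sum_joinBlocks (fun B B' => shiftContent c B + B') A hij)
    simp only [Multiset.map_add, map_sum_multiset, shiftContent_map_snd] at e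
    rw [add_comm] at e
    exact add_left_cancel e

lemma HasContent.term {A : Fin (k + 1) → Multiset (ZMod T × Fin m)}
    {g : Fin (k + 1) → FreeLieAlgebra ℂ (ZMod T × Fin m)} (h : HasContent A A₀ A' g u v)
    (t : ChainTerm T N k) : HasContent (t.blockContent A) (t.originContent A A₀)
      (t.siteContent A A') (t.blocks g) (t.originPart g u) (t.sitePart g v) := by
  rcases t with b | ⟨b, j, c⟩ | ⟨⟨⟨i, j⟩, hij⟩, c⟩
  · exact ⟨fun b' => h.blocks _, EnvMonomial.mul (h.blocks b).orbitSum h.origin, h.sites⟩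
  · refine ⟨fun b' => h.blocks _, h.origin, fun j' => ?_⟩
    simp only [ChainTerm.siteContent, ChainTerm.sitePart]
    rcases eq_or_ne j' j with rfl | hj
    · rw [Function.update_self, Function.update_self]
      exact EnvMonomial.mul ((h.blocks b).shiftHom c) (h.sites j')
    · rw [Function.update_of_ne hj, Function.update_of_ne hj]
      exact h.sites j'
  · refine ⟨?_, h.origin, h.sites⟩
    cases k with
    | zero => exact i.elim0
    | succ k =>
      intro b
      refine Fin.cases ?_ (fun b => ?_) b
      · exact ((h.blocks _).shiftHom c).lie (h.blocks _)
      · exact h.blocks _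

lemma IsConfig.term {A : Fin (k + 1) → Multiset (ZMod T × Fin m)}
    {g : Fin (k + 1) → FreeLieAlgebra ℂ (ZMod T × Fin m)} (h : IsConfig A A₀ A' g u v)
    (t : ChainTerm T N k) : IsConfig (t.blockContent A) (t.originContent A A₀) (t.siteContent A A')
      (t.blocks g) (t.originPart g u) (t.sitePart g v) :=
  ⟨h.toHasContent.term t, (t.map_snd_totalContent A A₀ A').trans h.multilinear⟩

section Values

variable {A : Fin k → Multiset (ZMod T × Fin m)} {place : Fin m → Fin k ⊕ Option (Fin N)}
  {tw : Fin m → ZMod T} {ω : ℂˣ} {z : Fin N → ℂ} (hp : IsPlacement A A₀ A' place tw)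
include hp

lemma IsPlacement.anchored_shift_iff (hω : IsPrimitiveRoot ω T) {b : Fin k} (hA : A b ≠ 0)
    (s : Fin k → ℂ) (a : ℂ) (c : ZMod T) :
    placePoint ω z place tw s ∈ anchored ω a (shiftContent c (A b)) ↔
      (cycPow ω c : ℂ) * s b = a := by
  have h : ∀ x ∈ shiftContent c (A b),
      (cycPow ω x.1 : ℂ) * placePoint ω z place tw s x.2 = (cycPow ω c : ℂ) * s b := by
    intro x hx
    have := hp.cycPow_mul (ω := ω) (z := z) s (o := Sum.inl b) (mem_shiftContent.1 hx)
    change _ = s b at this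
    rw [← this, cycPow_sub hω]
    have := (cycPow ω c).ne_zero
    simp only [Units.val_mul, Units.val_inv_eq_inv_val]
    field_simp
  obtain ⟨y, hy⟩ := Multiset.exists_mem_of_ne_zero hA
  have hy' : ((y.1 + c, y.2) : ZMod T × Fin m) ∈ shiftContent c (A b) := by
    rw [mem_shiftContent]; simpa using hy
  constructor
  · intro H
    rw [← h _ hy']
    exact H _ hy'
  · rintro rfl x hx
    exact h x hx

lemma IsPlacement.anchored_iff (hω : IsPrimitiveRoot ω T) {b : Fin k} (hA : A b ≠ 0)
    (s : Fin k → ℂ) (a : ℂ) :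
    placePoint ω z place tw s ∈ anchored ω a (A b) ↔ s b = a := by
  have h := hp.anchored_shift_iff (z := z) hω hA s a 0
  have e : shiftContent 0 (A b) = A b := by
    rw [shiftContent]
    convert Multiset.map_id (A b) using 2
    ext <;> simp
  rwa [e, show (cycPow ω (0 : ZMod T) : ℂ) = 1 by simp [cycPow], one_mul] at h

lemma IsPlacement.swimming_join_iff (hω : IsPrimitiveRoot ω T) {b b' : Fin k} (hA : A b ≠ 0)
    (hA' : A b' ≠ 0) (s : Fin k → ℂ) (c : ZMod T) :
    placePoint ω z place tw s ∈ swimming ω (shiftContent c (A b) + A b') ↔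
      (cycPow ω c : ℂ) * s b = s b' := by
  have h1 := (hp.anchored_shift_iff (z := z) hω hA s _ c).2 rfl
  have h2 := (hp.anchored_iff (z := z) hω hA' s _).2 rfl
  constructor
  · intro H
    obtain ⟨y, hy⟩ := Multiset.exists_mem_of_ne_zero hA
    have hy' : ((y.1 + c, y.2) : ZMod T × Fin m) ∈ shiftContent c (A b) := by
      rw [mem_shiftContent]; simpa using hy
    obtain ⟨y', hy''⟩ := Multiset.exists_mem_of_ne_zero hA'
    rw [← h1 _ hy', ← h2 _ hy'']
    exact H _ (Multiset.mem_add.2 (Or.inl hy')) _ (Multiset.mem_add.2 (Or.inr hy''))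
  · intro H x hx y hy
    have h3 : ∀ x ∈ shiftContent c (A b) + A b',
        (cycPow ω x.1 : ℂ) * placePoint ω z place tw s x.2 = s b' := by
      intro x hx
      rcases Multiset.mem_add.1 hx with hx | hx
      · rw [← H, ← h1 x hx]
      · exact h2 x hx
    rw [h3 x hx, h3 y hy]

end Values

omit [NeZero T] in
lemma anchored_add {ω : ℂˣ} {a : ℂ} {A B : Multiset (ZMod T × Fin m)} {t : Fin m → ℂ} :
    t ∈ anchored ω a (A + B) ↔ t ∈ anchored ω a A ∧ t ∈ anchored ω a B := by
  constructor
  · exact fun h => ⟨fun x hx => h x (Multiset.mem_add.2 (Or.inl hx)),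
      fun x hx => h x (Multiset.mem_add.2 (Or.inr hx))⟩
  · rintro ⟨h1, h2⟩ x hx
    exact (Multiset.mem_add.1 hx).elim (h1 x) (h2 x)

omit [NeZero T] in
lemma swimming_of_anchored {ω : ℂˣ} {a : ℂ} {A : Multiset (ZMod T × Fin m)} {t : Fin m → ℂ}
    (h : t ∈ anchored ω a A) : t ∈ swimming ω A :=
  fun x hx y hy => by rw [h x hx, h y hy]

lemma swimming_shift {ω : ℂˣ} (hω : IsPrimitiveRoot ω T) {c : ZMod T}
    {A : Multiset (ZMod T × Fin m)} {t : Fin m → ℂ} (h : t ∈ swimming ω (shiftContent c A)) :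
    t ∈ swimming ω A := by
  intro x hx y hy
  have := h (x.1 + c, x.2) (by rw [mem_shiftContent]; simpa using hx) (y.1 + c, y.2)
    (by rw [mem_shiftContent]; simpa using hy)
  simp only [cycPow_add hω, Units.val_mul] at this
  refine mul_left_cancel₀ (cycPow ω c).ne_zero ?_
  linear_combination this

omit [NeZero T] in
lemma swimming_add_left {ω : ℂˣ} {A B : Multiset (ZMod T × Fin m)} {t : Fin m → ℂ}
    (h : t ∈ swimming ω (A + B)) : t ∈ swimming ω A :=
  fun x hx y hy => h x (Multiset.mem_add.2 (Or.inl hx)) y (Multiset.mem_add.2 (Or.inl hy))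

omit [NeZero T] in
lemma swimming_add_right {ω : ℂˣ} {A B : Multiset (ZMod T × Fin m)} {t : Fin m → ℂ}
    (h : t ∈ swimming ω (A + B)) : t ∈ swimming ω B :=
  fun x hx y hy => h x (Multiset.mem_add.2 (Or.inr hx)) y (Multiset.mem_add.2 (Or.inr hy))

namespace ChainTerm

variable {A : Fin (k + 1) → Multiset (ZMod T × Fin m)}
  {place : Fin m → Fin (k + 1) ⊕ Option (Fin N)}
  {tw : Fin m → ZMod T} {ω : ℂˣ} {z : Fin N → ℂ}

/-- The edge of a term of the differential. -/
def edge (ω : ℂˣ) (z : Fin N → ℂ) (A : Fin (k + 1) → Multiset (ZMod T × Fin m))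
    (A₀ : Multiset (ZMod T × Fin m)) (A' : Fin N → Multiset (ZMod T × Fin m))
    (t : ChainTerm T N k) : AffineSubspace ℂ (Fin m → ℂ) :=
  chainEdge ω z (t.blockContent A) (t.originContent A A₀) (t.siteContent A A')

lemma edge_le (hω : IsPrimitiveRoot ω T) (t : ChainTerm T N k) :
    t.edge ω z A A₀ A' ≤ chainEdge ω z A A₀ A' := by
  intro p h
  rw [edge, mem_chainEdge hω] at h
  rw [mem_chainEdge hω]
  obtain ⟨h1, h2, h3⟩ := h
  rcases t with b | ⟨b, j, c⟩ | ⟨⟨⟨i, j⟩, hij⟩, c⟩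
  · simp only [blockContent, originContent, siteContent] at h1 h2 h3
    rw [anchored_add] at h2
    refine ⟨fun b' => ?_, h2.2, h3⟩
    rcases eq_or_ne b' b with rfl | hb
    · exact swimming_of_anchored h2.1
    · obtain ⟨d, rfl⟩ := Fin.exists_succAbove_eq hb
      exact h1 d
  · simp only [blockContent, originContent, siteContent] at h1 h2 h3
    have h4 := h3 j
    rw [Function.update_self, anchored_add] at h4
    refine ⟨fun b' => ?_, h2, fun j' => ?_⟩
    · rcases eq_or_ne b' b with rfl | hb
      · exact swimming_shift hω (swimming_of_anchored h4.1)
      · obtain ⟨d, rfl⟩ := Fin.exists_succAbove_eq hb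
        exact h1 d
    · rcases eq_or_ne j' j with rfl | hj
      · exact h4.2
      · have := h3 j'
        rwa [Function.update_of_ne hj] at this
  · simp only [blockContent, originContent, siteContent] at h1 h2 h3
    rw [forall_joinBlocks _ _ hij (fun B => p ∈ swimming ω B)] at h1
    refine ⟨fun b => ?_, h2, h3⟩
    by_cases hb : b = i.castSucc
    · exact hb ▸ swimming_add_right h1.1
    by_cases hb' : b = j.succ
    · exact hb' ▸ swimming_shift hω (swimming_add_left h1.1)
    · exact h1.2 b hb hb'

lemma placePoint_mem_edge (hω : IsPrimitiveRoot ω T) (hp : IsPlacement A A₀ A' place tw)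
    (hA : ∀ b, A b ≠ 0) (t : ChainTerm T N k) (s : Fin (k + 1) → ℂ) :
    placePoint ω z place tw s ∈ t.edge ω z A A₀ A' ↔ s ∈ t.locus ω z := by
  have h0 := hp.placePoint_mem (z := z) hω s
  rw [mem_chainEdge hω] at h0
  obtain ⟨h1, h2, h3⟩ := h0
  rw [edge, mem_chainEdge hω]
  rcases t with b | ⟨b, j, c⟩ | ⟨⟨⟨i, j⟩, hij⟩, c⟩
  · simp only [blockContent, originContent, siteContent, locus, Set.mem_ofPred_eq]
    rw [anchored_add, hp.anchored_iff hω (hA b)]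
    exact ⟨fun h => h.2.1.1, fun h => ⟨fun d => h1 _, ⟨h, h2⟩, h3⟩⟩
  · simp only [blockContent, originContent, siteContent, locus, Set.mem_ofPred_eq]
    rw [← hp.anchored_shift_iff (z := z) hω (hA b)]
    constructor
    · rintro ⟨-, -, h⟩
      have := h j
      rw [Function.update_self, anchored_add] at this
      exact this.1
    · refine fun h => ⟨fun d => h1 _, h2, fun j' => ?_⟩
      rcases eq_or_ne j' j with rfl | hj
      · rw [Function.update_self, anchored_add]
        exact ⟨h, h3 j'⟩
      · rw [Function.update_of_ne hj]
        exact h3 j'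
  · simp only [blockContent, originContent, siteContent, locus, Set.mem_ofPred_eq]
    rw [forall_joinBlocks _ _ hij (fun B => placePoint ω z place tw s ∈ swimming ω B),
      hp.swimming_join_iff hω (hA _) (hA _)]
    exact ⟨fun h => h.1.1, fun h => ⟨⟨h, fun b _ _ => h1 b⟩, h2, h3⟩⟩

lemma mem_edge_iff (hω : IsPrimitiveRoot ω T) (hp : IsPlacement A A₀ A' place tw)
    (hA : ∀ b, A b ≠ 0) (t : ChainTerm T N k) (p : Fin m → ℂ) :
    p ∈ t.edge ω z A A₀ A' ↔ ∃ s ∈ t.locus ω z, p = placePoint ω z place tw s := by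
  constructor
  · intro h
    obtain ⟨s, rfl⟩ := hp.eq_placePoint hω hA (edge_le hω t h)
    exact ⟨s, (placePoint_mem_edge hω hp hA t s).1 h, rfl⟩
  · rintro ⟨s, hs, rfl⟩
    exact (placePoint_mem_edge hω hp hA t s).2 hs

end ChainTerm

end TermEdges

/-! ### Distinct terms have distinct edges -/

section Generic

variable {T m N k : ℕ} [NeZero T] {ω : ℂˣ} {z : Fin N → ℂ}

attribute [local instance] LieRing.ofAssociativeRing

lemma norm_cycPow (hω : IsPrimitiveRoot ω T) (c : ZMod T) : ‖(cycPow ω c : ℂ)‖ = 1 := by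
  have h : (cycPow ω c : ℂ) ^ T = 1 := by
    rw [cycPow, Units.val_pow_eq_pow_val, ← pow_mul, mul_comm, pow_mul, ← Units.val_pow_eq_pow_val,
      hω.pow_eq_one, Units.val_one, one_pow]
  exact Complex.norm_eq_one_of_pow_eq_one h (NeZero.ne T)

lemma cycPow_injective (hω : IsPrimitiveRoot ω T) : Function.Injective (cycPow (T := T) ω) :=
  fun a b h => ZMod.val_injective T (hω.pow_inj (ZMod.val_lt a) (ZMod.val_lt b) h)

/-- A bound that exceeds the norms of the `z_j`. -/
def siteBound (z : Fin N → ℂ) : ℝ := 2 + ∑ j, ‖z j‖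

lemma norm_lt_siteBound (j : Fin N) : ‖z j‖ < siteBound z := by
  have := Finset.single_le_sum (f := fun j => ‖z j‖) (fun _ _ => norm_nonneg _) (Finset.mem_univ j)
  simp only [siteBound]
  linarith

lemma one_lt_siteBound : 1 < siteBound z := by
  have : 0 ≤ ∑ j, ‖z j‖ := Finset.sum_nonneg fun _ _ => norm_nonneg _
  simp only [siteBound]
  linarith

/-- A generic point. -/
def genericPoint (z : Fin N → ℂ) (b : Fin k) : ℂ := ((siteBound z ^ ((b : ℕ) + 1) : ℝ) : ℂ)

lemma norm_genericPoint (b : Fin k) : ‖genericPoint z b‖ = siteBound z ^ ((b : ℕ) + 1) := by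
  rw [genericPoint, Complex.norm_real, Real.norm_eq_abs, abs_of_pos]
  exact pow_pos (zero_lt_one.trans one_lt_siteBound) _

lemma norm_genericPoint_injective {b b' : Fin k} (h : ‖genericPoint z b‖ = ‖genericPoint z b'‖) :
    b = b' := by
  rw [norm_genericPoint, norm_genericPoint] at h
  have := pow_right_injective₀ (zero_lt_one.trans one_lt_siteBound) one_lt_siteBound.ne' h
  exact Fin.ext (by omega)

lemma norm_site_lt_genericPoint (j : Fin N) (b : Fin k) : ‖z j‖ < ‖genericPoint z b‖ := by
  rw [norm_genericPoint]
  refine (norm_lt_siteBound j).trans_le ?_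
  exact le_self_pow₀ one_lt_siteBound.le (by omega)

lemma genericPoint_norm_pos (b : Fin k) : 0 < ‖genericPoint z b‖ := by
  rw [norm_genericPoint]
  exact pow_pos (zero_lt_one.trans one_lt_siteBound) _

namespace ChainTerm

lemma norm_of_mem_locus (hω : IsPrimitiveRoot ω T) {t : ChainTerm T N k} {s : Fin (k + 1) → ℂ}
    (h : s ∈ t.locus ω z) : match t with
      | Sum.inl b => ‖s b‖ = 0
      | Sum.inr (Sum.inl p) => ‖s p.1‖ = ‖z p.2.1‖
      | Sum.inr (Sum.inr p) => ‖s p.1.1.2.succ‖ = ‖s p.1.1.1.castSucc‖ := by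
  rcases t with b | p | p
  · exact norm_eq_zero.2 h
  · have := congrArg norm (show (cycPow ω p.2.2 : ℂ) * s p.1 = z p.2.1 from h)
    rwa [norm_mul, norm_cycPow hω, one_mul] at this
  · have := congrArg norm
      (show (cycPow ω p.2 : ℂ) * s p.1.1.2.succ = s p.1.1.1.castSucc from h)
    rwa [norm_mul, norm_cycPow hω, one_mul] at this

lemma castSucc_lt_succ (p : {p : Fin k × Fin k // p.1 ≤ p.2}) : p.1.1.castSucc < p.1.2.succ :=
  Fin.castSucc_lt_succ_iff.2 p.2

lemma exists_generic (hω : IsPrimitiveRoot ω T) (hz0 : ∀ j, z j ≠ 0)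
    (hz : ∀ i j, i ≠ j → ∀ n : ℕ, z i ≠ (ω : ℂ) ^ n * z j) (t : ChainTerm T N k) :
    ∃ s ∈ t.locus ω z, ∀ t' : ChainTerm T N k, s ∈ t'.locus ω z → t' = t := by
  have hpos := fun b : Fin (k + 1) => (genericPoint_norm_pos (z := z) b).ne'
  have hsite := fun (j : Fin N) (b : Fin (k + 1)) => (norm_site_lt_genericPoint (z := z) j b).ne'
  have hz0' : ∀ j, ‖z j‖ ≠ 0 := fun j => norm_ne_zero_iff.2 (hz0 j)
  rcases t with b | ⟨b, j, c⟩ | ⟨p, c⟩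
  · set s : Fin (k + 1) → ℂ := Function.update (genericPoint z) b 0 with hs
    have hb : ‖s b‖ = 0 := by simp [hs]
    have hb' : ∀ b', b' ≠ b → ‖s b'‖ = ‖genericPoint z b'‖ := fun b' h => by
      rw [hs, Function.update_of_ne h]
    refine ⟨s, by simp [locus, hs], fun t' ht' => ?_⟩
    have hn := norm_of_mem_locus hω ht'
    rcases t' with b' | ⟨b', j, c⟩ | ⟨p, c⟩ <;> simp only at hn
    · by_cases h : b' = b
      · rw [h]
      · exact (hpos b' ((hb' b' h).symm.trans hn)).elim
    · by_cases h : b' = b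
      · subst h; exact (hz0' j (hn.symm.trans hb)).elim
      · exact (hsite j b' ((hb' b' h).symm.trans hn)).elim
    · have hlt := castSucc_lt_succ p
      by_cases h1 : p.1.2.succ = b
      · rw [h1, hb, hb' _ (h1 ▸ hlt.ne)] at hn
        exact (hpos _ hn.symm).elim
      · by_cases h2 : p.1.1.castSucc = b
        · rw [h2, hb, hb' _ h1] at hn
          exact (hpos _ hn).elim
        · rw [hb' _ h1, hb' _ h2] at hn
          exact (hlt.ne' (norm_genericPoint_injective hn)).elim
  · set s : Fin (k + 1) → ℂ :=
      Function.update (genericPoint z) b ((cycPow ω c : ℂ)⁻¹ * z j) with hs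
    have hsb : s b = (cycPow ω c : ℂ)⁻¹ * z j := by simp [hs]
    have hb : ‖s b‖ = ‖z j‖ := by rw [hsb, norm_mul, norm_inv, norm_cycPow hω, inv_one, one_mul]
    have hb' : ∀ b', b' ≠ b → ‖s b'‖ = ‖genericPoint z b'‖ := fun b' h => by
      rw [hs, Function.update_of_ne h]
    have hne := (cycPow ω c).ne_zero
    refine ⟨s, by simp [locus, hsb, hne], fun t' ht' => ?_⟩
    have hn := norm_of_mem_locus hω ht'
    rcases t' with b' | ⟨b', j', c'⟩ | ⟨p, c⟩ <;> simp only at hn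
    · by_cases h : b' = b
      · subst h; exact (hz0' j (hb.symm.trans hn)).elim
      · exact (hpos b' ((hb' b' h).symm.trans hn)).elim
    · by_cases h : b' = b
      · subst h
        have e : (cycPow ω c' : ℂ) * s b' = z j' := ht'
        rw [hsb] at e
        have hj : j' = j := by
          by_contra hj
          refine hz j' j hj (c' - c).val ?_
          have := cycPow_sub hω c' c
          rw [cycPow] at this
          rw [← Units.val_pow_eq_pow_val, this, ← e]
          simp [mul_assoc]
        subst hj
        have : (cycPow ω c' : ℂ) = cycPow ω c := by
          rw [← mul_assoc] at e
          have := mul_right_cancel₀ (hz0 j') (e.trans (one_mul _).symm)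
          exact (mul_inv_eq_one₀ hne).1 this
        rw [cycPow_injective hω (Units.ext this)]
      · exact (hsite j' b' ((hb' b' h).symm.trans hn)).elim
    · have hlt := castSucc_lt_succ p
      by_cases h1 : p.1.2.succ = b
      · rw [h1, hb, hb' _ (h1 ▸ hlt.ne)] at hn
        exact (hsite _ _ hn.symm).elim
      · by_cases h2 : p.1.1.castSucc = b
        · rw [h2, hb, hb' _ h1] at hn
          exact (hsite _ _ hn).elim
        · rw [hb' _ h1, hb' _ h2] at hn
          exact (hlt.ne' (norm_genericPoint_injective hn)).elim
  · have hlt := castSucc_lt_succ p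
    set s : Fin (k + 1) → ℂ := Function.update (genericPoint z) p.1.1.castSucc
      ((cycPow ω c : ℂ) * genericPoint z p.1.2.succ) with hs
    have hsb : s p.1.1.castSucc = (cycPow ω c : ℂ) * genericPoint z p.1.2.succ := by simp [hs]
    have hsb' : s p.1.2.succ = genericPoint z p.1.2.succ := by
      rw [hs, Function.update_of_ne hlt.ne']
    have hb : ‖s p.1.1.castSucc‖ = ‖genericPoint z p.1.2.succ‖ := by
      rw [hsb, norm_mul, norm_cycPow hω, one_mul]
    have hb' : ∀ b', b' ≠ p.1.1.castSucc → ‖s b'‖ = ‖genericPoint z b'‖ := fun b' h => by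
      rw [hs, Function.update_of_ne h]
    have hex : ∀ b, ∃ b', ‖s b‖ = ‖genericPoint z b'‖ := fun b => by
      by_cases h : b = p.1.1.castSucc
      · exact ⟨_, h ▸ hb⟩
      · exact ⟨b, hb' b h⟩
    refine ⟨s, by simp [locus, hsb, hsb'], fun t' ht' => ?_⟩
    have hn := norm_of_mem_locus hω ht'
    rcases t' with b | ⟨b, j', c'⟩ | ⟨p', c'⟩ <;> simp only at hn
    · obtain ⟨b', h⟩ := hex b
      exact (hpos b' (h.symm.trans hn)).elim
    · obtain ⟨b', h⟩ := hex b
      exact (hsite _ b' (h.symm.trans hn)).elim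
    · have hlt' := castSucc_lt_succ p'
      have key : p'.1.1.castSucc = p.1.1.castSucc ∧ p'.1.2.succ = p.1.2.succ := by
        by_cases h1 : p'.1.2.succ = p.1.1.castSucc
        · have h2 : p'.1.1.castSucc ≠ p.1.1.castSucc := h1 ▸ hlt'.ne
          rw [h1, hb, hb' _ h2] at hn
          have := norm_genericPoint_injective hn
          rw [← h1, this] at hlt
          exact (lt_asymm hlt hlt').elim
        · by_cases h2 : p'.1.1.castSucc = p.1.1.castSucc
          · rw [h2, hb, hb' _ h1] at hn
            exact ⟨h2, norm_genericPoint_injective hn⟩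
          · rw [hb' _ h1, hb' _ h2] at hn
            exact (hlt'.ne' (norm_genericPoint_injective hn)).elim
      have hpp : p' = p := Subtype.ext (Prod.ext (Fin.castSucc_injective _ key.1)
        (Fin.succ_injective _ key.2))
      subst hpp
      have e : (cycPow ω c' : ℂ) * s p'.1.2.succ = s p'.1.1.castSucc := ht'
      rw [hsb, hsb'] at e
      have h0 : genericPoint z p'.1.2.succ ≠ 0 := norm_ne_zero_iff.1 (hpos _)
      rw [cycPow_injective hω (Units.ext (mul_right_cancel₀ h0 e))]

variable {A : Fin (k + 1) → Multiset (ZMod T × Fin m)} {A₀ : Multiset (ZMod T × Fin m)}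
  {A' : Fin N → Multiset (ZMod T × Fin m)} {place : Fin m → Fin (k + 1) ⊕ Option (Fin N)}
  {tw : Fin m → ZMod T}

lemma eq_of_edge_le (hω : IsPrimitiveRoot ω T) (hz0 : ∀ j, z j ≠ 0)
    (hz : ∀ i j, i ≠ j → ∀ n : ℕ, z i ≠ (ω : ℂ) ^ n * z j)
    (hp : IsPlacement A A₀ A' place tw) (hA : ∀ b, A b ≠ 0) {t t' : ChainTerm T N k}
    (h : t.edge ω z A A₀ A' ≤ t'.edge ω z A A₀ A') : t' = t := by
  obtain ⟨s, hs, hs'⟩ := exists_generic hω hz0 hz t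
  refine hs' t' ((placePoint_mem_edge hω hp hA t' s).1 (h ?_))
  exact (placePoint_mem_edge hω hp hA t s).2 hs

lemma exists_lt_eq {b b' : Fin (k + 1)} (h : b < b') :
    ∃ p : {p : Fin k × Fin k // p.1 ≤ p.2}, p.1.1.castSucc = b ∧ p.1.2.succ = b' := by
  obtain ⟨i, rfl⟩ := Fin.exists_castSucc_eq.2 (h.trans_le (Fin.le_last _)).ne
  obtain ⟨j, rfl⟩ := Fin.exists_succ_eq.2 ((Fin.zero_le _).trans_lt h).ne'
  exact ⟨⟨(i, j), Fin.castSucc_lt_succ_iff.1 h⟩, rfl, rfl⟩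

lemma exists_locus_eq (hω : IsPrimitiveRoot ω T) (o o' : Fin (k + 1) ⊕ Option (Fin N))
    (a : ZMod T) {s₀ s₁ : Fin (k + 1) → ℂ}
    (h₀ : placeVal z s₀ o = (cycPow ω a : ℂ) * placeVal z s₀ o')
    (h₁ : placeVal z s₁ o ≠ (cycPow ω a : ℂ) * placeVal z s₁ o') :
    ∃ t : ChainTerm T N k, ∀ s, placeVal z s o = (cycPow ω a : ℂ) * placeVal z s o' ↔
      s ∈ t.locus ω z := by
  have hne : (cycPow ω a : ℂ) ≠ 0 := (cycPow ω a).ne_zero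
  rcases o with b | _ | j <;> rcases o' with b' | _ | j'
  · rcases lt_trichotomy b b' with h | rfl | h
    · obtain ⟨p, rfl, rfl⟩ := exists_lt_eq h
      exact ⟨Sum.inr (Sum.inr (p, a)), fun s => eq_comm⟩
    · refine ⟨Sum.inl b, fun s => ⟨fun h => ?_, fun h => ?_⟩⟩
      · by_contra hs
        apply h₁
        change s b = (cycPow ω a : ℂ) * s b at h
        have : (cycPow ω a : ℂ) = 1 := (mul_right_cancel₀ hs ((one_mul _).trans h)).symm
        rw [this, one_mul]
      · change s b = (cycPow ω a : ℂ) * s b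
        rw [show s b = 0 from h, mul_zero]
    · obtain ⟨p, rfl, rfl⟩ := exists_lt_eq h
      refine ⟨Sum.inr (Sum.inr (p, -a)), fun s => ?_⟩
      change s _ = (cycPow ω a : ℂ) * s _ ↔ (cycPow ω (-a) : ℂ) * s _ = s _
      rw [cycPow_neg hω, inv_mul_eq_iff_eq_mul₀ hne]
  · refine ⟨Sum.inl b, fun s => ?_⟩
    change s b = (cycPow ω a : ℂ) * 0 ↔ s b = 0
    rw [mul_zero]
  · refine ⟨Sum.inr (Sum.inl (b, j', -a)), fun s => ?_⟩
    change s b = (cycPow ω a : ℂ) * z j' ↔ (cycPow ω (-a) : ℂ) * s b = z j'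
    rw [cycPow_neg hω, inv_mul_eq_iff_eq_mul₀ hne]
  · refine ⟨Sum.inl b', fun s => ?_⟩
    change 0 = (cycPow ω a : ℂ) * s b' ↔ s b' = 0
    rw [eq_comm, mul_eq_zero, or_iff_right hne]
  · exact (h₁ h₀).elim
  · exact (h₁ h₀).elim
  · exact ⟨Sum.inr (Sum.inl (b', j, a)), fun s => eq_comm⟩
  · exact (h₁ h₀).elim
  · exact (h₁ h₀).elim

lemma exists_placeVal_eq (hω : IsPrimitiveRoot ω T) {H : AffineSubspace ℂ (Fin m → ℂ)}
    (hH : H ∈ cycArrangement T m ω z) (place : Fin m → Fin (k + 1) ⊕ Option (Fin N))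
    (tw : Fin m → ZMod T) : ∃ (o o' : Fin (k + 1) ⊕ Option (Fin N)) (a : ZMod T), ∀ s,
      placePoint ω z place tw s ∈ H ↔ placeVal z s o = (cycPow ω a : ℂ) * placeVal z s o' := by
  rcases hH with ⟨i, j, c, -, rfl⟩ | ⟨i, j, c, rfl⟩ | ⟨i, rfl⟩
  · refine ⟨place i, place j, c + tw i - tw j, fun s => ?_⟩
    rw [mem_hyperplaneTT, placePoint, placePoint, cycPow_sub hω, cycPow_add hω]
    have h1 := (cycPow ω (tw i)).ne_zero
    have h2 := (cycPow ω (tw j)).ne_zero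
    simp only [Units.val_mul, Units.val_inv_eq_inv_val]
    field_simp
  · refine ⟨place i, Sum.inr (some j), c + tw i, fun s => ?_⟩
    rw [mem_hyperplaneTZ, placePoint, cycPow_add hω]
    have h1 := (cycPow ω (tw i)).ne_zero
    simp only [Units.val_mul, placeVal, Sum.elim_inr, Option.elim_some]
    field_simp
  · refine ⟨place i, Sum.inr none, 0, fun s => ?_⟩
    rw [mem_hyperplaneT0, placePoint]
    simp [placeVal]

lemma exists_edge_eq_inf (hω : IsPrimitiveRoot ω T)
    (hp : IsPlacement A A₀ A' place tw) (hA : ∀ b, A b ≠ 0)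
    {H : AffineSubspace ℂ (Fin m → ℂ)} (hH : H ∈ cycArrangement T m ω z)
    (hne : chainEdge ω z A A₀ A' ⊓ H ≠ ⊥) (hle : ¬ chainEdge ω z A A₀ A' ≤ H) :
    ∃ t : ChainTerm T N k, t.edge ω z A A₀ A' = chainEdge ω z A A₀ A' ⊓ H := by
  suffices h : ∃ t : ChainTerm T N k, ∀ s, placePoint ω z place tw s ∈ H ↔ s ∈ t.locus ω z by
    obtain ⟨t, ht⟩ := h
    refine ⟨t, ?_⟩
    ext p
    rw [mem_edge_iff hω hp hA, AffineSubspace.mem_inf_iff]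
    constructor
    · rintro ⟨s, hs, rfl⟩
      exact ⟨hp.placePoint_mem hω s, (ht s).2 hs⟩
    · rintro ⟨h1, h2⟩
      obtain ⟨s, rfl⟩ := hp.eq_placePoint hω hA h1
      exact ⟨s, (ht s).1 h2, rfl⟩
  obtain ⟨o, o', a, h⟩ := exists_placeVal_eq hω hH place tw
  obtain ⟨p, hp1, hp2⟩ := (AffineSubspace.nonempty_iff_ne_bot _).2 hne
  obtain ⟨s₀, rfl⟩ := hp.eq_placePoint hω hA hp1
  obtain ⟨p', hp1', hp2'⟩ := SetLike.not_le_iff_exists.1 hle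
  obtain ⟨s₁, rfl⟩ := hp.eq_placePoint hω hA hp1'
  obtain ⟨t, ht⟩ := exists_locus_eq hω o o' a ((h s₀).1 hp2) (mt (h s₁).2 hp2')
  exact ⟨t, fun s => (h s).trans (ht s)⟩

end ChainTerm

variable {A : Fin (k + 1) → Multiset (ZMod T × Fin m)} {A₀ : Multiset (ZMod T × Fin m)}
  {A' : Fin N → Multiset (ZMod T × Fin m)}
  {g : Fin (k + 1) → FreeLieAlgebra ℂ (ZMod T × Fin m)}
  {u : UniversalEnvelopingAlgebra ℂ (fixedSubalgebra (cycShift T m))}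
  {v : Fin N → UniversalEnvelopingAlgebra ℂ (FreeLieAlgebra ℂ (ZMod T × Fin m))}

lemma IsConfig.edgeProj_chainD_edge (hω : IsPrimitiveRoot ω T) (hz0 : ∀ j, z j ≠ 0)
    (hz : ∀ i j, i ≠ j → ∀ n : ℕ, z i ≠ (ω : ℂ) ^ n * z j) (h : IsConfig A A₀ A' g u v)
    (t : ChainTerm T N k) : edgeProj ω z k (t.edge ω z A A₀ A')
      (chainD (cycShift T m) N k (monomial g u v)) = (-1 : ℂ) ^ t.parity • t.chain g u v := by
  classical
  obtain ⟨place, tw, hp⟩ := h.multilinear.exists_placement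
  rw [chainD_monomial, map_sum, Finset.sum_eq_single t]
  · rw [map_smul, ChainTerm.chain, (h.term t).isMonomialChain.edgeProj_apply, ← ChainTerm.edge,
      if_pos rfl]
  · intro t' _ hne
    rw [map_smul, ChainTerm.chain, (h.term t').isMonomialChain.edgeProj_apply, ← ChainTerm.edge,
      if_neg, smul_zero]
    exact fun he => hne (ChainTerm.eq_of_edge_le hω hz0 hz hp h.ne_zero (le_of_eq he.symm))
  · simp

lemma IsConfig.edgeProj_chainD_of_ne (h : IsConfig A A₀ A' g u v)
    {L : AffineSubspace ℂ (Fin m → ℂ)}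
    (hL : ∀ t : ChainTerm T N k, t.edge ω z A A₀ A' ≠ L) : edgeProj ω z k L
      (chainD (cycShift T m) N k (monomial g u v)) = 0 := by
  classical
  rw [chainD_monomial, map_sum, Finset.sum_eq_zero]
  intro t _
  rw [map_smul, ChainTerm.chain, (h.term t).isMonomialChain.edgeProj_apply, ← ChainTerm.edge,
    if_neg (hL t), smul_zero]

end Generic

/-! ### Flags -/

section Flags

variable {m k : ℕ} {𝒞 : Set (AffineSubspace ℂ (Fin m → ℂ))}

lemma eq_of_le_of_finrank_le {L L' : AffineSubspace ℂ (Fin m → ℂ)} (hL : L ≠ ⊥) (h : L ≤ L')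
    (hr : Module.finrank ℂ L'.direction ≤ Module.finrank ℂ L.direction) : L = L' :=
  AffineSubspace.eq_of_direction_eq_of_nonempty_of_le
    (Submodule.eq_of_le_of_finrank_le (AffineSubspace.direction_le h) hr)
    ((AffineSubspace.nonempty_iff_ne_bot _).2 hL) h

lemma eq_inf_of_finrank {L L₀ H : AffineSubspace ℂ (Fin m → ℂ)} (hL : L ≠ ⊥) (h0 : L ≤ L₀)
    (hH : L ≤ H) (hn : ¬ L₀ ≤ H)
    (hr : Module.finrank ℂ L.direction + 1 = Module.finrank ℂ L₀.direction) : L = L₀ ⊓ H := by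
  refine eq_of_le_of_finrank_le hL (le_inf h0 hH) ?_
  by_contra hlt
  refine hn ?_
  have h1 : L₀ ⊓ H ≠ ⊥ := fun h => hL (le_bot_iff.1 (h ▸ le_inf h0 hH))
  have := eq_of_le_of_finrank_le h1 inf_le_left (by omega)
  rw [← this]
  exact inf_le_right

namespace Flag

@[ext]
lemma ext_init_last {F G : Flag 𝒞 (k + 1)} (h : F.init = G.init) (h' : F.last = G.last) :
    F = G := by
  refine Flag.ext (funext fun j => ?_)
  refine Fin.lastCases h' (fun j => ?_) j
  exact congrFun (congrArg Flag.edge h) j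

lemma last_ne_bot (F : Flag 𝒞 k) : F.last ≠ ⊥ := (F.isEdge _).1

lemma last_le_init_last (F : Flag 𝒞 (k + 1)) : F.last ≤ F.init.last :=
  F.anti (Fin.le_last _)

lemma finrank_last (F : Flag 𝒞 k) : Module.finrank ℂ F.last.direction + k = m :=
  F.codim (Fin.last k)

/-- Extend a flag by one more edge. -/
def snoc (F : Flag 𝒞 k) (L : AffineSubspace ℂ (Fin m → ℂ)) (hL : IsEdge 𝒞 L)
    (hr : Module.finrank ℂ L.direction + (k + 1) = m) (hle : L ≤ F.last) : Flag 𝒞 (k + 1) where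
  edge := Fin.snoc (α := fun _ => AffineSubspace ℂ (Fin m → ℂ)) F.edge L
  isEdge j := by
    refine Fin.lastCases ?_ (fun j => ?_) j
    · rw [Fin.snoc_last]; exact hL
    · rw [Fin.snoc_castSucc]; exact F.isEdge j
  codim j := by
    refine Fin.lastCases ?_ (fun j => ?_) j
    · rw [Fin.snoc_last]; exact hr
    · rw [Fin.snoc_castSucc]; exact F.codim j
  anti i j h := by
    induction j using Fin.lastCases with
    | last =>
      rw [Fin.snoc_last]
      induction i using Fin.lastCases with
      | last => rw [Fin.snoc_last]
      | cast i => rw [Fin.snoc_castSucc]; exact hle.trans (F.anti (Fin.le_last i))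
    | cast j =>
      induction i using Fin.lastCases with
      | last => exact ((Fin.castSucc_lt_last j).not_ge h).elim
      | cast i =>
        rw [Fin.snoc_castSucc, Fin.snoc_castSucc]
        exact F.anti (Fin.castSucc_le_castSucc_iff.1 h)

@[simp]
lemma snoc_last (F : Flag 𝒞 k) (L : AffineSubspace ℂ (Fin m → ℂ)) (hL : IsEdge 𝒞 L)
    (hr : Module.finrank ℂ L.direction + (k + 1) = m) (hle : L ≤ F.last) :
    (F.snoc L hL hr hle).last = L :=
  Fin.snoc_last (α := fun _ => AffineSubspace ℂ (Fin m → ℂ)) _ _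

@[simp]
lemma snoc_init (F : Flag 𝒞 k) (L : AffineSubspace ℂ (Fin m → ℂ)) (hL : IsEdge 𝒞 L)
    (hr : Module.finrank ℂ L.direction + (k + 1) = m) (hle : L ≤ F.last) :
    (F.snoc L hL hr hle).init = F :=
  Flag.ext (funext fun j => Fin.snoc_castSucc (α := fun _ => AffineSubspace ℂ (Fin m → ℂ)) _ _ j)

lemma exists_hyperplane (F : Flag 𝒞 (k + 1)) : ∃ H ∈ 𝒞, F.last ≤ H ∧ ¬ F.init.last ≤ H := by
  obtain ⟨-, S, hS, hF⟩ := F.isEdge (Fin.last _)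
  change F.last = sInf S at hF
  by_contra hcon
  push Not at hcon
  have h1 : F.init.last ≤ F.last := by
    rw [hF]
    exact le_sInf fun H hH => hcon H (hS hH) (hF ▸ sInf_le hH)
  have h2 := F.finrank_last
  have h3 := F.init.finrank_last
  rw [le_antisymm h1 F.last_le_init_last] at h3
  omega

lemma last_eq_inf (F : Flag 𝒞 (k + 1)) {H : AffineSubspace ℂ (Fin m → ℂ)} (hH : F.last ≤ H)
    (hn : ¬ F.init.last ≤ H) : F.last = F.init.last ⊓ H := by
  refine eq_inf_of_finrank F.last_ne_bot F.last_le_init_last hH hn ?_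
  have h2 := F.finrank_last
  have h3 := F.init.finrank_last
  omega

lemma edge_zero (F : Flag 𝒞 k) : F.edge 0 = ⊤ := by
  refine eq_of_le_of_finrank_le (F.isEdge 0).1 le_top ?_
  have := F.codim 0
  rw [AffineSubspace.direction_top, finrank_top]
  simpa using this.ge

end Flag

variable [Finite 𝒞]

lemma FlagSpace.span_mk : Submodule.span ℂ (Set.range (FlagSpace.mk (𝒞 := 𝒞) (k := k))) = ⊤ := by
  rw [eq_top_iff]
  rintro x -
  obtain ⟨y, rfl⟩ := Submodule.mkQ_surjective _ x
  induction y using Finsupp.induction_linear with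
  | zero => rw [map_zero]; exact Submodule.zero_mem _
  | add f g hf hg => rw [map_add]; exact Submodule.add_mem _ hf hg
  | single F c =>
    have : (flagRelations 𝒞 k).mkQ (Finsupp.single F c) = c • FlagSpace.mk F := by
      rw [FlagSpace.mk, ← map_smul]; simp
    rw [this]
    exact Submodule.smul_mem _ _ (Submodule.subset_span ⟨F, rfl⟩)

lemma FlagSpace.hom_ext {E : Type*} [AddCommMonoid E] [Module ℂ E] {f f' : FlagSpace 𝒞 k →ₗ[ℂ] E}
    (h : ∀ F, f (FlagSpace.mk F) = f' (FlagSpace.mk F)) : f = f' := by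
  refine LinearMap.ext_on FlagSpace.span_mk ?_
  rintro _ ⟨F, rfl⟩
  exact h F

open Classical in
lemma flagDiff_mk (F : Flag 𝒞 k) :
    flagDiff 𝒞 k (FlagSpace.mk F) = ∑ G : Flag 𝒞 (k + 1) with G.init = F, FlagSpace.mk G :=
  FlagSpace.lift_mk _ _ F

lemma flagDiff_flagDiff (v : FlagSpace 𝒞 k) : flagDiff 𝒞 (k + 1) (flagDiff 𝒞 k v) = 0 := by
  classical
  suffices h : flagDiff 𝒞 (k + 1) ∘ₗ flagDiff 𝒞 k = 0 from LinearMap.congr_fun h v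
  refine FlagSpace.hom_ext fun F => ?_
  rw [LinearMap.comp_apply, LinearMap.zero_apply, flagDiff_mk, map_sum]
  simp only [flagDiff_mk]
  rw [← Finset.sum_biUnion (by
    intro a _ b _ hab
    simp only [Function.onFun, Finset.disjoint_left, Finset.mem_filter, Finset.mem_univ, true_and]
    rintro G rfl h
    exact hab h)]
  rw [← Finset.sum_fiberwise_of_maps_to
    (t := Finset.image Flag.last (Finset.univ : Finset (Flag 𝒞 (k + 2))))
    (g := Flag.last) (by intro G _; simp)]
  refine Finset.sum_eq_zero fun E _ => ?_
  by_cases hne : ∃ G₀ : Flag 𝒞 (k + 2), G₀.init.init = F ∧ G₀.last = E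
  · obtain ⟨G₀, rfl, rfl⟩ := hne
    refine FlagSpace.sum_mk_eq_zero G₀ (Fin.last (k + 1)).castSucc (by simp) (by simp) ?_
    intro G
    simp only [Finset.mem_filter, Finset.mem_biUnion, Finset.mem_univ, true_and, exists_eq_right']
    constructor
    · rintro ⟨h1, h2⟩ j hj
      induction j using Fin.lastCases with
      | last => exact h2
      | cast j =>
        induction j using Fin.lastCases with
        | last => exact (hj rfl).elim
        | cast j => exact congrFun (congrArg Flag.edge h1) j
    · intro h
      refine ⟨Flag.ext (funext fun j => ?_), h (Fin.last _) (Fin.castSucc_lt_last _).ne'⟩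
      refine h j.castSucc.castSucc fun e => ?_
      exact (Fin.castSucc_lt_last j).ne (Fin.castSucc_injective _ e)
  · refine Finset.sum_eq_zero fun G hG => (hne ⟨G, ?_, ?_⟩).elim
    · simp only [Finset.mem_filter, Finset.mem_biUnion, Finset.mem_univ, true_and,
        exists_eq_right'] at hG
      exact hG.1
    · exact (Finset.mem_filter.1 hG).2

open Classical in
/-- The map that sends a flag to its extension by the edge `L`, or to zero if there is none. -/
def flagExt (𝒞 : Set (AffineSubspace ℂ (Fin m → ℂ))) [Finite 𝒞] (k : ℕ)
    (L : AffineSubspace ℂ (Fin m → ℂ)) : FlagSpace 𝒞 k →ₗ[ℂ] FlagSpace 𝒞 (k + 1) :=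
  FlagSpace.lift (fun F => ∑ G : Flag 𝒞 (k + 1) with G.init = F ∧ G.last = L, FlagSpace.mk G) <| by
    intro F i h0 hk s hs
    rw [← Finset.sum_biUnion (by
      intro a _ b _ hab
      simp only [Function.onFun, Finset.disjoint_left, Finset.mem_filter, Finset.mem_univ, true_and]
      rintro G ⟨rfl, -⟩ h
      exact hab h.1)]
    by_cases hne : ∃ G₀ : Flag 𝒞 (k + 1), G₀.init ∈ s ∧ G₀.last = L
    · obtain ⟨G₀, hG₀, rfl⟩ := hne
      refine FlagSpace.sum_mk_eq_zero G₀ i.castSucc (by simpa using h0)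
        (by simpa using hk.trans (Nat.lt_succ_self k)) ?_
      intro G
      simp only [Finset.mem_filter, Finset.mem_biUnion, Finset.mem_univ, true_and]
      rw [hs] at hG₀
      constructor
      · rintro ⟨F', hF', rfl, h2⟩ j hj
        rw [hs] at hF'
        induction j using Fin.lastCases with
        | last => exact h2
        | cast j =>
          have hj' : j ≠ i := fun h => hj (by rw [h])
          exact (hF' j hj').trans (hG₀ j hj').symm
      · intro h
        refine ⟨G.init, (hs _).2 fun j hj => ?_, rfl, h (Fin.last _) (Fin.castSucc_lt_last _).ne'⟩
        exact (h j.castSucc (fun e => hj (Fin.castSucc_injective _ e))).trans (hG₀ j hj)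
    · refine Finset.sum_eq_zero fun G hG => (hne ⟨G, ?_, ?_⟩).elim <;>
        simp only [Finset.mem_filter, Finset.mem_biUnion, Finset.mem_univ, true_and] at hG
      · obtain ⟨F', hF', rfl, -⟩ := hG
        exact hF'
      · obtain ⟨F', -, -, h⟩ := hG
        exact h

lemma flagExt_mk_init (G : Flag 𝒞 (k + 1)) :
    flagExt 𝒞 k G.last (FlagSpace.mk G.init) = FlagSpace.mk G := by
  classical
  refine (FlagSpace.lift_mk _ _ _).trans ?_
  rw [Finset.sum_eq_single G]
  · intro G' hG' hne
    have := (Finset.mem_filter.1 hG').2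
    exact (hne (Flag.ext_init_last this.1 this.2)).elim
  · simp

lemma mk_mem_span_not_le (G : Flag 𝒞 (k + 1)) {H : AffineSubspace ℂ (Fin m → ℂ)} (hH : H ≠ ⊤) :
    FlagSpace.mk G ∈ Submodule.span ℂ
      {x | ∃ G' : Flag 𝒞 (k + 1), G'.last = G.last ∧ ¬ G'.init.last ≤ H ∧ x = FlagSpace.mk G'} := by
  classical
  suffices h : ∀ (n : ℕ) (i : Fin (k + 1)) (_ : (i : ℕ) + n = k) (G' : Flag 𝒞 (k + 1)),
      G'.last = G.last → ¬ G'.edge i.castSucc ≤ H → FlagSpace.mk G' ∈ Submodule.span ℂ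
        {x | ∃ G' : Flag 𝒞 (k + 1), G'.last = G.last ∧ ¬ G'.init.last ≤ H ∧
          x = FlagSpace.mk G'} by
    refine h k 0 (by simp) G rfl fun h0 => hH (top_le_iff.1 ?_)
    rw [← G.edge_zero]
    exact h0
  intro n
  induction n with
  | zero =>
    intro i hi G' hG' hn
    have : i = Fin.last k := Fin.ext (by simpa using hi)
    subst this
    exact Submodule.subset_span ⟨G', hG', hn, rfl⟩
  | succ n ih =>
    intro i hi G' hG' hn
    obtain ⟨j, hj⟩ : ∃ j : Fin (k + 1), (j : ℕ) = i + 1 := ⟨⟨i + 1, by omega⟩, rfl⟩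
    by_cases hj' : G'.edge j.castSucc ≤ H
    · set s : Finset (Flag 𝒞 (k + 1)) :=
        Finset.univ.filter fun K => ∀ l, l ≠ j.castSucc → K.edge l = G'.edge l with hs
      have hsum : ∑ K ∈ s, FlagSpace.mk K = 0 :=
        FlagSpace.sum_mk_eq_zero G' j.castSucc (by simp [hj]) (by simp [hj]; omega)
          (fun K => by simp [hs])
      rw [← Finset.add_sum_erase s _ (show G' ∈ s by simp [hs])] at hsum
      rw [eq_neg_of_add_eq_zero_left hsum]
      refine Submodule.neg_mem _ (Submodule.sum_mem _ fun K hK => ?_)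
      obtain ⟨hne, hK⟩ := Finset.mem_erase.1 hK
      have hK' : ∀ l, l ≠ j.castSucc → K.edge l = G'.edge l := by simpa [hs] using hK
      refine ih j (by omega) K ?_ fun hKH => hne ?_
      · rw [← hG']
        exact hK' _ (Fin.castSucc_lt_last j).ne'
      · have hij : i.castSucc ≤ j.castSucc := by
          rw [Fin.le_def]; simp [hj]
        have hij' : i.castSucc ≠ j.castSucc := by
          rw [Ne, Fin.ext_iff]; simp [hj]
        have key : ∀ K : Flag 𝒞 (k + 1), K.edge i.castSucc = G'.edge i.castSucc →
            K.edge j.castSucc ≤ H → K.edge j.castSucc = G'.edge i.castSucc ⊓ H := by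
          intro K h1 h2
          refine eq_inf_of_finrank (K.isEdge _).1 (h1 ▸ K.anti hij) h2 hn ?_
          have e1 := K.codim j.castSucc
          have e2 := G'.codim i.castSucc
          simp only [Fin.val_castSucc, hj] at e1 e2
          omega
        refine Flag.ext (funext fun l => ?_)
        rcases eq_or_ne l j.castSucc with rfl | hl
        · rw [key K (hK' _ hij') hKH, key G' rfl hj']
        · exact hK' l hl
    · exact ih j (by omega) G' hG' hj'

end Flags

/-! ### The chain of a flag -/

section FlagChain

variable {T m N : ℕ} [NeZero T] {ω : ℂˣ} {z : Fin N → ℂ}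

attribute [local instance] LieRing.ofAssociativeRing

omit [NeZero T] in
lemma Flag.exists_snoc {q : ℕ} (F : Flag (cycArrangement T m ω z) q)
    {L : AffineSubspace ℂ (Fin m → ℂ)} (hL : IsEdge (cycArrangement T m ω z) L)
    (hc : Module.finrank ℂ L.direction + (q + 1) = m) (hle : L ≤ F.last) :
    ∃ G : Flag (cycArrangement T m ω z) (q + 1), G.init = F ∧ G.last = L :=
  ⟨F.snoc L hL hc hle, Flag.snoc_init _ _ _ _ _, Flag.snoc_last _ _ _ _ _⟩

/-- The chain `f̄_1 ∧ ⋯ ∧ f̄_m ⊗ 1 ⊗ ⋯ ⊗ 1`. -/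
def baseChain (N : ℕ) {p : ℕ} (h : p = m) : ChainSpace (cycShift T m) N p :=
  exteriorPower.ιMulti ℂ p (fun i => orbitSum (gen T (Fin.cast h i))) ⊗ₜ
    (1 ⊗ₜ PiTensorProduct.tprod ℂ fun _ => 1)

lemma baseChain_eq (N : ℕ) {p : ℕ} (h : p = m) : baseChain (T := T) N h =
    monomial (fun i => gen T (Fin.cast h i.rev)) 1 fun _ => 1 := by
  simp [baseChain, monomial, wedgeRev, Function.comp_def]

omit [NeZero T] in
lemma isConfig_base (N : ℕ) {p : ℕ} (h : p = m) :
    IsConfig (T := T) (N := N) (fun i : Fin p => {(0, Fin.cast h i.rev)}) 0 (fun _ => 0)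
      (fun i => gen T (Fin.cast h i.rev)) 1 fun _ => 1 := by
  refine ⟨⟨fun b => IsCommutator.of _, EnvMonomial.one, fun _ => EnvMonomial.one⟩, ?_⟩
  subst h
  rw [IsMultilinear, totalContent, Finset.sum_const_zero, add_zero, add_zero, map_sum_multiset]
  simp only [Multiset.map_singleton, Fin.cast_eq_self]
  rw [← Finset.sum_multiset_singleton]
  exact Equiv.sum_comp Fin.revPerm fun i => ({i} : Multiset (Fin p))

/-- The chain `x` is, up to sign, a multilinear monomial with the edge `L`. -/
def IsSignedMonomial (ω : ℂˣ) (z : Fin N → ℂ) {k : ℕ} (L : AffineSubspace ℂ (Fin m → ℂ))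
    (x : ChainSpace (cycShift T m) N k) : Prop :=
  ∃ (n : ℕ) (A : Fin k → Multiset (ZMod T × Fin m)) (A₀ : Multiset (ZMod T × Fin m))
    (A' : Fin N → Multiset (ZMod T × Fin m)) (g : Fin k → FreeLieAlgebra ℂ (ZMod T × Fin m))
    (u : UniversalEnvelopingAlgebra ℂ (fixedSubalgebra (cycShift T m)))
    (v : Fin N → UniversalEnvelopingAlgebra ℂ (FreeLieAlgebra ℂ (ZMod T × Fin m))),
    IsConfig A A₀ A' g u v ∧ chainEdge ω z A A₀ A' = L ∧ x = (-1 : ℂ) ^ n • monomial g u v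

open Classical in
lemma IsSignedMonomial.edgeProj_apply {k : ℕ} {L : AffineSubspace ℂ (Fin m → ℂ)}
    {x : ChainSpace (cycShift T m) N k} (h : IsSignedMonomial ω z L x)
    (L' : AffineSubspace ℂ (Fin m → ℂ)) : edgeProj ω z k L' x = if L = L' then x else 0 := by
  obtain ⟨n, A, A₀, A', g, u, v, h, rfl, rfl⟩ := h
  rw [map_smul, h.isMonomialChain.edgeProj_apply]
  split_ifs
  · rfl
  · rw [smul_zero]

lemma IsSignedMonomial.isEdge (hω : IsPrimitiveRoot ω T) {k : ℕ}
    {L : AffineSubspace ℂ (Fin m → ℂ)} {x : ChainSpace (cycShift T m) N k}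
    (h : IsSignedMonomial ω z L x) : IsEdge (cycArrangement T m ω z) L := by
  obtain ⟨n, A, A₀, A', g, u, v, h, rfl, rfl⟩ := h
  obtain ⟨place, tw, hp⟩ := h.multilinear.exists_placement
  exact hp.isEdge hω h.ne_zero

lemma IsSignedMonomial.finrank (hω : IsPrimitiveRoot ω T) {k : ℕ}
    {L : AffineSubspace ℂ (Fin m → ℂ)} {x : ChainSpace (cycShift T m) N k}
    (h : IsSignedMonomial ω z L x) : Module.finrank ℂ L.direction = k := by
  obtain ⟨n, A, A₀, A', g, u, v, h, rfl, rfl⟩ := h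
  obtain ⟨place, tw, hp⟩ := h.multilinear.exists_placement
  exact hp.finrank_direction hω h.ne_zero

lemma isSignedMonomial_base (hω : IsPrimitiveRoot ω T) {p : ℕ} (h : p = m) :
    IsSignedMonomial ω z ⊤ (baseChain (T := T) N h) := by
  have hc := isConfig_base (T := T) N h
  refine ⟨0, _, _, _, _, _, _, hc, ?_, by rw [pow_zero, one_smul, baseChain_eq]⟩
  obtain ⟨place, tw, hp⟩ := hc.multilinear.exists_placement
  refine eq_of_le_of_finrank_le (hp.isEdge hω hc.ne_zero).1 le_top ?_
  rw [hp.finrank_direction hω hc.ne_zero, AffineSubspace.direction_top, finrank_top]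
  simp [h]

variable (ω z) in
/-- The chain of a flag. -/
def flagChain : (q p : ℕ) → p + q = m → Flag (cycArrangement T m ω z) q →
    ChainSpace (cycShift T m) N p
  | 0, _, h, _ => baseChain N h
  | q + 1, p, h, F => edgeProj ω z p F.last
      (chainD (cycShift T m) N p (flagChain q (p + 1) (by omega) F.init))

section

variable (hω : IsPrimitiveRoot ω T) (hz0 : ∀ j, z j ≠ 0)
  (hz : ∀ i j, i ≠ j → ∀ n : ℕ, z i ≠ (ω : ℂ) ^ n * z j)
include hω hz0 hz

lemma IsSignedMonomial.edgeProj_chainD {k : ℕ}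
    {L L' : AffineSubspace ℂ (Fin m → ℂ)} {x : ChainSpace (cycShift T m) N (k + 1)}
    (h : IsSignedMonomial ω z L x) {H : AffineSubspace ℂ (Fin m → ℂ)}
    (hH : H ∈ cycArrangement T m ω z) (hL' : L' ≠ ⊥) (hLH : L' = L ⊓ H) (hle : ¬ L ≤ H) :
    IsSignedMonomial ω z L' (edgeProj ω z k L' (chainD (cycShift T m) N k x)) := by
  obtain ⟨n, A, A₀, A', g, u, v, h, rfl, rfl⟩ := h
  obtain ⟨place, tw, hp⟩ := h.multilinear.exists_placement
  obtain ⟨t, ht⟩ := ChainTerm.exists_edge_eq_inf hω hp h.ne_zero hH (hLH ▸ hL') hle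
  refine ⟨n + t.parity, _, _, _, _, _, _, h.term t, ht.trans hLH.symm, ?_⟩
  rw [map_smul, map_smul, hLH, ← ht, h.edgeProj_chainD_edge hω hz0 hz, smul_smul, pow_add]
  rfl

lemma flagChain_isSignedMonomial : ∀ (q p : ℕ) (h : p + q = m)
    (F : Flag (cycArrangement T m ω z) q), IsSignedMonomial ω z F.last (flagChain ω z q p h F)
  | 0, p, h, F => by
    rw [show F.last = ⊤ from F.edge_zero]
    exact isSignedMonomial_base hω h
  | q + 1, p, h, F => by
    obtain ⟨H, hH, h1, h2⟩ := F.exists_hyperplane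
    exact (flagChain_isSignedMonomial q (p + 1) _ F.init).edgeProj_chainD hω hz0 hz hH
      F.last_ne_bot (F.last_eq_inf h1 h2) h2

omit hz0 hz in
lemma edgeProj_chainD_eq_zero {k : ℕ} {L L' : AffineSubspace ℂ (Fin m → ℂ)}
    {x : ChainSpace (cycShift T m) N (k + 1)} (h : IsSignedMonomial ω z L x) (hle : ¬ L' ≤ L) :
    edgeProj ω z k L' (chainD (cycShift T m) N k x) = 0 := by
  obtain ⟨n, A, A₀, A', g, u, v, h, rfl, rfl⟩ := h
  rw [map_smul, map_smul, h.edgeProj_chainD_of_ne, smul_zero]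
  rintro t rfl
  exact hle (ChainTerm.edge_le hω t)

omit hz0 hz in
lemma exists_chainD_eq_sum {k : ℕ} {L : AffineSubspace ℂ (Fin m → ℂ)}
    {x : ChainSpace (cycShift T m) N (k + 1)} (h : IsSignedMonomial ω z L x) :
    ∃ (E : ChainTerm T N k → AffineSubspace ℂ (Fin m → ℂ))
      (y : ChainTerm T N k → ChainSpace (cycShift T m) N k),
      chainD (cycShift T m) N k x = ∑ t, y t ∧ ∀ t, E t ≤ L ∧ IsSignedMonomial ω z (E t) (y t) := by
  obtain ⟨n, A, A₀, A', g, u, v, h, rfl, rfl⟩ := h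
  refine ⟨fun t => t.edge ω z A A₀ A', fun t => (-1 : ℂ) ^ (n + t.parity) • t.chain g u v, ?_,
    fun t => ⟨ChainTerm.edge_le hω t, n + t.parity, _, _, _, _, _, _, h.term t, rfl, rfl⟩⟩
  rw [map_smul, chainD_monomial, Finset.smul_sum]
  exact Finset.sum_congr rfl fun t _ => by rw [smul_smul, ← pow_add]

lemma edgeProj_chainD_sum_edgeProj {q p : ℕ} (h : p + 1 + 1 + q = m)
    (F : Flag (cycArrangement T m ω z) q) (L : AffineSubspace ℂ (Fin m → ℂ))
    (hL : IsEdge (cycArrangement T m ω z) L)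
    (hc : Module.finrank ℂ L.direction + (q + 1 + 1) = m)
    (s : Finset (Flag (cycArrangement T m ω z) (q + 1 + 1)))
    (hs : ∀ G, G ∈ s ↔ G.init.init = F ∧ G.last = L) :
    edgeProj ω z p L (chainD (cycShift T m) N p (∑ G ∈ s, edgeProj ω z (p + 1) G.init.last
      (chainD (cycShift T m) N (p + 1) (flagChain ω z q (p + 1 + 1) h F)))) = 0 := by
  classical
  obtain ⟨E, y, hd, hy⟩ := exists_chainD_eq_sum hω (flagChain_isSignedMonomial hω hz0 hz _ _ h F)
  have hsum : ∑ G ∈ s, edgeProj ω z (p + 1) G.init.last (∑ t, y t) =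
      ∑ t, ∑ G ∈ s, edgeProj ω z (p + 1) G.init.last (y t) := by
    rw [Finset.sum_comm]
    exact Finset.sum_congr rfl fun G hG => map_sum _ _ _
  have hzero := congrArg (edgeProj ω z p L)
    (chainD_chainD (cycShift T m) N p (flagChain ω z q (p + 1 + 1) h F))
  rw [hd, map_sum, map_sum, map_zero] at hzero
  rw [hd, hsum, map_sum, map_sum, ← hzero]
  refine Finset.sum_congr rfl fun t _ => ?_
  obtain ⟨hE, hEt⟩ := hy t
  by_cases hle : L ≤ E t
  · obtain ⟨K, hK1, hK2⟩ := Flag.exists_snoc F (hEt.isEdge hω)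
      (by rw [hEt.finrank hω]; omega) hE
    obtain ⟨G, hG1, hG2⟩ := Flag.exists_snoc K hL hc (hK2 ▸ hle)
    have hGs : G ∈ s := (hs G).2 ⟨by rw [hG1, hK1], hG2⟩
    rw [Finset.sum_eq_single G]
    · rw [hEt.edgeProj_apply, if_pos (by rw [hG1, hK2])]
    · intro G' hG' hne
      rw [hEt.edgeProj_apply, if_neg]
      intro he
      refine hne (Flag.ext_init_last (Flag.ext_init_last ?_ ?_) ?_)
      · rw [((hs G').1 hG').1, ((hs G).1 hGs).1]
      · rw [← he, hG1, hK2]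
      · rw [((hs G').1 hG').2, hG2]
    · exact fun h => (h hGs).elim
  · rw [edgeProj_chainD_eq_zero hω hEt hle, Finset.sum_eq_zero, map_zero, map_zero]
    intro G hG
    rw [hEt.edgeProj_apply, if_neg]
    rintro he
    rw [he, ← ((hs G).1 hG).2] at hle
    exact hle G.last_le_init_last

lemma sum_flagChain : ∀ (q p : ℕ) (h : p + q = m)
    (F : Flag (cycArrangement T m ω z) q) (i : Fin (q + 1)), 0 < (i : ℕ) → (i : ℕ) < q →
      ∀ s : Finset (Flag (cycArrangement T m ω z) q),
        (∀ G, G ∈ s ↔ ∀ j, j ≠ i → G.edge j = F.edge j) → ∑ G ∈ s, flagChain ω z q p h G = 0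
  | 0, p, h, F, i, h0, hi, s, hs => (Nat.not_lt_zero _ hi).elim
  | q + 1, p, h, F, i, h0, hi, s, hs => by
    classical
    obtain ⟨i, rfl⟩ : ∃ i' : Fin (q + 1), i = i'.castSucc := ⟨⟨i, hi⟩, rfl⟩
    have hlast : ∀ G ∈ s, G.last = F.last := fun G hG =>
      (hs G).1 hG _ (Fin.castSucc_lt_last i).ne'
    have hstep : ∑ G ∈ s, flagChain ω z (q + 1) p h G =
        edgeProj ω z p F.last (chainD (cycShift T m) N p
          (∑ G ∈ s, flagChain ω z q (p + 1) (by omega) G.init)) := by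
      rw [map_sum, map_sum]
      refine Finset.sum_congr rfl fun G hG => ?_
      rw [flagChain, hlast G hG]
    rw [hstep]
    by_cases hiq : (i : ℕ) < q
    · have hinit : ∀ G ∈ s, ∀ G' ∈ s, G.init = G'.init → G = G' := fun G hG G' hG' hGG =>
        Flag.ext_init_last hGG ((hlast G hG).trans (hlast G' hG').symm)
      rw [← Finset.sum_image (g := Flag.init) (f := flagChain ω z q (p + 1) (by omega)) hinit,
        sum_flagChain q (p + 1) (by omega) F.init i (by simpa using h0) hiq, map_zero, map_zero]
      intro G
      rw [Finset.mem_image]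
      constructor
      · rintro ⟨K, hK, rfl⟩ j hj
        exact (hs K).1 hK j.castSucc fun h => hj (Fin.castSucc_injective _ h)
      · intro hG
        have hGl : G.last = F.init.last := hG _ fun h => by
          rw [← h] at hiq; simp at hiq
        obtain ⟨K, hK1, hK2⟩ := Flag.exists_snoc G (F.isEdge (Fin.last _)) (F.codim (Fin.last _))
          (hGl ▸ F.last_le_init_last)
        refine ⟨K, (hs _).2 fun j hj => ?_, hK1⟩
        induction j using Fin.lastCases with
        | last => exact hK2
        | cast j =>
          exact (congrFun (congrArg Flag.edge hK1) j).trans (hG j fun h => hj (by rw [h]))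
    · obtain ⟨q, rfl⟩ : ∃ q', q = q' + 1 := ⟨q - 1, by simp at h0; omega⟩
      have hi' : i = Fin.last (q + 1) := Fin.ext (by have := i.2; simp; omega)
      subst hi'
      have hs' : ∀ G, G ∈ s ↔ G.init.init = F.init.init ∧ G.last = F.last := by
        intro G
        refine ⟨fun hG => ⟨Flag.ext (funext fun j => (hs G).1 hG j.castSucc.castSucc fun e =>
          (Fin.castSucc_lt_last j).ne (Fin.castSucc_injective _ e)), hlast G hG⟩,
          fun hG => (hs G).2 fun j hj => ?_⟩
        induction j using Fin.lastCases with
        | last => exact hG.2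
        | cast j =>
          induction j using Fin.lastCases with
          | last => exact (hj rfl).elim
          | cast j => exact congrFun (congrArg Flag.edge hG.1) j
      have hinner : ∑ G ∈ s, flagChain ω z (q + 1) (p + 1) (by omega) G.init =
          ∑ G ∈ s, edgeProj ω z (p + 1) G.init.last (chainD (cycShift T m) N (p + 1)
            (flagChain ω z q (p + 1 + 1) (by omega) F.init.init)) := by
        refine Finset.sum_congr rfl fun G hG => ?_
        rw [flagChain, ((hs' G).1 hG).1]
      rw [hinner]
      exact edgeProj_chainD_sum_edgeProj hω hz0 hz (by omega) F.init.init F.last (F.isEdge _)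
        (F.codim (Fin.last _)) s hs'

end

/-- The linear map from flags to chains. -/
def flagToChain (hω : IsPrimitiveRoot ω T) (hz0 : ∀ j, z j ≠ 0)
    (hz : ∀ i j, i ≠ j → ∀ n : ℕ, z i ≠ (ω : ℂ) ^ n * z j) (q p : ℕ) (h : p + q = m) :
    FlagSpace (cycArrangement T m ω z) q →ₗ[ℂ] ChainSpace (cycShift T m) N p :=
  FlagSpace.lift (E := ChainSpace (cycShift T m) N p) (flagChain ω z q p h)
    (sum_flagChain hω hz0 hz q p h)

variable (hω : IsPrimitiveRoot ω T) (hz0 : ∀ j, z j ≠ 0)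
  (hz : ∀ i j, i ≠ j → ∀ n : ℕ, z i ≠ (ω : ℂ) ^ n * z j)

lemma flagToChain_mk (q p : ℕ) (h : p + q = m) (F : Flag (cycArrangement T m ω z) q) :
    flagToChain hω hz0 hz q p h (FlagSpace.mk F) = flagChain ω z q p h F :=
  FlagSpace.lift_mk _ _ _

lemma flagToChain_flagDiff (q p : ℕ) (h : p + 1 + q = m) (h' : p + (q + 1) = m)
    (v : FlagSpace (cycArrangement T m ω z) q) :
    flagToChain hω hz0 hz (q + 1) p h' (flagDiff _ q v) =
      chainD (cycShift T m) N p (flagToChain hω hz0 hz q (p + 1) h v) := by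
  classical
  suffices H : flagToChain hω hz0 hz (q + 1) p h' ∘ₗ flagDiff _ q =
      chainD (cycShift T m) N p ∘ₗ flagToChain hω hz0 hz q (p + 1) h from LinearMap.congr_fun H v
  refine FlagSpace.hom_ext fun F => ?_
  rw [LinearMap.comp_apply, LinearMap.comp_apply, flagDiff_mk, map_sum]
  simp only [flagToChain_mk]
  obtain ⟨E, y, hd, hy⟩ := exists_chainD_eq_sum hω
    (flagChain_isSignedMonomial hω hz0 hz q (p + 1) h F)
  have h1 : ∀ G ∈ Finset.univ.filter (fun G : Flag (cycArrangement T m ω z) (q + 1) => G.init = F),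
      flagChain ω z (q + 1) p h' G = ∑ t, edgeProj ω z p G.last (y t) := by
    intro G hG
    rw [flagChain, (Finset.mem_filter.1 hG).2, hd, map_sum]
  rw [Finset.sum_congr rfl h1, Finset.sum_comm, hd]
  refine Finset.sum_congr rfl fun t _ => ?_
  have hEt := (hy t).2
  obtain ⟨K, hK1, hK2⟩ : ∃ K : Flag (cycArrangement T m ω z) (q + 1), K.init = F ∧ K.last = E t :=
    ⟨F.snoc (E t) (hEt.isEdge hω) (by rw [hEt.finrank hω]; omega) (hy t).1,
      Flag.snoc_init _ _ _ _ _, Flag.snoc_last _ _ _ _ _⟩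
  rw [Finset.sum_eq_single K]
  · rw [hEt.edgeProj_apply, if_pos hK2.symm]
  · intro G hG hne
    rw [hEt.edgeProj_apply, if_neg]
    intro he
    exact hne (Flag.ext_init_last ((Finset.mem_filter.1 hG).2.trans hK1.symm)
      (he.symm.trans hK2.symm))
  · exact fun h => (h (by simp [hK1])).elim

end FlagChain

/-! ### Extraction of a factor from a product -/

section Extraction

attribute [local instance] LieRing.ofAssociativeRing

variable {L : Type} [LieRing L] [LieAlgebra ℂ L]

/-- The diagonal action of `L` on `L ⊗ U(L)`. -/
def tensorDiag (L : Type) [LieRing L] [LieAlgebra ℂ L] :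
    L →ₗ[ℂ] Module.End ℂ (L ⊗[ℂ] UniversalEnvelopingAlgebra ℂ L) where
  toFun a := LinearMap.rTensor _ (LieModule.toEnd ℂ L L a) +
    LinearMap.lTensor L (LinearMap.mulLeft ℂ (UniversalEnvelopingAlgebra.ι ℂ a))
  map_add' a b := by
    refine TensorProduct.ext' fun x u => ?_
    simp [TensorProduct.tmul_add, add_mul]
    abel
  map_smul' c a := by
    refine TensorProduct.ext' fun x u => ?_
    simp [TensorProduct.smul_tmul']

lemma tensorDiag_tmul (a x : L) (u : UniversalEnvelopingAlgebra ℂ L) :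
    tensorDiag L a (x ⊗ₜ u) = ⁅a, x⁆ ⊗ₜ u + x ⊗ₜ (UniversalEnvelopingAlgebra.ι ℂ a * u) := rfl

lemma ι_lie (x y : L) : UniversalEnvelopingAlgebra.ι ℂ ⁅x, y⁆ =
    UniversalEnvelopingAlgebra.ι ℂ x * UniversalEnvelopingAlgebra.ι ℂ y -
      UniversalEnvelopingAlgebra.ι ℂ y * UniversalEnvelopingAlgebra.ι ℂ x := by
  rw [LieHom.map_lie, LieRing.of_associative_ring_bracket]

/-- The representation of `L` on `U(L) × (L ⊗ U(L))` attached to linear maps `p₀` and `p₁`. -/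
def extractAct (p₀ p₁ : L →ₗ[ℂ] L) : L →ₗ[ℂ] Module.End ℂ
    (UniversalEnvelopingAlgebra ℂ L × (L ⊗[ℂ] UniversalEnvelopingAlgebra ℂ L)) where
  toFun x := LinearMap.prod
    (LinearMap.mulLeft ℂ (UniversalEnvelopingAlgebra.ι ℂ (p₀ x)) ∘ₗ LinearMap.fst _ _ _)
    (TensorProduct.mk ℂ L _ (p₁ x) ∘ₗ LinearMap.fst _ _ _ +
      tensorDiag L (p₀ x) ∘ₗ LinearMap.snd _ _ _)
  map_add' x y := by
    refine LinearMap.ext fun w => Prod.ext ?_ ?_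
    · simp [add_mul]
    · simp
      abel
  map_smul' c x := by
    refine LinearMap.ext fun w => Prod.ext ?_ ?_
    · simp
    · simp [TensorProduct.smul_tmul']

lemma extractAct_apply (p₀ p₁ : L →ₗ[ℂ] L) (x : L) (u : UniversalEnvelopingAlgebra ℂ L)
    (w : L ⊗[ℂ] UniversalEnvelopingAlgebra ℂ L) : extractAct p₀ p₁ x (u, w) =
      (UniversalEnvelopingAlgebra.ι ℂ (p₀ x) * u, p₁ x ⊗ₜ u + tensorDiag L (p₀ x) w) := rfl

lemma tensorDiag_lie (x y : L) (w : L ⊗[ℂ] UniversalEnvelopingAlgebra ℂ L) :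
    tensorDiag L ⁅x, y⁆ w =
      tensorDiag L x (tensorDiag L y w) - tensorDiag L y (tensorDiag L x w) := by
  suffices h : tensorDiag L ⁅x, y⁆ =
      tensorDiag L x ∘ₗ tensorDiag L y - tensorDiag L y ∘ₗ tensorDiag L x from
    LinearMap.congr_fun h w
  refine TensorProduct.ext' fun z u => ?_
  simp only [LinearMap.sub_apply, LinearMap.comp_apply, tensorDiag_tmul, map_add, ι_lie, sub_mul,
    TensorProduct.tmul_sub, lie_lie, TensorProduct.sub_tmul, mul_assoc]
  abel

/-- The Lie algebra homomorphism given by `extractAct`. -/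
def extractHom (p₀ p₁ : L →ₗ[ℂ] L) (h₀ : ∀ x y, p₀ ⁅x, y⁆ = ⁅p₀ x, p₀ y⁆)
    (h₁ : ∀ x y, p₁ ⁅x, y⁆ = ⁅p₁ x, p₀ y⁆ + ⁅p₀ x, p₁ y⁆) : L →ₗ⁅ℂ⁆ Module.End ℂ
    (UniversalEnvelopingAlgebra ℂ L × (L ⊗[ℂ] UniversalEnvelopingAlgebra ℂ L)) where
  __ := extractAct p₀ p₁
  map_lie' {x y} := by
    change extractAct p₀ p₁ ⁅x, y⁆ = ⁅extractAct p₀ p₁ x, extractAct p₀ p₁ y⁆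
    rw [LieRing.of_associative_ring_bracket]
    refine LinearMap.ext fun ⟨u, w⟩ => ?_
    simp only [LinearMap.sub_apply, Module.End.mul_apply, extractAct_apply]
    refine Prod.ext ?_ ?_
    · simp only [h₀, ι_lie, sub_mul, mul_assoc, Prod.fst_sub]
    · have h : ⁅p₁ x, p₀ y⁆ = -⁅p₀ y, p₁ x⁆ := (lie_skew _ _).symm
      simp only [Prod.snd_sub, h₀, h₁, h, tensorDiag_lie, map_add, tensorDiag_tmul,
        TensorProduct.add_tmul, TensorProduct.neg_tmul]
      abel

variable {X : Type} (P : X → Prop) [DecidablePred P]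

/-- If the elements of `L` can be split according to the number of letters that satisfy `P`, then one
can extract from a product its first factor when that factor alone contains such a letter. -/
lemma exists_extract {S : Multiset X → L → Prop} (p₀ p₁ : L →ₗ[ℂ] L)
    (h₀ : ∀ x y, p₀ ⁅x, y⁆ = ⁅p₀ x, p₀ y⁆) (h₁ : ∀ x y, p₁ ⁅x, y⁆ = ⁅p₁ x, p₀ y⁆ + ⁅p₀ x, p₁ y⁆)
    (hS₀ : ∀ A y, S A y → A.countP P = 0 → p₀ y = y ∧ p₁ y = 0)
    (hS₁ : ∀ A y, S A y → A.countP P = 1 → p₀ y = 0 ∧ p₁ y = y) :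
    ∃ E : UniversalEnvelopingAlgebra ℂ L →ₗ[ℂ] L ⊗[ℂ] UniversalEnvelopingAlgebra ℂ L,
      ∀ A y a u, S A y → A.countP P = 1 → EnvMonomial S a u → a.countP P = 0 →
        E (UniversalEnvelopingAlgebra.ι ℂ y * u) = y ⊗ₜ u := by
  set ρ := UniversalEnvelopingAlgebra.lift ℂ (extractHom p₀ p₁ h₀ h₁) with hρ
  have hι : ∀ y u w, ρ (UniversalEnvelopingAlgebra.ι ℂ y) (u, w) =
      (UniversalEnvelopingAlgebra.ι ℂ (p₀ y) * u, p₁ y ⊗ₜ u + tensorDiag L (p₀ y) w) := by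
    intro y u w
    rw [hρ, UniversalEnvelopingAlgebra.lift_ι_apply]
    rfl
  have hu : ∀ a u, EnvMonomial S a u → a.countP P = 0 → ρ u (1, 0) = (u, 0) := by
    intro a u h
    induction h with
    | one => intro _; rw [map_one]; rfl
    | mul hy _ ih =>
      intro ha
      rw [Multiset.countP_add, Nat.add_eq_zero_iff] at ha
      rw [map_mul, Module.End.mul_apply, ih ha.2, hι, (hS₀ _ _ hy ha.1).1, (hS₀ _ _ hy ha.1).2]
      simp
  refine ⟨LinearMap.snd _ _ _ ∘ₗ LinearMap.applyₗ (1, 0) ∘ₗ ρ.toLinearMap,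
    fun A y a u hy hA hau ha => ?_⟩
  simp only [LinearMap.comp_apply, AlgHom.toLinearMap_apply, LinearMap.applyₗ_apply_apply,
    LinearMap.snd_apply]
  rw [map_mul, Module.End.mul_apply, hu a u hau ha, hι, (hS₁ _ _ hy hA).1, (hS₁ _ _ hy hA).2]
  simp

variable [Countable X]

/-- The projection of the free Lie algebra to the span of the commutators with `d` letters that
satisfy `P`. -/
def letterPart (d : ℕ) : FreeLieAlgebra ℂ X →ₗ[ℂ] FreeLieAlgebra ℂ X :=
  contentMap fun A => if A.countP P = d then 1 else 0

variable {P}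

lemma IsCommutator.letterPart {A : Multiset X} {g : FreeLieAlgebra ℂ X} (h : IsCommutator A g)
    (d : ℕ) : letterPart P d g = if A.countP P = d then g else 0 := by
  rw [Cyclotomic.letterPart, h.contentMap_apply]
  split_ifs <;> simp

omit [Countable X] in
lemma freeLie_hom_ext₂ {E : Type*} [AddCommMonoid E] [Module ℂ E]
    {f f' : FreeLieAlgebra ℂ X →ₗ[ℂ] FreeLieAlgebra ℂ X →ₗ[ℂ] E}
    (h : ∀ A g B h, IsCommutator A g → IsCommutator B h → f g h = f' g h) : f = f' :=
  freeLie_hom_ext fun A g hg => freeLie_hom_ext fun B k hk => h A g B k hg hk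

lemma letterPart_zero_lie (x y : FreeLieAlgebra ℂ X) :
    letterPart P 0 ⁅x, y⁆ = ⁅letterPart P 0 x, letterPart P 0 y⁆ := by
  let b := (LieModule.toEnd ℂ (FreeLieAlgebra ℂ X) (FreeLieAlgebra ℂ X)).toLinearMap
  suffices h : b.compr₂ (letterPart P 0) = b.compl₁₂ (letterPart P 0) (letterPart P 0) from
    LinearMap.congr_fun₂ h x y
  refine freeLie_hom_ext₂ fun A g B h hg hh => ?_
  change letterPart P 0 ⁅g, h⁆ = ⁅letterPart P 0 g, letterPart P 0 h⁆
  rw [(hg.lie hh).letterPart, hg.letterPart, hh.letterPart, Multiset.countP_add]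
  split_ifs <;> first | omega | simp

lemma letterPart_one_lie (x y : FreeLieAlgebra ℂ X) :
    letterPart P 1 ⁅x, y⁆ =
      ⁅letterPart P 1 x, letterPart P 0 y⁆ + ⁅letterPart P 0 x, letterPart P 1 y⁆ := by
  let b := (LieModule.toEnd ℂ (FreeLieAlgebra ℂ X) (FreeLieAlgebra ℂ X)).toLinearMap
  suffices h : b.compr₂ (letterPart P 1) = b.compl₁₂ (letterPart P 1) (letterPart P 0) +
      b.compl₁₂ (letterPart P 0) (letterPart P 1) from LinearMap.congr_fun₂ h x y
  refine freeLie_hom_ext₂ fun A g B h hg hh => ?_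
  change letterPart P 1 ⁅g, h⁆ =
    ⁅letterPart P 1 g, letterPart P 0 h⁆ + ⁅letterPart P 0 g, letterPart P 1 h⁆
  rw [(hg.lie hh).letterPart, hg.letterPart, hh.letterPart, hg.letterPart, hh.letterPart,
    Multiset.countP_add]
  split_ifs <;> first | omega | simp

variable (P)

lemma exists_extract_freeLie :
    ∃ E : UniversalEnvelopingAlgebra ℂ (FreeLieAlgebra ℂ X) →ₗ[ℂ]
        FreeLieAlgebra ℂ X ⊗[ℂ] UniversalEnvelopingAlgebra ℂ (FreeLieAlgebra ℂ X),
      ∀ A y a u, IsCommutator A y → A.countP P = 1 → EnvMonomial IsCommutator a u →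
        a.countP P = 0 → E (UniversalEnvelopingAlgebra.ι ℂ y * u) = y ⊗ₜ u := by
  refine exists_extract P (letterPart P 0) (letterPart P 1) letterPart_zero_lie letterPart_one_lie
    (fun A y h hA => ?_) fun A y h hA => ?_
  · simp [h.letterPart, hA]
  · simp [h.letterPart, hA]

lemma exists_extract_fixed {e : Equiv.Perm X} (he : ∀ x, P (e x) ↔ P x) {n : ℕ} (hn : e ^ n = 1) :
    ∃ E : UniversalEnvelopingAlgebra ℂ (fixedSubalgebra e) →ₗ[ℂ]
        fixedSubalgebra e ⊗[ℂ] UniversalEnvelopingAlgebra ℂ (fixedSubalgebra e),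
      ∀ A y a u, IsCycCommutator hn A y → A.countP P = 1 → EnvMonomial (IsCycCommutator hn) a u →
        a.countP P = 0 → E (UniversalEnvelopingAlgebra.ι ℂ y * u) = y ⊗ₜ u := by
  have hF : ∀ (d : ℕ) (A : Multiset X),
      (if (A.map e).countP P = d then (1 : ℂ) else 0) = if A.countP P = d then 1 else 0 := by
    intro d A
    rw [Multiset.countP_map, Multiset.countP_eq_card_filter]
    simp only [he]
  refine exists_extract P (fixedContentMap e _ (hF 0)) (fixedContentMap e _ (hF 1))
    (fun x y => Subtype.ext (letterPart_zero_lie (P := P) (x : FreeLieAlgebra ℂ X) y))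
    (fun x y => Subtype.ext (letterPart_one_lie (P := P) (x : FreeLieAlgebra ℂ X) y))
    (fun A y h hA => ?_) fun A y h hA => ?_
  · simp [h.fixedContentMap_apply, hA]
  · simp [h.fixedContentMap_apply, hA]

end Extraction

/-! ### Operators that undo a term of the differential -/

section Insert

variable {L M : Type*} [LieRing L] [LieAlgebra ℂ L] [AddCommGroup M] [Module ℂ M]

/-- The operator `w ⊗ m ↦ ∑ (w ∧ x_i) ⊗ m_i`, where `f m = ∑ x_i ⊗ m_i`. -/
def chainInsert (k : ℕ) (f : M →ₗ[ℂ] L ⊗[ℂ] M) :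
    ⋀[ℂ]^k L ⊗[ℂ] M →ₗ[ℂ] ⋀[ℂ]^(k + 1) L ⊗[ℂ] M :=
  LinearMap.rTensor M (TensorProduct.lift (wedgeCons L k).flip) ∘ₗ
    (TensorProduct.assoc ℂ (⋀[ℂ]^k L) L M).symm.toLinearMap ∘ₗ LinearMap.lTensor _ f

lemma chainInsert_tmul {k : ℕ} {f : M →ₗ[ℂ] L ⊗[ℂ] M} {m m' : M} {x : L} (h : f m = x ⊗ₜ m')
    (w : ⋀[ℂ]^k L) : chainInsert k f (w ⊗ₜ m) = wedgeCons L k x w ⊗ₜ m' := by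
  simp [chainInsert, h]

/-- Apply a map `U → L ⊗ U` to a factor of a tensor power of `U`. -/
def slotMap {U : Type*} [AddCommGroup U] [Module ℂ U] {N : ℕ} (E : U →ₗ[ℂ] L ⊗[ℂ] U) (j : Fin N) :
    (PiTensorProduct ℂ fun _ : Fin N => U) →ₗ[ℂ] L ⊗[ℂ] PiTensorProduct ℂ fun _ : Fin N => U :=
  PiTensorProduct.lift
    { toFun := fun v => LinearMap.lTensor L ((PiTensorProduct.tprod ℂ).toLinearMap v j) (E (v j))
      map_update_add' := fun {inst} v i a b => by
        obtain rfl : inst = instDecidableEqFin N := Subsingleton.elim _ _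
        have hid : ∀ y : U, (PiTensorProduct.tprod ℂ (s := fun _ : Fin N => U)).toLinearMap
            (Function.update v j y) j = (PiTensorProduct.tprod ℂ).toLinearMap v j := fun y =>
          LinearMap.ext fun c => by simp [MultilinearMap.toLinearMap]
        rcases eq_or_ne i j with rfl | hij
        · simp only [hid, Function.update_self, map_add]
        · simp only [Function.update_of_ne hij.symm]
          rw [← LinearMap.add_apply, ← LinearMap.lTensor_add]
          congr 2
          refine LinearMap.ext fun y => ?_
          simp [MultilinearMap.toLinearMap, Function.update_comm hij]
      map_update_smul' := fun {inst} v i c a => by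
        obtain rfl : inst = instDecidableEqFin N := Subsingleton.elim _ _
        have hid : ∀ y : U, (PiTensorProduct.tprod ℂ (s := fun _ : Fin N => U)).toLinearMap
            (Function.update v j y) j = (PiTensorProduct.tprod ℂ).toLinearMap v j := fun y =>
          LinearMap.ext fun c => by simp [MultilinearMap.toLinearMap]
        rcases eq_or_ne i j with rfl | hij
        · simp only [hid, Function.update_self, map_smul]
        · simp only [Function.update_of_ne hij.symm]
          rw [← LinearMap.smul_apply, ← LinearMap.lTensor_smul]
          congr 2
          refine LinearMap.ext fun y => ?_
          simp [MultilinearMap.toLinearMap, Function.update_comm hij] }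

lemma slotMap_tprod {U : Type*} [AddCommGroup U] [Module ℂ U] {N : ℕ} {E : U →ₗ[ℂ] L ⊗[ℂ] U}
    {j : Fin N} {v : Fin N → U} {y u : U} {x : L} (h : E y = x ⊗ₜ u) :
    slotMap E j (PiTensorProduct.tprod ℂ (Function.update v j y)) =
      x ⊗ₜ PiTensorProduct.tprod ℂ (Function.update v j u) := by
  simp [slotMap, h, MultilinearMap.toLinearMap]

/-- The operators `w ↦ w ∧ y ∧ x`. -/
def wedgeConsCons (L : Type*) [LieRing L] [LieAlgebra ℂ L] (p : ℕ) :
    L ⊗[ℂ] L →ₗ[ℂ] (⋀[ℂ]^p L →ₗ[ℂ] ⋀[ℂ]^(p + 2) L) :=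
  TensorProduct.lift
    (LinearMap.compl₂ ((LinearMap.llcomp ℂ _ _ _) ∘ₗ wedgeCons L (p + 1)) (wedgeCons L p))

lemma wedgeConsCons_tmul (p : ℕ) (x y : L) (w : ⋀[ℂ]^p L) :
    wedgeConsCons L p (x ⊗ₜ y) w = wedgeCons L (p + 1) x (wedgeCons L p y w) := rfl

/-- The operator `g_k ∧ ⋯ ∧ g_1 ↦ ∑_i (-1)^(i-1) (g_k ∧ ⋯ ĝ_i ⋯ ∧ g_1) ∧ y_i ∧ x_i`, where `x_i ⊗ y_i`
stands for `f g_i`. -/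
def wedgeSplit (f : L →ₗ[ℂ] L ⊗[ℂ] L) (p : ℕ) : ⋀[ℂ]^(p + 1) L →ₗ[ℂ] ⋀[ℂ]^(p + 2) L :=
  wedgeLift (AlternatingMap.alternatizeUncurryFin
    { toFun := fun a => (wedgeConsCons L p (f a)).compAlternatingMap (wedgeRev L p)
      map_add' := fun a b => by ext; simp
      map_smul' := fun c a => by ext; simp })

lemma wedgeSplit_cons {f : L →ₗ[ℂ] L ⊗[ℂ] L} {p : ℕ} {a : L} {g : Fin p → L}
    (h : ∀ i, f (g i) = 0) : wedgeSplit f p (wedgeRev L (p + 1) (Fin.cons a g)) =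
      wedgeConsCons L p (f a) (wedgeRev L p g) := by
  rw [wedgeSplit, wedgeLift_apply, AlternatingMap.alternatizeUncurryFin_apply, Fin.sum_univ_succ,
    Finset.sum_eq_zero]
  · simp
  · intro i _
    simp [h]

lemma wedgeSplit_cons_of_eq_tmul {f : L →ₗ[ℂ] L ⊗[ℂ] L} {p : ℕ} {a x y : L} {g : Fin p → L}
    (h : ∀ i, f (g i) = 0) (ha : f a = x ⊗ₜ y ∨ f (-a) = y ⊗ₜ x) :
    wedgeSplit f p (wedgeRev L (p + 1) (Fin.cons a g)) =
      wedgeRev L (p + 2) (Fin.cons x (Fin.cons y g : Fin (p + 1) → L)) := by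
  rw [wedgeSplit_cons h]
  rcases ha with ha | ha
  · rw [ha, wedgeConsCons_tmul, wedgeCons_apply, wedgeCons_apply]
  · have ha' : f a = (-1 : ℂ) • (y ⊗ₜ[ℂ] x) := by rw [← ha, ← map_smul, neg_one_smul, neg_neg]
    rw [ha', map_smul, LinearMap.smul_apply, wedgeConsCons_tmul, wedgeCons_apply, wedgeCons_apply,
      ← wedgeRev_cons_cons_swap']

end Insert

/-! ### Splitting a commutator into two factors -/

section Split

attribute [local instance] LieRing.ofAssociativeRing

variable {L : Type} [LieRing L] [LieAlgebra ℂ L]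

/-- The operators on `ℂ × L × (L ⊗ L)` by which elements of the four kinds act: the elements of kind
`0` act by derivations, `g` of kind `1` sends `(c, y, w)` to `(0, 0, g ⊗ y)`, `g` of kind `2` sends it
to `(0, c g, 0)`, and the elements of kind `3` act by zero. -/
def splitOp : Fin 4 → L →ₗ[ℂ] Module.End ℂ (ℂ × L × (L ⊗[ℂ] L))
  | 0 =>
    { toFun := fun x => LinearMap.prod 0 (LinearMap.prod
        (LieModule.toEnd ℂ L L x ∘ₗ LinearMap.fst ℂ L (L ⊗[ℂ] L) ∘ₗ LinearMap.snd _ _ _)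
        (LieModule.toEnd ℂ L (L ⊗[ℂ] L) x ∘ₗ LinearMap.snd ℂ L (L ⊗[ℂ] L) ∘ₗ
          LinearMap.snd _ _ _))
      map_add' := fun x y => LinearMap.ext fun v => by simp
      map_smul' := fun c x => LinearMap.ext fun v => by simp }
  | 1 =>
    { toFun := fun x => LinearMap.prod 0 (LinearMap.prod 0
        (TensorProduct.mk ℂ L L x ∘ₗ LinearMap.fst ℂ L (L ⊗[ℂ] L) ∘ₗ LinearMap.snd _ _ _))
      map_add' := fun x y => LinearMap.ext fun v => by simp
      map_smul' := fun c x => LinearMap.ext fun v => by simp [TensorProduct.smul_tmul'] }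
  | 2 =>
    { toFun := fun x => LinearMap.prod 0 (LinearMap.prod
        (LinearMap.toSpanSingleton ℂ L x ∘ₗ LinearMap.fst _ _ _) 0)
      map_add' := fun x y => LinearMap.ext fun v => by simp
      map_smul' := fun c x => LinearMap.ext fun v => by simp [smul_comm c] }
  | 3 => 0

lemma splitOp_zero (x y : L) (c : ℂ) (w : L ⊗[ℂ] L) :
    splitOp 0 x (c, y, w) = (0, ⁅x, y⁆, ⁅x, w⁆) := rfl

lemma splitOp_one (x y : L) (c : ℂ) (w : L ⊗[ℂ] L) :
    splitOp 1 x (c, y, w) = (0, 0, x ⊗ₜ y) := rfl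

lemma splitOp_two (x y : L) (c : ℂ) (w : L ⊗[ℂ] L) : splitOp 2 x (c, y, w) = (0, c • x, 0) := rfl

lemma splitOp_three (x : L) (v : ℂ × L × (L ⊗[ℂ] L)) : splitOp 3 x v = 0 := rfl

lemma lie_splitOp (x y : L) (κ : Fin 4) :
    ⁅splitOp 0 x, splitOp κ y⁆ = splitOp κ ⁅x, y⁆ := by
  rw [LieRing.of_associative_ring_bracket]
  refine LinearMap.ext fun ⟨c, a, w⟩ => ?_
  rw [LinearMap.sub_apply, Module.End.mul_apply, Module.End.mul_apply]
  fin_cases κ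
  · change splitOp 0 x (splitOp 0 y _) - splitOp 0 y (splitOp 0 x _) = splitOp 0 _ _
    simp [splitOp_zero]
  · change splitOp 0 x (splitOp 1 y _) - splitOp 1 y (splitOp 0 x _) = splitOp 1 _ _
    simp [splitOp_zero, splitOp_one, TensorProduct.LieModule.lie_tmul_right]
  · change splitOp 0 x (splitOp 2 y _) - splitOp 2 y (splitOp 0 x _) = splitOp 2 _ _
    simp [splitOp_zero, splitOp_two]
  · change splitOp 0 x (splitOp 3 y _) - splitOp 3 y (splitOp 0 x _) = splitOp 3 _ _
    simp [splitOp_three]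

lemma splitOp_lie (x y : L) (κ : Fin 4) :
    ⁅splitOp κ x, splitOp 0 y⁆ = splitOp κ ⁅x, y⁆ := by
  rw [← lie_skew, lie_splitOp, ← lie_skew x y, map_neg]

lemma add_eq_singleton {α : Type*} {s t : Multiset α} {a : α} (h : s + t = {a}) :
    s = {a} ∧ t = 0 ∨ s = 0 ∧ t = {a} := by
  have hc := congrArg Multiset.card h
  rw [Multiset.card_add, Multiset.card_singleton] at hc
  rcases Nat.eq_zero_or_pos s.card with hs | hs
  · rw [Multiset.card_eq_zero] at hs
    exact Or.inr ⟨hs, by rw [← h, hs, zero_add]⟩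
  · have ht : t = 0 := Multiset.card_eq_zero.1 (by omega)
    exact Or.inl ⟨by rw [← h, ht, add_zero], ht⟩

variable {X : Type} (kind : X → Fin 4)

/-- The representation of the free Lie algebra in which the generators act according to their kind. -/
def splitHom : FreeLieAlgebra ℂ X →ₗ⁅ℂ⁆
    Module.End ℂ (ℂ × FreeLieAlgebra ℂ X × (FreeLieAlgebra ℂ X ⊗[ℂ] FreeLieAlgebra ℂ X)) :=
  FreeLieAlgebra.lift ℂ fun x => splitOp (kind x) (FreeLieAlgebra.of ℂ x)

variable {kind}

lemma IsCommutator.splitHom {A : Multiset X} {g : FreeLieAlgebra ℂ X} (h : IsCommutator A g) :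
    ((A.map kind).filter (· ≠ 0) = 0 → splitHom kind g = splitOp 0 g) ∧
      ∀ κ, (A.map kind).filter (· ≠ 0) = {κ} → splitHom kind g = splitOp κ g := by
  induction h with
  | of x =>
    rw [Cyclotomic.splitHom, FreeLieAlgebra.lift_of_apply]
    by_cases hx : kind x = 0
    · refine ⟨fun _ => by rw [hx], fun κ h => ?_⟩
      simp [Multiset.filter_singleton, hx] at h
    · refine ⟨fun h => ?_, fun κ h => ?_⟩
      · simp [Multiset.filter_singleton, hx] at h
      · simp [Multiset.filter_singleton, hx] at h
        rw [h]
  | lie _ _ ihg ihh =>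
    rw [Multiset.map_add, Multiset.filter_add, LieHom.map_lie]
    refine ⟨fun h => ?_, fun κ h => ?_⟩
    · rw [add_eq_zero] at h
      rw [ihg.1 h.1, ihh.1 h.2, lie_splitOp]
    · rcases add_eq_singleton h with ⟨h1, h2⟩ | ⟨h1, h2⟩
      · rw [ihg.2 κ h1, ihh.1 h2, splitOp_lie]
      · rw [ihg.1 h1, ihh.2 κ h2, lie_splitOp]

/-- The linear map `g ↦ w`, where `g · (1, 0, 0) = (c, y, w)`. -/
def splitMap (kind : X → Fin 4) :
    FreeLieAlgebra ℂ X →ₗ[ℂ] FreeLieAlgebra ℂ X ⊗[ℂ] FreeLieAlgebra ℂ X :=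
  LinearMap.snd _ _ _ ∘ₗ LinearMap.snd _ _ _ ∘ₗ LinearMap.applyₗ (1, 0, 0) ∘ₗ
    (splitHom kind).toLinearMap

lemma splitMap_apply (g : FreeLieAlgebra ℂ X) :
    splitMap kind g = (splitHom kind g (1, 0, 0)).2.2 := rfl

lemma IsCommutator.splitMap_of_neutral {A : Multiset X} {g : FreeLieAlgebra ℂ X}
    (h : IsCommutator A g) (hA : (A.map kind).filter (· ≠ 0) = 0) : splitMap kind g = 0 := by
  rw [splitMap_apply, h.splitHom.1 hA, splitOp_zero]
  exact lie_zero g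

lemma splitMap_lie {A B : Multiset X} {g h : FreeLieAlgebra ℂ X} (hg : IsCommutator A g)
    (hh : IsCommutator B h) (hB : (B.map kind).filter (· ≠ 0) = {2}) :
    ((A.map kind).filter (· ≠ 0) = {1} → splitMap kind ⁅g, h⁆ = g ⊗ₜ h) ∧
      ((A.map kind).filter (· ≠ 0) = {3} → splitMap kind ⁅g, h⁆ = 0) := by
  have e : splitHom kind ⁅g, h⁆ (1, 0, 0) = splitHom kind g (splitHom kind h (1, 0, 0)) -
      splitHom kind h (splitHom kind g (1, 0, 0)) := by
    rw [LieHom.map_lie, LieRing.of_associative_ring_bracket]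
    rfl
  rw [splitMap_apply, e, hh.splitHom.2 2 hB]
  refine ⟨fun hA => ?_, fun hA => ?_⟩
  · simp [hg.splitHom.2 1 hA, splitOp_one, splitOp_two]
  · simp [hg.splitHom.2 3 hA, splitOp_three]

end Split

section FixedSplit

variable {T m : ℕ} [NeZero T]

/-- The kinds of the generators for splitting off the factor that contains the index `i` from the factor
that contains the index `i'`. -/
def indexKind (T : ℕ) (i i' : Fin m) (x : ZMod T × Fin m) : Fin 4 :=
  if x.2 = i' then 2 else if x.2 = i then if x.1 = 0 then 1 else 3 else 0

omit [NeZero T] in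
lemma filter_indexKind_eq_zero {i i' : Fin m} {A : Multiset (ZMod T × Fin m)}
    (h : i ∉ A.map Prod.snd) (h' : i' ∉ A.map Prod.snd) :
    (A.map (indexKind T i i')).filter (· ≠ 0) = 0 := by
  rw [Multiset.filter_eq_nil]
  intro κ hκ
  obtain ⟨x, hx, rfl⟩ := Multiset.mem_map.1 hκ
  rw [not_not, indexKind, if_neg, if_neg]
  · exact fun e => h (e ▸ Multiset.mem_map_of_mem _ hx)
  · exact fun e => h' (e ▸ Multiset.mem_map_of_mem _ hx)

omit [NeZero T] in
lemma filter_indexKind_eq_singleton {i i' : Fin m} {A : Multiset (ZMod T × Fin m)}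
    {x : ZMod T × Fin m} (hx : x ∈ A) (hx0 : indexKind T i i' x ≠ 0)
    (h : i ∉ (A.erase x).map Prod.snd) (h' : i' ∉ (A.erase x).map Prod.snd) :
    (A.map (indexKind T i i')).filter (· ≠ 0) = {indexKind T i i' x} := by
  rw [← Multiset.cons_erase hx, Multiset.map_cons, Multiset.filter_cons_of_pos (p := (· ≠ 0)) _ hx0,
    filter_indexKind_eq_zero h h']
  rfl

omit [NeZero T] in
lemma exists_mem_of_count_eq_one {i i' : Fin m} {A : Multiset (ZMod T × Fin m)}
    (h : (A.map Prod.snd).count i = 1) (h' : (A.map Prod.snd).count i' = 0) :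
    ∃ a, (a, i) ∈ A ∧ i ∉ (A.erase (a, i)).map Prod.snd ∧ i' ∉ (A.erase (a, i)).map Prod.snd := by
  obtain ⟨⟨a, j⟩, hx, rfl⟩ := Multiset.mem_map.1 (Multiset.count_pos.1 (by rw [h]; exact one_pos))
  refine ⟨a, hx, ?_, ?_⟩
  · rw [← Multiset.cons_erase hx, Multiset.map_cons, Multiset.count_cons_self] at h
    exact Multiset.count_eq_zero.1 (Nat.succ_injective h)
  · rw [← Multiset.cons_erase hx, Multiset.map_cons] at h'
    exact fun hm => Multiset.count_eq_zero.1 h' (Multiset.mem_cons_of_mem hm)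

lemma exists_fixed_split {i i' : Fin m} (hi : i ≠ i') :
    ∃ f : fixedSubalgebra (cycShift T m) →ₗ[ℂ]
      fixedSubalgebra (cycShift T m) ⊗[ℂ] fixedSubalgebra (cycShift T m),
      (∀ A g, IsCommutator A g → (A.map Prod.snd).count i = 0 → (A.map Prod.snd).count i' = 0 →
        f (orbitSum g) = 0) ∧
      ∀ A g B h, IsCommutator A g → IsCommutator B h → (A.map Prod.snd).count i = 1 →
        (A.map Prod.snd).count i' = 0 → (B.map Prod.snd).count i' = 1 →
        (B.map Prod.snd).count i = 0 → f (orbitSum ⁅g, h⁆) = orbitSum g ⊗ₜ orbitSum h := by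
  refine ⟨TensorProduct.map (orbitMap T m) (orbitMap T m) ∘ₗ splitMap (indexKind T i i') ∘ₗ
    (fixedSubalgebra (cycShift T m)).toSubmodule.subtype, fun A g hg h0 h0' => ?_,
    fun A g B h hg hh hA hA' hB hB' => ?_⟩
  · change TensorProduct.map (orbitMap T m) (orbitMap T m) (splitMap (indexKind T i i')
      (orbitSum g : FreeLieAlgebra ℂ (ZMod T × Fin m))) = 0
    rw [coe_orbitSum, map_sum, Finset.sum_eq_zero, map_zero]
    intro c _
    refine (hg.shiftHom c).splitMap_of_neutral (filter_indexKind_eq_zero ?_ ?_) <;>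
      rw [shiftContent_map_snd, ← Multiset.count_eq_zero] <;> assumption
  · change TensorProduct.map (orbitMap T m) (orbitMap T m) (splitMap (indexKind T i i')
      (orbitSum ⁅g, h⁆ : FreeLieAlgebra ℂ (ZMod T × Fin m))) = _
    have key : ∀ c : ZMod T, ∃ a, (a, i) ∈ shiftContent c A ∧
        (a = 0 → splitMap (indexKind T i i') (shiftHom c ⁅g, h⁆) =
          shiftHom c g ⊗ₜ shiftHom c h) ∧
        (a ≠ 0 → splitMap (indexKind T i i') (shiftHom c ⁅g, h⁆) = 0) := by
      intro c
      obtain ⟨a, ha, h1, h2⟩ := exists_mem_of_count_eq_one (A := shiftContent c A) (i := i) (i' := i')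
        (by rw [shiftContent_map_snd, hA]) (by rw [shiftContent_map_snd, hA'])
      obtain ⟨b, hb, h3, h4⟩ := exists_mem_of_count_eq_one (A := shiftContent c B) (i := i') (i' := i)
        (by rw [shiftContent_map_snd, hB]) (by rw [shiftContent_map_snd, hB'])
      have e2 : indexKind T i i' (b, i') = 2 := by simp [indexKind]
      have hfB := filter_indexKind_eq_singleton hb (by rw [e2]; decide) h4 h3
      rw [e2] at hfB
      have hsp := splitMap_lie (hg.shiftHom c) (hh.shiftHom c) hfB
      rw [LieHom.map_lie]
      refine ⟨a, ha, fun ha0 => hsp.1 ?_, fun ha0 => hsp.2 ?_⟩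
      · have e1 : indexKind T i i' (a, i) = 1 := by simp [indexKind, hi, ha0]
        rw [← e1]
        exact filter_indexKind_eq_singleton ha (by rw [e1]; decide) h1 h2
      · have e1 : indexKind T i i' (a, i) = 3 := by simp [indexKind, hi, ha0]
        rw [← e1]
        exact filter_indexKind_eq_singleton ha (by rw [e1]; decide) h1 h2
    choose a ha h1 h2 using key
    have hac : ∀ c, a c = a 0 + c := by
      intro c
      have e0 := ha 0
      have ec := ha c
      rw [mem_shiftContent] at e0 ec
      simp only [sub_zero] at e0
      by_contra hne
      have hsub : ({i, i} : Multiset (Fin m)) ≤ A.map Prod.snd := by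
        have : ({(a c - c, i), (a 0, i)} : Multiset (ZMod T × Fin m)) ≤ A := by
          refine (Multiset.le_iff_subset ?_).2 ?_
          · simp only [Multiset.insert_eq_cons, Multiset.nodup_cons, Multiset.mem_singleton,
              Multiset.nodup_singleton, and_true, Prod.mk.injEq]
            exact fun h => hne (by rw [← h, sub_add_cancel])
          · intro x hx
            simp only [Multiset.insert_eq_cons, Multiset.mem_cons, Multiset.mem_singleton] at hx
            rcases hx with rfl | rfl <;> assumption
        simpa using Multiset.map_le_map (f := Prod.snd) this
      have := Multiset.count_le_of_le i hsub
      simp [hA] at this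
    rw [coe_orbitSum, map_sum, Finset.sum_eq_single (-a 0)]
    · rw [h1 _ (by rw [hac, add_neg_cancel]), TensorProduct.map_tmul, orbitMap_apply, orbitMap_apply,
        orbitSum_shiftHom, orbitSum_shiftHom]
    · intro c _ hc
      exact h2 c fun h => hc (by rw [hac] at h; exact (neg_eq_of_add_eq_zero_right h).symm)
    · simp

end FixedSplit

/-! ### The positions of the indices and the hyperplanes that contain an edge -/

section Positions

variable {T m N k : ℕ} {A : Fin k → Multiset (ZMod T × Fin m)}
  {A₀ : Multiset (ZMod T × Fin m)} {A' : Fin N → Multiset (ZMod T × Fin m)}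

lemma IsMultilinear.sum_count (h : IsMultilinear A A₀ A') (i : Fin m) :
    ∑ o, ((contents A A₀ A' o).map Prod.snd).count i = 1 := by
  rw [← Multiset.count_sum', ← map_sum_multiset, sum_contents, h]
  exact Multiset.count_eq_one_of_mem Finset.univ.nodup (Finset.mem_univ_val _)

lemma IsMultilinear.count_eq_one (h : IsMultilinear A A₀ A') {x : ZMod T × Fin m}
    {o : Fin k ⊕ Option (Fin N)} (hx : x ∈ contents A A₀ A' o) :
    ((contents A A₀ A' o).map Prod.snd).count x.2 = 1 := by
  have h1 := h.sum_count x.2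
  have h2 : 1 ≤ ((contents A A₀ A' o).map Prod.snd).count x.2 :=
    Multiset.one_le_count_iff_mem.2 (Multiset.mem_map_of_mem _ hx)
  have h3 := Finset.single_le_sum (f := fun o => ((contents A A₀ A' o).map Prod.snd).count x.2)
    (fun _ _ => Nat.zero_le _) (Finset.mem_univ o)
  beta_reduce at h3
  omega

lemma IsMultilinear.count_eq_zero (h : IsMultilinear A A₀ A') {x : ZMod T × Fin m}
    {o o' : Fin k ⊕ Option (Fin N)} (hx : x ∈ contents A A₀ A' o) (ho : o' ≠ o) :
    ((contents A A₀ A' o').map Prod.snd).count x.2 = 0 := by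
  have h1 := h.sum_count x.2
  have h2 := h.count_eq_one hx
  have h3 := Finset.add_le_sum (s := Finset.univ)
    (f := fun o => ((contents A A₀ A' o).map Prod.snd).count x.2) (fun _ _ => Nat.zero_le _)
    (Finset.mem_univ o') (Finset.mem_univ o) ho
  beta_reduce at h3
  omega

lemma countP_snd_eq (i : Fin m) (B : Multiset (ZMod T × Fin m)) :
    B.countP (fun x => i = x.2) = (B.map Prod.snd).count i := by
  rw [Multiset.count_map, Multiset.countP_eq_card_filter]

variable [NeZero T] {ω : ℂˣ} {z : Fin N → ℂ} {place : Fin m → Fin k ⊕ Option (Fin N)}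
  {tw : Fin m → ZMod T}

lemma IsPlacement.exists_mem_origin (hω : IsPrimitiveRoot ω T) (hz0 : ∀ j, z j ≠ 0)
    (hp : IsPlacement A A₀ A' place tw) {i : Fin m}
    (hi : chainEdge ω z A A₀ A' ≤ hyperplaneT0 i) : ∃ x ∈ A₀, x.2 = i := by
  have h := mem_hyperplaneT0.1 (hi (hp.placePoint_mem (z := z) hω 1))
  have h2 := cycPow_mul_placePoint (ω := ω) (z := z) (place := place) (tw := tw) 1 i
  rw [h, mul_zero] at h2
  have hm := hp.mem i
  rcases hi' : place i with b | _ | j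
  · rw [hi'] at h2
    simp [placeVal] at h2
  · rw [hi'] at hm
    exact ⟨_, hm, rfl⟩
  · rw [hi'] at h2
    exact (hz0 j h2.symm).elim

lemma IsPlacement.mem_site (hω : IsPrimitiveRoot ω T) (hz0 : ∀ j, z j ≠ 0)
    (hz : ∀ i j, i ≠ j → ∀ n : ℕ, z i ≠ (ω : ℂ) ^ n * z j)
    (hp : IsPlacement A A₀ A' place tw) {i : Fin m} {j : Fin N} {c : ZMod T}
    (hi : chainEdge ω z A A₀ A' ≤ hyperplaneTZ ω z i j c) : (-c, i) ∈ A' j := by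
  have h := mem_hyperplaneTZ.1 (hi (hp.placePoint_mem (z := z) hω 0))
  have h2 := cycPow_mul_placePoint (ω := ω) (z := z) (place := place) (tw := tw) 0 i
  rw [h, ← mul_assoc, ← Units.val_mul, ← cycPow_add hω] at h2
  have hne : (cycPow ω (tw i + c) : ℂ) * z j ≠ 0 := mul_ne_zero (Units.ne_zero _) (hz0 j)
  have hm := hp.mem i
  rcases hi' : place i with b | _ | j'
  · rw [hi'] at h2
    exact (hne h2).elim
  · rw [hi'] at h2
    exact (hne h2).elim
  · rw [hi'] at h2 hm
    change _ = z j' at h2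
    obtain rfl : j = j' := by
      by_contra hne'
      refine hz j' j (Ne.symm hne') (tw i + c).val ?_
      rw [← h2, cycPow, Units.val_pow_eq_pow_val]
    have h3 : (cycPow ω (tw i + c) : ℂ) = 1 := mul_right_cancel₀ (hz0 j) (h2.trans (one_mul _).symm)
    have h4 : tw i + c = 0 := cycPow_injective hω (Units.ext (h3.trans (by simp [cycPow])))
    rw [← eq_neg_of_add_eq_zero_left h4]
    exact hm

lemma IsPlacement.exists_mem_block (hω : IsPrimitiveRoot ω T)
    (hp : IsPlacement A A₀ A' place tw) (h0 : A₀ = 0) (h0' : ∀ j, A' j = 0) {i i' : Fin m}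
    {c : ZMod T} (hi : chainEdge ω z A A₀ A' ≤ hyperplaneTT ω i i' c) :
    ∃ b, ∃ x ∈ A b, ∃ y ∈ A b, x.2 = i ∧ y.2 = i' := by
  classical
  have hblock : ∀ i, ∃ b, place i = Sum.inl b := by
    intro i
    have hm := hp.mem i
    rcases hi' : place i with b | _ | j'
    · exact ⟨b, rfl⟩
    · rw [hi'] at hm
      change _ ∈ A₀ at hm
      simp [h0] at hm
    · rw [hi'] at hm
      change _ ∈ A' j' at hm
      simp [h0'] at hm
  obtain ⟨b, hb⟩ := hblock i
  obtain ⟨b', hb'⟩ := hblock i'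
  have hm := hp.mem i
  have hm' := hp.mem i'
  rw [hb] at hm
  rw [hb'] at hm'
  obtain rfl : b = b' := by
    by_contra hne
    have h := mem_hyperplaneTT.1 (hi (hp.placePoint_mem (z := z) hω (Pi.single b 1)))
    have e1 := cycPow_mul_placePoint (ω := ω) (z := z) (place := place) (tw := tw) (Pi.single b 1) i
    have e2 := cycPow_mul_placePoint (ω := ω) (z := z) (place := place) (tw := tw)
      (Pi.single b 1) i'
    rw [hb] at e1
    rw [hb'] at e2
    simp only [placeVal, Sum.elim_inl, Pi.single_eq_same, Pi.single_eq_of_ne (Ne.symm hne)] at e1 e2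
    rw [mul_eq_zero, or_iff_right (Units.ne_zero _)] at e2
    rw [h, e2, mul_zero, mul_zero] at e1
    exact zero_ne_one e1
  exact ⟨b, _, hm, _, hm', rfl, rfl⟩

lemma chainEdge_le_T0 (hω : IsPrimitiveRoot ω T) {x : ZMod T × Fin m} (hx : x ∈ A₀) :
    chainEdge ω z A A₀ A' ≤ hyperplaneT0 x.2 := by
  intro p hp
  have := ((mem_chainEdge hω).1 hp).2.1 x hx
  rw [mul_eq_zero, or_iff_right (Units.ne_zero _)] at this
  exact mem_hyperplaneT0.2 this

lemma chainEdge_le_TZ (hω : IsPrimitiveRoot ω T) {x : ZMod T × Fin m} {j : Fin N}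
    (hx : x ∈ A' j) : chainEdge ω z A A₀ A' ≤ hyperplaneTZ ω z x.2 j (-x.1) := by
  intro p hp
  have := ((mem_chainEdge hω).1 hp).2.2 j x hx
  rw [mem_hyperplaneTZ, cycPow_neg hω, ← this, inv_mul_cancel_left₀ (Units.ne_zero _)]

lemma le_TT_of_swimming (hω : IsPrimitiveRoot ω T) {L L₀ : AffineSubspace ℂ (Fin m → ℂ)}
    (hL : L ≤ L₀) {B : Multiset (ZMod T × Fin m)} (hB : ∀ p ∈ L₀, p ∈ swimming ω B)
    {x y : ZMod T × Fin m} (hx : x ∈ B) (hy : y ∈ B) {c : ZMod T}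
    (h : L ≤ hyperplaneTT ω x.2 y.2 c) (h0 : ¬ L ≤ hyperplaneT0 y.2) :
    L₀ ≤ hyperplaneTT ω x.2 y.2 c := by
  obtain ⟨p, hp, hp0⟩ := SetLike.not_le_iff_exists.1 h0
  rw [mem_hyperplaneT0] at hp0
  have e : ∀ q ∈ L₀, q x.2 = (cycPow ω (y.1 - x.1) : ℂ) * q y.2 := by
    intro q hq
    have := hB q hq x hx y hy
    rw [cycPow_sub hω]
    have hne := Units.ne_zero (cycPow ω x.1)
    simp only [Units.val_mul, Units.val_inv_eq_inv_val]
    field_simp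
    linear_combination this
  have h1 := e p (hL hp)
  rw [mem_hyperplaneTT.1 (h hp)] at h1
  have h2 := mul_right_cancel₀ hp0 h1
  intro q hq
  rw [mem_hyperplaneTT, h2]
  exact e q hq

end Positions

/-! ### Undoing the terms of the differential -/

section Undo

variable {T m N k : ℕ} [NeZero T] {ω : ℂˣ} {z : Fin N → ℂ}

attribute [local instance] LieRing.ofAssociativeRing

/-- The operator `h` undoes the terms with the edge `L` of the differentials of monomials whose edges
do not lie in `H`. -/
def IsUndo (ω : ℂˣ) (z : Fin N → ℂ) (L H : AffineSubspace ℂ (Fin m → ℂ))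
    (h : ChainSpace (cycShift T m) N k →ₗ[ℂ] ChainSpace (cycShift T m) N (k + 1)) : Prop :=
  ∀ A A₀ A' g u v, IsConfig A A₀ A' g u v → ¬ chainEdge ω z A A₀ A' ≤ H →
    ∀ t : ChainTerm T N k, t.edge ω z A A₀ A' = L →
      h (t.chain g u v) = (-1 : ℂ) ^ t.parity • monomial g u v

lemma exists_undo_origin (hω : IsPrimitiveRoot ω T) (hz0 : ∀ j, z j ≠ 0) (k : ℕ)
    {L : AffineSubspace ℂ (Fin m → ℂ)} {i : Fin m} (hi : L ≤ hyperplaneT0 i) :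
    ∃ h : ChainSpace (cycShift T m) N k →ₗ[ℂ] ChainSpace (cycShift T m) N (k + 1),
      IsUndo ω z L (hyperplaneT0 i) h := by
  obtain ⟨E, hE⟩ := exists_extract_fixed (fun x : ZMod T × Fin m => i = x.2)
    (e := cycShift T m) (fun x => Iff.rfl) cycShift_pow_self
  refine ⟨chainInsert k ((TensorProduct.assoc ℂ _ _ _).toLinearMap ∘ₗ LinearMap.rTensor _ E), ?_⟩
  intro A A₀ A' g u v hc hle t ht
  obtain ⟨place, tw, hp⟩ := (hc.term t).multilinear.exists_placement
  obtain ⟨x, hx, hxi⟩ := hp.exists_mem_origin hω hz0 (i := i) ((le_of_eq ht).trans hi)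
  have hx0 : x ∉ A₀ := fun h => hle (hxi ▸ chainEdge_le_T0 hω h)
  rcases t with b | ⟨b, j, c⟩ | ⟨p, c⟩
  · have hxb : x ∈ A b := (Multiset.mem_add.1 hx).resolve_right hx0
    have h1 := hc.multilinear.count_eq_one (o := Sum.inl b) hxb
    have h2 := hc.multilinear.count_eq_zero (o := Sum.inl b) (o' := Sum.inr none) hxb (by simp)
    rw [hxi, ← countP_snd_eq] at h1 h2
    have h3 := hE (A b) (orbitSum (g b)) A₀ u (hc.blocks b).orbitSum h1 hc.origin h2
    have h4 : ((TensorProduct.assoc ℂ _ _ _).toLinearMap ∘ₗ LinearMap.rTensor _ E)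
        ((UniversalEnvelopingAlgebra.ι ℂ (orbitSum (g b)) * u) ⊗ₜ[ℂ] PiTensorProduct.tprod ℂ v) =
          orbitSum (g b) ⊗ₜ (u ⊗ₜ PiTensorProduct.tprod ℂ v) := by
      rw [LinearMap.comp_apply, LinearMap.rTensor_tmul, h3]
      rfl
    rw [ChainTerm.chain, monomial]
    refine (chainInsert_tmul h4 _).trans ?_
    have h5 := wedgeRev_cons_removeNth (fun b => orbitSum (g b)) b
    rw [wedgeCons_apply]
    exact (congrArg (fun w => w ⊗ₜ[ℂ] (u ⊗ₜ[ℂ] PiTensorProduct.tprod ℂ v)) h5).trans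
      (TensorProduct.smul_tmul' _ _ _)
  · exact (hx0 hx).elim
  · exact (hx0 hx).elim

lemma exists_undo_site (hω : IsPrimitiveRoot ω T) (hz0 : ∀ j, z j ≠ 0)
    (hz : ∀ i j, i ≠ j → ∀ n : ℕ, z i ≠ (ω : ℂ) ^ n * z j) (k : ℕ)
    {L : AffineSubspace ℂ (Fin m → ℂ)} {i : Fin m} {j : Fin N} {c : ZMod T}
    (hi : L ≤ hyperplaneTZ ω z i j c) :
    ∃ h : ChainSpace (cycShift T m) N k →ₗ[ℂ] ChainSpace (cycShift T m) N (k + 1),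
      IsUndo ω z L (hyperplaneTZ ω z i j c) h := by
  obtain ⟨E, hE⟩ := exists_extract_freeLie (fun x : ZMod T × Fin m => i = x.2)
  refine ⟨chainInsert k ((TensorProduct.leftComm ℂ _ _ _).toLinearMap ∘ₗ
    LinearMap.lTensor _ (slotMap (LinearMap.rTensor _ (orbitMap T m) ∘ₗ E) j)), ?_⟩
  intro A A₀ A' g u v hc hle t ht
  obtain ⟨place, tw, hp⟩ := (hc.term t).multilinear.exists_placement
  have hx := hp.mem_site hω hz0 hz (i := i) (j := j) (c := c) ((le_of_eq ht).trans hi)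
  have hx0 : (-c, i) ∉ A' j := fun h => hle (by simpa using chainEdge_le_TZ hω h)
  rcases t with b | ⟨b, j', c'⟩ | ⟨p, c'⟩
  · exact (hx0 hx).elim
  · simp only [ChainTerm.siteContent] at hx
    obtain rfl : j = j' := by
      by_contra hne
      rw [Function.update_of_ne hne] at hx
      exact hx0 hx
    rw [Function.update_self] at hx
    have hxb := (Multiset.mem_add.1 hx).resolve_right hx0
    rw [mem_shiftContent] at hxb
    have h1 := hc.multilinear.count_eq_one (o := Sum.inl b) hxb
    have h2 := hc.multilinear.count_eq_zero (o := Sum.inl b) (o' := Sum.inr (some j)) hxb (by simp)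
    simp only [contents, Sum.elim_inl] at h1
    change ((A' j).map Prod.snd).count i = 0 at h2
    rw [← shiftContent_map_snd c', ← countP_snd_eq] at h1
    rw [← countP_snd_eq] at h2
    have h3 := hE _ _ _ _ ((hc.blocks b).shiftHom c') h1 (hc.sites j) h2
    have h3' : (LinearMap.rTensor _ (orbitMap T m) ∘ₗ E)
        (UniversalEnvelopingAlgebra.ι ℂ (shiftHom c' (g b)) * v j) = orbitSum (g b) ⊗ₜ v j := by
      rw [LinearMap.comp_apply, h3, LinearMap.rTensor_tmul, orbitMap_apply, orbitSum_shiftHom]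
    have h4 : ((TensorProduct.leftComm ℂ _ _ _).toLinearMap ∘ₗ
        LinearMap.lTensor _ (slotMap (LinearMap.rTensor _ (orbitMap T m) ∘ₗ E) j))
        (u ⊗ₜ[ℂ] PiTensorProduct.tprod ℂ (Function.update v j
          (UniversalEnvelopingAlgebra.ι ℂ (shiftHom c' (g b)) * v j))) =
          orbitSum (g b) ⊗ₜ (u ⊗ₜ PiTensorProduct.tprod ℂ v) := by
      rw [LinearMap.comp_apply, LinearMap.lTensor_tmul, slotMap_tprod h3',
        Function.update_eq_self]
      rfl
    rw [ChainTerm.chain, monomial]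
    refine (chainInsert_tmul h4 _).trans ?_
    have h5 := wedgeRev_cons_removeNth (fun b => orbitSum (g b)) b
    rw [wedgeCons_apply]
    exact (congrArg (fun w => w ⊗ₜ[ℂ] (u ⊗ₜ[ℂ] PiTensorProduct.tprod ℂ v)) h5).trans
      (TensorProduct.smul_tmul' _ _ _)
  · exact (hx0 hx).elim

/-- The data of a term that joins the block of the index `i` with the block of the index `i'`. -/
lemma exists_join_of_edge (hω : IsPrimitiveRoot ω T) {L : AffineSubspace ℂ (Fin m → ℂ)}
    (h0 : ∀ i, ¬ L ≤ hyperplaneT0 i) (h0' : ∀ i j (c : ZMod T), ¬ L ≤ hyperplaneTZ ω z i j c) {i i' : Fin m}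
    {c : ZMod T} (hi : L ≤ hyperplaneTT ω i i' c) {A : Fin (k + 1) → Multiset (ZMod T × Fin m)}
    {A₀ : Multiset (ZMod T × Fin m)} {A' : Fin N → Multiset (ZMod T × Fin m)}
    {g : Fin (k + 1) → FreeLieAlgebra ℂ (ZMod T × Fin m)}
    {u : UniversalEnvelopingAlgebra ℂ (fixedSubalgebra (cycShift T m))}
    {v : Fin N → UniversalEnvelopingAlgebra ℂ (FreeLieAlgebra ℂ (ZMod T × Fin m))}
    (hc : IsConfig A A₀ A' g u v) (hle : ¬ chainEdge ω z A A₀ A' ≤ hyperplaneTT ω i i' c)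
    {t : ChainTerm T N k} (ht : t.edge ω z A A₀ A' = L) :
    ∃ p c', t = Sum.inr (Sum.inr (p, c')) ∧ ∃ x y, x.2 = i ∧ y.2 = i' ∧
      (x ∈ A p.1.2.succ ∧ y ∈ A p.1.1.castSucc ∨ x ∈ A p.1.1.castSucc ∧ y ∈ A p.1.2.succ) := by
  obtain ⟨place, tw, hp⟩ := (hc.term t).multilinear.exists_placement
  have e0 : t.originContent A A₀ = 0 := Multiset.eq_zero_of_forall_notMem fun x hx =>
    h0 x.2 ((le_of_eq ht.symm).trans (chainEdge_le_T0 hω hx))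
  have e0' : ∀ j, t.siteContent A A' j = 0 := fun j => Multiset.eq_zero_of_forall_notMem fun x hx =>
    h0' x.2 j (-x.1) ((le_of_eq ht.symm).trans (chainEdge_le_TZ hω hx))
  obtain ⟨b, x, hx, y, hy, rfl, rfl⟩ := hp.exists_mem_block hω e0 e0' ((le_of_eq ht).trans hi)
  have hLL : L ≤ chainEdge ω z A A₀ A' := (le_of_eq ht.symm).trans (ChainTerm.edge_le hω t)
  have hsw : ∀ B, (∀ p ∈ chainEdge ω z A A₀ A', p ∈ swimming ω B) → x ∈ B → y ∈ B → False :=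
    fun B hB hx hy => hle (le_TT_of_swimming hω hLL hB hx hy hi (h0 _))
  have hblock : ∀ b, ∀ p ∈ chainEdge ω z A A₀ A', p ∈ swimming ω (A b) :=
    fun b p hp => ((mem_chainEdge hω).1 hp).1 b
  rcases t with b' | ⟨b', j, c'⟩ | ⟨p, c'⟩
  · exact (hc.ne_zero b' (add_eq_zero.1 e0).1).elim
  · have := e0' j
    simp only [ChainTerm.siteContent, Function.update_self, add_eq_zero] at this
    exact (hc.ne_zero b' (Multiset.map_eq_zero.1 this.1)).elim
  · refine ⟨p, c', rfl, ?_⟩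
    obtain ⟨⟨i, j⟩, hij⟩ := p
    have key := (forall_joinBlocks (fun B B' => shiftContent c' B + B') A hij
      (fun B => x ∈ B → y ∈ B → ∃ x' y' : ZMod T × Fin m, x'.2 = x.2 ∧ y'.2 = y.2 ∧
        (x' ∈ A j.succ ∧ y' ∈ A i.castSucc ∨ x' ∈ A i.castSucc ∧ y' ∈ A j.succ))).2
      ⟨?_, fun b _ _ hx hy => (hsw _ (hblock b) hx hy).elim⟩ b
    · exact key hx hy
    · intro hx hy
      have hshift : ∀ p ∈ chainEdge ω z A A₀ A', p ∈ swimming ω (shiftContent c' (A j.succ)) := by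
        intro p hp a ha a' ha'
        rw [mem_shiftContent] at ha ha'
        have := hblock j.succ p hp _ ha _ ha'
        simp only at this
        rw [← sub_add_cancel a.1 c', ← sub_add_cancel a'.1 c', cycPow_add hω, cycPow_add hω,
          Units.val_mul, Units.val_mul]
        linear_combination (cycPow ω c' : ℂ) * this
      rcases Multiset.mem_add.1 hx with hx | hx <;> rcases Multiset.mem_add.1 hy with hy | hy
      · exact (hsw _ hshift hx hy).elim
      · exact ⟨(x.1 - c', x.2), y, rfl, rfl, Or.inl ⟨mem_shiftContent.1 hx, hy⟩⟩
      · exact ⟨x, (y.1 - c', y.2), rfl, rfl, Or.inr ⟨hx, mem_shiftContent.1 hy⟩⟩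
      · exact (hsw _ (hblock _) hx hy).elim

end Undo

/-! ### The map from flags to chains is injective -/

section Injectivity

variable {T m N k : ℕ} [NeZero T] {ω : ℂˣ} {z : Fin N → ℂ}

attribute [local instance] LieRing.ofAssociativeRing

lemma wedgeSplit_joinBlocks
    {f : fixedSubalgebra (cycShift T m) →ₗ[ℂ]
      fixedSubalgebra (cycShift T m) ⊗[ℂ] fixedSubalgebra (cycShift T m)} {p : ℕ}
    {g : Fin (p + 2) → FreeLieAlgebra ℂ (ZMod T × Fin m)} {a b : Fin (p + 1)} (hab : a ≤ b)
    {c : ZMod T} (hrest : ∀ d, f (orbitSum (b.removeNth (a.castSucc.removeNth g) d)) = 0)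
    (h : f (orbitSum ⁅shiftHom c (g b.succ), g a.castSucc⁆) =
        orbitSum (g b.succ) ⊗ₜ orbitSum (g a.castSucc) ∨
      f (orbitSum ⁅g a.castSucc, shiftHom c (g b.succ)⁆) =
        orbitSum (g a.castSucc) ⊗ₜ orbitSum (g b.succ)) :
    wedgeSplit f p (wedgeRev _ (p + 1)
      fun d => orbitSum (joinBlocks (fun h h' => ⁅shiftHom c h, h'⁆) g a b d)) =
      (-1 : ℂ) ^ ((a : ℕ) + (b + 1)) • wedgeRev _ (p + 2) fun d => orbitSum (g d) := by
  set G : Fin (p + 2) → fixedSubalgebra (cycShift T m) := fun d => orbitSum (g d) with hG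
  set w := wedgeRev _ p (b.removeNth (a.castSucc.removeNth G)) with hw
  have e1 : wedgeCons _ (p + 1) (G a.castSucc) (wedgeCons _ p (G b.succ) w) =
      (-1 : ℂ) ^ ((a : ℕ) + b) • wedgeRev _ (p + 2) G := by
    have e := wedgeRev_cons_removeNth (a.castSucc.removeNth G) b
    rw [show a.castSucc.removeNth G b = G b.succ by
      rw [Fin.removeNth, succAbove_castSucc_of_le hab]] at e
    rw [hw, wedgeCons_apply, e, map_smul, wedgeCons_apply, wedgeRev_cons_removeNth, smul_smul,
      ← pow_add, Fin.val_castSucc, Nat.add_comm b a]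
  have e2 : wedgeCons _ (p + 1) (G b.succ) (wedgeCons _ p (G a.castSucc) w) =
      (-1 : ℂ) ^ ((a : ℕ) + (b + 1)) • wedgeRev _ (p + 2) G := by
    rw [hw, wedgeCons_apply, wedgeCons_apply, wedgeRev_cons_cons_swap', ← wedgeCons_apply,
      ← wedgeCons_apply, ← hw, e1, smul_smul, ← add_assoc, pow_succ']
  have e3 : (fun d => orbitSum (joinBlocks (fun h h' => ⁅shiftHom c h, h'⁆) g a b d)) =
      (Fin.cons (orbitSum ⁅shiftHom c (g b.succ), g a.castSucc⁆)
        (b.removeNth (a.castSucc.removeNth G)) : Fin (p + 1) → _) := by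
    funext d
    refine Fin.cases rfl (fun d => rfl) d
  have hrest' : ∀ d, f (b.removeNth (a.castSucc.removeNth G) d) = 0 := hrest
  rw [e3]
  rw [wedgeSplit_cons_of_eq_tmul hrest' (h.imp id fun h => ?_), ← wedgeCons_apply,
    ← wedgeCons_apply, ← hw, e2]
  rw [← h, ← orbitMap_apply, ← orbitMap_apply, ← lie_skew, map_neg, map_neg, map_neg, neg_neg]

lemma exists_undo_join (hω : IsPrimitiveRoot ω T) (k : ℕ) {L : AffineSubspace ℂ (Fin m → ℂ)}
    (h0 : ∀ i, ¬ L ≤ hyperplaneT0 i) (h0' : ∀ i j (c : ZMod T), ¬ L ≤ hyperplaneTZ ω z i j c)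
    {i i' : Fin m} (hii : i ≠ i') {c : ZMod T} (hi : L ≤ hyperplaneTT ω i i' c) :
    ∃ h : ChainSpace (cycShift T m) N k →ₗ[ℂ] ChainSpace (cycShift T m) N (k + 1),
      IsUndo ω z L (hyperplaneTT ω i i' c) h := by
  cases k with
  | zero =>
    refine ⟨0, fun A A₀ A' g u v hc hle t ht => ?_⟩
    obtain ⟨p, -⟩ := exists_join_of_edge hω h0 h0' hi hc hle ht
    exact p.1.1.elim0
  | succ p =>
    obtain ⟨f, hf, hf'⟩ := exists_fixed_split (T := T) hii
    refine ⟨LinearMap.rTensor _ (wedgeSplit f p), fun A A₀ A' g u v hc hle t ht => ?_⟩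
    obtain ⟨⟨⟨a, b⟩, hab⟩, c', rfl, x, y, rfl, rfl, hxy⟩ :=
      exists_join_of_edge hω h0 h0' hi hc hle ht
    have hml := hc.multilinear
    have hone : ∀ {d} {x : ZMod T × Fin m}, x ∈ A d → ((A d).map Prod.snd).count x.2 = 1 :=
      fun hx => hml.count_eq_one (o := Sum.inl _) hx
    have hzero : ∀ {d d'} {x : ZMod T × Fin m}, x ∈ A d → d' ≠ d →
        ((A d').map Prod.snd).count x.2 = 0 := fun hx hd =>
      hml.count_eq_zero (o := Sum.inl _) (o' := Sum.inl _) hx fun h => hd (Sum.inl_injective h)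
    have hne : b.succ ≠ a.castSucc := (Fin.castSucc_lt_succ_iff.2 hab).ne'
    have key := wedgeSplit_joinBlocks (f := f) (g := g) (c := c') hab ?_ ?_
    · rw [ChainTerm.chain, monomial, LinearMap.rTensor_tmul]
      refine (congrArg (fun w => w ⊗ₜ[ℂ] (u ⊗ₜ[ℂ] PiTensorProduct.tprod ℂ v)) key).trans ?_
      exact TensorProduct.smul_tmul' _ _ _
    · intro d
      have h1 : a.castSucc.succAbove (b.succAbove d) ≠ a.castSucc := Fin.succAbove_ne _ _
      have h2 : a.castSucc.succAbove (b.succAbove d) ≠ b.succ := by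
        rw [← succAbove_castSucc_of_le hab]
        exact fun h => Fin.succAbove_ne _ _ (Fin.succAbove_right_injective h)
      refine hf _ _ (hc.blocks _) ?_ ?_ <;> rcases hxy with ⟨hx, hy⟩ | ⟨hx, hy⟩
      · exact hzero hx h2
      · exact hzero hx h1
      · exact hzero hy h1
      · exact hzero hy h2
    · rcases hxy with ⟨hx, hy⟩ | ⟨hx, hy⟩
      · left
        rw [hf' _ _ _ _ ((hc.blocks b.succ).shiftHom c') (hc.blocks a.castSucc),
          orbitSum_shiftHom]
        · rw [shiftContent_map_snd]; exact hone hx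
        · rw [shiftContent_map_snd]; exact hzero hy hne
        · exact hone hy
        · exact hzero hx hne.symm
      · right
        rw [hf' _ _ _ _ (hc.blocks a.castSucc) ((hc.blocks b.succ).shiftHom c'),
          orbitSum_shiftHom]
        · exact hone hx
        · exact hzero hy hne.symm
        · rw [shiftContent_map_snd]; exact hone hy
        · rw [shiftContent_map_snd]; exact hzero hx hne

lemma exists_undo (hω : IsPrimitiveRoot ω T) (hz0 : ∀ j, z j ≠ 0)
    (hz : ∀ i j, i ≠ j → ∀ n : ℕ, z i ≠ (ω : ℂ) ^ n * z j) (k : ℕ)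
    {L : AffineSubspace ℂ (Fin m → ℂ)} (hL : IsEdge (cycArrangement T m ω z) L) (hL' : L ≠ ⊤) :
    ∃ H ∈ cycArrangement T m ω z, L ≤ H ∧
      ∃ h : ChainSpace (cycShift T m) N k →ₗ[ℂ] ChainSpace (cycShift T m) N (k + 1),
        IsUndo ω z L H h := by
  by_cases h0 : ∃ i, L ≤ hyperplaneT0 i
  · obtain ⟨i, hi⟩ := h0
    exact ⟨_, Or.inr (Or.inr ⟨i, rfl⟩), hi, exists_undo_origin hω hz0 k hi⟩
  by_cases h0' : ∃ i j, ∃ c : ZMod T, L ≤ hyperplaneTZ ω z i j c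
  · obtain ⟨i, j, c, hi⟩ := h0'
    exact ⟨_, Or.inr (Or.inl ⟨i, j, c, rfl⟩), hi, exists_undo_site hω hz0 hz k hi⟩
  push Not at h0 h0'
  obtain ⟨-, S, hS, hLS⟩ := hL
  obtain ⟨H, hH⟩ : S.Nonempty := by
    rw [Set.nonempty_iff_ne_empty]
    rintro rfl
    exact hL' (by rw [hLS, sInf_empty])
  have hLH : L ≤ H := hLS ▸ sInf_le hH
  rcases hS hH with ⟨i, i', c, hii, rfl⟩ | ⟨i, j, c, rfl⟩ | ⟨i, rfl⟩
  · exact ⟨_, hS hH, hLH, exists_undo_join hω k h0 h0' hii hLH⟩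
  · exact (h0' i j c hLH).elim
  · exact (h0 i hLH).elim

lemma IsUndo.apply (hω : IsPrimitiveRoot ω T) (hz0 : ∀ j, z j ≠ 0)
    (hz : ∀ i j, i ≠ j → ∀ n : ℕ, z i ≠ (ω : ℂ) ^ n * z j) {L H : AffineSubspace ℂ (Fin m → ℂ)}
    {h : ChainSpace (cycShift T m) N k →ₗ[ℂ] ChainSpace (cycShift T m) N (k + 1)}
    (hh : IsUndo ω z L H h) (hH : H ∈ cycArrangement T m ω z) (hL : L ≠ ⊥)
    {L₀ : AffineSubspace ℂ (Fin m → ℂ)} {x : ChainSpace (cycShift T m) N (k + 1)}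
    (hx : IsSignedMonomial ω z L₀ x) (hLL : L = L₀ ⊓ H) (hle : ¬ L₀ ≤ H) :
    h (edgeProj ω z k L (chainD (cycShift T m) N k x)) = x := by
  obtain ⟨n, A, A₀, A', g, u, v, hc, rfl, rfl⟩ := hx
  obtain ⟨place, tw, hp⟩ := hc.multilinear.exists_placement
  obtain ⟨t, ht⟩ := ChainTerm.exists_edge_eq_inf hω hp hc.ne_zero hH (hLL ▸ hL) hle
  rw [map_smul, map_smul, map_smul, hLL, ← ht, hc.edgeProj_chainD_edge hω hz0 hz, map_smul,
    hh A A₀ A' g u v hc hle t (ht.trans hLL.symm), smul_smul, smul_smul, mul_assoc, ← mul_pow]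
  simp

omit [NeZero T] in
lemma ne_top_of_mem_cycArrangement (hz0 : ∀ j, z j ≠ 0) {H : AffineSubspace ℂ (Fin m → ℂ)}
    (hH : H ∈ cycArrangement T m ω z) : H ≠ ⊤ := by
  rintro rfl
  rcases hH with ⟨i, i', c, hii, h⟩ | ⟨i, j, c, h⟩ | ⟨i, h⟩
  · have := mem_hyperplaneTT.1 (h.le (AffineSubspace.mem_top ℂ (Fin m → ℂ) (Pi.single i (1 : ℂ))))
    simp [hii.symm] at this
  · have := mem_hyperplaneTZ.1 (h.le (AffineSubspace.mem_top ℂ (Fin m → ℂ) (0 : Fin m → ℂ)))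
    exact (mul_ne_zero (Units.ne_zero _) (hz0 j)) this.symm
  · have := mem_hyperplaneT0.1 (h.le (AffineSubspace.mem_top ℂ (Fin m → ℂ) (1 : Fin m → ℂ)))
    exact one_ne_zero this

open Classical in
/-- The linear coefficients of an element of the free Lie algebra. -/
def linearPart (X : Type) : FreeLieAlgebra ℂ X →ₗ[ℂ] (X → ℂ) :=
  LinearMap.pi fun x => (FreeLieAlgebra.lift ℂ fun y => if y = x then (1 : ℂ) else 0).toLinearMap

open Classical in
lemma linearPart_of {X : Type} (x y : X) :
    linearPart X (FreeLieAlgebra.of ℂ y) x = if y = x then 1 else 0 := by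
  exact FreeLieAlgebra.lift_of_apply _ _

/-- A linear functional that detects the chain `f̄_1 ∧ ⋯ ∧ f̄_m ⊗ 1 ⊗ ⋯ ⊗ 1`. -/
lemma exists_functional_baseChain (T N m : ℕ) [NeZero T] :
    ∃ ℓ : ChainSpace (cycShift T m) N m →ₗ[ℂ] ℂ, ℓ (baseChain N rfl) = 1 := by
  set c : fixedSubalgebra (cycShift T m) →ₗ[ℂ] (Fin m → ℂ) :=
    LinearMap.funLeft ℂ ℂ (fun i => ((0 : ZMod T), i)) ∘ₗ linearPart _ ∘ₗ
      (fixedSubalgebra (cycShift T m)).toSubmodule.subtype with hc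
  have hcf : ∀ i, c (orbitSum (gen T i)) = Pi.single i 1 := by
    intro i
    funext j
    change linearPart _ (orbitSum (gen T i) : FreeLieAlgebra ℂ (ZMod T × Fin m)) (0, j) = _
    rw [coe_orbitSum, map_sum, Finset.sum_apply, Finset.sum_eq_single 0]
    · simp [shiftHom, gen, linearPart_of, Pi.single_apply, eq_comm]
    · intro b _ hb
      simp [shiftHom, gen, linearPart_of, hb]
    · simp
  set ε := (UniversalEnvelopingAlgebra.lift ℂ
    (0 : FreeLieAlgebra ℂ (ZMod T × Fin m) →ₗ⁅ℂ⁆ ℂ)).toLinearMap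
  set ε' := (UniversalEnvelopingAlgebra.lift ℂ
    (0 : fixedSubalgebra (cycShift T m) →ₗ⁅ℂ⁆ ℂ)).toLinearMap
  refine ⟨(LinearMap.mul' ℂ ℂ) ∘ₗ TensorProduct.map
    (exteriorPower.alternatingMapLinearEquiv (Matrix.detRowAlternating.compLinearMap c))
    ((LinearMap.mul' ℂ ℂ) ∘ₗ TensorProduct.map ε' (PiTensorProduct.lift
      ((MultilinearMap.mkPiAlgebra ℂ (Fin N) ℂ).compLinearMap fun _ => ε))), ?_⟩
  have hdet : Matrix.detRowAlternating (fun i => c (orbitSum (gen T i))) = 1 := by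
    rw [← Matrix.det_one (n := Fin m) (R := ℂ)]
    congr 1
    ext i j
    rw [hcf, Matrix.one_apply, Pi.single_apply]
    simp [eq_comm]
  have hε : ε 1 = 1 := map_one (UniversalEnvelopingAlgebra.lift ℂ
    (0 : FreeLieAlgebra ℂ (ZMod T × Fin m) →ₗ⁅ℂ⁆ ℂ))
  have hε' : ε' 1 = 1 := map_one (UniversalEnvelopingAlgebra.lift ℂ
    (0 : fixedSubalgebra (cycShift T m) →ₗ⁅ℂ⁆ ℂ))
  rw [baseChain, LinearMap.comp_apply, TensorProduct.map_tmul, LinearMap.comp_apply,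
    TensorProduct.map_tmul, exteriorPower.alternatingMapLinearEquiv_apply_ιMulti,
    PiTensorProduct.lift.tprod, hε']
  simp only [Fin.cast_refl, id, AlternatingMap.compLinearMap_apply] at *
  simp [hdet, hε]

lemma exists_leftInverse_flagToChain (hω : IsPrimitiveRoot ω T) (hz0 : ∀ j, z j ≠ 0)
    (hz : ∀ i j, i ≠ j → ∀ n : ℕ, z i ≠ (ω : ℂ) ^ n * z j) : ∀ (q p : ℕ) (h : p + q = m),
    ∃ β : ChainSpace (cycShift T m) N p →ₗ[ℂ] FlagSpace (cycArrangement T m ω z) q,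
      ∀ F, β (flagChain ω z q p h F) = FlagSpace.mk F
  | 0, p, h => by
    have h' : p = m := h
    subst h'
    by_cases hF : Nonempty (Flag (cycArrangement T p ω z) 0)
    · obtain ⟨F₀⟩ := hF
      obtain ⟨ℓ, hℓ⟩ := exists_functional_baseChain T N p
      refine ⟨LinearMap.toSpanSingleton ℂ _ (FlagSpace.mk F₀) ∘ₗ ℓ, fun F => ?_⟩
      have hFF : F = F₀ := Flag.ext (funext fun j => by
        obtain rfl : j = 0 := Fin.ext (by omega)
        rw [F.edge_zero, F₀.edge_zero])
      rw [flagChain, LinearMap.comp_apply, hℓ, hFF]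
      simp
    · exact ⟨0, fun F => (hF ⟨F⟩).elim⟩
  | q + 1, p, h => by
    classical
    obtain ⟨β, hβ⟩ := exists_leftInverse_flagToChain hω hz0 hz q (p + 1) (by omega)
    have hex : ∀ L : AffineSubspace ℂ (Fin m → ℂ), ∃ (H : AffineSubspace ℂ (Fin m → ℂ))
        (h : ChainSpace (cycShift T m) N p →ₗ[ℂ] ChainSpace (cycShift T m) N (p + 1)),
        IsEdge (cycArrangement T m ω z) L → L ≠ ⊤ →
          H ∈ cycArrangement T m ω z ∧ L ≤ H ∧ IsUndo ω z L H h := by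
      intro L
      by_cases hL : IsEdge (cycArrangement T m ω z) L ∧ L ≠ ⊤
      · obtain ⟨H, hH, hLH, h, hh⟩ := exists_undo hω hz0 hz p hL.1 hL.2
        exact ⟨H, h, fun _ _ => ⟨hH, hLH, hh⟩⟩
      · exact ⟨⊤, 0, fun h1 h2 => (hL ⟨h1, h2⟩).elim⟩
    choose H η hη using hex
    have htop : ∀ G : Flag (cycArrangement T m ω z) (q + 1), G.last ≠ ⊤ := by
      intro G hG
      have := G.finrank_last
      rw [hG, AffineSubspace.direction_top, finrank_top] at this
      simp at this
    have hη' := fun G : Flag (cycArrangement T m ω z) (q + 1) =>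
      hη G.last (G.isEdge _) (htop G)
    set β' : ChainSpace (cycShift T m) N p →ₗ[ℂ] FlagSpace (cycArrangement T m ω z) (q + 1) :=
      ∑ L ∈ Finset.univ.image (Flag.last (𝒞 := cycArrangement T m ω z) (k := q + 1)),
        flagExt _ q L ∘ₗ β ∘ₗ η L ∘ₗ edgeProj ω z p L with hβ'
    have key : ∀ G : Flag (cycArrangement T m ω z) (q + 1), ¬ G.init.last ≤ H G.last →
        β' (flagChain ω z (q + 1) p h G) = FlagSpace.mk G := by
      intro G hG
      obtain ⟨h1, h2, h3⟩ := hη' G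
      rw [hβ', LinearMap.sum_apply, Finset.sum_eq_single G.last]
      · simp only [LinearMap.comp_apply]
        rw [(flagChain_isSignedMonomial hω hz0 hz (q + 1) p h G).edgeProj_apply, if_pos rfl,
          flagChain, h3.apply hω hz0 hz h1 G.last_ne_bot
            (flagChain_isSignedMonomial hω hz0 hz q (p + 1) _ G.init) (G.last_eq_inf h2 hG) hG,
          hβ, flagExt_mk_init]
      · intro L _ hL
        simp only [LinearMap.comp_apply]
        rw [(flagChain_isSignedMonomial hω hz0 hz (q + 1) p h G).edgeProj_apply, if_neg hL.symm,
          map_zero, map_zero, map_zero]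
      · exact fun hn => (hn (Finset.mem_image_of_mem _ (Finset.mem_univ _))).elim
    refine ⟨β', fun F => ?_⟩
    obtain ⟨h1, h2, -⟩ := hη' F
    have hmem := mk_mem_span_not_le F (ne_top_of_mem_cycArrangement hz0 h1)
    have heq : Set.EqOn (β' ∘ₗ flagToChain hω hz0 hz (q + 1) p h)
        (LinearMap.id : FlagSpace (cycArrangement T m ω z) (q + 1) →ₗ[ℂ] _)
        {x | ∃ G' : Flag (cycArrangement T m ω z) (q + 1), G'.last = F.last ∧
          ¬ G'.init.last ≤ H F.last ∧ x = FlagSpace.mk G'} := by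
      rintro _ ⟨G, hG1, hG2, rfl⟩
      rw [LinearMap.comp_apply, flagToChain_mk, LinearMap.id_apply]
      exact key G (hG1 ▸ hG2)
    have := LinearMap.eqOn_span heq hmem
    rwa [LinearMap.comp_apply, flagToChain_mk, LinearMap.id_apply] at this

lemma flagToChain_injective (hω : IsPrimitiveRoot ω T) (hz0 : ∀ j, z j ≠ 0)
    (hz : ∀ i j, i ≠ j → ∀ n : ℕ, z i ≠ (ω : ℂ) ^ n * z j) (q p : ℕ) (h : p + q = m) :
    Function.Injective (flagToChain hω hz0 hz q p h) := by
  obtain ⟨β, hβ⟩ := exists_leftInverse_flagToChain hω hz0 hz q p h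
  have e : β ∘ₗ flagToChain hω hz0 hz q p h = LinearMap.id :=
    FlagSpace.hom_ext fun F => by rw [LinearMap.comp_apply, flagToChain_mk, hβ, LinearMap.id_apply]
  exact Function.LeftInverse.injective fun x => LinearMap.congr_fun e x

end Injectivity

/-! ### Multilinear monomials and the recursive rules -/

section Multilinear

variable {T m N k : ℕ}

attribute [local instance] LieRing.ofAssociativeRing

lemma degIndex_cycShift (x : ZMod T × Fin m) : degIndex T m (cycShift T m x) = degIndex T m x :=
  rfl

lemma degSum_single {X I : Type} [DecidableEq I] (f : X → I) (A : Multiset X) (i : I) :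
    degSum (fun x => Pi.single (f x) 1) A i = (A.map f).count i := by
  induction A using Multiset.induction_on with
  | empty => simp
  | cons x A ih =>
    rw [← Multiset.singleton_add, map_add, Pi.add_apply, ih, degSum_singleton, Multiset.map_add,
      Multiset.count_add, Multiset.map_singleton, Multiset.count_singleton, Pi.single_apply]

lemma degSum_single_eq_one_iff {X I : Type} [Fintype I] [DecidableEq I] (f : X → I)
    (A : Multiset X) :
    degSum (fun x => Pi.single (f x) 1) A = (1 : I → ℕ) ↔ A.map f = Finset.univ.val := by
  rw [Multiset.ext, funext_iff]
  refine forall_congr' fun i => ?_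
  rw [degSum_single, Multiset.count_univ, Pi.one_apply]

lemma isMultilinear_iff {A : Fin k → Multiset (ZMod T × Fin m)} {A₀ : Multiset (ZMod T × Fin m)}
    {A' : Fin N → Multiset (ZMod T × Fin m)} :
    IsMultilinear A A₀ A' ↔ degSum (degIndex T m) (totalContent A A₀ A') = 1 := by
  exact (degSum_single_eq_one_iff Prod.snd _).symm

variable [NeZero T] {A : Fin k → Multiset (ZMod T × Fin m)} {A₀ : Multiset (ZMod T × Fin m)}
  {A' : Fin N → Multiset (ZMod T × Fin m)} {g : Fin k → FreeLieAlgebra ℂ (ZMod T × Fin m)}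
  {u : UniversalEnvelopingAlgebra ℂ (fixedSubalgebra (cycShift T m))}
  {v : Fin N → UniversalEnvelopingAlgebra ℂ (FreeLieAlgebra ℂ (ZMod T × Fin m))}

lemma IsConfig.mem_weightChain (h : IsConfig A A₀ A' g u v) :
    monomial g u v ∈ weightChain (cycShift T m) (degIndex T m) N k 1 := by
  have := h.isMonomialChain.mem_weightChain degIndex_cycShift
  rwa [isMultilinear_iff.1 h.multilinear] at this

lemma HasContent.eq_zero (h : HasContent A A₀ A' g u v) (hn : ¬ IsMultilinear A A₀ A')
    (hx : monomial g u v ∈ weightChain (cycShift T m) (degIndex T m) N k 1) :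
    monomial g u v = 0 := by
  by_contra h0
  exact hn (isMultilinear_iff.2 (weightChain_disjoint cycShift_pow_self (NeZero.ne T)
    degIndex_cycShift (h.isMonomialChain.mem_weightChain degIndex_cycShift) hx h0))

omit [NeZero T] in
lemma EnvMonomial.isMonomial {B : Multiset (ZMod T × Fin m)}
    {w : UniversalEnvelopingAlgebra ℂ (FreeLieAlgebra ℂ (ZMod T × Fin m))}
    (h : EnvMonomial IsCommutator B w) : IsMonomial w := by
  induction h with
  | one => exact ⟨[], by simp, rfl⟩
  | mul hg _ ih =>
    obtain ⟨l, hl, rfl⟩ := ih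
    exact ⟨_ :: l, List.forall_mem_cons.2 ⟨⟨_, hg⟩, hl⟩, rfl⟩

lemma EnvMonomial.isProjMonomial {B : Multiset (ZMod T × Fin m)}
    {w : UniversalEnvelopingAlgebra ℂ (fixedSubalgebra (cycShift T m))}
    (h : EnvMonomial (IsCycCommutator cycShift_pow_self) B w) : IsProjMonomial w := by
  induction h with
  | one => exact ⟨[], by simp, rfl⟩
  | mul hg _ ih =>
    obtain ⟨l, hl, rfl⟩ := ih
    obtain ⟨f, hf, rfl⟩ := hg
    refine ⟨f :: l, List.forall_mem_cons.2 ⟨⟨_, hf⟩, hl⟩, ?_⟩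
    rw [← orbitSum_eq_cycSum]
    rfl

omit [NeZero T] in
lemma IsMonomial.exists_content
    {w : UniversalEnvelopingAlgebra ℂ (FreeLieAlgebra ℂ (ZMod T × Fin m))} (h : IsMonomial w) :
    ∃ B, EnvMonomial IsCommutator B w := by
  obtain ⟨l, hl, rfl⟩ := h
  induction l with
  | nil => exact ⟨0, EnvMonomial.one⟩
  | cons f l ih =>
    obtain ⟨⟨B, hB⟩, hl⟩ := List.forall_mem_cons.1 hl
    obtain ⟨C, hC⟩ := ih hl
    exact ⟨B + C, EnvMonomial.mul hB hC⟩

lemma IsProjMonomial.exists_content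
    {w : UniversalEnvelopingAlgebra ℂ (fixedSubalgebra (cycShift T m))} (h : IsProjMonomial w) :
    ∃ B, EnvMonomial (IsCycCommutator cycShift_pow_self) B w := by
  obtain ⟨l, hl, rfl⟩ := h
  induction l with
  | nil => exact ⟨0, EnvMonomial.one⟩
  | cons f l ih =>
    obtain ⟨⟨B, hB⟩, hl⟩ := List.forall_mem_cons.1 hl
    obtain ⟨C, hC⟩ := ih hl
    exact ⟨B + C, EnvMonomial.mul hB.orbitSum hC⟩

omit [NeZero T] in
lemma alternatingMap_comp_perm {L E : Type*} [AddCommGroup L] [Module ℂ L] [AddCommGroup E]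
    [Module ℂ E] (F : L [⋀^Fin k]→ₗ[ℂ] E) (s : Equiv.Perm (Fin k)) (f : Fin k → L) :
    F (fun i => f (s i)) = ((Equiv.Perm.sign s : ℤ) : ℂ) • F f := by
  refine (F.map_perm f s).trans ?_
  rcases Int.units_eq_one_or (Equiv.Perm.sign s) with h | h <;> rw [h] <;> simp

end Multilinear

namespace ChainTerm

variable {T m N k : ℕ} [NeZero T]

attribute [local instance] LieRing.ofAssociativeRing

omit [NeZero T] in
lemma shiftHom_zero (g : FreeLieAlgebra ℂ (ZMod T × Fin m)) : shiftHom 0 g = g := by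
  rw [shiftHom]
  convert permHom_one g using 2
  ext x
  simp

omit [NeZero T] in
lemma shiftContent_zero (B : Multiset (ZMod T × Fin m)) : shiftContent 0 B = B := by
  rw [shiftContent]
  convert Multiset.map_id B using 2
  ext <;> simp

/-- The term in which the first factor goes to the origin. -/
def toOrigin : ChainTerm T N k := Sum.inl 0

/-- The term in which the first factor goes to the site `j`, without a twist. -/
def toSite (j : Fin N) : ChainTerm T N k := Sum.inr (Sum.inl (0, j, 0))

/-- The term in which the first two factors are joined, without a twist. -/
def toJoin : ChainTerm T N (k + 1) := Sum.inr (Sum.inr (⟨(0, 0), le_rfl⟩, 0))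

variable (g : Fin k → FreeLieAlgebra ℂ (ZMod T × Fin m))
  (g₁ g₂ : FreeLieAlgebra ℂ (ZMod T × Fin m))
  (u : UniversalEnvelopingAlgebra ℂ (fixedSubalgebra (cycShift T m)))
  (v : Fin N → UniversalEnvelopingAlgebra ℂ (FreeLieAlgebra ℂ (ZMod T × Fin m)))

lemma chain_toOrigin : (-1 : ℂ) ^ (toOrigin : ChainTerm T N k).parity •
    (toOrigin : ChainTerm T N k).chain (Fin.cons g₁ g) u v =
      monomial g (UniversalEnvelopingAlgebra.ι ℂ (orbitSum g₁) * u) v := by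
  simp only [toOrigin, parity, chain, blocks, originPart, sitePart, Fin.val_zero, pow_zero,
    one_smul, Fin.cons_zero]
  rfl

lemma chain_toSite (j : Fin N) : (-1 : ℂ) ^ (toSite j : ChainTerm T N k).parity •
    (toSite j : ChainTerm T N k).chain (Fin.cons g₁ g) u v =
      monomial g u (Function.update v j (UniversalEnvelopingAlgebra.ι ℂ g₁ * v j)) := by
  simp only [toSite, parity, chain, blocks, originPart, sitePart, Fin.val_zero, pow_zero,
    one_smul, Fin.cons_zero, shiftHom_zero]
  rfl

lemma chain_toJoin : (-1 : ℂ) ^ (toJoin : ChainTerm T N (k + 1)).parity •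
    (toJoin : ChainTerm T N (k + 1)).chain (Fin.cons g₁ (Fin.cons g₂ g : Fin (k + 1) → _)) u v =
      monomial (Fin.cons ⁅g₁, g₂⁆ g) u v := by
  have h1 : (toJoin : ChainTerm T N (k + 1)).blocks
      (Fin.cons g₁ (Fin.cons g₂ g : Fin (k + 1) → _)) = Fin.cons ⁅g₂, g₁⁆ g := by
    simp only [toJoin, blocks, joinBlocks, shiftHom_zero]
    rfl
  have h2 : ∀ f : FreeLieAlgebra ℂ (ZMod T × Fin m),
      wedgeRev (fixedSubalgebra (cycShift T m)) (k + 1)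
        (fun i => orbitSum ((Fin.cons f g : Fin (k + 1) → _) i)) =
      wedgeCons _ k (orbitMap T m f) (wedgeRev _ k fun i => orbitSum (g i)) := by
    intro f
    rw [wedgeCons_apply, orbitMap_apply]
    congr 1
    funext b
    exact Fin.cases rfl (fun b => rfl) b
  have h3 : (-1 : ℂ) ^ (toJoin : ChainTerm T N (k + 1)).parity = -1 := by
    simp [toJoin, parity]
  rw [h3, chain, h1, monomial, monomial, h2, h2, ← lie_skew g₂ g₁, map_neg, map_neg,
    TensorProduct.smul_tmul', ]
  simp only [originPart, sitePart, toJoin]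
  congr 1
  rw [← LinearMap.smul_apply]
  congr 1
  module

variable {A : Fin k → Multiset (ZMod T × Fin m)} {A₀ B B' : Multiset (ZMod T × Fin m)}
  {A' : Fin N → Multiset (ZMod T × Fin m)} {ω : ℂˣ} {z : Fin N → ℂ}

omit [NeZero T] in
lemma siteContent_toSite (j : Fin N) : (toSite j : ChainTerm T N k).siteContent
    (Fin.cons B A) A' = Function.update A' j (B + A' j) := by
  simp only [siteContent, toSite, Fin.cons_zero, shiftContent_zero]

omit [NeZero T] in
lemma blockContent_toJoin : (toJoin : ChainTerm T N (k + 1)).blockContent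
    (Fin.cons B (Fin.cons B' A : Fin (k + 1) → _)) = Fin.cons (B + B') A := by
  simp only [toJoin, blockContent, joinBlocks, shiftContent_zero]
  rw [add_comm B B']
  rfl

lemma coe_edge_toOrigin (hω : IsPrimitiveRoot ω T) :
    ((toOrigin : ChainTerm T N k).edge ω z (Fin.cons B A) A₀ A' : Set (Fin m → ℂ)) =
      (chainEdge ω z (Fin.cons B A : Fin (k + 1) → _) A₀ A' : Set (Fin m → ℂ)) ∩
        anchored ω 0 B := by
  ext t
  rw [Set.mem_inter_iff, SetLike.mem_coe, SetLike.mem_coe]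
  refine ⟨fun h => ⟨edge_le hω _ h, ?_⟩, ?_⟩
  · rw [edge, mem_chainEdge hω] at h
    exact (anchored_add.1 h.2.1).1
  · rw [edge, mem_chainEdge hω, mem_chainEdge hω]
    exact fun h => ⟨fun b => h.1.1 b.succ, anchored_add.2 ⟨h.2, h.1.2.1⟩, h.1.2.2⟩

lemma coe_edge_toSite (hω : IsPrimitiveRoot ω T) (j : Fin N) :
    ((toSite j : ChainTerm T N k).edge ω z (Fin.cons B A) A₀ A' : Set (Fin m → ℂ)) =
      (chainEdge ω z (Fin.cons B A : Fin (k + 1) → _) A₀ A' : Set (Fin m → ℂ)) ∩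
        anchored ω (z j) B := by
  ext t
  rw [Set.mem_inter_iff, SetLike.mem_coe, SetLike.mem_coe]
  refine ⟨fun h => ⟨edge_le hω _ h, ?_⟩, ?_⟩
  · rw [edge, mem_chainEdge hω] at h
    have := h.2.2 j
    rw [siteContent_toSite, Function.update_self] at this
    exact (anchored_add.1 this).1
  · rw [edge, mem_chainEdge hω, mem_chainEdge hω]
    refine fun h => ⟨fun b => h.1.1 b.succ, h.1.2.1, fun j' => ?_⟩
    rw [siteContent_toSite]
    rcases eq_or_ne j' j with rfl | hj
    · rw [Function.update_self]
      exact anchored_add.2 ⟨h.2, h.1.2.2 j'⟩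
    · rw [Function.update_of_ne hj]
      exact h.1.2.2 j'

lemma coe_edge_toJoin (hω : IsPrimitiveRoot ω T) :
    ((toJoin : ChainTerm T N (k + 1)).edge ω z
        (Fin.cons B (Fin.cons B' A : Fin (k + 1) → _)) A₀ A' : Set (Fin m → ℂ)) =
      (chainEdge ω z (Fin.cons B (Fin.cons B' A : Fin (k + 1) → _) : Fin (k + 1 + 1) → _) A₀ A' :
        Set (Fin m → ℂ)) ∩ swimming ω (B + B') := by
  ext t
  rw [Set.mem_inter_iff, SetLike.mem_coe, SetLike.mem_coe]
  refine ⟨fun h => ⟨edge_le hω _ h, ?_⟩, ?_⟩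
  · rw [edge, mem_chainEdge hω, blockContent_toJoin] at h
    exact h.1 0
  · rw [edge, mem_chainEdge hω, mem_chainEdge hω, blockContent_toJoin]
    refine fun h => ⟨fun b => ?_, h.1.2⟩
    refine Fin.cases h.2 (fun b => ?_) b
    exact h.1.1 b.succ.succ

end ChainTerm

/-! ### The recursive rules determine the maps -/

section Reach

variable {T m N : ℕ} [NeZero T] {ω : ℂˣ} {z : Fin N → ℂ} {k q p : ℕ}

attribute [local instance] LieRing.ofAssociativeRing

variable (ω z) in
/-- Up to a sign, `x` is the chain of a flag with last edge `L`, and the recursive rules force the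
image of `x` to be that flag. -/
def Reached (q : ℕ) (h : p + q = m) (L : Set (Fin m → ℂ)) (x : ChainSpace (cycShift T m) N p) :
    Prop :=
  ∃ (F : Flag (cycArrangement T m ω z) q) (s : ℤˣ), (F.last : Set (Fin m → ℂ)) = L ∧
    x = ((s : ℤ) : ℂ) • flagChain ω z q p h F ∧
    ∀ ψ, IsPsi ω z ψ → ∀ y : MultilinearChains T m N p, (y : ChainSpace (cycShift T m) N p) = x →
      ψ p q h y = (s : ℤ) • FlagSpace.mk F

omit [NeZero T] in
lemma sign_smul_smul {E : Type*} [AddCommGroup E] [Module ℂ E] (s : ℤˣ) (x : E) :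
    ((s : ℤ) : ℂ) • ((s : ℤ) : ℂ) • x = x := by
  rcases Int.units_eq_one_or s with rfl | rfl <;> simp

omit [NeZero T] in
lemma smul_eq_sign_smul {E : Type*} [AddCommGroup E] [Module ℂ E] (s : ℤˣ) (x : E) :
    (s : ℤ) • x = ((s : ℤ) : ℂ) • x := by
  rw [Int.cast_smul_eq_zsmul]

lemma Reached.sign_smul {h : p + q = m} {L : Set (Fin m → ℂ)}
    {x : ChainSpace (cycShift T m) N p} (hx : Reached ω z q h L x) (ε : ℤˣ) :
    Reached ω z q h L (((ε : ℤ) : ℂ) • x) := by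
  obtain ⟨F, s, h1, h2, h3⟩ := hx
  refine ⟨F, ε * s, h1, ?_, fun ψ hψ y hy => ?_⟩
  · rw [h2, smul_smul]
    simp
  · have h4 := h3 ψ hψ (((ε : ℤ) : ℂ) • y) (by
      rw [Submodule.coe_smul, hy]
      exact sign_smul_smul (E := ChainSpace (cycShift T m) N p) ε x)
    rw [map_smul] at h4
    rw [← sign_smul_smul ε (ψ p q h y), h4, Units.val_mul, mul_smul, smul_eq_sign_smul ε]

lemma ChainTerm.isEdge_edge (hω : IsPrimitiveRoot ω T)
    {A : Fin (k + 1) → Multiset (ZMod T × Fin m)} {A₀ : Multiset (ZMod T × Fin m)}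
    {A' : Fin N → Multiset (ZMod T × Fin m)} {g : Fin (k + 1) → FreeLieAlgebra ℂ (ZMod T × Fin m)}
    {u : UniversalEnvelopingAlgebra ℂ (fixedSubalgebra (cycShift T m))}
    {v : Fin N → UniversalEnvelopingAlgebra ℂ (FreeLieAlgebra ℂ (ZMod T × Fin m))}
    (h : IsConfig A A₀ A' g u v) (t : ChainTerm T N k) :
    IsEdge (cycArrangement T m ω z) (t.edge ω z A A₀ A') ∧
      Module.finrank ℂ (t.edge ω z A A₀ A').direction = k := by
  obtain ⟨place, tw, hp⟩ := (h.term t).multilinear.exists_placement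
  exact ⟨hp.isEdge hω (h.term t).ne_zero, hp.finrank_direction hω (h.term t).ne_zero⟩

section

variable {A : Fin (k + 1) → Multiset (ZMod T × Fin m)} {A₀ : Multiset (ZMod T × Fin m)}
  {A' : Fin N → Multiset (ZMod T × Fin m)} {g : Fin (k + 1) → FreeLieAlgebra ℂ (ZMod T × Fin m)}
  {u : UniversalEnvelopingAlgebra ℂ (fixedSubalgebra (cycShift T m))}
  {v : Fin N → UniversalEnvelopingAlgebra ℂ (FreeLieAlgebra ℂ (ZMod T × Fin m))}
  (hω : IsPrimitiveRoot ω T) (hz0 : ∀ j, z j ≠ 0)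
  (hz : ∀ i j, i ≠ j → ∀ n : ℕ, z i ≠ (ω : ℂ) ^ n * z j)
include hω hz0 hz

lemma IsConfig.flagChain_term (hc : IsConfig A A₀ A' g u v) (t : ChainTerm T N k)
    (h : k + 1 + q = m) (h' : k + (q + 1) = m) {s : ℤˣ} {F : Flag (cycArrangement T m ω z) q}
    {F' : Flag (cycArrangement T m ω z) (q + 1)}
    (hF : monomial g u v = ((s : ℤ) : ℂ) • flagChain ω z q (k + 1) h F) (hF' : F'.init = F)
    (hlast : F'.last = t.edge ω z A A₀ A') :
    (-1 : ℂ) ^ t.parity • t.chain g u v = ((s : ℤ) : ℂ) • flagChain ω z (q + 1) k h' F' := by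
  rw [flagChain, hF', hlast, ← hc.edgeProj_chainD_edge hω hz0 hz, hF, map_smul, map_smul]

lemma Reached.of_term (hc : IsConfig A A₀ A' g u v) (t : ChainTerm T N k)
    (h : k + 1 + q = m) (h' : k + (q + 1) = m)
    (hx : Reached ω z q h (chainEdge ω z A A₀ A') (monomial g u v))
    (hstep : ∀ ψ, IsPsi ω z ψ → ∀ (x : MultilinearChains T m N (k + 1))
      (x' : MultilinearChains T m N k) (s : ℤˣ) (F : Flag (cycArrangement T m ω z) q)
      (F' : Flag (cycArrangement T m ω z) (q + 1)),
      (x : ChainSpace (cycShift T m) N (k + 1)) = monomial g u v →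
      (x' : ChainSpace (cycShift T m) N k) = (-1 : ℂ) ^ t.parity • t.chain g u v →
      F'.init = F → F.last = chainEdge ω z A A₀ A' → F'.last = t.edge ω z A A₀ A' →
      ψ (k + 1) q h x = (s : ℤ) • FlagSpace.mk F →
      ψ k (q + 1) h' x' = (s : ℤ) • FlagSpace.mk F') :
    Reached ω z (q + 1) h' (t.edge ω z A A₀ A') ((-1 : ℂ) ^ t.parity • t.chain g u v) := by
  obtain ⟨F, s, h1, h2, h3⟩ := hx
  replace h1 := SetLike.coe_injective h1
  obtain ⟨he, hr⟩ := t.isEdge_edge hω hc (z := z)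
  obtain ⟨F', hF1, hF2⟩ := F.exists_snoc he (by omega) (h1 ▸ t.edge_le hω)
  refine ⟨F', s, by rw [hF2], hc.flagChain_term hω hz0 hz t h h' h2 hF1 hF2,
    fun ψ hψ y hy => ?_⟩
  exact hstep ψ hψ ⟨_, hc.mem_weightChain⟩ y s F F' rfl hy hF1 h1 hF2
    (h3 ψ hψ ⟨_, hc.mem_weightChain⟩ rfl)

end

section

variable {A : Fin k → Multiset (ZMod T × Fin m)} {A₀ B B' : Multiset (ZMod T × Fin m)}
  {A' : Fin N → Multiset (ZMod T × Fin m)} {g : Fin k → FreeLieAlgebra ℂ (ZMod T × Fin m)}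
  {g₁ g₂ : FreeLieAlgebra ℂ (ZMod T × Fin m)}
  {u : UniversalEnvelopingAlgebra ℂ (fixedSubalgebra (cycShift T m))}
  {v : Fin N → UniversalEnvelopingAlgebra ℂ (FreeLieAlgebra ℂ (ZMod T × Fin m))}
  (hω : IsPrimitiveRoot ω T) (hz0 : ∀ j, z j ≠ 0)
  (hz : ∀ i j, i ≠ j → ∀ n : ℕ, z i ≠ (ω : ℂ) ^ n * z j)
include hω hz0 hz

lemma Reached.origin (hc : IsConfig (Fin.cons B A : Fin (k + 1) → _) A₀ A' (Fin.cons g₁ g) u v)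
    (h : k + 1 + q = m) (h' : k + (q + 1) = m)
    (hx : Reached ω z q h (chainEdge ω z (Fin.cons B A : Fin (k + 1) → _) A₀ A')
      (monomial (Fin.cons g₁ g) u v)) :
    Reached ω z (q + 1) h' (chainEdge ω z A (B + A₀) A')
      (monomial g (UniversalEnvelopingAlgebra.ι ℂ (orbitSum g₁) * u) v) := by
  have H := Reached.of_term hω hz0 hz hc ChainTerm.toOrigin h h' hx ?_
  · rw [ChainTerm.chain_toOrigin] at H
    exact H
  · intro ψ hψ x x' s F F' e1 e2 e3 e4 e5 e6
    rw [ChainTerm.chain_toOrigin] at e2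
    refine hψ.origin h h' g g₁ B u v x x' s F F' (fun i => ⟨_, hc.blocks i.succ⟩) (hc.blocks 0)
      hc.origin.isProjMonomial (fun i => (hc.sites i).isMonomial) e1 e2 e3 ?_ e6
    rw [e5, e4, ChainTerm.coe_edge_toOrigin hω]

lemma Reached.site (hc : IsConfig (Fin.cons B A : Fin (k + 1) → _) A₀ A' (Fin.cons g₁ g) u v)
    (h : k + 1 + q = m) (h' : k + (q + 1) = m) (j : Fin N)
    (hx : Reached ω z q h (chainEdge ω z (Fin.cons B A : Fin (k + 1) → _) A₀ A')
      (monomial (Fin.cons g₁ g) u v)) :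
    Reached ω z (q + 1) h' (chainEdge ω z A A₀ (Function.update A' j (B + A' j)))
      (monomial g u (Function.update v j (UniversalEnvelopingAlgebra.ι ℂ g₁ * v j))) := by
  have H := Reached.of_term hω hz0 hz hc (ChainTerm.toSite j) h h' hx ?_
  · rw [ChainTerm.chain_toSite, ChainTerm.edge, ChainTerm.siteContent_toSite] at H
    exact H
  · intro ψ hψ x x' s F F' e1 e2 e3 e4 e5 e6
    rw [ChainTerm.chain_toSite] at e2
    refine hψ.anchor h h' g g₁ B u v j x x' s F F' (fun i => ⟨_, hc.blocks i.succ⟩) (hc.blocks 0)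
      hc.origin.isProjMonomial (fun i => (hc.sites i).isMonomial) e1 e2 e3 ?_ e6
    rw [e5, e4, ChainTerm.coe_edge_toSite hω]

lemma Reached.join (hc : IsConfig (Fin.cons B (Fin.cons B' A : Fin (k + 1) → _) :
      Fin (k + 1 + 1) → _) A₀ A' (Fin.cons g₁ (Fin.cons g₂ g : Fin (k + 1) → _)) u v)
    (h : k + 1 + 1 + q = m) (h' : k + 1 + (q + 1) = m)
    (hx : Reached ω z q h (chainEdge ω z (Fin.cons B (Fin.cons B' A : Fin (k + 1) → _) :
      Fin (k + 1 + 1) → _) A₀ A')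
      (monomial (Fin.cons g₁ (Fin.cons g₂ g : Fin (k + 1) → _)) u v)) :
    Reached ω z (q + 1) h' (chainEdge ω z (Fin.cons (B + B') A : Fin (k + 1) → _) A₀ A')
      (monomial (Fin.cons ⁅g₁, g₂⁆ g) u v) := by
  have H := Reached.of_term hω hz0 hz hc ChainTerm.toJoin h h' hx ?_
  · rw [ChainTerm.chain_toJoin, ChainTerm.edge, ChainTerm.blockContent_toJoin] at H
    exact H
  · intro ψ hψ x x' s F F' e1 e2 e3 e4 e5 e6
    rw [ChainTerm.chain_toJoin] at e2
    refine hψ.join h h' g g₁ g₂ B B' u v x x' s F F' (fun i => ⟨_, hc.blocks i.succ.succ⟩)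
      (hc.blocks 0) (hc.blocks 1)
      hc.origin.isProjMonomial (fun i => (hc.sites i).isMonomial) e1 e2 e3 ?_ e6
    rw [e5, e4, ChainTerm.coe_edge_toJoin hω]

end

lemma IsCommutator.exists_of {X : Type} {B : Multiset X} {f : FreeLieAlgebra ℂ X}
    (h : IsCommutator B f) : (∃ x, B = {x} ∧ f = FreeLieAlgebra.of ℂ x) ∨
      ∃ B₁ B₂ f₁ f₂, IsCommutator B₁ f₁ ∧ IsCommutator B₂ f₂ ∧ B = B₁ + B₂ ∧ f = ⁅f₁, f₂⁆ := by
  cases h with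
  | of x => exact Or.inl ⟨x, rfl, rfl⟩
  | lie h₁ h₂ => exact Or.inr ⟨_, _, _, _, h₁, h₂, rfl, rfl⟩

lemma EnvMonomial.eq_one {L X : Type} [LieRing L] [LieAlgebra ℂ L] {S : Multiset X → L → Prop}
    (hS : ∀ y, ¬ S 0 y) {B : Multiset X} {w : UniversalEnvelopingAlgebra ℂ L}
    (h : EnvMonomial S B w) (hB : B = 0) : w = 1 := by
  cases h with
  | one => rfl
  | mul hg _ =>
    obtain ⟨rfl, -⟩ := add_eq_zero.1 hB
    exact (hS _ hg).elim

omit [NeZero T] in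
lemma wedgeRev_comp_perm_eq_ιMulti {L : Type*} [LieRing L] [LieAlgebra ℂ L]
    (s : Equiv.Perm (Fin k)) (f : Fin k → L) : wedgeRev L k (fun i => f (s i)) =
      ((Equiv.Perm.sign (s * Fin.revPerm) : ℤ) : ℂ) • exteriorPower.ιMulti ℂ k f := by
  rw [← alternatingMap_comp_perm]
  simp [wedgeRev, Function.comp_def]

lemma monomial_cons_removeNth (g : Fin (k + 1) → FreeLieAlgebra ℂ (ZMod T × Fin m))
    (u : UniversalEnvelopingAlgebra ℂ (fixedSubalgebra (cycShift T m)))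
    (v : Fin N → UniversalEnvelopingAlgebra ℂ (FreeLieAlgebra ℂ (ZMod T × Fin m)))
    (b : Fin (k + 1)) : monomial g u v =
      ((((-1) ^ (b : ℕ) : ℤˣ) : ℤ) : ℂ) • monomial (Fin.cons (g b) (b.removeNth g)) u v := by
  have h1 : (fun i => orbitSum ((Fin.cons (g b) (b.removeNth g) :
      Fin (k + 1) → FreeLieAlgebra ℂ (ZMod T × Fin m)) i)) =
      Fin.cons (orbitSum (g b)) (b.removeNth fun i => orbitSum (g i)) := by
    funext i
    exact Fin.cases rfl (fun i => rfl) i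
  rw [monomial, monomial, h1, wedgeRev_cons_removeNth (fun i => orbitSum (g i)) b,
    ← TensorProduct.smul_tmul', smul_smul]
  have h2 : ((((-1) ^ (b : ℕ) : ℤˣ) : ℤ) : ℂ) * (-1 : ℂ) ^ (b : ℕ) = 1 := by
    push_cast
    rw [← mul_pow]
    simp
  rw [h2, one_smul]

section

variable {A : Fin k → Multiset (ZMod T × Fin m)} {A₀ : Multiset (ZMod T × Fin m)}
  {A' : Fin N → Multiset (ZMod T × Fin m)} {g : Fin k → FreeLieAlgebra ℂ (ZMod T × Fin m)}
  {u : UniversalEnvelopingAlgebra ℂ (fixedSubalgebra (cycShift T m))}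
  {v : Fin N → UniversalEnvelopingAlgebra ℂ (FreeLieAlgebra ℂ (ZMod T × Fin m))}

omit [NeZero T] in
lemma IsMultilinear.card (h : IsMultilinear A A₀ A') :
    ∑ b, (A b).card + A₀.card + ∑ j, (A' j).card = m := by
  have := congrArg Multiset.card h
  simpa [totalContent] using this

omit [NeZero T] in
lemma exists_flag_zero : ∃ F : Flag (cycArrangement T m ω z) 0, F.last = ⊤ :=
  ⟨⟨fun _ => ⊤, fun _ => ⟨top_ne_bot, ∅, Set.empty_subset _, sInf_empty.symm⟩,
    fun j => by
      rw [AffineSubspace.direction_top, finrank_top]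
      simp, fun _ _ _ => le_rfl⟩, rfl⟩

lemma baseChain_rfl (k : ℕ) : baseChain (T := T) N (rfl : k = k) =
    exteriorPower.ιMulti ℂ k (fun i => orbitSum (gen T i)) ⊗ₜ
      (1 ⊗ₜ PiTensorProduct.tprod ℂ fun _ => 1) := by
  simp only [baseChain, Fin.cast_eq_self]

lemma reached_base {z : Fin N → ℂ} (k : ℕ) : Reached ω z 0 (add_zero k)
    ((⊤ : AffineSubspace ℂ (Fin k → ℂ)) : Set (Fin k → ℂ))
    (baseChain (T := T) N (rfl : k = k)) := by
  obtain ⟨F, hF⟩ := exists_flag_zero (T := T) (m := k) (ω := ω) (z := z)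
  refine ⟨F, 1, by rw [hF], ?_, fun ψ hψ y hy => ?_⟩
  · rw [Units.val_one, Int.cast_one, one_smul, flagChain]
  · rw [Units.val_one, one_smul]
    rw [baseChain_rfl] at hy
    exact hψ.base _ y F hy

lemma IsConfig.reached_of_letters (hω : IsPrimitiveRoot ω T) (hc : IsConfig A A₀ A' g u v)
    (h : k + 0 = m) : Reached ω z 0 h (chainEdge ω z A A₀ A') (monomial g u v) := by
  have hcard := hc.multilinear.card
  have hA1 : ∀ b, 1 ≤ (A b).card := fun b => Multiset.card_pos.2 (hc.ne_zero b)
  have hsum : ∑ _b : Fin k, 1 = k := by simp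
  have hle : ∑ _b : Fin k, 1 ≤ ∑ b, (A b).card := Finset.sum_le_sum fun b _ => hA1 b
  have hA0 : A₀ = 0 := Multiset.card_eq_zero.1 (by omega)
  have hA' : ∀ j, A' j = 0 := by
    have : ∑ j, (A' j).card = 0 := by omega
    exact fun j => Multiset.card_eq_zero.1 (Finset.sum_eq_zero_iff.1 this j (Finset.mem_univ j))
  have hA : ∀ b, (A b).card = 1 := by
    have := (Finset.sum_eq_sum_iff_of_le fun b _ => hA1 b).1
      (by omega : ∑ _b : Fin k, 1 = ∑ b, (A b).card)
    exact fun b => (this b (Finset.mem_univ b)).symm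
  have hu : u = 1 := hc.origin.eq_one (fun y hy => by
    obtain ⟨f, hf, -⟩ := hy
    exact hf.ne_zero rfl) hA0
  have hv : v = fun _ => 1 := funext fun j =>
    (hc.sites j).eq_one (fun y hy => hy.ne_zero rfl) (hA' j)
  have hx : ∀ b, ∃ x, A b = {x} ∧ g b = FreeLieAlgebra.of ℂ x := by
    intro b
    rcases (hc.blocks b).exists_of with h | ⟨B₁, B₂, f₁, f₂, h1, h2, h3, -⟩
    · exact h
    · have := hA b
      rw [h3, Multiset.card_add] at this
      have := Multiset.card_pos.2 h1.ne_zero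
      have := Multiset.card_pos.2 h2.ne_zero
      omega
  choose x hxA hxg using hx
  rw [add_zero] at h
  subst h
  have hsurj : Function.Surjective fun b => (x b).2 := by
    intro i
    have hi : i ∈ (totalContent A A₀ A').map Prod.snd := by
      rw [hc.multilinear]
      exact Finset.mem_univ i
    simp only [totalContent, hA0, hA', Finset.sum_const_zero, add_zero, map_sum_multiset, hxA,
      Multiset.map_singleton] at hi
    obtain ⟨b, hb⟩ := mem_sum_multiset.1 hi
    exact ⟨b, (Multiset.mem_singleton.1 hb).symm⟩
  let s : Equiv.Perm (Fin k) := Equiv.ofBijective _ (Finite.injective_iff_bijective.1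
    (Finite.injective_iff_surjective.2 hsurj))
  have hg : ∀ b, orbitSum (g b) = orbitSum (gen T (s b)) := by
    intro b
    rw [hxg, ← orbitSum_shiftHom (x b).1 (gen T (s b)), gen, shiftHom, permHom_of]
    congr 2
    ext <;> simp [s]
  have hmon : monomial g u v = ((Equiv.Perm.sign (s * Fin.revPerm) : ℤ) : ℂ) •
      baseChain (T := T) N (rfl : k = k) := by
    have hw : wedgeRev _ k (fun b => orbitSum (g b)) = ((Equiv.Perm.sign (s * Fin.revPerm) : ℤ) : ℂ) •
        exteriorPower.ιMulti ℂ k fun i => orbitSum (gen T i) := by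
      rw [← wedgeRev_comp_perm_eq_ιMulti]
      exact congrArg _ (funext hg)
    rw [monomial, hw, hu, hv, ← TensorProduct.smul_tmul', baseChain_rfl]
  have hedge : chainEdge ω z A A₀ A' = ⊤ := by
    refine eq_top_iff.2 fun t _ => ?_
    rw [mem_chainEdge hω, hA0]
    refine ⟨fun b => ?_, fun y hy => (Multiset.notMem_zero _ hy).elim, fun j y hy => ?_⟩
    · rw [hxA]
      intro y hy y' hy'
      rw [Multiset.mem_singleton.1 hy, Multiset.mem_singleton.1 hy']
    · rw [hA'] at hy
      exact (Multiset.notMem_zero _ hy).elim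
  rw [hmon, hedge]
  exact (reached_base k).sign_smul _

end

section

variable (hω : IsPrimitiveRoot ω T) (hz0 : ∀ j, z j ≠ 0)
  (hz : ∀ i j, i ≠ j → ∀ n : ℕ, z i ≠ (ω : ℂ) ^ n * z j)
include hω hz0 hz

lemma IsConfig.reached : ∀ (q k : ℕ) {A : Fin k → Multiset (ZMod T × Fin m)}
    {A₀ : Multiset (ZMod T × Fin m)} {A' : Fin N → Multiset (ZMod T × Fin m)}
    {g : Fin k → FreeLieAlgebra ℂ (ZMod T × Fin m)}
    {u : UniversalEnvelopingAlgebra ℂ (fixedSubalgebra (cycShift T m))}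
    {v : Fin N → UniversalEnvelopingAlgebra ℂ (FreeLieAlgebra ℂ (ZMod T × Fin m))}
    (_ : IsConfig A A₀ A' g u v) (h : k + q = m),
    Reached ω z q h (chainEdge ω z A A₀ A') (monomial g u v)
  | 0, k, A, A₀, A', g, u, v, hc, h => hc.reached_of_letters hω h
  | q + 1, k, A, A₀, A', g, u, v, hc, h => by
    have ht : ∀ {B : Multiset (ZMod T × Fin m)} {A₀ A'} (t : ChainTerm T N k),
        IsMultilinear (t.blockContent (Fin.cons B A)) (t.originContent (Fin.cons B A) A₀)
          (t.siteContent (Fin.cons B A) A') → IsMultilinear (Fin.cons B A : Fin (k + 1) → _) A₀ A' :=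
      fun t h => (t.map_snd_totalContent _ _ _).symm.trans h
    have hblocks : ∀ {B f}, IsCommutator B f → ∀ b, IsCommutator
        ((Fin.cons B A : Fin (k + 1) → _) b)
        ((Fin.cons f g : Fin (k + 1) → FreeLieAlgebra ℂ (ZMod T × Fin m)) b) :=
      fun hf b => Fin.cases hf hc.blocks b
    by_cases h0 : A₀ = 0
    · by_cases h1 : ∀ j, A' j = 0
      · have hcard := hc.multilinear.card
        obtain ⟨b, hb⟩ : ∃ b, 1 < (A b).card := by
          by_contra! hle
          have := Finset.sum_le_sum fun b (_ : b ∈ Finset.univ) => hle b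
          simp only [Finset.sum_const, Finset.card_univ, Fintype.card_fin, smul_eq_mul, mul_one]
            at this
          simp only [h0, h1, Multiset.card_zero, Finset.sum_const_zero, add_zero] at hcard
          omega
        obtain ⟨x, hx, -⟩ | ⟨B, B', f, f', hf, hf', hB, hg⟩ := (hc.blocks b).exists_of
        · rw [hx] at hb
          simp at hb
        obtain ⟨k, rfl⟩ : ∃ k', k = k' + 1 := ⟨k - 1, by have := b.2; omega⟩
        have hA : ∀ {M : Type} [AddCommMonoid M] (F : Fin (k + 1) → M),
            ∑ i, F i = ∑ i, (Fin.cons (F b) (b.removeNth F) : Fin (k + 1) → M) i := fun F => by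
          rw [Fin.sum_univ_succAbove F b, Fin.sum_univ_succ]
          rfl
        have hc' : IsConfig (Fin.cons B (Fin.cons B' (b.removeNth A) : Fin (k + 1) → _) :
            Fin (k + 1 + 1) → _) A₀ A'
            (Fin.cons f (Fin.cons f' (b.removeNth g) : Fin (k + 1) → _)) u v := by
          refine ⟨⟨fun i => Fin.cases hf (fun i => Fin.cases hf' (fun i => hc.blocks _) i) i,
            hc.origin, hc.sites⟩, ?_⟩
          have e := hc.multilinear
          rw [IsMultilinear, totalContent, hA, hB] at e
          rw [IsMultilinear, totalContent, ← e, Fin.sum_univ_succ, Fin.sum_univ_succ,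
            Fin.sum_univ_succ (n := k)]
          simp only [Fin.cons_zero, Fin.cons_succ, add_assoc]
        have H := (IsConfig.reached q (k + 1 + 1) hc' (by omega)).join hω hz0 hz hc' (by omega) h
        have hedge : chainEdge ω z (Fin.cons (B + B') (b.removeNth A) : Fin (k + 1) → _) A₀ A' =
            chainEdge ω z A A₀ A' := by
          ext t
          rw [mem_chainEdge hω, mem_chainEdge hω, ← hB]
          refine and_congr_left fun _ => ⟨fun h i => ?_, fun h i => ?_⟩
          · rcases eq_or_ne i b with rfl | hi
            · exact h 0
            · obtain ⟨i, rfl⟩ := Fin.exists_succAbove_eq hi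
              exact h i.succ
          · exact Fin.cases (h b) (fun i => h _) i
        rw [hedge, ← hg] at H
        rw [monomial_cons_removeNth g u v b]
        exact H.sign_smul _
      · push Not at h1
        obtain ⟨j, hj⟩ := h1
        generalize hB : A' j = B at hj
        generalize hw : v j = w
        have hs := hc.sites j
        rw [hB, hw] at hs
        cases hs with
        | one => exact (hj rfl).elim
        | @mul B C f w hf hs =>
          have e1 : A' = Function.update (Function.update A' j C) j
              (B + Function.update A' j C j) := by
            simp [← hB]
          have e2 : v = Function.update (Function.update v j w) j
              (UniversalEnvelopingAlgebra.ι ℂ f * Function.update v j w j) := by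
            rw [Function.update_self, Function.update_idem, ← hw, Function.update_eq_self]
          have hc' : IsConfig (Fin.cons B A : Fin (k + 1) → _) A₀ (Function.update A' j C)
              (Fin.cons f g) u (Function.update v j w) := by
            refine ⟨⟨hblocks hf, hc.origin, fun j' => ?_⟩, ht (ChainTerm.toSite j) ?_⟩
            · rcases eq_or_ne j' j with rfl | hne
              · rwa [Function.update_self, Function.update_self]
              · rw [Function.update_of_ne hne, Function.update_of_ne hne]
                exact hc.sites j'
            · rw [ChainTerm.siteContent_toSite, ← e1]
              exact hc.multilinear
          have H := (IsConfig.reached q (k + 1) hc' (by omega)).site hω hz0 hz hc' (by omega) h j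
          rwa [← e1, ← e2] at H
    · have hs := hc.origin
      cases hs with
      | one => exact (h0 rfl).elim
      | @mul B C f w hf hs =>
        obtain ⟨f, hf, rfl⟩ := hf
        have hc' : IsConfig (Fin.cons B A : Fin (k + 1) → _) C A' (Fin.cons f g) w v :=
          ⟨⟨hblocks hf, hs, hc.sites⟩, ht ChainTerm.toOrigin hc.multilinear⟩
        rw [← orbitSum_eq_cycSum]
        exact (IsConfig.reached q (k + 1) hc' (by omega)).origin hω hz0 hz hc' (by omega) h

end

end Reach

/-! ### Existence and uniqueness of the maps from chains to flags -/

section PsiMaps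

variable {T m N : ℕ} [NeZero T] {ω : ℂˣ} {z : Fin N → ℂ} {k q p : ℕ}

attribute [local instance] LieRing.ofAssociativeRing

omit [NeZero T] in
lemma hom_ext_of_le_span {V E : Type*} [AddCommGroup V] [Module ℂ V] [AddCommGroup E] [Module ℂ E]
    {W : Submodule ℂ V} {S : Set V} (hS : W ≤ Submodule.span ℂ S) (hSW : S ⊆ W)
    {f g : W →ₗ[ℂ] E} (h : ∀ x ∈ S, ∀ hx : x ∈ W, f ⟨x, hx⟩ = g ⟨x, hx⟩) : f = g := by
  have hle : Submodule.span ℂ S ≤ W := Submodule.span_le.2 hSW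
  have key : ∀ x (hx : x ∈ Submodule.span ℂ S), f ⟨x, hle hx⟩ = g ⟨x, hle hx⟩ := by
    intro x hx
    induction hx using Submodule.span_induction with
    | mem x hx => exact h x hx _
    | zero => exact (map_zero f).trans (map_zero g).symm
    | add a b ha hb iha ihb =>
      have e := congrArg₂ (· + ·) iha ihb
      simp only [← map_add] at e
      exact e
    | smul c a ha ih =>
      have e := congrArg (c • ·) ih
      simp only [← map_smul] at e
      exact e
  exact LinearMap.ext fun x => key x.1 (hS x.2)

lemma exists_content {g : Fin k → FreeLieAlgebra ℂ (ZMod T × Fin m)}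
    {u : UniversalEnvelopingAlgebra ℂ (fixedSubalgebra (cycShift T m))}
    {v : Fin N → UniversalEnvelopingAlgebra ℂ (FreeLieAlgebra ℂ (ZMod T × Fin m))}
    (hg : ∀ i, ∃ B, IsCommutator B (g i)) (hu : IsProjMonomial u) (hv : ∀ i, IsMonomial (v i)) :
    ∃ A A₀ A', HasContent A A₀ A' g u v := by
  choose A hA using hg
  obtain ⟨A₀, hA₀⟩ := hu.exists_content
  choose A' hA' using fun i => (hv i).exists_content
  exact ⟨A, A₀, A', hA, hA₀, hA'⟩

lemma IsMonomialChain.exists_hasContent {A : Fin k → Multiset (ZMod T × Fin m)}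
    {A₀ : Multiset (ZMod T × Fin m)} {A' : Fin N → Multiset (ZMod T × Fin m)}
    {x : ChainSpace (cycShift T m) N k} (h : IsMonomialChain cycShift_pow_self A A₀ A' x) :
    ∃ g u v, HasContent A A₀ A' g u v ∧ x = monomial g u v := by
  obtain ⟨g, u, v, hg, hu, hv, rfl⟩ := h
  choose f hf hgf using hg
  refine ⟨f, u, v, ⟨hf, hu, hv⟩, ?_⟩
  simp only [monomial, orbitSum_eq_cycSum, ← hgf]

lemma mem_span_isConfig {x : ChainSpace (cycShift T m) N k}
    (hx : x ∈ weightChain (cycShift T m) (degIndex T m) N k 1) :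
    x ∈ Submodule.span ℂ {x : ChainSpace (cycShift T m) N k |
      ∃ A A₀ A' g u v, IsConfig A A₀ A' g u v ∧ x = monomial g u v} := by
  refine Submodule.span_mono ?_ (weightChain_le cycShift_pow_self (NeZero.ne T) _ _ _ _ hx)
  rintro _ ⟨A, A₀, A', h, hd⟩
  obtain ⟨g, u, v, hc, rfl⟩ := h.exists_hasContent
  exact ⟨A, A₀, A', g, u, v, ⟨hc, isMultilinear_iff.2 hd⟩, rfl⟩

variable (hω : IsPrimitiveRoot ω T) (hz0 : ∀ j, z j ≠ 0)
  (hz : ∀ i j, i ≠ j → ∀ n : ℕ, z i ≠ (ω : ℂ) ^ n * z j)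

include hω hz0 hz in
lemma HasContent.flagChain_term {A : Fin (k + 1) → Multiset (ZMod T × Fin m)}
    {A₀ : Multiset (ZMod T × Fin m)} {A' : Fin N → Multiset (ZMod T × Fin m)}
    {g : Fin (k + 1) → FreeLieAlgebra ℂ (ZMod T × Fin m)}
    {u : UniversalEnvelopingAlgebra ℂ (fixedSubalgebra (cycShift T m))}
    {v : Fin N → UniversalEnvelopingAlgebra ℂ (FreeLieAlgebra ℂ (ZMod T × Fin m))}
    (hc : HasContent A A₀ A' g u v) (t : ChainTerm T N k)
    (h : k + 1 + q = m) (h' : k + (q + 1) = m)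
    (hx : monomial g u v ∈ weightChain (cycShift T m) (degIndex T m) N (k + 1) 1)
    (hx' : (-1 : ℂ) ^ t.parity • t.chain g u v ∈
      weightChain (cycShift T m) (degIndex T m) N k 1)
    {s : ℤˣ} {F : Flag (cycArrangement T m ω z) q} {F' : Flag (cycArrangement T m ω z) (q + 1)}
    (hF : monomial g u v = ((s : ℤ) : ℂ) • flagChain ω z q (k + 1) h F) (hF' : F'.init = F)
    (hlast : F.last = chainEdge ω z A A₀ A' → F'.last = t.edge ω z A A₀ A') :
    (-1 : ℂ) ^ t.parity • t.chain g u v = ((s : ℤ) : ℂ) • flagChain ω z (q + 1) k h' F' := by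
  classical
  have hF2 : flagChain ω z q (k + 1) h F = ((s : ℤ) : ℂ) • monomial g u v := by
    rw [hF]
    exact (sign_smul_smul (E := ChainSpace (cycShift T m) N (k + 1)) s _).symm
  have hzero : monomial g u v = 0 → ((s : ℤ) : ℂ) • flagChain ω z (q + 1) k h' F' = 0 := by
    intro h0
    rw [flagChain, hF', hF2, h0, smul_zero, map_zero, map_zero, smul_zero]
  by_cases hm : IsMultilinear A A₀ A'
  · have hc' : IsConfig A A₀ A' g u v := ⟨hc, hm⟩
    by_cases h0 : monomial g u v = 0
    · rw [hzero h0, ← hc'.edgeProj_chainD_edge hω hz0 hz t, h0, map_zero, map_zero]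
    · refine hc'.flagChain_term hω hz0 hz t h h' hF hF' (hlast ?_)
      have e := (flagChain_isSignedMonomial hω hz0 hz q (k + 1) h F).edgeProj_apply F.last
      rw [if_pos rfl, hF2, map_smul, hc.isMonomialChain.edgeProj_apply] at e
      by_contra hne
      rw [if_neg (Ne.symm hne), smul_zero] at e
      rw [hF2, ← e] at hF
      exact h0 (hF.trans (smul_zero _))
  · have h0 := hc.eq_zero hm hx
    have h1 : t.chain g u v ∈ weightChain (cycShift T m) (degIndex T m) N k 1 := by
      have := Submodule.smul_mem _ ((-1 : ℂ) ^ t.parity) hx'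
      rwa [smul_smul, ← mul_pow, neg_one_mul, neg_neg, one_pow, one_smul] at this
    have h2 : t.chain g u v = 0 :=
      (hc.term t).eq_zero (fun h => hm ((t.map_snd_totalContent A A₀ A').symm.trans h)) h1
    rw [h2, hzero h0, smul_zero]

lemma flagToChain_mem (h : p + q = m) (w : FlagSpace (cycArrangement T m ω z) q) :
    flagToChain hω hz0 hz q p h w ∈ weightChain (cycShift T m) (degIndex T m) N p 1 := by
  have hw : w ∈ Submodule.span ℂ (Set.range (FlagSpace.mk (𝒞 := cycArrangement T m ω z) (k := q))) :=
    FlagSpace.span_mk (𝒞 := cycArrangement T m ω z) (k := q) ▸ Submodule.mem_top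
  induction hw using Submodule.span_induction with
  | mem w hw =>
    obtain ⟨F, rfl⟩ := hw
    rw [flagToChain_mk]
    obtain ⟨n, A, A₀, A', g, u, v, hc, -, hx⟩ := flagChain_isSignedMonomial hω hz0 hz q p h F
    rw [hx]
    exact Submodule.smul_mem _ _ hc.mem_weightChain
  | zero => rw [map_zero]; exact Submodule.zero_mem _
  | add a b _ _ ha hb => rw [map_add]; exact Submodule.add_mem _ ha hb
  | smul c a _ ha => rw [map_smul]; exact Submodule.smul_mem _ _ ha

lemma exists_flagToChain_eq (h : p + q = m) {x : ChainSpace (cycShift T m) N p}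
    (hx : x ∈ weightChain (cycShift T m) (degIndex T m) N p 1) :
    ∃ w, flagToChain hω hz0 hz q p h w = x := by
  have hs := mem_span_isConfig hx
  clear hx
  induction hs using Submodule.span_induction with
  | mem x hx =>
    obtain ⟨A, A₀, A', g, u, v, hc, rfl⟩ := hx
    obtain ⟨F, s, -, h2, -⟩ := IsConfig.reached hω hz0 hz q p hc h
    exact ⟨((s : ℤ) : ℂ) • FlagSpace.mk F, by rw [map_smul, flagToChain_mk, h2]⟩
  | zero => exact ⟨0, map_zero _⟩
  | add a b _ _ ha hb =>
    obtain ⟨a', rfl⟩ := ha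
    obtain ⟨b', rfl⟩ := hb
    exact ⟨a' + b', map_add _ _ _⟩
  | smul c a _ ha =>
    obtain ⟨a', rfl⟩ := ha
    exact ⟨c • a', map_smul _ _ _⟩

/-- The isomorphism from flags to chains of weight `(1, …, 1)`. -/
def flagChainEquiv (p q : ℕ) (h : p + q = m) :
    FlagSpace (cycArrangement T m ω z) q ≃ₗ[ℂ] MultilinearChains T m N p :=
  LinearEquiv.ofBijective
    ((flagToChain hω hz0 hz q p h).codRestrict _ (flagToChain_mem hω hz0 hz h))
    ⟨fun _ _ hab => flagToChain_injective hω hz0 hz q p h (congrArg Subtype.val hab),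
      fun x => (exists_flagToChain_eq hω hz0 hz h x.2).imp fun _ hw => Subtype.ext hw⟩

lemma coe_flagChainEquiv (h : p + q = m) (w : FlagSpace (cycArrangement T m ω z) q) :
    (flagChainEquiv hω hz0 hz p q h w : ChainSpace (cycShift T m) N p) =
      flagToChain hω hz0 hz q p h w := rfl

lemma flagChainEquiv_symm_eq_iff (h : p + q = m) (x : MultilinearChains T m N p) (s : ℤˣ)
    (F : Flag (cycArrangement T m ω z) q) :
    (flagChainEquiv hω hz0 hz p q h).symm x = (s : ℤ) • FlagSpace.mk F ↔
      (x : ChainSpace (cycShift T m) N p) = ((s : ℤ) : ℂ) • flagChain ω z q p h F := by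
  rw [LinearEquiv.symm_apply_eq, Subtype.ext_iff, coe_flagChainEquiv, smul_eq_sign_smul, map_smul,
    flagToChain_mk]

lemma isPsi_flagChainEquiv_symm :
    IsPsi (T := T) (m := m) ω z fun p q h =>
      (flagChainEquiv hω hz0 hz p q h).symm.toLinearMap where
  base h x F hx := by
    have := (flagChainEquiv_symm_eq_iff hω hz0 hz h x 1 F).2 (by
      rw [hx, flagChain, baseChain_rfl, Units.val_one, Int.cast_one, one_smul])
    rwa [Units.val_one, one_smul] at this
  anchor {p q} h h' g g₁ A u v j x x' s F F' hg hg₁ hu hv hx hx' hF hlast hψ := by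
    obtain ⟨B, A₀, A', hc⟩ := exists_content hg hu hv
    have hc' : HasContent (Fin.cons A B : Fin (p + 1) → _) A₀ A' (Fin.cons g₁ g) u v :=
      ⟨fun b => Fin.cases hg₁ hc.blocks b, hc.origin, hc.sites⟩
    refine (flagChainEquiv_symm_eq_iff hω hz0 hz h' x' s F').2 ?_
    have e := (flagChainEquiv_symm_eq_iff hω hz0 hz h x s F).1 hψ
    rw [← ChainTerm.chain_toSite] at hx'
    rw [hx']
    refine hc'.flagChain_term hω hz0 hz _ h h' (hx ▸ x.2) (hx' ▸ x'.2) (hx ▸ e) hF fun hl => ?_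
    refine SetLike.coe_injective ?_
    rw [hlast, hl, ChainTerm.coe_edge_toSite hω]
  origin {p q} h h' g g₁ A u v x x' s F F' hg hg₁ hu hv hx hx' hF hlast hψ := by
    obtain ⟨B, A₀, A', hc⟩ := exists_content hg hu hv
    have hc' : HasContent (Fin.cons A B : Fin (p + 1) → _) A₀ A' (Fin.cons g₁ g) u v :=
      ⟨fun b => Fin.cases hg₁ hc.blocks b, hc.origin, hc.sites⟩
    refine (flagChainEquiv_symm_eq_iff hω hz0 hz h' x' s F').2 ?_
    have e := (flagChainEquiv_symm_eq_iff hω hz0 hz h x s F).1 hψ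
    rw [← ChainTerm.chain_toOrigin] at hx'
    rw [hx']
    refine hc'.flagChain_term hω hz0 hz _ h h' (hx ▸ x.2) (hx' ▸ x'.2) (hx ▸ e) hF fun hl => ?_
    refine SetLike.coe_injective ?_
    rw [hlast, hl, ChainTerm.coe_edge_toOrigin hω]
  join {p q} h h' g g₁ g₂ A₁ A₂ u v x x' s F F' hg hg₁ hg₂ hu hv hx hx' hF hlast hψ := by
    obtain ⟨B, A₀, A', hc⟩ := exists_content hg hu hv
    have hc' : HasContent (Fin.cons A₁ (Fin.cons A₂ B : Fin (p + 1) → _) : Fin (p + 1 + 1) → _)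
        A₀ A' (Fin.cons g₁ (Fin.cons g₂ g : Fin (p + 1) → _)) u v :=
      ⟨fun b => Fin.cases hg₁ (fun b => Fin.cases hg₂ hc.blocks b) b, hc.origin, hc.sites⟩
    refine (flagChainEquiv_symm_eq_iff hω hz0 hz h' x' s F').2 ?_
    have e := (flagChainEquiv_symm_eq_iff hω hz0 hz h x s F).1 hψ
    rw [← ChainTerm.chain_toJoin] at hx'
    rw [hx']
    refine hc'.flagChain_term hω hz0 hz _ h h' (hx ▸ x.2) (hx' ▸ x'.2) (hx ▸ e) hF fun hl => ?_
    refine SetLike.coe_injective ?_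
    rw [hlast, hl, ChainTerm.coe_edge_toJoin hω]

lemma IsPsi.flagToChain_apply {ψ : ∀ p q : ℕ, p + q = m →
    (MultilinearChains T m N p →ₗ[ℂ] FlagSpace (cycArrangement T m ω z) q)} (hψ : IsPsi ω z ψ)
    (h : p + q = m) (x : MultilinearChains T m N p) :
    flagToChain hω hz0 hz q p h (ψ p q h x) = x := by
  have H : flagToChain hω hz0 hz q p h ∘ₗ ψ p q h = Submodule.subtype _ := by
    refine hom_ext_of_le_span (V := ChainSpace (cycShift T m) N p)
      (E := ChainSpace (cycShift T m) N p) (fun x hx => mem_span_isConfig hx) ?_ ?_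
    · rintro _ ⟨A, A₀, A', g, u, v, hc, rfl⟩
      exact hc.mem_weightChain
    · rintro _ ⟨A, A₀, A', g, u, v, hc, rfl⟩ hx
      obtain ⟨F, s, -, h2, h3⟩ := IsConfig.reached hω hz0 hz q p hc h
      rw [LinearMap.comp_apply, h3 ψ hψ _ rfl, smul_eq_sign_smul, map_smul, flagToChain_mk, ← h2]
      rfl
  exact LinearMap.congr_fun H x

include hω hz0 hz in
lemma existsUnique_isPsi : ∃! ψ, IsPsi (T := T) (m := m) ω z ψ := by
  refine ⟨_, isPsi_flagChainEquiv_symm hω hz0 hz, fun ψ hψ => ?_⟩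
  funext p q h
  refine LinearMap.ext fun x => ?_
  change _ = (flagChainEquiv hω hz0 hz p q h).symm x
  rw [LinearEquiv.eq_symm_apply]
  exact Subtype.ext (hψ.flagToChain_apply hω hz0 hz h x)

end PsiMaps

/-! ### Substitution of letters -/

section LetterHom

variable {X Y Z J : Type}

attribute [local instance] LieRing.ofAssociativeRing

/-- The homomorphism of free Lie algebras that replaces the generator `x` by the generator `f x`. -/
def letterHom (f : X → Y) : FreeLieAlgebra ℂ X →ₗ⁅ℂ⁆ FreeLieAlgebra ℂ Y :=
  FreeLieAlgebra.lift ℂ fun x => FreeLieAlgebra.of ℂ (f x)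

@[simp]
lemma letterHom_of (f : X → Y) (x : X) :
    letterHom f (FreeLieAlgebra.of ℂ x) = FreeLieAlgebra.of ℂ (f x) := by
  simp [letterHom]

lemma lieHom_permHom {e : Equiv.Perm X} {e' : Equiv.Perm Y}
    {φ : FreeLieAlgebra ℂ X →ₗ⁅ℂ⁆ FreeLieAlgebra ℂ Y}
    (h : ∀ x, φ (FreeLieAlgebra.of ℂ (e x)) = permHom e' (φ (FreeLieAlgebra.of ℂ x)))
    (g : FreeLieAlgebra ℂ X) : φ (permHom e g) = permHom e' (φ g) := by
  suffices H : φ.comp (permHom e) = (permHom e').comp φ from LieHom.congr_fun H g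
  refine FreeLieAlgebra.hom_ext fun x => ?_
  rw [LieHom.comp_apply, LieHom.comp_apply, permHom_of, h]

lemma letterHom_permHom {e : Equiv.Perm X} {e' : Equiv.Perm Y} {f : X → Y}
    (hf : ∀ x, f (e x) = e' (f x)) (g : FreeLieAlgebra ℂ X) :
    letterHom f (permHom e g) = permHom e' (letterHom f g) :=
  lieHom_permHom (fun x => by simp [hf]) g

lemma IsCommutator.letterHom (f : X → Y) {A : Multiset X} {g : FreeLieAlgebra ℂ X}
    (h : IsCommutator A g) : IsCommutator (A.map f) (letterHom f g) := by
  induction h with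
  | of x =>
    rw [letterHom_of, Multiset.map_singleton]
    exact IsCommutator.of _
  | lie _ _ ih₁ ih₂ =>
    rw [LieHom.map_lie, Multiset.map_add]
    exact ih₁.lie ih₂

lemma IsCycCommutator.letterHom {e : Equiv.Perm X} {e' : Equiv.Perm Y} {n : ℕ} {hn : e ^ n = 1}
    (hn' : e' ^ n = 1) {f : X → Y} (hf : ∀ x, f (e x) = e' (f x)) {A : Multiset X}
    {y : fixedSubalgebra e} (h : IsCycCommutator hn A y) :
    IsCycCommutator hn' (A.map f) (fixedMap (Cyclotomic.letterHom f) (letterHom_permHom hf) y) := by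
  obtain ⟨g, hg, rfl⟩ := h
  exact ⟨_, hg.letterHom f, fixedMap_cycSum hn hn' _ _ _⟩

/-- The chain map that replaces the letter `x` by the letter `f x`. -/
def letterMap {e : Equiv.Perm X} {e' : Equiv.Perm Y} {f : X → Y}
    (hf : ∀ x, f (e x) = e' (f x)) (N k : ℕ) : ChainSpace e N k →ₗ[ℂ] ChainSpace e' N k :=
  chainMap (letterHom f) (letterHom_permHom hf) N k

variable {N k : ℕ}

lemma IsMonomialChain.letterMap {e : Equiv.Perm X} {e' : Equiv.Perm Y} {n : ℕ} {hn : e ^ n = 1}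
    (hn' : e' ^ n = 1) {f : X → Y} (hf : ∀ x, f (e x) = e' (f x)) {A : Fin k → Multiset X}
    {A₀ : Multiset X} {A' : Fin N → Multiset X} {x : ChainSpace e N k}
    (h : IsMonomialChain hn A A₀ A' x) :
    IsMonomialChain hn' (fun b => (A b).map f) (A₀.map f) (fun j => (A' j).map f)
      (letterMap hf N k x) := by
  obtain ⟨g, u, v, hg, hu, hv, rfl⟩ := h
  exact ⟨_, _, _, fun i => (hg i).letterHom hn' hf,
    hu.envMap (S' := IsCycCommutator hn') _ (Multiset.mapAddMonoidHom f)
      fun _ _ h => h.letterHom hn' hf,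
    fun j => (hv j).envMap (S' := IsCommutator) _ (Multiset.mapAddMonoidHom f)
      fun _ _ h => h.letterHom f, chainMap_tmul _ _ _ _ _⟩

lemma totalContent_map (f : X → Y) (A : Fin k → Multiset X) (A₀ : Multiset X)
    (A' : Fin N → Multiset X) : totalContent (fun b => (A b).map f) (A₀.map f)
      (fun j => (A' j).map f) = (totalContent A A₀ A').map f := by
  rw [totalContent, totalContent, Multiset.map_add, Multiset.map_add, map_sum_multiset,
    map_sum_multiset]

lemma chainSpace_hom_ext {e : Equiv.Perm X} {n : ℕ} (hn : e ^ n = 1) (h0 : n ≠ 0)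
    {E : Type*} [AddCommMonoid E] [Module ℂ E] {f f' : ChainSpace e N k →ₗ[ℂ] E}
    (h : ∀ A A₀ A' x, IsMonomialChain hn A A₀ A' x → f x = f' x) : f = f' :=
  LinearMap.ext_on (span_isMonomialChain hn h0 N k) fun x ⟨A, A₀, A', hx⟩ => h A A₀ A' x hx

lemma envMap_envMap {L L' L'' : Type} [LieRing L] [LieAlgebra ℂ L] [LieRing L'] [LieAlgebra ℂ L']
    [LieRing L''] [LieAlgebra ℂ L''] {φ : L →ₗ⁅ℂ⁆ L'} {φ' : L' →ₗ⁅ℂ⁆ L''} {ψ : L →ₗ⁅ℂ⁆ L''}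
    (h : ∀ x, φ' (φ x) = ψ x) (u : UniversalEnvelopingAlgebra ℂ L) :
    envMap φ' (envMap φ u) = envMap ψ u := by
  suffices H : (envMap φ').comp (envMap φ) = envMap ψ from DFunLike.congr_fun H u
  refine UniversalEnvelopingAlgebra.hom_ext (R := ℂ) ?_
  ext x
  change envMap φ' (envMap φ (UniversalEnvelopingAlgebra.ι ℂ x)) =
    envMap ψ (UniversalEnvelopingAlgebra.ι ℂ x)
  rw [envMap_ι, envMap_ι, envMap_ι, h]

lemma chainMap_chainMap {e : Equiv.Perm X} {e' : Equiv.Perm Y} {e'' : Equiv.Perm Z} {n : ℕ}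
    (hn : e ^ n = 1) (h0 : n ≠ 0) {φ : FreeLieAlgebra ℂ X →ₗ⁅ℂ⁆ FreeLieAlgebra ℂ Y}
    {φ' : FreeLieAlgebra ℂ Y →ₗ⁅ℂ⁆ FreeLieAlgebra ℂ Z}
    {ψ : FreeLieAlgebra ℂ X →ₗ⁅ℂ⁆ FreeLieAlgebra ℂ Z}
    (hφ : ∀ x, φ (permHom e x) = permHom e' (φ x))
    (hφ' : ∀ x, φ' (permHom e' x) = permHom e'' (φ' x))
    (hψ : ∀ x, ψ (permHom e x) = permHom e'' (ψ x))
    (h : ∀ x, φ' (φ (FreeLieAlgebra.of ℂ x)) = ψ (FreeLieAlgebra.of ℂ x)) (w : ChainSpace e N k) :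
    chainMap φ' hφ' N k (chainMap φ hφ N k w) = chainMap ψ hψ N k w := by
  have h' : ∀ x, φ' (φ x) = ψ x :=
    LieHom.congr_fun (FreeLieAlgebra.hom_ext (F₁ := φ'.comp φ) fun x => h x)
  suffices H : chainMap φ' hφ' N k ∘ₗ chainMap φ hφ N k = chainMap ψ hψ N k from
    LinearMap.congr_fun H w
  refine chainSpace_hom_ext hn h0 ?_
  rintro A A₀ A' x ⟨g, u, v, -, -, -, rfl⟩
  rw [LinearMap.comp_apply, chainMap_tmul, chainMap_tmul, chainMap_tmul,
    envMap_envMap (ψ := fixedMap ψ hψ) fun x => Subtype.ext (h' x)]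
  congr 3
  · exact funext fun i => Subtype.ext (h' _)
  · exact funext fun j => envMap_envMap h' _

lemma chainMap_comm {W : Type} {e : Equiv.Perm X} {e' : Equiv.Perm Y} {e'' : Equiv.Perm Z}
    {e₁ : Equiv.Perm W} {n : ℕ} (hn : e ^ n = 1) (h0 : n ≠ 0)
    {φ : FreeLieAlgebra ℂ X →ₗ⁅ℂ⁆ FreeLieAlgebra ℂ Y}
    {φ' : FreeLieAlgebra ℂ Y →ₗ⁅ℂ⁆ FreeLieAlgebra ℂ Z}
    {χ : FreeLieAlgebra ℂ X →ₗ⁅ℂ⁆ FreeLieAlgebra ℂ W}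
    {χ' : FreeLieAlgebra ℂ W →ₗ⁅ℂ⁆ FreeLieAlgebra ℂ Z}
    (hφ : ∀ x, φ (permHom e x) = permHom e' (φ x))
    (hφ' : ∀ x, φ' (permHom e' x) = permHom e'' (φ' x))
    (hχ : ∀ x, χ (permHom e x) = permHom e₁ (χ x))
    (hχ' : ∀ x, χ' (permHom e₁ x) = permHom e'' (χ' x))
    (h : ∀ x, φ' (φ (FreeLieAlgebra.of ℂ x)) = χ' (χ (FreeLieAlgebra.of ℂ x)))
    (w : ChainSpace e N k) :
    chainMap φ' hφ' N k (chainMap φ hφ N k w) = chainMap χ' hχ' N k (chainMap χ hχ N k w) := by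
  have hc : ∀ x, φ'.comp φ (permHom e x) = permHom e'' (φ'.comp φ x) := fun x => by
    rw [LieHom.comp_apply, LieHom.comp_apply, hφ, hφ']
  rw [chainMap_chainMap hn h0 hφ hφ' hc fun x => rfl]
  exact (chainMap_chainMap hn h0 hχ hχ' hc (fun x => (h x).symm) w).symm

lemma IsMonomialChain.coe_weightProj [Fintype J] [DecidableEq J] {e : Equiv.Perm X} {n : ℕ}
    {hn : e ^ n = 1} (h0 : n ≠ 0) {deg : X → J → ℕ} (hdeg : ∀ x, deg (e x) = deg x)
    {A : Fin k → Multiset X} {A₀ : Multiset X} {A' : Fin N → Multiset X} {x : ChainSpace e N k}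
    (h : IsMonomialChain hn A A₀ A' x) (μ : J → ℕ) :
    (weightProj e deg N k μ x : ChainSpace e N k) =
      if degSum deg (totalContent A A₀ A') = μ then x else 0 := by
  have hx := h.mem_weightChain hdeg
  split_ifs with hμ
  · rw [hμ] at hx
    rw [weightProj_apply_self hn h0 hdeg hx]
  · rw [weightProj_apply_of_ne hn h0 hdeg hμ hx]
    rfl

end LetterHom

/-! ### Lifting monomials along a substitution of letters -/

section Lift

variable {X Y : Type} {N k : ℕ}

attribute [local instance] LieRing.ofAssociativeRing

lemma exists_add_of_map_eq_add {f : X → Y} {B : Multiset X} {A₁ A₂ : Multiset Y}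
    (h : B.map f = A₁ + A₂) : ∃ B₁ B₂, B = B₁ + B₂ ∧ B₁.map f = A₁ ∧ B₂.map f = A₂ := by
  induction A₁ using Multiset.induction_on generalizing B with
  | empty => exact ⟨0, B, (zero_add B).symm, rfl, by rw [h, zero_add]⟩
  | cons a A ih =>
    obtain ⟨b, hb, rfl⟩ := Multiset.mem_map.1 (h ▸ by simp : a ∈ B.map f)
    obtain ⟨B, rfl⟩ := Multiset.exists_cons_of_mem hb
    rw [Multiset.map_cons, Multiset.cons_add, Multiset.cons_inj_right] at h
    obtain ⟨B₁, B₂, rfl, h₁, h₂⟩ := ih h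
    exact ⟨b ::ₘ B₁, B₂, by simp, by simp [h₁], h₂⟩

lemma exists_sum_of_map_eq_sum {f : X → Y} : ∀ {k : ℕ} {B : Multiset X} {A : Fin k → Multiset Y}
    (_ : B.map f = ∑ i, A i), ∃ C : Fin k → Multiset X, B = ∑ i, C i ∧ ∀ i, (C i).map f = A i
  | 0, B, A, h => ⟨fun _ => 0, by simpa using h, fun i => i.elim0⟩
  | k + 1, B, A, h => by
    rw [Fin.sum_univ_succ] at h
    obtain ⟨B₁, B₂, rfl, h₁, h₂⟩ := exists_add_of_map_eq_add h
    obtain ⟨C, rfl, hC⟩ := exists_sum_of_map_eq_sum h₂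
    exact ⟨Fin.cons B₁ C, by rw [Fin.sum_univ_succ]; rfl, fun i => Fin.cases h₁ hC i⟩

lemma IsCommutator.exists_lift {f : X → Y} {A : Multiset Y} {g : FreeLieAlgebra ℂ Y}
    (h : IsCommutator A g) {B : Multiset X} (hB : B.map f = A) :
    ∃ g', IsCommutator B g' ∧ Cyclotomic.letterHom f g' = g := by
  induction h generalizing B with
  | of x =>
    obtain ⟨b, rfl, rfl⟩ := Multiset.map_eq_singleton.1 hB
    exact ⟨_, IsCommutator.of b, letterHom_of f b⟩
  | lie _ _ ih₁ ih₂ =>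
    obtain ⟨B₁, B₂, rfl, h₁, h₂⟩ := exists_add_of_map_eq_add hB
    obtain ⟨g₁, hg₁, rfl⟩ := ih₁ h₁
    obtain ⟨g₂, hg₂, rfl⟩ := ih₂ h₂
    exact ⟨_, hg₁.lie hg₂, LieHom.map_lie _ _ _⟩

lemma EnvMonomial.exists_lift {L L' : Type} [LieRing L] [LieAlgebra ℂ L] [LieRing L']
    [LieAlgebra ℂ L'] {S : Multiset Y → L → Prop} {S' : Multiset X → L' → Prop} {f : X → Y}
    {φ : L' →ₗ⁅ℂ⁆ L}
    (hS : ∀ A y, S A y → ∀ B : Multiset X, B.map f = A → ∃ y', S' B y' ∧ φ y' = y)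
    {A : Multiset Y} {u : UniversalEnvelopingAlgebra ℂ L} (h : EnvMonomial S A u)
    {B : Multiset X} (hB : B.map f = A) : ∃ u', EnvMonomial S' B u' ∧ Cyclotomic.envMap φ u' = u := by
  induction h generalizing B with
  | one =>
    obtain rfl := Multiset.map_eq_zero.1 hB
    exact ⟨1, EnvMonomial.one, map_one _⟩
  | mul hg _ ih =>
    obtain ⟨B₁, B₂, rfl, h₁, h₂⟩ := exists_add_of_map_eq_add hB
    obtain ⟨g, hg', rfl⟩ := hS _ _ hg _ h₁
    obtain ⟨u', hu, rfl⟩ := ih h₂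
    exact ⟨_, EnvMonomial.mul hg' hu, by rw [map_mul, envMap_ι]⟩

lemma IsMonomialChain.exists_lift {e : Equiv.Perm X} {e' : Equiv.Perm Y} {n : ℕ} (hn : e ^ n = 1)
    {hn' : e' ^ n = 1} {f : X → Y} (hf : ∀ x, f (e x) = e' (f x)) {A : Fin k → Multiset Y}
    {A₀ : Multiset Y} {A' : Fin N → Multiset Y} {x : ChainSpace e' N k}
    (h : IsMonomialChain hn' A A₀ A' x) {B : Multiset X} (hB : B.map f = totalContent A A₀ A') :
    ∃ C C₀ C' y, IsMonomialChain hn C C₀ C' y ∧ totalContent C C₀ C' = B ∧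
      Cyclotomic.letterMap hf N k y = x := by
  obtain ⟨g, u, v, hg, hu, hv, rfl⟩ := h
  obtain ⟨B₁, B₂, rfl, h₁, h₂⟩ := exists_add_of_map_eq_add hB
  obtain ⟨B₁, C₀, rfl, h₁, h₀⟩ := exists_add_of_map_eq_add h₁
  obtain ⟨C, rfl, hC⟩ := exists_sum_of_map_eq_sum h₁
  obtain ⟨C', rfl, hC'⟩ := exists_sum_of_map_eq_sum h₂
  have hcyc : ∀ A y, IsCycCommutator hn' A y → ∀ B : Multiset X, B.map f = A →
      ∃ y', IsCycCommutator hn B y' ∧ fixedMap (letterHom f) (letterHom_permHom hf) y' = y := by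
    rintro A _ ⟨g, hg, rfl⟩ B hB
    obtain ⟨g', hg', rfl⟩ := hg.exists_lift hB
    exact ⟨_, ⟨g', hg', rfl⟩, fixedMap_cycSum hn hn' _ _ _⟩
  choose g' hg' hgg using fun i => hcyc _ _ (hg i) _ (hC i)
  obtain ⟨u', hu', rfl⟩ := hu.exists_lift hcyc h₀
  choose v' hv' hvv using fun j => (hv j).exists_lift (φ := letterHom f)
    (fun _ _ h _ hB => h.exists_lift hB) (hC' j)
  refine ⟨C, C₀, C', _, ⟨g', u', v', hg', hu', hv', rfl⟩, rfl, ?_⟩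
  rw [Cyclotomic.letterMap, chainMap_tmul]
  simp only [hgg, hvv]

end Lift

/-! ### Expansion of a substitution of sums of letters -/

section Expand

variable {X Y C I : Type} [Fintype C] [Fintype I] [DecidableEq I] {N k : ℕ}

attribute [local instance] LieRing.ofAssociativeRing

omit [DecidableEq I] in
lemma exists_section_of_map_eq_univ {f : Y → I} {B : Multiset Y} (h : B.map f = Finset.univ.val) :
    ∃ s : I → Y, B = Finset.univ.val.map s ∧ ∀ i, f (s i) = i := by
  have hmem : ∀ i, ∃ y ∈ B, f y = i := fun i => Multiset.mem_map.1 (h ▸ Finset.mem_univ i)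
  choose s hs hsi using hmem
  refine ⟨s, (Multiset.eq_of_le_of_card_le ?_ ?_).symm, hsi⟩
  · refine (Multiset.le_iff_subset ?_).2 fun y hy => ?_
    · exact (Multiset.nodup_map_iff_of_injective fun a b hab => by
        rw [← hsi a, ← hsi b, hab]).2 Finset.univ.nodup
    · obtain ⟨i, -, rfl⟩ := Multiset.mem_map.1 hy
      exact hs i
  · rw [Multiset.card_map, ← h, Multiset.card_map]

/-- The homomorphism that replaces the generator `x` by the combination of the generators `(x, c)` with
the coefficients `w x c`. -/
def spreadHom (w : X → C → ℂ) : FreeLieAlgebra ℂ X →ₗ⁅ℂ⁆ FreeLieAlgebra ℂ (X × C) :=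
  FreeLieAlgebra.lift ℂ fun x => ∑ c, w x c • FreeLieAlgebra.of ℂ (x, c)

lemma spreadHom_of (w : X → C → ℂ) (x : X) : spreadHom w (FreeLieAlgebra.of ℂ x) =
    ∑ c, w x c • FreeLieAlgebra.of ℂ (x, c) := by
  simp [spreadHom]

lemma spreadHom_permHom {e : Equiv.Perm X} {w : X → C → ℂ} (hw : ∀ x c, w (e x) c = w x c)
    (g : FreeLieAlgebra ℂ X) : spreadHom w (permHom e g) =
      permHom (e.prodCongr (Equiv.refl C)) (spreadHom w g) :=
  lieHom_permHom (fun x => by simp [spreadHom_of, hw]) g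

variable [DecidableEq C] {e : Equiv.Perm X} {n : ℕ}

omit [Fintype C] [DecidableEq C] in
lemma prodCongr_refl_pow (hn : e ^ n = 1) : (e.prodCongr (Equiv.refl C)) ^ n = 1 := by
  have h : ∀ j, (e.prodCongr (Equiv.refl C)) ^ j = (e ^ j).prodCongr (Equiv.refl C) := by
    intro j
    induction j with
    | zero => ext x <;> simp
    | succ j ih =>
      rw [pow_succ, ih]
      ext x <;> simp [pow_succ]
  rw [h, hn]
  ext x <;> simp

lemma sum_prod_section (idx : X → I) {B : Multiset (X × C)}
    (h : B.map (fun y => idx y.1) = Finset.univ.val) :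
    ∑ α : I → C, (B.map fun y => if α (idx y.1) = y.2 then (1 : ℂ) else 0).prod = 1 := by
  obtain ⟨s, rfl, hs⟩ := exists_section_of_map_eq_univ h
  simp only [Multiset.map_map, Function.comp_def, hs]
  have h1 : ∀ α : I → C, (Finset.univ.val.map fun i => if α i = (s i).2 then (1 : ℂ) else 0).prod =
      if α = fun i => (s i).2 then 1 else 0 := by
    intro α
    change ∏ i, (if α i = (s i).2 then (1 : ℂ) else 0) = _
    rw [Finset.prod_ite_zero]
    simp [funext_iff]
  rw [Finset.sum_congr rfl fun α _ => h1 α]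
  simp

/-- A substitution of linear combinations of letters, applied to a chain which is linear in the letters
of each class, is a combination of substitutions of letters. -/
lemma chainMap_eq_sum_letterMap (hn : e ^ n = 1) (h0 : n ≠ 0) {e' : Equiv.Perm Y} (idx : X → I)
    (hidx : ∀ x, idx (e x) = idx x) (w : I → C → ℂ) (f : I → C → X → Y)
    (hf : ∀ i c x, f i c (e x) = e' (f i c x))
    (φ : FreeLieAlgebra ℂ X →ₗ⁅ℂ⁆ FreeLieAlgebra ℂ Y)
    (hφ : ∀ x, φ (permHom e x) = permHom e' (φ x))
    (h : ∀ x, φ (FreeLieAlgebra.of ℂ x) =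
      ∑ c, w (idx x) c • FreeLieAlgebra.of ℂ (f (idx x) c x))
    {y : ChainSpace e N k}
    (hy : y ∈ weightChain e (fun x => (Pi.single (idx x) 1 : I → ℕ)) N k 1) :
    chainMap φ hφ N k y = ∑ α : I → C, (∏ i, w i (α i)) •
      letterMap (f := fun x => f (idx x) (α (idx x)) x) (e := e) (e' := e')
        (fun x => by rw [hidx, hf]) N k y := by
  have hY : e.prodCongr (Equiv.refl C) ^ n = 1 := prodCongr_refl_pow hn
  have hsp := spreadHom_permHom (e := e) (w := fun x c => w (idx x) c) (by simp [hidx])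
  have hQ : ∀ y : X × C, f (idx (e.prodCongr (Equiv.refl C) y).1) (e.prodCongr (Equiv.refl C) y).2
      (e.prodCongr (Equiv.refl C) y).1 = e' (f (idx y.1) y.2 y.1) := fun y => by
    simp [hidx, hf]
  have hP : ∀ α : I → C, ∀ y : X × C, (if α (idx (e.prodCongr (Equiv.refl C) y).1) =
      (e.prodCongr (Equiv.refl C) y).2 then (1 : ℂ) else 0) =
      if α (idx y.1) = y.2 then (1 : ℂ) else 0 := fun α y => by simp [hidx]
  have hdeg : ∀ x, (Pi.single (idx (e x)) 1 : I → ℕ) = Pi.single (idx x) 1 := fun x => by rw [hidx]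
  have hdegY : ∀ y : X × C, (Pi.single (idx (e.prodCongr (Equiv.refl C) y).1) 1 : I → ℕ) =
      Pi.single (idx y.1) 1 := fun y => by simp [hidx]
  have hD : chainMap (spreadHom fun x c => w (idx x) c) hsp N k y ∈
      weightChain (e.prodCongr (Equiv.refl C)) (fun y => (Pi.single (idx y.1) 1 : I → ℕ)) N k 1 := by
    rw [mem_weightChain_iff hn h0 hdeg] at hy
    rw [mem_weightChain_iff hY h0 hdegY]
    have e1 := congrArg (chainMap (spreadHom fun x c => w (idx x) c) hsp N k) hy
    rw [map_smul] at e1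
    rw [← e1]
    refine chainMap_comm hn h0 _ _ _ _ (fun x => ?_) y
    simp only [spreadHom_of, scaleHom_of, map_smul, map_sum, Finset.smul_sum]
    exact Finset.sum_congr rfl fun c _ => smul_comm _ _ _
  have hexp : ∀ v ∈ weightChain (e.prodCongr (Equiv.refl C))
      (fun y => (Pi.single (idx y.1) 1 : I → ℕ)) N k 1,
      ∑ α : I → C, chainMap (scaleHom fun y : X × C => if α (idx y.1) = y.2 then (1 : ℂ) else 0)
        (scaleHom_permHom (hP α)) N k v = v := by
    intro v hv
    replace hv := weightChain_le hY h0 _ N k _ hv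
    have := LinearMap.eqOn_span (f := ∑ α : I → C,
      chainMap (scaleHom fun y : X × C => if α (idx y.1) = y.2 then (1 : ℂ) else 0)
        (scaleHom_permHom (hP α)) N k) (g := LinearMap.id) ?_ hv
    · simpa using this
    · rintro x ⟨A, A₀, A', hx, hd⟩
      rw [degSum_single_eq_one_iff] at hd
      rw [LinearMap.sum_apply, Finset.sum_congr rfl fun α _ => hx.map_scaleHom (hP α),
        ← Finset.sum_smul, sum_prod_section idx hd, one_smul, LinearMap.id_apply]
  have hJ : chainMap φ hφ N k y = chainMap (letterHom fun y : X × C => f (idx y.1) y.2 y.1)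
      (letterHom_permHom hQ) N k (chainMap (spreadHom fun x c => w (idx x) c) hsp N k y) := by
    refine (chainMap_chainMap hn h0 _ _ _ (fun x => ?_) y).symm
    simp [spreadHom_of, h]
  rw [hJ, ← hexp _ hD, map_sum]
  refine Finset.sum_congr rfl fun α _ => ?_
  have hsc : chainMap (scaleHom fun x => w (idx x) (α (idx x)))
      (scaleHom_permHom fun x => by rw [hidx]) N k y = (∏ i, w i (α i)) • y := by
    replace hy := weightChain_le hn h0 _ N k _ hy
    have := LinearMap.eqOn_span (f := chainMap (scaleHom fun x => w (idx x) (α (idx x)))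
      (scaleHom_permHom fun x => by rw [hidx]) N k) (g := (∏ i, w i (α i)) • LinearMap.id) ?_ hy
    · simpa using this
    · rintro x ⟨A, A₀, A', hx, hd⟩
      rw [degSum_single_eq_one_iff] at hd
      rw [hx.map_scaleHom (fun x => by rw [hidx]), LinearMap.smul_apply, LinearMap.id_apply]
      congr 1
      rw [← Function.comp_def (fun i => w i (α i)) idx, ← Multiset.map_map, hd]
      rfl
  rw [← map_smul, ← hsc, letterMap]
  have hQP : ∀ g, (letterHom fun y : X × C => f (idx y.1) y.2 y.1).comp
      (scaleHom fun y : X × C => if α (idx y.1) = y.2 then (1 : ℂ) else 0)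
      (permHom (e.prodCongr (Equiv.refl C)) g) = permHom e'
        ((letterHom fun y : X × C => f (idx y.1) y.2 y.1).comp
      (scaleHom fun y : X × C => if α (idx y.1) = y.2 then (1 : ℂ) else 0) g) := fun g => by
    rw [LieHom.comp_apply, LieHom.comp_apply, scaleHom_permHom (hP α), letterHom_permHom hQ]
  rw [chainMap_chainMap hY h0 (scaleHom_permHom (hP α)) (letterHom_permHom hQ) hQP fun _ => rfl]
  refine chainMap_comm hn h0 _ _ _ _ (fun x => ?_) y
  simp only [spreadHom_of, scaleHom_of, map_smul, map_sum, LieHom.comp_apply, letterHom_of]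
  rw [Finset.sum_eq_single (α (idx x)) (fun c _ hc => by rw [if_neg (Ne.symm hc), zero_smul,
    smul_zero]) fun h => (h (Finset.mem_univ _)).elim, if_pos rfl, one_smul]

end Expand

/-! ### The symmetrization as a sum over substitutions -/

section Substitution

variable {T m N k : ℕ}

attribute [local instance] LieRing.ofAssociativeRing

/-- The substitution of letters that turns `ᵏf_p` into `ᵏ⁺ᶜf_q` where `(c, q) = α p`. -/
def subst (α : Fin m → ZMod T × Fin m) (x : ZMod T × Fin m) : ZMod T × Fin m :=
  (x.1 + (α x.2).1, (α x.2).2)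

lemma subst_cycShift (α : Fin m → ZMod T × Fin m) (x : ZMod T × Fin m) :
    subst α (cycShift T m x) = cycShift T m (subst α x) := by
  ext
  · exact add_right_comm _ _ _
  · rfl

lemma subst_injective {α : Fin m → ZMod T × Fin m}
    (hα : Function.Injective fun p => (α p).2) : Function.Injective (subst α) := by
  rintro ⟨c, p⟩ ⟨d, q⟩ h
  obtain ⟨h1, h2⟩ := Prod.ext_iff.1 h
  obtain rfl := hα h2
  exact Prod.ext (add_right_cancel h1) rfl

lemma map_snd_map_subst (α : Fin m → ZMod T × Fin m) (B : Multiset (ZMod T × Fin m)) :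
    (B.map (subst α)).map Prod.snd = (B.map Prod.snd).map fun p => (α p).2 := by
  rw [Multiset.map_map, Multiset.map_map]
  rfl

lemma univ_map_eq_univ_iff {f : Fin m → Fin m} :
    (Finset.univ : Finset (Fin m)).val.map f = Finset.univ.val ↔ Function.Bijective f := by
  constructor
  · intro h
    refine Finite.surjective_iff_bijective.1 fun i => ?_
    obtain ⟨j, -, hj⟩ := Multiset.mem_map.1 (by rw [h]; exact Finset.mem_univ i :
      i ∈ (Finset.univ : Finset (Fin m)).val.map f)
    exact ⟨j, hj⟩
  · intro h
    have := congrArg Finset.val (Finset.map_univ_equiv (Equiv.ofBijective f h))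
    rwa [Finset.map_val] at this

variable [NeZero T]

/-- The substitution of letters on chains. -/
def substMap (α : Fin m → ZMod T × Fin m) (N k : ℕ) :
    ChainSpace (cycShift T m) N k →ₗ[ℂ] ChainSpace (cycShift T m) N k :=
  letterMap (subst_cycShift α) N k

open Classical in
lemma weightProj_substMap (α : Fin m → ZMod T × Fin m) {y : ChainSpace (cycShift T m) N k}
    (hy : y ∈ weightChain (cycShift T m) (degIndex T m) N k 1) :
    (weightProj (cycShift T m) (degIndex T m) N k 1 (substMap α N k y) :
      ChainSpace (cycShift T m) N k) =
      if Function.Bijective fun p => (α p).2 then substMap α N k y else 0 := by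
  have H := LinearMap.eqOn_span (f := (weightChain (cycShift T m) (degIndex T m) N k 1).subtype ∘ₗ
      weightProj (cycShift T m) (degIndex T m) N k 1 ∘ₗ substMap α N k)
    (g := if Function.Bijective fun p => (α p).2 then substMap α N k else 0) ?_
    (weightChain_le cycShift_pow_self (NeZero.ne T) _ _ _ _ hy)
  · refine H.trans ?_
    split_ifs <;> rfl
  · rintro x ⟨A, A₀, A', hx, hd⟩
    have e := (hx.letterMap cycShift_pow_self (subst_cycShift α)).coe_weightProj (NeZero.ne T)
      degIndex_cycShift 1
    refine e.trans ?_
    rw [totalContent_map]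
    have hd' := (degSum_single_eq_one_iff Prod.snd _).1 hd
    have h2 : degSum (degIndex T m) ((totalContent A A₀ A').map (subst α)) = 1 ↔
        Function.Bijective fun p => (α p).2 := by
      refine (degSum_single_eq_one_iff Prod.snd _).trans ?_
      rw [map_snd_map_subst, hd', univ_map_eq_univ_iff]
    simp only [h2]
    split_ifs <;> rfl

lemma coe_weightProj_substMap_comm {α : Fin m → ZMod T × Fin m}
    (hα : Function.Bijective fun p => (α p).2) (w : ChainSpace (cycShift T m) N k) :
    substMap α N k (weightProj (cycShift T m) (degIndex T m) N k 1 w) =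
      weightProj (cycShift T m) (degIndex T m) N k 1 (substMap α N k w) := by
  suffices H : substMap α N k ∘ₗ (weightChain (cycShift T m) (degIndex T m) N k 1).subtype ∘ₗ
      weightProj (cycShift T m) (degIndex T m) N k 1 =
      (weightChain (cycShift T m) (degIndex T m) N k 1).subtype ∘ₗ
      weightProj (cycShift T m) (degIndex T m) N k 1 ∘ₗ substMap α N k from LinearMap.congr_fun H w
  refine chainSpace_hom_ext cycShift_pow_self (NeZero.ne T) fun A A₀ A' x hx => ?_
  have e1 := hx.coe_weightProj (NeZero.ne T) degIndex_cycShift 1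
  have e2 := (hx.letterMap cycShift_pow_self (subst_cycShift α)).coe_weightProj (NeZero.ne T)
      degIndex_cycShift 1
  rw [totalContent_map] at e2
  have h2 : degSum (degIndex T m) ((totalContent A A₀ A').map (subst α)) = 1 ↔
      degSum (degIndex T m) (totalContent A A₀ A') = 1 := by
    refine (degSum_single_eq_one_iff Prod.snd _).trans
      (Iff.trans ?_ (degSum_single_eq_one_iff Prod.snd _).symm)
    rw [map_snd_map_subst]
    have e3 := (univ_map_eq_univ_iff (f := fun p => (α p).2)).2 hα
    constructor
    · intro h
      exact Multiset.map_injective hα.1 (h.trans e3.symm)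
    · intro h
      rw [h, e3]
  change substMap α N k _ = _
  refine (congrArg _ e1).trans (Eq.trans ?_ e2.symm)
  simp only [h2]
  split_ifs
  · rfl
  · exact map_zero _

end Substitution

section

lemma map_sum_prod_ite_smul {E ι κ : Type*} [Fintype ι] [Fintype κ] [AddCommGroup E] [Module ℂ E]
    (W : E →ₗ[ℂ] E) (S : ι → E) (C : ι → κ → Prop) (Q P : ι → Prop)
    [∀ i p, Decidable (C i p)] [DecidablePred Q] [DecidablePred P] (hP : ∀ i, P i ↔ (∀ p, C i p) ∧ Q i) (h : ∀ i, W (S i) = if Q i then S i else 0) :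
    W (∑ i, (∏ p, if C i p then (1 : ℂ) else 0) • S i) = ∑ i with P i, S i := by
  rw [map_sum, Finset.sum_filter]
  refine Finset.sum_congr rfl fun i _ => ?_
  rw [map_smul, h, Finset.prod_ite_zero]
  have := hP i
  split_ifs <;> simp_all

end

section Project

variable {R r T N k : ℕ} [NeZero T] {σ : Equiv.Perm (Fin R)} (hT : orderOf σ = T)
  {rep : Fin r → Fin R} {lam : Fin r → ℕ}

attribute [local instance] LieRing.ofAssociativeRing

/-- The block that contains a number. -/
def block (lam : Fin r → ℕ) (p : Fin (∑ i, lam i)) : Fin r := (finSigmaFinEquiv.symm p).1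

variable (σ rep lam) in
/-- The letter of `𝔫` that corresponds to a letter of `𝔞`. -/
def toLetter (x : ZMod T × Fin (∑ i, lam i)) : Fin R := (σ ^ x.1.val) (rep (block lam x.2))

include hT in
lemma pow_val_add (a b : ZMod T) : σ ^ (a + b).val = σ ^ a.val * σ ^ b.val := by
  have h : σ ^ ((a.val + b.val) % T) = σ ^ (a.val + b.val) :=
    (pow_eq_pow_mod _ (hT ▸ pow_orderOf_eq_one σ)).symm
  rw [ZMod.val_add, h, pow_add]

omit [NeZero T] in
include hT in
lemma pow_val_natCast (a : ℕ) : σ ^ (a : ZMod T).val = σ ^ a := by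
  rw [ZMod.val_natCast]
  exact (pow_eq_pow_mod _ (hT ▸ pow_orderOf_eq_one σ)).symm

include hT in
lemma toLetter_cycShift (x : ZMod T × Fin (∑ i, lam i)) :
    toLetter σ rep lam (cycShift T _ x) = σ (toLetter σ rep lam x) := by
  change (σ ^ (x.1 + 1).val) (rep (block lam x.2)) = σ ((σ ^ x.1.val) (rep (block lam x.2)))
  rw [add_comm, pow_val_add hT, ← Nat.cast_one, pow_val_natCast hT, pow_one, Equiv.Perm.mul_apply]

omit [NeZero T] in
include hT in
lemma pow_eq_one_of_orderOf : σ ^ T = 1 := hT ▸ pow_orderOf_eq_one σ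

variable (rep) in
/-- The map of chain spaces that replaces the letters of `𝔞` by letters of `𝔫`. -/
def projectMap (N k : ℕ) :
    ChainSpace (cycShift T (∑ i, lam i)) N k →ₗ[ℂ] ChainSpace σ N k :=
  letterMap (toLetter_cycShift (rep := rep) hT) N k

variable (T σ rep lam) in
/-- The choices `(c, q)` for which `ᶜf_q` corresponds to the same letter as `⁰f_p`. -/
def IsChoice (p : Fin (∑ i, lam i)) (c : ZMod T × Fin (∑ i, lam i)) : Prop :=
  block lam c.2 = block lam p ∧ (σ ^ c.1.val) (rep (block lam p)) = rep (block lam p)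

include hT in
lemma toLetter_add_iff (hrep : ∀ a, ∃! i, σ.SameCycle (rep i) a)
    (x : ZMod T × Fin (∑ i, lam i)) (c : ZMod T × Fin (∑ i, lam i)) :
    toLetter σ rep lam (x.1 + c.1, c.2) = toLetter σ rep lam x ↔ IsChoice T σ rep lam x.2 c := by
  rw [toLetter, toLetter, pow_val_add hT, Equiv.Perm.mul_apply, (σ ^ x.1.val).injective.eq_iff]
  constructor
  · intro h
    have hb : block lam c.2 = block lam x.2 := by
      refine (hrep (rep (block lam x.2))).unique ?_ (Equiv.Perm.SameCycle.refl _ _)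
      exact ⟨c.1.val, by rw [zpow_natCast]; exact h⟩
    exact ⟨hb, by rwa [hb] at h⟩
  · rintro ⟨h1, h2⟩
    rw [h1, h2]

include hT in
lemma toLetter_subst {α : Fin (∑ i, lam i) → ZMod T × Fin (∑ i, lam i)}
    (hα : ∀ p, IsChoice T σ rep lam p (α p)) (x : ZMod T × Fin (∑ i, lam i)) :
    toLetter σ rep lam (subst α x) = toLetter σ rep lam x := by
  obtain ⟨h1, h2⟩ := hα x.2
  rw [subst, toLetter, toLetter, pow_val_add hT, Equiv.Perm.mul_apply, h1, h2]

lemma projectMap_substMap {α : Fin (∑ i, lam i) → ZMod T × Fin (∑ i, lam i)}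
    (hα : ∀ p, IsChoice T σ rep lam p (α p)) (y : ChainSpace (cycShift T (∑ i, lam i)) N k) :
    projectMap hT rep N k (substMap α N k y) = projectMap hT rep N k y := by
  refine chainMap_chainMap cycShift_pow_self (NeZero.ne T) _ _ _ (fun x => ?_) y
  rw [letterHom_of, letterHom_of, letterHom_of, toLetter_subst hT hα]

open Classical in
lemma chainMap_jHom_projectMap (hrep : ∀ a, ∃! i, σ.SameCycle (rep i) a)
    {y : ChainSpace (cycShift T (∑ i, lam i)) N k}
    (hy : y ∈ weightChain (cycShift T _) (degIndex T _) N k 1) :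
    chainMap (jHom T σ rep lam) (jHom_permHom rep lam hT) N k (projectMap hT rep N k y) =
      ∑ α : Fin (∑ i, lam i) → ZMod T × Fin (∑ i, lam i),
        (∏ p, if IsChoice T σ rep lam p (α p) then (1 : ℂ) else 0) • substMap α N k y := by
  have hJ : ∀ x, (jHom T σ rep lam).comp (letterHom (toLetter σ rep lam))
      (permHom (cycShift T (∑ i, lam i)) x) = permHom (cycShift T (∑ i, lam i))
        ((jHom T σ rep lam).comp (letterHom (toLetter σ rep lam)) x) := fun x => by
    rw [LieHom.comp_apply, LieHom.comp_apply, letterHom_permHom (toLetter_cycShift hT),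
      jHom_permHom rep lam hT]
  have e1 := chainMap_chainMap (N := N) (k := k) (cycShift_pow_self (T := T)) (NeZero.ne T)
    (letterHom_permHom (toLetter_cycShift (rep := rep) (lam := lam) hT))
    (jHom_permHom rep lam hT) hJ (fun x => rfl) y
  refine e1.trans ?_
  refine chainMap_eq_sum_letterMap (C := ZMod T × Fin (∑ i, lam i)) cycShift_pow_self (NeZero.ne T)
    (e' := cycShift T (∑ i, lam i)) Prod.snd (fun x => rfl)
    (fun p c => if IsChoice T σ rep lam p c then (1 : ℂ) else 0)
    (fun p c x => (x.1 + c.1, c.2)) (fun p c x => ?_) _ hJ (fun x => ?_) hy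
  · ext
    · exact add_right_comm _ _ _
    · rfl
  · rw [LieHom.comp_apply, letterHom_of, jHom, FreeLieAlgebra.lift_of_apply]
    simp only [ite_smul, one_smul, zero_smul]
    rw [← Finset.sum_filter]
    refine (Finset.sum_equiv ((Equiv.addLeft x.1).prodCongr (Equiv.refl _)) (fun c => ?_)
      fun c _ => rfl).symm
    simp only [Finset.mem_filter, Finset.mem_univ, true_and]
    exact (toLetter_add_iff hT hrep x c).symm

variable (T σ rep lam) in
/-- The substitutions that permute the letters with the same image in `𝔫`. -/
def IsSymmetry (α : Fin (∑ i, lam i) → ZMod T × Fin (∑ i, lam i)) : Prop :=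
  (∀ p, IsChoice T σ rep lam p (α p)) ∧ Function.Bijective fun p => (α p).2

open Classical in
lemma weightProj_jHom_projectMap (hrep : ∀ a, ∃! i, σ.SameCycle (rep i) a)
    {y : ChainSpace (cycShift T (∑ i, lam i)) N k}
    (hy : y ∈ weightChain (cycShift T _) (degIndex T _) N k 1) :
    (weightProj (cycShift T _) (degIndex T _) N k 1
      (chainMap (jHom T σ rep lam) (jHom_permHom rep lam hT) N k (projectMap hT rep N k y)) :
        ChainSpace (cycShift T _) N k) =
      ∑ α : Fin (∑ i, lam i) → ZMod T × Fin (∑ i, lam i) with IsSymmetry T σ rep lam α,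
        substMap α N k y := by
  let W : ChainSpace (cycShift T (∑ i, lam i)) N k →ₗ[ℂ] ChainSpace (cycShift T (∑ i, lam i)) N k :=
    (weightChain (cycShift T _) (degIndex T _) N k 1).subtype ∘ₗ
      weightProj (cycShift T _) (degIndex T _) N k 1
  have h0 : ∀ α, W (substMap α N k y) =
      if Function.Bijective fun p => (α p).2 then substMap α N k y else 0 :=
    fun α => weightProj_substMap α hy
  exact (congrArg W (chainMap_jHom_projectMap hT hrep hy)).trans
    (map_sum_prod_ite_smul (E := ChainSpace (cycShift T (∑ i, lam i)) N k) W
      (fun α => substMap α N k y) (fun α p => IsChoice T σ rep lam p (α p))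
      (fun α => Function.Bijective fun p => (α p).2) (IsSymmetry T σ rep lam) (fun _ => Iff.rfl) h0)

omit [NeZero T] in
lemma isSymmetry_refl : IsSymmetry T σ rep lam fun p => (0, p) :=
  ⟨fun p => ⟨rfl, by simp⟩, Function.bijective_id⟩

include hT in
lemma letterHom_subst_jHom {α : Fin (∑ i, lam i) → ZMod T × Fin (∑ i, lam i)}
    (hα : IsSymmetry T σ rep lam α) (a : Fin R) :
    letterHom (subst α) (jHom T σ rep lam (FreeLieAlgebra.of ℂ a)) =
      jHom T σ rep lam (FreeLieAlgebra.of ℂ a) := by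
  simp only [jHom, FreeLieAlgebra.lift_of_apply, map_sum]
  refine Finset.sum_equiv (Equiv.ofBijective (subst α) (Finite.injective_iff_bijective.1
    (subst_injective hα.2.1))) (fun x => ?_) fun x _ => letterHom_of _ _
  simp only [Finset.mem_filter, Finset.mem_univ, true_and]
  exact iff_of_eq (congrArg (· = a) (toLetter_subst hT hα.1 x).symm)

lemma substMap_chainMap_jHom {α : Fin (∑ i, lam i) → ZMod T × Fin (∑ i, lam i)}
    (hα : IsSymmetry T σ rep lam α) (x : ChainSpace σ N k) :
    substMap α N k (chainMap (jHom T σ rep lam) (jHom_permHom rep lam hT) N k x) =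
      chainMap (jHom T σ rep lam) (jHom_permHom rep lam hT) N k x :=
  chainMap_chainMap (N := N) (k := k) (pow_eq_one_of_orderOf hT) (NeZero.ne T)
    (jHom_permHom rep lam hT) (letterHom_permHom (subst_cycShift α)) (jHom_permHom rep lam hT)
    (letterHom_subst_jHom hT hα) x

end Project

/-! ### The image of the symmetrization -/

section Zip

lemma exists_zip_of_map_eq_map {X Y Z : Type*} {b : X → Z} {c : Y → Z} {M : Multiset X}
    {A : Multiset Y} (h : M.map b = A.map c) : ∃ B : Multiset (X × Y),
      B.map Prod.fst = M ∧ B.map Prod.snd = A ∧ ∀ x ∈ B, b x.1 = c x.2 := by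
  induction M using Multiset.induction_on generalizing A with
  | empty =>
    obtain rfl := Multiset.map_eq_zero.1 h.symm
    exact ⟨0, rfl, rfl, by simp⟩
  | cons p M ih =>
    obtain ⟨a, ha, hab⟩ := Multiset.mem_map.1 (h ▸ by simp : b p ∈ A.map c)
    obtain ⟨A, rfl⟩ := Multiset.exists_cons_of_mem ha
    rw [Multiset.map_cons, Multiset.map_cons, hab, Multiset.cons_inj_right] at h
    obtain ⟨B, rfl, rfl, hB⟩ := ih h
    refine ⟨(p, a) ::ₘ B, by simp, by simp, fun x hx => ?_⟩
    rcases Multiset.mem_cons.1 hx with rfl | hx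
    · exact hab.symm
    · exact hB x hx

lemma map_sum_of_const {E E' ι : Type*} [AddCommGroup E] [Module ℂ E] [AddCommGroup E']
    [Module ℂ E'] (f : E →ₗ[ℂ] E') {s : Finset ι} {v : ι → E} {w : E'} (h : ∀ i ∈ s, f (v i) = w) :
    f (∑ i ∈ s, v i) = (s.card : ℂ) • w := by
  rw [map_sum, Finset.sum_congr rfl h, Finset.sum_const, Nat.cast_smul_eq_nsmul]

end Zip

section Image

variable {R r T N k : ℕ} [NeZero T] {σ : Equiv.Perm (Fin R)} (hT : orderOf σ = T)
  {rep : Fin r → Fin R} {lam : Fin r → ℕ}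

attribute [local instance] LieRing.ofAssociativeRing

lemma degCycle_apply_perm (a : Fin R) : degCycle σ rep (σ a) = degCycle σ rep a := by
  funext i
  simp only [degCycle, Equiv.Perm.sameCycle_apply_right]

lemma degCycle_eq_single {a : Fin R} {i : Fin r} (hi : σ.SameCycle (rep i) a)
    (hrep : ∀ a, ∃! i, σ.SameCycle (rep i) a) : degCycle σ rep a = Pi.single i 1 := by
  funext j
  rw [degCycle, Pi.single_apply]
  exact if_congr ⟨fun h => (hrep a).unique h hi, fun h => h ▸ hi⟩ rfl rfl

omit [NeZero T] in
lemma sameCycle_toLetter (x : ZMod T × Fin (∑ i, lam i)) :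
    σ.SameCycle (rep (block lam x.2)) (toLetter σ rep lam x) :=
  ⟨x.1.val, by rw [zpow_natCast]; rfl⟩

lemma count_map_block (i : Fin r) :
    ((Finset.univ : Finset (Fin (∑ i, lam i))).val.map (block lam)).count i = lam i := by
  rw [Multiset.count_map, ← Finset.filter_val]
  change Finset.card _ = _
  rw [Finset.card_filter]
  refine (Fintype.sum_equiv finSigmaFinEquiv.symm _
    (fun s : Σ i, Fin (lam i) => if i = s.1 then 1 else 0) fun p => rfl).trans ?_
  rw [Fintype.sum_sigma]
  exact (Finset.sum_eq_single i (fun j _ h => by simp [Ne.symm h]) (by simp)).trans (by simp)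

omit [NeZero T] in
lemma degSum_degCycle_map_toLetter (hrep : ∀ a, ∃! i, σ.SameCycle (rep i) a)
    {B : Multiset (ZMod T × Fin (∑ i, lam i))} (hB : B.map Prod.snd = Finset.univ.val) :
    degSum (degCycle σ rep) (B.map (toLetter σ rep lam)) = lam := by
  have h1 : degSum (degCycle σ rep) (B.map (toLetter σ rep lam)) =
      degSum (fun i => Pi.single i 1) ((B.map Prod.snd).map (block lam)) := by
    change ((B.map _).map _).sum = (((B.map _).map _).map _).sum
    rw [Multiset.map_map, Multiset.map_map, Multiset.map_map]
    exact congrArg _ (Multiset.map_congr rfl fun x _ =>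
      degCycle_eq_single (sameCycle_toLetter x) hrep)
  funext i
  rw [h1, hB]
  exact (degSum_single id _ i).trans (by rw [Multiset.map_id, count_map_block])

omit [NeZero T] in
include hT in
lemma exists_map_toLetter (hrep : ∀ a, ∃! i, σ.SameCycle (rep i) a) {A : Multiset (Fin R)}
    (hA : degSum (degCycle σ rep) A = lam) :
    ∃ B : Multiset (ZMod T × Fin (∑ i, lam i)), B.map Prod.snd = Finset.univ.val ∧
      B.map (toLetter σ rep lam) = A := by
  choose c hc using fun a => (hrep a).exists
  have hdeg : degCycle σ rep = fun a => Pi.single (c a) 1 :=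
    funext fun a => degCycle_eq_single (hc a) hrep
  have h : (Finset.univ : Finset (Fin (∑ i, lam i))).val.map (block lam) = A.map c := by
    refine Multiset.ext.2 fun i => ?_
    rw [count_map_block, ← degSum_single, ← hdeg, hA]
  obtain ⟨B, hB, rfl, hBc⟩ := exists_zip_of_map_eq_map h
  have hk : ∀ x : Fin (∑ i, lam i) × Fin R, ∃ d : ZMod T, block lam x.1 = c x.2 →
      toLetter σ rep lam (d, x.1) = x.2 := by
    intro x
    by_cases hx : block lam x.1 = c x.2
    · obtain ⟨n, hn⟩ := (hc x.2).exists_nat_pow_eq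
      exact ⟨n, fun _ => by rw [toLetter, pow_val_natCast hT, hx, hn]⟩
    · exact ⟨0, fun h => (hx h).elim⟩
  choose d hd using hk
  refine ⟨B.map fun x => (d x, x.1), ?_, ?_⟩
  · rw [Multiset.map_map, ← hB]
    rfl
  · rw [Multiset.map_map]
    exact Multiset.map_congr rfl fun x hx => hd x (hBc x hx)

lemma projectMap_mem (hrep : ∀ a, ∃! i, σ.SameCycle (rep i) a)
    {y : ChainSpace (cycShift T (∑ i, lam i)) N k}
    (hy : y ∈ weightChain (cycShift T _) (degIndex T _) N k 1) :
    projectMap hT rep N k y ∈ weightChain σ (degCycle σ rep) N k lam := by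
  have H := weightChain_le cycShift_pow_self (NeZero.ne T) _ _ _ _ hy
  suffices h : Submodule.span ℂ _ ≤ (weightChain σ (degCycle σ rep) N k lam).comap
    (projectMap hT rep N k) from h H
  refine Submodule.span_le.2 ?_
  rintro x ⟨A, A₀, A', hx, hd⟩
  have h1 := (hx.letterMap (pow_eq_one_of_orderOf hT)
    (toLetter_cycShift (rep := rep) hT)).mem_weightChain (degCycle_apply_perm (rep := rep))
  rw [totalContent_map, degSum_degCycle_map_toLetter hrep
    ((degSum_single_eq_one_iff Prod.snd _).1 hd)] at h1
  exact h1

lemma exists_projectMap_eq (hrep : ∀ a, ∃! i, σ.SameCycle (rep i) a) {x : ChainSpace σ N k}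
    (hx : x ∈ weightChain σ (degCycle σ rep) N k lam) :
    ∃ y ∈ weightChain (cycShift T (∑ i, lam i)) (degIndex T _) N k 1,
      projectMap (lam := lam) hT rep N k y = x := by
  have H := weightChain_le (pow_eq_one_of_orderOf hT) (NeZero.ne T) _ _ _ _ hx
  suffices h : Submodule.span ℂ _ ≤ (weightChain (cycShift T _) (degIndex T _) N k 1).map
    (projectMap hT rep N k) from h H
  refine Submodule.span_le.2 ?_
  rintro x ⟨A, A₀, A', hx, hd⟩
  obtain ⟨B, hB, hBA⟩ := exists_map_toLetter hT hrep hd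
  obtain ⟨C, C₀, C', y, hy, rfl, rfl⟩ := hx.exists_lift cycShift_pow_self
    (toLetter_cycShift (rep := rep) hT) hBA
  have h1 := hy.mem_weightChain degIndex_cycShift
  rw [show degIndex T (∑ i, lam i) = fun x => Pi.single x.2 1 from rfl,
    (degSum_single_eq_one_iff Prod.snd _).2 hB] at h1
  exact ⟨y, h1, rfl⟩

open Classical in
variable (T σ rep lam) in
/-- The set of symmetries. -/
def symmetries : Finset (Fin (∑ i, lam i) → ZMod T × Fin (∑ i, lam i)) :=
  {α | IsSymmetry T σ rep lam α}

lemma mem_symmetries {α : Fin (∑ i, lam i) → ZMod T × Fin (∑ i, lam i)} :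
    α ∈ symmetries T σ rep lam ↔ IsSymmetry T σ rep lam α := by
  simp [symmetries]

lemma card_symmetries_ne_zero : ((symmetries T σ rep lam).card : ℂ) ≠ 0 :=
  Nat.cast_ne_zero.2 (Finset.card_ne_zero_of_mem (mem_symmetries.2 isSymmetry_refl))

lemma coe_symmetrize (hrep : ∀ a, ∃! i, σ.SameCycle (rep i) a)
    {y : ChainSpace (cycShift T (∑ i, lam i)) N k}
    (hy : y ∈ weightChain (cycShift T _) (degIndex T _) N k 1)
    {x : weightChain σ (degCycle σ rep) N k lam} (hx : projectMap hT rep N k y = x) :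
    (symmetrize σ rep lam hT N k x : ChainSpace (cycShift T _) N k) =
      ∑ α ∈ symmetries T σ rep lam, substMap α N k y := by
  let W : ChainSpace σ N k →ₗ[ℂ] ChainSpace (cycShift T (∑ i, lam i)) N k :=
    (weightChain (cycShift T _) (degIndex T _) N k 1).subtype ∘ₗ
      weightProj (cycShift T _) (degIndex T _) N k 1 ∘ₗ
        chainMap (jHom T σ rep lam) (jHom_permHom rep lam hT) N k
  have h : W (projectMap hT rep N k y) = ∑ α ∈ symmetries T σ rep lam, substMap α N k y :=
    weightProj_jHom_projectMap hT hrep hy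
  exact (congrArg W hx.symm).trans h

lemma projectMap_symmetrize (hrep : ∀ a, ∃! i, σ.SameCycle (rep i) a)
    (x : weightChain σ (degCycle σ rep) N k lam) :
    projectMap (lam := lam) hT rep N k (symmetrize σ rep lam hT N k x) =
      ((symmetries T σ rep lam).card : ℂ) • (x : ChainSpace σ N k) := by
  obtain ⟨y, hy, hyx⟩ := exists_projectMap_eq hT hrep x.2
  refine (congrArg _ (coe_symmetrize hT hrep hy hyx)).trans (map_sum_of_const
    (E := ChainSpace (cycShift T (∑ i, lam i)) N k) (E' := ChainSpace σ N k)
    (projectMap hT rep N k) fun α hα => ?_)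
  rw [projectMap_substMap hT (mem_symmetries.1 hα).1, hyx]

lemma symmetrize_injective (hrep : ∀ a, ∃! i, σ.SameCycle (rep i) a) :
    Function.Injective (symmetrize σ rep lam hT N k) := by
  intro x x' h
  have h1 := projectMap_symmetrize hT hrep x
  rw [h, projectMap_symmetrize hT hrep x'] at h1
  exact Subtype.ext (smul_right_injective (M := ChainSpace σ N k)
    (card_symmetries_ne_zero (σ := σ) (rep := rep) (lam := lam)) h1).symm

lemma substMap_symmetrize {α : Fin (∑ i, lam i) → ZMod T × Fin (∑ i, lam i)}
    (hα : IsSymmetry T σ rep lam α) (x : weightChain σ (degCycle σ rep) N k lam) :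
    substMap α N k (symmetrize σ rep lam hT N k x) = symmetrize σ rep lam hT N k x := by
  refine (coe_weightProj_substMap_comm hα.2 (chainMap (jHom T σ rep lam)
    (jHom_permHom rep lam hT) N k (x : ChainSpace σ N k))).trans ?_
  rw [substMap_chainMap_jHom hT hα]
  rfl

lemma exists_symmetrize_eq (hrep : ∀ a, ∃! i, σ.SameCycle (rep i) a)
    (y : weightChain (cycShift T (∑ i, lam i)) (degIndex T _) N k 1)
    (h : ∀ α, IsSymmetry T σ rep lam α → substMap α N k (y : ChainSpace (cycShift T _) N k) = y) :
    ∃ x, symmetrize σ rep lam hT N k x = y := by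
  have h1 := coe_symmetrize hT hrep y.2 (x := ⟨_, projectMap_mem hT hrep y.2⟩) rfl
  have h2 := h1.trans (map_sum_of_const (E := ChainSpace (cycShift T (∑ i, lam i)) N k)
    (E' := ChainSpace (cycShift T (∑ i, lam i)) N k) LinearMap.id
    fun α hα => h α (mem_symmetries.1 hα))
  refine ⟨((symmetries T σ rep lam).card : ℂ)⁻¹ • ⟨_, projectMap_mem hT hrep y.2⟩, ?_⟩
  rw [map_smul]
  refine Subtype.ext ?_
  refine (congrArg (((symmetries T σ rep lam).card : ℂ)⁻¹ • ·) h2).trans ?_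
  exact inv_smul_smul₀ card_symmetries_ne_zero _

end Image

/-! ### The symmetries as elements of the symmetry group -/

section Choice

variable {R r T : ℕ} {σ : Equiv.Perm (Fin R)} {rep : Fin r → Fin R} {lam : Fin r → ℕ}

/-- The substitution of letters defined by an element of the symmetry group. -/
def SigmaZ.choice (g : SigmaZ T σ rep lam) (p : Fin (∑ i, lam i)) : ZMod T × Fin (∑ i, lam i) :=
  (((cycleLength σ rep (finSigmaFinEquiv.symm p).1 *
    ((g (finSigmaFinEquiv.symm p).1).shift (finSigmaFinEquiv.symm p).2).val : ℕ) : ZMod T), g.perm p)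

lemma SigmaZ.perm_finSigmaFinEquiv (g : SigmaZ T σ rep lam) (i : Fin r) (n : Fin (lam i)) :
    g.perm (finSigmaFinEquiv ⟨i, n⟩) = finSigmaFinEquiv ⟨i, (g i).perm n⟩ := by
  simp [SigmaZ.perm]

lemma SigmaZ.choice_finSigmaFinEquiv (g : SigmaZ T σ rep lam) (i : Fin r) (n : Fin (lam i)) :
    g.choice (finSigmaFinEquiv ⟨i, n⟩) =
      (((cycleLength σ rep i * ((g i).shift n).val : ℕ) : ZMod T),
        finSigmaFinEquiv ⟨i, (g i).perm n⟩) := by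
  rw [SigmaZ.choice, perm_finSigmaFinEquiv, Equiv.symm_apply_apply]

lemma pow_apply_eq_self_iff {a : Fin R} (n : ℕ) :
    (σ ^ n) a = a ↔ Function.minimalPeriod σ a ∣ n := by
  rw [← Function.isPeriodicPt_iff_minimalPeriod_dvd, Function.IsPeriodicPt, Function.IsFixedPt,
    Equiv.Perm.iterate_eq_pow]

variable [NeZero T] (hT : orderOf σ = T)

include hT in
lemma isChoice_iff (i : Fin r) (n : Fin (lam i)) (c : ZMod T × Fin (∑ i, lam i)) :
    IsChoice T σ rep lam (finSigmaFinEquiv ⟨i, n⟩) c ↔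
      ∃ (d : ZMod (T / cycleLength σ rep i)) (n' : Fin (lam i)),
        c = (((cycleLength σ rep i * d.val : ℕ) : ZMod T), finSigmaFinEquiv ⟨i, n'⟩) := by
  obtain ⟨a, q⟩ := c
  obtain ⟨⟨j, n'⟩, rfl⟩ := finSigmaFinEquiv.surjective q
  rw [IsChoice, block, block, Equiv.symm_apply_apply, Equiv.symm_apply_apply]
  constructor
  · rintro ⟨h1, h2⟩
    obtain rfl : j = i := h1
    obtain ⟨d, hd⟩ := (pow_apply_eq_self_iff _).1 h2
    refine ⟨d, n', Prod.ext ?_ rfl⟩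
    have hT' : cycleLength σ rep j ∣ T :=
      (pow_apply_eq_self_iff T).1 (by rw [pow_eq_one_of_orderOf hT]; rfl)
    obtain ⟨e, he⟩ := hT'
    have hlt : cycleLength σ rep j * d < cycleLength σ rep j * e := by
      rw [← he]
      exact hd ▸ ZMod.val_lt a
    have hpos : 0 < cycleLength σ rep j :=
      Nat.pos_of_ne_zero fun h => by simp [h] at hlt
    have hdiv : T / cycleLength σ rep j = e := by
      rw [he, Nat.mul_div_cancel_left _ hpos]
    change a = _
    rw [ZMod.val_natCast, hdiv, Nat.mod_eq_of_lt (Nat.lt_of_mul_lt_mul_left hlt)]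
    change _ = ((Function.minimalPeriod _ _ * d : ℕ) : ZMod T)
    rw [← hd, ZMod.natCast_zmod_val]
  · rintro ⟨d, n', h⟩
    obtain ⟨rfl, h2⟩ := Prod.ext_iff.1 h
    have h3 := finSigmaFinEquiv.injective h2
    obtain rfl : j = i := congrArg Sigma.fst h3
    refine ⟨rfl, ?_⟩
    change (σ ^ ((_ : ℕ) : ZMod T).val) (rep j) = rep j
    rw [pow_val_natCast hT, pow_apply_eq_self_iff]
    exact Dvd.intro _ rfl

include hT in
lemma SigmaZ.isSymmetry_choice (g : SigmaZ T σ rep lam) : IsSymmetry T σ rep lam g.choice := by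
  refine ⟨fun p => ?_, g.perm.bijective⟩
  obtain ⟨⟨i, n⟩, rfl⟩ := finSigmaFinEquiv.surjective p
  exact (isChoice_iff hT i n _).2 ⟨_, _, g.choice_finSigmaFinEquiv i n⟩

include hT in
lemma exists_choice_eq {α : Fin (∑ i, lam i) → ZMod T × Fin (∑ i, lam i)}
    (hα : IsSymmetry T σ rep lam α) : ∃ g : SigmaZ T σ rep lam, g.choice = α := by
  choose d s hs using fun i n => (isChoice_iff hT i n _).1 (hα.1 (finSigmaFinEquiv ⟨i, n⟩))
  have hinj : ∀ i, Function.Injective (s i) := by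
    intro i n n' h
    have h1 : (finSigmaFinEquiv ⟨i, n⟩ : Fin (∑ i, lam i)) = finSigmaFinEquiv ⟨i, n'⟩ :=
      hα.2.1 (by simp only [hs, h])
    simpa using finSigmaFinEquiv.injective h1
  refine ⟨fun i => ⟨Equiv.ofBijective (s i) (Finite.injective_iff_bijective.1 (hinj i)), d i⟩, ?_⟩
  funext p
  obtain ⟨⟨i, n⟩, rfl⟩ := finSigmaFinEquiv.surjective p
  rw [SigmaZ.choice_finSigmaFinEquiv, hs]
  rfl

end Choice

section Sign

lemma sign_sigmaCongrRight {ι : Type*} [Fintype ι] [DecidableEq ι] {β : ι → Type*}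
    [∀ i, Fintype (β i)] [∀ i, DecidableEq (β i)] (f : ∀ i, Equiv.Perm (β i)) :
    Equiv.Perm.sign (Equiv.sigmaCongrRight f) = ∏ i, Equiv.Perm.sign (f i) := by
  let F : (∀ i, Equiv.Perm (β i)) →* ℤˣ := Equiv.Perm.sign.comp (Equiv.Perm.sigmaCongrRightHom β)
  have hswap : ∀ i (x y : β i), x ≠ y → F (Pi.mulSingle i (Equiv.swap x y)) = -1 := by
    intro i x y hxy
    have : Equiv.sigmaCongrRight (Pi.mulSingle i (Equiv.swap x y) : ∀ i, Equiv.Perm (β i)) =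
        Equiv.swap ⟨i, x⟩ ⟨i, y⟩ := by
      refine Equiv.ext ?_
      rintro ⟨j, b⟩
      by_cases hj : j = i
      · subst hj
        simp only [Equiv.sigmaCongrRight_apply, Pi.mulSingle_eq_same,
          Equiv.swap_apply_def, Sigma.mk.injEq, heq_eq_eq, true_and]
        split_ifs <;> rfl
      · rw [Equiv.swap_apply_of_ne_of_ne (fun h => hj (congrArg Sigma.fst h))
          fun h => hj (congrArg Sigma.fst h)]
        simp [Pi.mulSingle_eq_of_ne hj]
    change Equiv.Perm.sign (Equiv.sigmaCongrRight _) = _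
    rw [this, Equiv.Perm.sign_swap fun h => hxy (by simpa using h)]
  have hsingle : ∀ i (g : Equiv.Perm (β i)), F (Pi.mulSingle i g) = Equiv.Perm.sign g := by
    intro i g
    induction g using Equiv.Perm.swap_induction_on with
    | one => rw [Pi.mulSingle_one, map_one, map_one]
    | swap_mul g x y hxy ih =>
      rw [Pi.mulSingle_mul, map_mul, map_mul, ih, hswap i x y hxy, Equiv.Perm.sign_swap hxy]
  have H : F = ∏ i, Equiv.Perm.sign.comp
      (Pi.evalMonoidHom (fun i => Equiv.Perm (β i)) i) := by
    refine MonoidHom.pi_ext fun i g => ?_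
    rw [hsingle, MonoidHom.finsetProd_apply, Finset.prod_eq_single i]
    · simp
    · intro j _ hj
      simp [Pi.mulSingle_eq_of_ne hj]
    · simp
  refine (DFunLike.congr_fun H f).trans ?_
  rw [MonoidHom.finsetProd_apply]
  rfl

lemma SigmaZ.sign_perm {R r T : ℕ} {σ : Equiv.Perm (Fin R)} {rep : Fin r → Fin R}
    {lam : Fin r → ℕ} (g : SigmaZ T σ rep lam) :
    (Equiv.Perm.sign g.perm : ℤ) = SigmaZ.sign g := by
  rw [SigmaZ.perm, Equiv.Perm.sign_symm_trans_trans, sign_sigmaCongrRight, SigmaZ.sign,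
    Units.coe_prod]

end Sign

/-! ### Equivariance of the map from flags to chains -/

section Equivariance

variable {R r T N : ℕ} [NeZero T] {σ : Equiv.Perm (Fin R)} {rep : Fin r → Fin R} {lam : Fin r → ℕ}
  {ω : ℂˣ} {z : Fin N → ℂ}

attribute [local instance] LieRing.ofAssociativeRing

omit [NeZero T] in
lemma SigmaZ.scalar_eq (hω : IsPrimitiveRoot ω T) (g : SigmaZ T σ rep lam)
    (p : Fin (∑ i, lam i)) : g.scalar ω p = cycPow ω (g.choice p).1 := by
  rw [SigmaZ.scalar, cycPow, SigmaZ.choice, ZMod.val_natCast, pow_mod_of_isPrimitiveRoot hω]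

lemma SigmaZ.cycPow_mul_coordChange (hω : IsPrimitiveRoot ω T) (g : SigmaZ T σ rep lam)
    (t : Fin (∑ i, lam i) → ℂ) (x : ZMod T × Fin (∑ i, lam i)) :
    (cycPow ω x.1 : ℂ) * g.coordChange ω t x.2 =
      (cycPow ω (subst g.choice x).1 : ℂ) * t (subst g.choice x).2 := by
  rw [SigmaZ.coordChange_apply, g.scalar_eq hω, subst, cycPow_add hω, Units.val_mul, mul_assoc]
  rfl

lemma pullback_chainEdge (hω : IsPrimitiveRoot ω T) (g : SigmaZ T σ rep lam) {k : ℕ}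
    (A : Fin k → Multiset (ZMod T × Fin (∑ i, lam i)))
    (A₀ : Multiset (ZMod T × Fin (∑ i, lam i))) (A' : Fin N → Multiset (ZMod T × Fin (∑ i, lam i))) :
    pullback (g.coordChange ω) (chainEdge ω z A A₀ A') =
      chainEdge ω z (fun b => (A b).map (subst g.choice)) (A₀.map (subst g.choice))
        (fun j => (A' j).map (subst g.choice)) := by
  ext t
  rw [pullback, AffineSubspace.mem_comap, mem_chainEdge hω, mem_chainEdge hω]
  simp only [swimming, anchored, Set.mem_ofPred_eq, Multiset.forall_mem_map_iff,
    ← g.cycPow_mul_coordChange hω]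
  rfl

lemma edgeProj_pullback (hω : IsPrimitiveRoot ω T) (g : SigmaZ T σ rep lam) {k : ℕ}
    (L : AffineSubspace ℂ (Fin (∑ i, lam i) → ℂ)) (x : ChainSpace (cycShift T (∑ i, lam i)) N k) :
    edgeProj ω z k (pullback (g.coordChange ω) L) (substMap g.choice N k x) =
      substMap g.choice N k (edgeProj ω z k L x) := by
  suffices H : edgeProj ω z k (pullback (g.coordChange ω) L) ∘ₗ substMap g.choice N k =
      substMap g.choice N k ∘ₗ edgeProj ω z k L from LinearMap.congr_fun H x
  refine chainSpace_hom_ext cycShift_pow_self (NeZero.ne T) fun A A₀ A' x hx => ?_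
  have e1 := hx.edgeProj_apply ω z L
  have e2 := (hx.letterMap cycShift_pow_self (subst_cycShift g.choice)).edgeProj_apply ω z
    (pullback (g.coordChange ω) L)
  rw [← pullback_chainEdge hω] at e2
  refine e2.trans (Eq.trans ?_ (congrArg (substMap g.choice N k) e1).symm)
  have hinj : pullback (g.coordChange ω) (chainEdge ω z A A₀ A') = pullback (g.coordChange ω) L ↔
      chainEdge ω z A A₀ A' = L :=
    (Function.LeftInverse.injective (pullback_symm_pullback (g.coordChange ω))).eq_iff
  by_cases hL : chainEdge ω z A A₀ A' = L
  · rw [if_pos hL, if_pos (hinj.2 hL)]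
    rfl
  · rw [if_neg hL, if_neg fun h => hL (hinj.1 h)]
    exact (map_zero _).symm

lemma fixedMap_letterHom_orbitSum {m : ℕ} (α : Fin m → ZMod T × Fin m)
    (i : Fin m) : fixedMap (letterHom (subst α)) (letterHom_permHom (subst_cycShift α))
      (orbitSum (gen T i)) = orbitSum (gen T (α i).2) := by
  have h : letterHom (subst α) (gen T i) = shiftHom (α i).1 (gen T (α i).2) := by
    rw [gen, letterHom_of, shiftHom, gen, permHom_of]
    rfl
  rw [orbitSum_eq_cycSum, fixedMap_cycSum _ cycShift_pow_self, h, ← orbitSum_eq_cycSum,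
    orbitSum_shiftHom]

lemma substMap_baseChain (g : SigmaZ T σ rep lam) {p : ℕ} (h : p = ∑ i, lam i) :
    substMap g.choice N p (baseChain N h) = ((SigmaZ.sign g : ℤ) : ℂ) • baseChain N h := by
  subst h
  rw [baseChain_rfl, ← g.sign_perm, substMap, letterMap, chainMap, TensorProduct.map_tmul,
    TensorProduct.map_tmul, exteriorPower.map_apply_ιMulti, PiTensorProduct.map_tprod]
  have h1 : (fun i => fixedMap (letterHom (subst g.choice))
      (letterHom_permHom (subst_cycShift g.choice)) (orbitSum (gen T i))) =
      fun i => orbitSum (gen T (g.perm i)) := funext fun i => fixedMap_letterHom_orbitSum _ i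
  have h2 := alternatingMap_comp_perm (exteriorPower.ιMulti ℂ (∑ i, lam i)
    (M := fixedSubalgebra (cycShift T (∑ i, lam i)))) g.perm fun i => orbitSum (gen T i)
  simp only [AlgHom.toLinearMap_apply, map_one]
  refine Eq.trans ?_ (TensorProduct.smul_tmul' _ _ _).symm
  exact congrArg (· ⊗ₜ _) ((congrArg _ h1).trans h2)

lemma flagChain_pullback (hω : IsPrimitiveRoot ω T) (g : SigmaZ T σ rep lam) :
    ∀ (q p : ℕ) (h : p + q = ∑ i, lam i) (F : Flag (cycArrangement T (∑ i, lam i) ω z) q),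
      substMap g.choice N p (flagChain ω z q p h F) = ((SigmaZ.sign g : ℤ) : ℂ) •
        flagChain ω z q p h (F.pullback (g.coordChange ω) (g.pullback_mem hω z))
  | 0, p, h, F => substMap_baseChain g h
  | q + 1, p, h, F => by
    have ih := flagChain_pullback hω g q (p + 1) (by omega) F.init
    rw [flagChain, flagChain]
    refine (edgeProj_pullback hω g F.last _).symm.trans ?_
    have h1 := (chainD_chainMap (letterHom (subst g.choice))
      (letterHom_permHom (subst_cycShift g.choice)) N p
      (flagChain ω z q (p + 1) (by omega) F.init)).symm.trans
      (congrArg (chainD (cycShift T (∑ i, lam i)) N p) ih)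
    rw [map_smul] at h1
    exact (congrArg _ h1).trans (map_smul _ _ _)

variable (hω : IsPrimitiveRoot ω T) (hz0 : ∀ j, z j ≠ 0)
  (hz : ∀ i j, i ≠ j → ∀ n : ℕ, z i ≠ (ω : ℂ) ^ n * z j)

lemma flagToChain_act (g : SigmaZ T σ rep lam) (q p : ℕ) (h : p + q = ∑ i, lam i)
    (v : FlagSpace (cycArrangement T (∑ i, lam i) ω z) q) :
    flagToChain hω hz0 hz q p h (((SigmaZ.sign g : ℂ) • SigmaZ.act hω z q g) v) =
      substMap g.choice N p (flagToChain hω hz0 hz q p h v) := by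
  suffices H : flagToChain hω hz0 hz q p h ∘ₗ ((SigmaZ.sign g : ℂ) • SigmaZ.act hω z q g) =
      substMap g.choice N p ∘ₗ flagToChain hω hz0 hz q p h from LinearMap.congr_fun H v
  refine FlagSpace.hom_ext fun F => ?_
  rw [LinearMap.comp_apply, LinearMap.comp_apply, LinearMap.smul_apply, map_smul, SigmaZ.act,
    flagAction, FlagSpace.lift_mk, flagToChain_mk, flagToChain_mk, flagChain_pullback hω g]

lemma mem_isotypicFlags_iff (hT : orderOf σ = T) (q p : ℕ) (h : p + q = ∑ i, lam i)
    (v : FlagSpace (cycArrangement T (∑ i, lam i) ω z) q) :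
    v ∈ isotypicFlags σ rep lam hω z q ↔ ∀ α, IsSymmetry T σ rep lam α →
      substMap α N p (flagToChain hω hz0 hz q p h v) = flagToChain hω hz0 hz q p h v := by
  rw [isotypicFlags, Submodule.mem_iInf]
  have h1 : ∀ g : SigmaZ T σ rep lam,
      v ∈ LinearMap.eqLocus ((SigmaZ.sign g : ℂ) • SigmaZ.act hω z q g) LinearMap.id ↔
      substMap g.choice N p (flagToChain hω hz0 hz q p h v) = flagToChain hω hz0 hz q p h v := by
    intro g
    rw [LinearMap.mem_eqLocus, ← flagToChain_act, LinearMap.id_apply]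
    exact (flagToChain_injective hω hz0 hz q p h).eq_iff.symm
  constructor
  · intro hv α hα
    obtain ⟨g, rfl⟩ := exists_choice_eq hT hα
    exact (h1 g).1 (hv g)
  · exact fun hv g => (h1 g).2 (hv _ (g.isSymmetry_choice hT))

end Equivariance

/-! ### The isotypic flags and the symmetrized chains -/

section Isotypic

variable {R r T N : ℕ} [NeZero T] {σ : Equiv.Perm (Fin R)} {rep : Fin r → Fin R} {lam : Fin r → ℕ}
  {ω : ℂˣ} {z : Fin N → ℂ} (hT : orderOf σ = T) (hω : IsPrimitiveRoot ω T) (hz0 : ∀ j, z j ≠ 0)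
  (hz : ∀ i j, i ≠ j → ∀ n : ℕ, z i ≠ (ω : ℂ) ^ n * z j)

attribute [local instance] LieRing.ofAssociativeRing

lemma flagSpace_eq_zero_of_lt {m q : ℕ} (h : m < q) (v : FlagSpace (cycArrangement T m ω z) q) :
    v = 0 := by
  have hv : v ∈ Submodule.span ℂ (Set.range (FlagSpace.mk (𝒞 := cycArrangement T m ω z) (k := q))) :=
    FlagSpace.span_mk (𝒞 := cycArrangement T m ω z) (k := q) ▸ Submodule.mem_top
  have he : IsEmpty (Flag (cycArrangement T m ω z) q) :=
    ⟨fun F => by have := F.codim (Fin.last q); simp at this; omega⟩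
  rwa [Set.range_eq_empty, Submodule.span_empty, Submodule.mem_bot] at hv

include hT hz0 hz in
lemma flagDiff_mem_isotypicFlags {q : ℕ} {v : FlagSpace (cycArrangement T (∑ i, lam i) ω z) q}
    (hv : v ∈ isotypicFlags σ rep lam hω z q) :
    flagDiff (cycArrangement T (∑ i, lam i) ω z) q v ∈ isotypicFlags σ rep lam hω z (q + 1) := by
  rcases Nat.lt_or_ge (∑ i, lam i) (q + 1) with h | h
  · rw [flagSpace_eq_zero_of_lt h (flagDiff _ q v)]
    exact Submodule.zero_mem _
  · obtain ⟨p, hp⟩ : ∃ p, p + (q + 1) = ∑ i, lam i := ⟨_, Nat.sub_add_cancel h⟩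
    have hp' : p + 1 + q = ∑ i, lam i := by omega
    rw [mem_isotypicFlags_iff hω hz0 hz hT q (p + 1) hp'] at hv
    refine (mem_isotypicFlags_iff hω hz0 hz hT (q + 1) p hp _).2 fun α hα => ?_
    rw [flagToChain_flagDiff hω hz0 hz q p hp' hp]
    exact (chainD_chainMap (letterHom (subst α)) (letterHom_permHom (subst_cycShift α)) N p
      (flagToChain hω hz0 hz q (p + 1) hp' v)).symm.trans
      (congrArg (chainD (cycShift T (∑ i, lam i)) N p) (hv α hα))

variable {ψ : ∀ p q : ℕ, p + q = ∑ i, lam i → (MultilinearChains T (∑ i, lam i) N p →ₗ[ℂ]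
    FlagSpace (cycArrangement T (∑ i, lam i) ω z) q)} (hψ : IsPsi ω z ψ)
include hψ hω hz0 hz

lemma IsPsi.injective {p q : ℕ} (h : p + q = ∑ i, lam i) : Function.Injective (ψ p q h) :=
  fun x y hxy => Subtype.ext (by
    rw [← hψ.flagToChain_apply hω hz0 hz h x, hxy, hψ.flagToChain_apply hω hz0 hz h y])

lemma IsPsi.injective_comp_symmetrize (hrep : ∀ a, ∃! i, σ.SameCycle (rep i) a) {p q : ℕ}
    (h : p + q = ∑ i, lam i) :
    Function.Injective (ψ p q h ∘ₗ symmetrize σ rep lam hT N p) :=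
  (hψ.injective hω hz0 hz h).comp (symmetrize_injective hT hrep)

lemma IsPsi.range_comp_symmetrize (hrep : ∀ a, ∃! i, σ.SameCycle (rep i) a) {p q : ℕ}
    (h : p + q = ∑ i, lam i) :
    LinearMap.range (ψ p q h ∘ₗ symmetrize σ rep lam hT N p) =
      isotypicFlags σ rep lam hω z q := by
  ext v
  rw [LinearMap.mem_range, mem_isotypicFlags_iff hω hz0 hz hT q p h]
  constructor
  · rintro ⟨x, rfl⟩ α hα
    rw [LinearMap.comp_apply, hψ.flagToChain_apply hω hz0 hz h]
    exact substMap_symmetrize hT hα x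
  · intro hv
    obtain ⟨x, hx⟩ := exists_symmetrize_eq hT hrep
      ⟨flagToChain hω hz0 hz q p h v, flagToChain_mem hω hz0 hz h v⟩ hv
    refine ⟨x, flagToChain_injective hω hz0 hz q p h ?_⟩
    rw [LinearMap.comp_apply, hψ.flagToChain_apply hω hz0 hz h, hx]

omit hψ hω hz0 hz in
lemma chainD_symmetrize {k : ℕ} (x : weightChain σ (degCycle σ rep) N (k + 1) lam)
    (y : weightChain σ (degCycle σ rep) N k lam) (hy : (y : ChainSpace σ N k) = chainD σ N k x) :
    chainD (cycShift T (∑ i, lam i)) N k (symmetrize σ rep lam hT N (k + 1) x) =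
      symmetrize σ rep lam hT N k y := by
  let W : ChainSpace σ N k →ₗ[ℂ] ChainSpace (cycShift T (∑ i, lam i)) N k :=
    (weightChain (cycShift T _) (degIndex T _) N k 1).subtype ∘ₗ
      weightProj (cycShift T _) (degIndex T _) N k 1 ∘ₗ
        chainMap (jHom T σ rep lam) (jHom_permHom rep lam hT) N k
  have h1 : chainD (cycShift T (∑ i, lam i)) N k (symmetrize σ rep lam hT N (k + 1) x) =
      weightProj (cycShift T _) (degIndex T _) N k 1 (chainD (cycShift T (∑ i, lam i)) N k
        (chainMap (jHom T σ rep lam) (jHom_permHom rep lam hT) N (k + 1)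
          (x : ChainSpace σ N (k + 1)))) :=
    coe_weightProj_comm cycShift_pow_self (NeZero.ne T) degIndex_cycShift cycShift_pow_self
      (NeZero.ne T) degIndex_cycShift (chainD (cycShift T (∑ i, lam i)) N k)
      (fun ν x hx => chainD_mem_weightChain cycShift_pow_self (NeZero.ne T) degIndex_cycShift hx) _
  rw [chainD_chainMap] at h1
  exact h1.trans (congrArg W hy.symm)

lemma IsPsi.flagDiff_symmetrize {k q : ℕ} (h : k + 1 + q = ∑ i, lam i)
    (h' : k + (q + 1) = ∑ i, lam i) (x : weightChain σ (degCycle σ rep) N (k + 1) lam)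
    (y : weightChain σ (degCycle σ rep) N k lam) (hy : (y : ChainSpace σ N k) = chainD σ N k x) :
    flagDiff (cycArrangement T (∑ i, lam i) ω z) q
        (ψ (k + 1) q h (symmetrize σ rep lam hT N (k + 1) x)) =
      ψ k (q + 1) h' (symmetrize σ rep lam hT N k y) := by
  refine flagToChain_injective hω hz0 hz (q + 1) k h' ?_
  rw [flagToChain_flagDiff hω hz0 hz q k h h', hψ.flagToChain_apply hω hz0 hz h,
    hψ.flagToChain_apply hω hz0 hz h', chainD_symmetrize hT x y hy]

end Isotypic
end
end Cyclotomic

theorem theorem1p2 {R r N T : ℕ} [NeZero T] (σ : Equiv.Perm (Fin R)) (hT : orderOf σ = T)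
    (rep : Fin r → Fin R) (hrep : ∀ a, ∃! i, σ.SameCycle (rep i) a) (lam : Fin r → ℕ)
    (ω : ℂˣ) (hω : IsPrimitiveRoot ω T) (z : Fin N → ℂ) (hz0 : ∀ j, z j ≠ 0)
    (hz : ∀ i j, i ≠ j → ∀ k : ℕ, z i ≠ (ω : ℂ) ^ k * z j) :
    -- the rules define the maps `ψ_k`
    (∃! ψ, IsPsi (T := T) (m := ∑ i, lam i) ω z ψ) ∧
    -- the subspaces of weight `λ` and the isotypic subspaces form complexes
    (∀ k, ∀ x ∈ weightChain σ (degCycle σ rep) N (k + 1) lam,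
      chainD σ N k x ∈ weightChain σ (degCycle σ rep) N k lam) ∧
    (∀ k, ∀ x ∈ weightChain σ (degCycle σ rep) N (k + 1 + 1) lam,
      chainD σ N k (chainD σ N (k + 1) x) = 0) ∧
    (∀ q, ∀ v ∈ isotypicFlags σ rep lam hω z q,
      flagDiff (cycArrangement T (∑ i, lam i) ω z) q v ∈ isotypicFlags σ rep lam hω z (q + 1)) ∧
    (∀ q v, flagDiff (cycArrangement T (∑ i, lam i) ω z) (q + 1)
      (flagDiff (cycArrangement T (∑ i, lam i) ω z) q v) = 0) ∧
    ∀ ψ, IsPsi (T := T) (m := ∑ i, lam i) ω z ψ →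
      -- each `ψ_k ∘ s` is a linear isomorphism onto the isotypic subspace
      (∀ (k q : ℕ) (h : k + q = ∑ i, lam i),
        Function.Injective (ψ k q h ∘ₗ symmetrize σ rep lam hT N k) ∧
        LinearMap.range (ψ k q h ∘ₗ symmetrize σ rep lam hT N k) =
          isotypicFlags σ rep lam hω z q) ∧
      -- these isomorphisms commute with the differentials
      ∀ (k q : ℕ) (h : k + 1 + q = ∑ i, lam i) (h' : k + (q + 1) = ∑ i, lam i)
        (x : weightChain σ (degCycle σ rep) N (k + 1) lam)
        (y : weightChain σ (degCycle σ rep) N k lam),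
        (y : ChainSpace σ N k) = chainD σ N k x →
          flagDiff (cycArrangement T (∑ i, lam i) ω z) q
            (ψ (k + 1) q h (symmetrize σ rep lam hT N (k + 1) x)) =
          ψ k (q + 1) h' (symmetrize σ rep lam hT N k y) := by
  refine ⟨existsUnique_isPsi hω hz0 hz, fun k x hx => ?_, fun k x _ => ?_, fun q v hv => ?_,
    fun q v => flagDiff_flagDiff v, fun ψ hψ => ⟨fun k q h => ⟨?_, ?_⟩, fun k q h h' x y hy => ?_⟩⟩
  · exact chainD_mem_weightChain (pow_eq_one_of_orderOf hT) (NeZero.ne T) degCycle_apply_perm hx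
  · exact chainD_chainD σ N k x
  · exact flagDiff_mem_isotypicFlags hT hω hz0 hz hv
  · exact hψ.injective_comp_symmetrize hT hω hz0 hz hrep h
  · exact hψ.range_comp_symmetrize hT hω hz0 hz hrep h
  · exact hψ.flagDiff_symmetrize hT hω hz0 hz h h' x y hy
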